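/- **Setting.** Let $\sigma,\delta\in\{1,-1\}$, $\varepsilon=\delta\sigma$, $q_0>0$, $q_-\in\mathbb R$ with $|q_-|=q_0$, $q_+=\delta q_-$, and consider the real nonlocal (reverse-space-time) mKdV equation $$q_t(x,t)-6\sigma q(x,t)q(-x,-t)q_x(x,t)+q_{xxx}(x,t)=0,\qquad \lim_{x\to\pm\infty}q(x,t)=q_\pm .\qquad (1)$$ For $z\in\mathbb C\setminus\{0\}$ put $k=\frac12(z+\varepsilon q_0^2/z)$, $\lambda=\frac12(z-\varepsilon q_0^2/z)$, $\theta(x,t,z)=\lambda[x+(4k^2+2\varepsilon q_0^2)t]$. Let $D^\pm=\{\pm\operatorname{Im}z>0\}$, $\Sigma=\mathbb R\setminus\{0\}$ if $\varepsilon=1$, and $D^\pm=\{\pm(|z|-q_0)\operatorname{Im}z>0\}$, $\Sigma=(\mathbb R\setminus\{0\})\cup\{|z|=q_0\}$ if $\varepsilon=-1$; let $\Sigma_0=\{z\in\Sigma: z^2\ne\varepsilon q_0^2\}$. The Lax pair of (1) is $\Phi_x=X\Phi$, $\Phi_t=T\Phi$ with $$X=ik\sigma_3+Q,\quad T=[4k^2+2\sigma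 q(x,t)q(-x,-t)]X-2ik\sigma_3Q_x+[Q_x,Q]-Q_{xx},\quad Q=\begin{pmatrix}0&q(x,t)\\ \sigma q(-x,-t)&0\end{pmatrix},\quad \sigma_3=\operatorname{diag}(1,-1).$$ For a real solution $q\in C^3(\mathbb R^2)$ of (1) with $(1+|x|)(q(\cdot,t)-q_\pm)\in L^1(\mathbb R^\pm)$ for all $t$, the Jost solutions $\Phi_\pm$ are the simultaneous solutions of both parts of the Lax pair with $$\mu_\pm:=\Phi_\pm e^{-i\theta\sigma_3}\to E_\pm=\begin{pmatrix}1& iq_\pm/z\\ -\varepsilon iq_\pm/z&1\end{pmatrix}\qquad (x\to\pm\infty),$$ the columns $\Phi_{+,1},\Phi_{-,2}$ being considered on $D^+\cup\Sigma$ and $\Phi_{-,1},\Phi_{+,2}$ on $D^-\cup\Sigma$. The scattering matrix is given by $\Phi_+=\Phi_-S$ on $\Sigma_0$, by $s_{11}=\det(\Phi_{+,1},\Phi_{-,2})/(1-\varepsilon q_0^2/z^2)$ on $D^+$ and by $s_{22}=\det(\Phi_{-,1},\Phi_{+,2})/(1-\varepsilon q_0^2/z^2)$ on $D^-$. The potential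 is reflectionless if $s_{12}=s_{21}=0$ on $\Sigma_0$. Put $M=(\mu_{+,1}/s_{11},\ \mu_{-,2})$ on $D^+$ and $M=(\mu_{-,1},\ \mu_{+,2}/s_{22})$ on $D^-$. Fix $N\ge1$, $z_0\in D^+$ with $\operatorname{Re}z_0>0$, and let $v_1=z_0$, $v_2=\varepsilon q_0^2/z_0$. *Laurent data* consist of functions $r,\tilde r$ with expansions ($g$ denotes functions analytic at the respective point) $$r=g+\sum_{n=1}^N\frac{r^1_{1,n}}{(z-v_1)^n},\quad r=g+\sum_{n=1}^N\frac{r^2_{1,n}}{(z+v_1^*)^n},\quad \tilde r=g+\sum_{n=1}^N\frac{r^1_{2,n}}{(z-v_2)^n},\quad \tilde r=g+\sum_{n=1}^N\frac{r^2_{2,n}}{(z+v_2^*)^n}$$ near $v_1,-v_1^*,v_2,-v_2^*$ respectively. A matrix $M$ with columns $M_1,M_2$ *satisfies the residue conditions* for $(r,\tilde r)$ at $(x,t)$ if $M_1-e^{-2i\theta}rM_2$ extends analytically to $v_1$ and $-v_1^*$, and $M_2-e^{2i\theta}\tilde rM_1$ extends analytically to $v_2$ and $-v_2^*$. Let $f^1_{1,\ell},f^2_{1,\ell}$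 be the Taylor coefficients of $z\mapsto e^{-2i\theta(x,t,z)}$ at $v_1,-v_1^*$, and $f^1_{2,\ell},f^2_{2,\ell}$ those of $e^{2i\theta}$ at $v_2,-v_2^*$. For sequences $\rho,f$ and $w\ne0$ let $B(\rho,f,w)$ be the $N\times N$ matrix, and for $p\neq 0$ let $\eta(\rho,f,p)$, $\tilde\eta(\rho,f)$ be the vectors in $\mathbb C^N$, with entries ($1\le s,m\le N$) $$B_{sm}=\sum_{j=s}^N\sum_{\ell=0}^{j-s}\binom{m+\ell-1}{\ell}\rho_jf_{j-s-\ell}\frac{(-1)^\ell}{w^{m+\ell}},\quad \eta_s=\sum_{j=s}^N\sum_{\ell=0}^{j-s}\rho_jf_{j-s-\ell}\frac{(-1)^\ell iq_-}{p^{\ell+1}},\quad \tilde\eta_s=\sum_{j=s}^N\rho_jf_{j-s}.$$ Put $$\Xi=\begin{pmatrix}B(r^1_1,f^1_1,v_1-v_2)&B(r^1_1,f^1_1,v_1+v_2^*)\\B(r^2_1,f^2_1,-v_1^*-v_2)&B(r^2_1,f^2_1,-v_1^*+v_2^*)\end{pmatrix},\quad \widetilde\Xi=\begin{pmatrix}B(r^1_2,f^1_2,v_2-v_1)&B(r^1_2,f^1_2,v_2+v_1^*)\\B(r^2_2,f^2_2,-v_2^*-v_1)&B(r^2_2,f^2_2,-v_2^*+v_1^*)\end{pmatrix},$$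 $$\alpha_1=\begin{pmatrix}\eta(r^1_1,f^1_1,v_1)\\ \eta(r^2_1,f^2_1,-v_1^*)\end{pmatrix},\quad \alpha_2=\begin{pmatrix}\tilde\eta(r^1_2,f^1_2)\\ \tilde\eta(r^2_2,f^2_2)\end{pmatrix},\quad \langle W_0|=(1,0,\dots,0,1,0,\dots,0)\in\mathbb C^{1\times 2N}\ (\text{ones in positions }1,\,N+1),$$ and, where $\det(I-\widetilde\Xi\Xi)\ne0$, $$\mathcal Q_N(x,t)=q_--i\left[\frac{\det\big((I-\widetilde\Xi\Xi)+\alpha_2\langle W_0|\big)+\det\big((I-\widetilde\Xi\Xi)+\widetilde\Xi\alpha_1\langle W_0|\big)}{\det(I-\widetilde\Xi\Xi)}-2\right].$$ **Theorem.** (a) Let $q$ be a real solution of (1) as above, with Jost solutions $\Phi_\pm$ and scattering matrix $S$, that is reflectionless and for which $s_{11}$ has a zero of order exactly $N$ at $z_0$ and no other zeros in $D^+$ except possibly $-z_0^*$. Then $v_1,-v_1^*\in D^+$ are zeros of order $N$ of $s_{11}$, and $v_2,-v_2^*\in D^-$ are zeros of order $N$ of $s_{22}$ and its only zeros in $D^-$.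 There are Laurent data such that $M$ satisfies the residue conditions at all $(x,t)\in\mathbb R^2$; and for any such data, $q(x,t)=\mathcal Q_N(x,t)$ at every $(x,t)$ with $\det(I-\widetilde\Xi\Xi)\neq0$. (b) For arbitrary Laurent data and every $(x,t)$ with $\det(I-\widetilde\Xi\Xi)\ne0$, the reflectionless Riemann–Hilbert problem ($M_1$ analytic on $\mathbb C\setminus\{0,v_1,-v_1^*\}$, $M_2$ analytic on $\mathbb C\setminus\{0,v_2,-v_2^*\}$, the residue conditions at $(x,t)$, $M=I+O(1/z)$ as $z\to\infty$, $M=\frac iz\begin{pmatrix}0&q_-\\-\varepsilon q_-&0\end{pmatrix}+O(1)$ as $z\to0$) has a solution, and for every solution the reconstructed potential is $-i\lim_{z\to\infty}zM_{12}(z)=\mathcal Q_N(x,t)$. (c) For any Laurent coefficients and any fixed $t$, the set of $x$ with $\det(I-\widetilde\Xi\Xi)=0$ is finite on every bounded interval. -/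

import Mathlib

open Complex Matrix Filter Topology Asymptotics MeasureTheory
open scoped ComplexConjugate

noncomputable section

namespace NonlocalMKdV

/-- The parameters: the signs `σ` (defocusing / focusing) and `δ`, the amplitude `q₀`, the left
boundary value `qm = q₋` and the spectral point `z₀`. Pure data, the constraints on it are
hypotheses of the theorem. -/
structure Params where
  σ : ℝ
  δ : ℝ
  q₀ : ℝ
  qm : ℝ
  z₀ : ℂ

namespace Params

variable (P : Params)

/-- The product `δσ`. -/
def ε : ℝ := P.δ * P.σ

/-- The right boundary value `q₊ = δ q₋`. -/
def qp : ℝ := P.δ * P.qm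

/-! ### Uniformization variable -/

/-- `k = (z + δσ q₀² / z) / 2`. -/
def k (z : ℂ) : ℂ := (z + P.ε * P.q₀ ^ 2 / z) / 2

/-- `λ = (z - δσ q₀² / z) / 2`. -/
def lam (z : ℂ) : ℂ := (z - P.ε * P.q₀ ^ 2 / z) / 2

/-- The phase `θ = λ (x + (4 k² + 2 δσ q₀²) t)`. -/
def θ (x t : ℝ) (z : ℂ) : ℂ := P.lam z * (x + (4 * P.k z ^ 2 + 2 * P.ε * P.q₀ ^ 2) * t)

/-- The domain `D⁺` (where `Im λ > 0`). -/
def Dplus : Set ℂ :=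
  if P.ε = 1 then {z | 0 < z.im} else {z | 0 < (‖z‖ - P.q₀) * z.im}

/-- The domain `D⁻` (where `Im λ < 0`). -/
def Dminus : Set ℂ :=
  if P.ε = 1 then {z | z.im < 0} else {z | (‖z‖ - P.q₀) * z.im < 0}

/-- The continuous spectrum `Σ`, without the point `0` (where `λ` is not defined). -/
def contSpec : Set ℂ :=
  if P.ε = 1 then {z | z ≠ 0 ∧ z.im = 0} else {z | z ≠ 0 ∧ (z.im = 0 ∨ ‖z‖ = P.q₀)}

/-- `Σ₀`: the continuous spectrum without the branch points `z² = δσ q₀²`. -/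
def contSpec₀ : Set ℂ := {z | z ∈ P.contSpec ∧ z ^ 2 ≠ P.ε * P.q₀ ^ 2}

/-! ### Lax pair, Jost solutions, scattering matrix -/

end Params

/-- Off-diagonal matrix with entries `a`, `b`. -/
def offDiag (a b : ℂ) : Matrix (Fin 2) (Fin 2) ℂ := !![0, a; b, 0]

/-- The third Pauli matrix. -/
def σ₃ : Matrix (Fin 2) (Fin 2) ℂ := !![1, 0; 0, -1]

/-- Partial derivative in the space variable. -/
def dx (f : ℝ → ℝ → ℝ) (x t : ℝ) : ℝ := deriv (fun y => f y t) x

/-- Partial derivative in the time variable. -/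
def dt (f : ℝ → ℝ → ℝ) (x t : ℝ) : ℝ := deriv (fun s => f x s) t

/-- Reverse space-time reflection `(x, t) ↦ f (-x) (-t)`. -/
def rst (f : ℝ → ℝ → ℝ) (x t : ℝ) : ℝ := f (-x) (-t)

namespace Params

variable (P : Params)

/-- `q` is a classical solution of the real nonlocal mKdV equation
`q_t - 6 σ q(x,t) q(-x,-t) q_x + q_xxx = 0` with `q → q_±` as `x → ±∞`, where the boundary values
are attained with `(1 + |x|) (q - q_±) ∈ L¹(ℝ^±)`. -/
structure IsSolution (q : ℝ → ℝ → ℝ) : Prop where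
  smooth : ContDiff ℝ 3 (fun p : ℝ × ℝ => q p.1 p.2)
  eqn : ∀ x t, dt q x t - 6 * P.σ * q x t * q (-x) (-t) * dx q x t + dx (dx (dx q)) x t = 0
  lim_right : ∀ t, Tendsto (fun x => q x t) atTop (𝓝 P.qp)
  lim_left : ∀ t, Tendsto (fun x => q x t) atBot (𝓝 P.qm)
  int_right : ∀ t, IntegrableOn (fun x => (1 + |x|) * (q x t - P.qp)) (Set.Ici 0)
  int_left : ∀ t, IntegrableOn (fun x => (1 + |x|) * (q x t - P.qm)) (Set.Iic 0)

/-- The potential matrix `Q`. -/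
def Q (q : ℝ → ℝ → ℝ) (x t : ℝ) : Matrix (Fin 2) (Fin 2) ℂ :=
  offDiag (q x t) (P.σ * rst q x t)

/-- `Q_x`. -/
def Qx (q : ℝ → ℝ → ℝ) (x t : ℝ) : Matrix (Fin 2) (Fin 2) ℂ :=
  offDiag (dx q x t) (P.σ * dx (rst q) x t)

/-- `Q_xx`. -/
def Qxx (q : ℝ → ℝ → ℝ) (x t : ℝ) : Matrix (Fin 2) (Fin 2) ℂ :=
  offDiag (dx (dx q) x t) (P.σ * dx (dx (rst q)) x t)

/-- `X = i k σ₃ + Q`. -/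
def X (q : ℝ → ℝ → ℝ) (x t : ℝ) (z : ℂ) : Matrix (Fin 2) (Fin 2) ℂ :=
  (I * P.k z) • σ₃ + P.Q q x t

/-- `T = (4 k² + 2 σ q(x,t) q(-x,-t)) X - 2 i k σ₃ Q_x + [Q_x, Q] - Q_xx`. -/
def T (q : ℝ → ℝ → ℝ) (x t : ℝ) (z : ℂ) : Matrix (Fin 2) (Fin 2) ℂ :=
  (4 * P.k z ^ 2 + 2 * P.σ * q x t * q (-x) (-t)) • P.X q x t z
    - (2 * I * P.k z) • (σ₃ * P.Qx q x t)
    + (P.Qx q x t * P.Q q x t - P.Q q x t * P.Qx q x t) - P.Qxx q x t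

/-- `φ` is a (vector) solution of both parts of the Lax pair at the spectral point `z`. -/
def IsLaxSolution (q : ℝ → ℝ → ℝ) (z : ℂ) (φ : ℝ → ℝ → Fin 2 → ℂ) : Prop :=
  (∀ x t, HasDerivAt (fun y => φ y t) (P.X q x t z *ᵥ φ x t) x) ∧
    ∀ x t, HasDerivAt (fun s => φ x s) (P.T q x t z *ᵥ φ x t) t

/-- The eigenvector matrix `E` of the asymptotic problem with boundary value `a`. -/
def E (a : ℝ) (z : ℂ) : Matrix (Fin 2) (Fin 2) ℂ :=
  !![1, I * a / z; -(P.ε * (I * a / z)), 1]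

/-- The factor of the `j`-th column of `exp(- i θ σ₃)`: `exp(-iθ)` for the first column and
`exp(iθ)` for the second one. -/
def osc (j : Fin 2) (x t : ℝ) (z : ℂ) : ℂ := exp ((if j = 0 then -I else I) * P.θ x t z)

/-- The `j`-th column of `Φ` is, at the point `z`, a Jost solution with normalization
`Φ exp(-iθσ₃) → E` at the end `l` (`atTop` or `atBot`) of the line. -/
def IsJostColumn (q : ℝ → ℝ → ℝ) (l : Filter ℝ) (a : ℝ) (j : Fin 2) (z : ℂ)
    (Φ : ℝ → ℝ → ℂ → Matrix (Fin 2) (Fin 2) ℂ) : Prop :=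
  P.IsLaxSolution q z (fun x t i => Φ x t z i j) ∧
    ∀ t i, Tendsto (fun x => Φ x t z i j * P.osc j x t z) l (𝓝 (P.E a z i j))

/-- `Φp = Φ₊` and `Φm = Φ₋` are the Jost solutions of the Lax pair, each column on the closed
domain on which it exists: `Φ₊,₁` and `Φ₋,₂` on `D⁺ ∪ Σ`, `Φ₋,₁` and `Φ₊,₂` on `D⁻ ∪ Σ`.
The values of the columns at other `z` are irrelevant. -/
structure IsJost (q : ℝ → ℝ → ℝ) (Φp Φm : ℝ → ℝ → ℂ → Matrix (Fin 2) (Fin 2) ℂ) : Prop where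
  p1 : ∀ z ∈ P.Dplus ∪ P.contSpec, P.IsJostColumn q atTop P.qp 0 z Φp
  m2 : ∀ z ∈ P.Dplus ∪ P.contSpec, P.IsJostColumn q atBot P.qm 1 z Φm
  m1 : ∀ z ∈ P.Dminus ∪ P.contSpec, P.IsJostColumn q atBot P.qm 0 z Φm
  p2 : ∀ z ∈ P.Dminus ∪ P.contSpec, P.IsJostColumn q atTop P.qp 1 z Φp

/-- Wronskian of the `i`-th column of `A` and the `j`-th column of `B`. -/
def wr (A : Matrix (Fin 2) (Fin 2) ℂ) (i : Fin 2) (B : Matrix (Fin 2) (Fin 2) ℂ) (j : Fin 2) : ℂ :=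
  A 0 i * B 1 j - A 1 i * B 0 j

/-- `S` is the scattering matrix: `Φ₊ = Φ₋ S` on `Σ₀`, with `s₁₁` on `D⁺` and `s₂₂` on `D⁻` given
by the Wronskian formulas. -/
structure IsScattering (Φp Φm : ℝ → ℝ → ℂ → Matrix (Fin 2) (Fin 2) ℂ)
    (S : ℂ → Matrix (Fin 2) (Fin 2) ℂ) : Prop where
  rel : ∀ z ∈ P.contSpec₀, ∀ x t, Φp x t z = Φm x t z * S z
  s11 : ∀ z ∈ P.Dplus, ∀ x t,
    S z 0 0 = wr (Φp x t z) 0 (Φm x t z) 1 / (1 - P.ε * P.q₀ ^ 2 / z ^ 2)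
  s22 : ∀ z ∈ P.Dminus, ∀ x t,
    S z 1 1 = wr (Φm x t z) 0 (Φp x t z) 1 / (1 - P.ε * P.q₀ ^ 2 / z ^ 2)

/-- Both reflection coefficients `s₂₁ / s₁₁` and `s₁₂ / s₂₂` vanish on the continuous spectrum. -/
def IsReflectionless (S : ℂ → Matrix (Fin 2) (Fin 2) ℂ) : Prop :=
  ∀ z ∈ P.contSpec₀, S z 1 0 = 0 ∧ S z 0 1 = 0

/-- The sectionally meromorphic matrix: `(μ₊,₁ / s₁₁, μ₋,₂)` on `D⁺` and
`(μ₋,₁, μ₊,₂ / s₂₂)` elsewhere, where `μ_± = Φ_± exp(-iθσ₃)`. -/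
def jostM (Φp Φm : ℝ → ℝ → ℂ → Matrix (Fin 2) (Fin 2) ℂ) (S : ℂ → Matrix (Fin 2) (Fin 2) ℂ)
    (x t : ℝ) (z : ℂ) : Matrix (Fin 2) (Fin 2) ℂ :=
  open Classical in
  if z ∈ P.Dplus then
    of fun i => ![Φp x t z i 0 * P.osc 0 x t z / S z 0 0, Φm x t z i 1 * P.osc 1 x t z]
  else
    of fun i => ![Φm x t z i 0 * P.osc 0 x t z, Φp x t z i 1 * P.osc 1 x t z / S z 1 1]

/-! ### The quartet and the Laurent data -/

/-- `v₁ = z₀`. -/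
def v₁ : ℂ := P.z₀

/-- `v₂ = δσ q₀² / z₀`. -/
def v₂ : ℂ := P.ε * P.q₀ ^ 2 / P.z₀

/-- The four points of the quartet: `v₁`, `-v₁*` (poles of the first column) ... -/
def poles₁ : Set ℂ := {P.v₁, -conj P.v₁}

/-- ... and `v₂`, `-v₂*` (poles of the second column). -/
def poles₂ : Set ℂ := {P.v₂, -conj P.v₂}

end Params

/-- `f` extends analytically to `p`. -/
def RegularAt (f : ℂ → ℂ) (p : ℂ) : Prop := ∃ g : ℂ → ℂ, AnalyticAt ℂ g p ∧ f =ᶠ[𝓝[≠] p] g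

/-- The Laurent expansion of `r` at `p` is `r₀(z) + ∑_{n=1}^N c n / (z - p)^n`, `r₀` analytic. -/
def HasLaurent (N : ℕ) (r : ℂ → ℂ) (p : ℂ) (c : ℕ → ℂ) : Prop :=
  RegularAt (fun z => r z - ∑ n ∈ Finset.Icc 1 N, c n / (z - p) ^ n) p

/-- Laurent coefficients (index `1, …, N`) at `v₁`, `-v₁*`, `v₂`, `-v₂*`, in this order. -/
structure Coeffs where
  r11 : ℕ → ℂ
  r12 : ℕ → ℂ
  r21 : ℕ → ℂ
  r22 : ℕ → ℂ

namespace Params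

variable (P : Params)

/-- `c` are the Laurent coefficients of `r` at `v₁`, `-v₁*` and of `rt` at `v₂`, `-v₂*`. -/
def HasLaurentCoeffs (N : ℕ) (r rt : ℂ → ℂ) (c : Coeffs) : Prop :=
  HasLaurent N r P.v₁ c.r11 ∧ HasLaurent N r (-conj P.v₁) c.r12 ∧
    HasLaurent N rt P.v₂ c.r21 ∧ HasLaurent N rt (-conj P.v₂) c.r22

/-- The generalized residue conditions at `(x, t)`: near `v₁` and `-v₁*` the first column of `M`
is `exp(-2iθ) r` times the second one up to an analytic function, near `v₂` and `-v₂*`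
the second column is `exp(2iθ) rt` times the first one up to an analytic function. -/
def ResidueConditions (r rt : ℂ → ℂ) (x t : ℝ) (M : ℂ → Matrix (Fin 2) (Fin 2) ℂ) : Prop :=
  (∀ p ∈ P.poles₁, ∀ i,
    RegularAt (fun z => M z i 0 - exp (-2 * I * P.θ x t z) * r z * M z i 1) p) ∧
  (∀ p ∈ P.poles₂, ∀ i,
    RegularAt (fun z => M z i 1 - exp (2 * I * P.θ x t z) * rt z * M z i 0) p)

/-- `M` solves the reflectionless (no jump across `Σ`) Riemann-Hilbert problem at `(x, t)`. -/
structure IsRHSolution (r rt : ℂ → ℂ) (x t : ℝ) (M : ℂ → Matrix (Fin 2) (Fin 2) ℂ) : Prop where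
  col1 : ∀ i, DifferentiableOn ℂ (fun z => M z i 0) (insert 0 P.poles₁)ᶜ
  col2 : ∀ i, DifferentiableOn ℂ (fun z => M z i 1) (insert 0 P.poles₂)ᶜ
  residue : P.ResidueConditions r rt x t M
  atInfinity : ∀ i j, (fun z => M z i j - (1 : Matrix (Fin 2) (Fin 2) ℂ) i j)
    =O[Bornology.cobounded ℂ] (fun z => z⁻¹)
  atZero : ∀ i j, (fun z => M z i j - ((I / z) • (σ₃ * offDiag P.qm (P.ε * P.qm))) i j)
    =O[𝓝[≠] 0] (fun _ => (1 : ℂ))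

end Params

/-! ### The determinant formula -/

/-- Taylor coefficient of order `l` of `g` at `p`. -/
def taylorCoeff (g : ℂ → ℂ) (p : ℂ) (l : ℕ) : ℂ := iteratedDeriv l g p / l.factorial

/-- The `N × N` block with `(s, p)` entry
`∑_{j=s}^N ∑_{l=0}^{j-s} C(p+l-1, l) ρ_j f_{j-s-l} (-1)^l / w^(p+l)`, `1 ≤ s, p ≤ N`. -/
def xiBlock (N : ℕ) (ρ f : ℕ → ℂ) (w : ℂ) : Matrix (Fin N) (Fin N) ℂ := of fun s' p' =>
  let s := s'.val + 1
  let p := p'.val + 1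
  ∑ j ∈ Finset.Icc s N, ∑ l ∈ Finset.range (j - s + 1),
    (Nat.choose (p + l - 1) l : ℂ) * ρ j * f (j - s - l) * ((-1) ^ l / w ^ (p + l))

/-- The vector `∑_{j=s}^N ∑_{l=0}^{j-s} ρ_j f_{j-s-l} (-1)^l b / v^(l+1)`, `1 ≤ s ≤ N`. -/
def etaVec (N : ℕ) (ρ f : ℕ → ℂ) (b v : ℂ) : Fin N → ℂ := fun s' =>
  let s := s'.val + 1
  ∑ j ∈ Finset.Icc s N, ∑ l ∈ Finset.range (j - s + 1),
    ρ j * f (j - s - l) * ((-1) ^ l * b / v ^ (l + 1))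

/-- The vector `∑_{j=s}^N ρ_j f_{j-s}`, `1 ≤ s ≤ N`. -/
def etaTildeVec (N : ℕ) (ρ f : ℕ → ℂ) : Fin N → ℂ := fun s' =>
  let s := s'.val + 1
  ∑ j ∈ Finset.Icc s N, ρ j * f (j - s)

/-- The row `⟨W₀| = (1, 0, …, 0, 1, 0, …, 0)`. -/
def W₀ (N : ℕ) : Fin N ⊕ Fin N → ℂ :=
  Sum.elim (fun s => if s.val = 0 then 1 else 0) (fun s => if s.val = 0 then 1 else 0)

namespace Params

variable (P : Params)

/-- Taylor coefficients of `exp(-2iθ)` at `p`. -/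
def f₁ (x t : ℝ) (p : ℂ) : ℕ → ℂ := taylorCoeff (fun z => exp (-2 * I * P.θ x t z)) p

/-- Taylor coefficients of `exp(2iθ)` at `p`. -/
def f₂ (x t : ℝ) (p : ℂ) : ℕ → ℂ := taylorCoeff (fun z => exp (2 * I * P.θ x t z)) p

/-- The `2N × 2N` matrix `Ξ`. -/
def Ξ (N : ℕ) (c : Coeffs) (x t : ℝ) : Matrix (Fin N ⊕ Fin N) (Fin N ⊕ Fin N) ℂ :=
  fromBlocks
    (xiBlock N c.r11 (P.f₁ x t P.v₁) (P.v₁ - P.v₂))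
    (xiBlock N c.r11 (P.f₁ x t P.v₁) (P.v₁ + conj P.v₂))
    (xiBlock N c.r12 (P.f₁ x t (-conj P.v₁)) (-conj P.v₁ - P.v₂))
    (xiBlock N c.r12 (P.f₁ x t (-conj P.v₁)) (-conj P.v₁ + conj P.v₂))

/-- The `2N × 2N` matrix `Ξ̃`. -/
def Ξt (N : ℕ) (c : Coeffs) (x t : ℝ) : Matrix (Fin N ⊕ Fin N) (Fin N ⊕ Fin N) ℂ :=
  fromBlocks
    (xiBlock N c.r21 (P.f₂ x t P.v₂) (P.v₂ - P.v₁))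
    (xiBlock N c.r21 (P.f₂ x t P.v₂) (P.v₂ + conj P.v₁))
    (xiBlock N c.r22 (P.f₂ x t (-conj P.v₂)) (-conj P.v₂ - P.v₁))
    (xiBlock N c.r22 (P.f₂ x t (-conj P.v₂)) (-conj P.v₂ + conj P.v₁))

/-- The vector `α₁`. -/
def α₁ (N : ℕ) (c : Coeffs) (x t : ℝ) : Fin N ⊕ Fin N → ℂ :=
  Sum.elim (etaVec N c.r11 (P.f₁ x t P.v₁) (I * P.qm) P.v₁)
    (etaVec N c.r12 (P.f₁ x t (-conj P.v₁)) (I * P.qm) (-conj P.v₁))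

/-- The vector `α₂`. -/
def α₂ (N : ℕ) (c : Coeffs) (x t : ℝ) : Fin N ⊕ Fin N → ℂ :=
  Sum.elim (etaTildeVec N c.r21 (P.f₂ x t P.v₂)) (etaTildeVec N c.r22 (P.f₂ x t (-conj P.v₂)))

/-- The matrix `I - Ξ̃ Ξ`. -/
def A (N : ℕ) (c : Coeffs) (x t : ℝ) : Matrix (Fin N ⊕ Fin N) (Fin N ⊕ Fin N) ℂ :=
  1 - P.Ξt N c x t * P.Ξ N c x t

/-- The determinant formula for the `N`-th order soliton (meaningful where `det (I - Ξ̃ Ξ) ≠ 0`). -/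
def soliton (N : ℕ) (c : Coeffs) (x t : ℝ) : ℂ :=
  P.qm - I * (((P.A N c x t + vecMulVec (P.α₂ N c x t) (W₀ N)).det
    + (P.A N c x t + vecMulVec (P.Ξt N c x t *ᵥ P.α₁ N c x t) (W₀ N)).det)
      / (P.A N c x t).det - 2)

end Params

end NonlocalMKdV

end

/-! ### Local complex analysis: removable singularities, Taylor coefficients, principal parts. -/

noncomputable section

namespace NonlocalMKdV

/-! ### Removable singularities -/

/-! Without a jump, each row of a solution of the Riemann–Hilbert problem is a pair of rational
functions. Liouville's theorem (`RowData.IsRow.first_eq`) writes an entry as its value at infinity,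
plus its pole at the origin, plus principal parts at two points of the quartet. The residue
conditions say that the principal parts of one column are those of the other column times a known
singular factor. Since the columns have disjoint poles, this is a finite linear system F = ΞG + β, G
= Ξ̃F + β̃ for the principal coefficients. Eliminating F leaves the matrix I − Ξ̃Ξ. The
1/z-coefficient at infinity involves only the simple-pole coefficients ⟨W₀|G⟩, and the matrix
determinant lemma turns it into the quotient of determinants. This settles (b).

For (c), the entries of Ξ and Ξ̃ are real analytic in x and tend to 0 as x → -∞, because exp(-2iθ)
decays at points of D⁺ and exp(2iθ) at points of D⁻. So det(I − Ξ̃Ξ) is analytic in x with limit 1,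
and its zeros are isolated.

For (a), the matrix M built from the Jost solutions must be shown to have a first row of this type.
The reflection (x,t) → (-x,-t), which is the nonlocal reduction itself, carries Φ₋ to Φ₊. Together
with z ↦ εq₀²/z it expresses all four columns through Φ₊,₁. That column solves a Volterra equation
on a right half-line, whose Picard iterates converge uniformly in z. This gives continuity up to Σ,
analyticity inside D⁺ and uniqueness, hence the symmetries (`jost_reflect`, `jost_hat`,
`jost_neg_conj`). Vanishing reflection makes the two expressions of M agree on Σ₀, and Painlevé's
theorem (`Admissible.analyticAt_glue`) continues M across the curve. At the branch points λ = 0 the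
coefficient s₁₁ is shown to have a nonzero limit (`exists_tendsto_s₁`), so that M is bounded there.
Integration by parts gives the behaviour at infinity, and z ↦ εq₀²/z transfers it to the origin.

The residue data come from the point (0,0), which the reflection fixes. If (a,c) is Φ₊,₁(0,0,z),
then Φ₋,₂(0,0,z) = (-σc,a), and s₁₁ is a nonvanishing factor times a² + σc². Hence Φ₊,₁ − (c/a)Φ₋,₂
is O(s₁₁) at (0,0), and by Gronwall's inequality for both parts of the Lax pair it is O(s₁₁) at
every (x,t). So r = c/(a s₁₁) and r̃(z) = -ε r(εq₀²/z) serve at all (x,t) at once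
(`regularAt_residue₁`, `regularAt_residue₂`). Finally the potential is read off from M₁₂ along the
imaginary axis and compared with (b), in `eq_soliton`. -/

lemma _root_.AnalyticAt.regularAt {f : ℂ → ℂ} {p : ℂ} (hf : AnalyticAt ℂ f p) : RegularAt f p :=
  ⟨f, hf, EventuallyEq.rfl⟩

lemma RegularAt.congr {f g : ℂ → ℂ} {p : ℂ} (hf : RegularAt f p) (h : g =ᶠ[𝓝[≠] p] f) :
    RegularAt g p := by
  obtain ⟨F, hF, e⟩ := hf
  exact ⟨F, hF, h.trans e⟩

lemma RegularAt.add {f g : ℂ → ℂ} {p : ℂ} (hf : RegularAt f p) (hg : RegularAt g p) :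
    RegularAt (fun z => f z + g z) p := by
  obtain ⟨F, hF, e⟩ := hf
  obtain ⟨G, hG, e'⟩ := hg
  exact ⟨fun z => F z + G z, hF.add hG, e.add e'⟩

lemma RegularAt.sub {f g : ℂ → ℂ} {p : ℂ} (hf : RegularAt f p) (hg : RegularAt g p) :
    RegularAt (fun z => f z - g z) p := by
  obtain ⟨F, hF, e⟩ := hf
  obtain ⟨G, hG, e'⟩ := hg
  exact ⟨fun z => F z - G z, hF.sub hG, e.sub e'⟩

lemma RegularAt.mul {f g : ℂ → ℂ} {p : ℂ} (hf : RegularAt f p) (hg : RegularAt g p) :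
    RegularAt (fun z => f z * g z) p := by
  obtain ⟨F, hF, e⟩ := hf
  obtain ⟨G, hG, e'⟩ := hg
  exact ⟨fun z => F z * G z, hF.mul hG, e.mul e'⟩

lemma RegularAt.sum {ι : Type*} (s : Finset ι) {f : ι → ℂ → ℂ} {p : ℂ}
    (hf : ∀ i ∈ s, RegularAt (f i) p) : RegularAt (fun z => ∑ i ∈ s, f i z) p := by
  classical
  induction s using Finset.induction with
  | empty => simpa using (analyticAt_const (v := (0 : ℂ)) (x := p)).regularAt
  | insert a s ha ih =>
    have h1 := (hf a (Finset.mem_insert_self _ _)).add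
      (ih fun i hi => hf i (Finset.mem_insert_of_mem hi))
    exact h1.congr (Eventually.of_forall fun z => by simp [Finset.sum_insert ha])

/-- Riemann's theorem. The value `f p` carries no information and is replaced by the limit. -/
lemma regularAt_of_bounded {f : ℂ → ℂ} {p : ℂ}
    (hd : ∀ᶠ z in 𝓝[≠] p, DifferentiableAt ℂ f z)
    (hb : f =O[𝓝[≠] p] (fun _ => (1 : ℂ))) : RegularAt f p := by
  obtain ⟨C, hC⟩ := hb.bound
  have hb' : IsBoundedUnder (· ≤ ·) (𝓝[≠] p) fun z => ‖f z - f p‖ := by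
    refine ⟨C + ‖f p‖, eventually_map.2 ?_⟩
    filter_upwards [hC] with z hz
    exact (norm_sub_le _ _).trans (by simpa using hz)
  have ht := tendsto_limUnder_of_differentiable_on_punctured_nhds_of_bounded_under hd hb'
  refine ⟨Function.update f p (limUnder (𝓝[≠] p) f), ?_, ?_⟩
  · apply analyticAt_of_differentiable_on_punctured_nhds_of_continuousAt
    · have hd2 := eventually_eventually_nhdsWithin.2 hd
      filter_upwards [hd, self_mem_nhdsWithin] with z hz hzp
      refine hz.congr_of_eventuallyEq ?_
      filter_upwards [isOpen_ne.mem_nhds hzp] with w hw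
      exact Function.update_of_ne hw _ _
    · exact continuousAt_update_same.2 ht
  · filter_upwards [self_mem_nhdsWithin] with z hz
    exact (Function.update_of_ne hz _ _).symm

lemma eventually_not_mem_of_finite {T : Set ℂ} (hT : T.Finite) (p : ℂ) :
    ∀ᶠ z in 𝓝[≠] p, z ∉ T := by
  have : (T \ {p})ᶜ ∈ 𝓝 p := (hT.subset Set.sdiff_subset).isClosed.isOpen_compl.mem_nhds (by simp)
  filter_upwards [mem_nhdsWithin_of_mem_nhds this, self_mem_nhdsWithin] with z h1 h2 h3
  exact h1 ⟨h3, h2⟩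

/-- Each point of `T` receives the value of its own local extension. Finiteness isolates the points,
so these corrections do not interfere with one another. It serves to repair `jostM` at the branch
points. -/
lemma exists_extension {f : ℂ → ℂ} {T : Set ℂ} (hT : T.Finite) (hr : ∀ p ∈ T, RegularAt f p) :
    ∃ F : ℂ → ℂ, (∀ p ∈ T, DifferentiableAt ℂ F p) ∧
      (∀ p ∉ T, DifferentiableAt ℂ f p → DifferentiableAt ℂ F p) ∧ ∀ z ∉ T, F z = f z := by
  classical
  choose! g hg e using hr
  refine ⟨fun z => if z ∈ T then g z z else f z, fun p hp => ?_, fun p hp hd => ?_,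
    fun z hz => by simp [hz]⟩
  · have h1 := eventually_not_mem_of_finite hT p
    refine (hg p hp).differentiableAt.congr_of_eventuallyEq ?_
    have h2 : ∀ᶠ z in 𝓝[≠] p, (if z ∈ T then g z z else f z) = g p z := by
      filter_upwards [h1, e p hp] with z hz hz'
      simp [hz, hz']
    rw [eventually_nhdsWithin_iff] at h2
    filter_upwards [h2] with z hz
    by_cases hzp : z = p
    · subst hzp; simp [hp]
    · exact hz hzp
  · have ho := hT.isClosed.isOpen_compl.mem_nhds hp
    refine hd.congr_of_eventuallyEq ?_
    filter_upwards [ho] with z hz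
    simp [show z ∉ T from hz]

lemma exists_differentiable_extension {f : ℂ → ℂ} {T : Set ℂ} (hT : T.Finite)
    (hd : DifferentiableOn ℂ f Tᶜ) (hr : ∀ p ∈ T, RegularAt f p) :
    ∃ F : ℂ → ℂ, Differentiable ℂ F ∧ ∀ z ∉ T, F z = f z := by
  obtain ⟨F, h1, h2, h3⟩ := exists_extension hT hr
  refine ⟨F, fun p => ?_, h3⟩
  by_cases hp : p ∈ T
  · exact h1 p hp
  · exact h2 p hp (hd.differentiableAt (hT.isClosed.isOpen_compl.mem_nhds hp))

/-- Liouville's theorem for functions with removable singularities. -/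
lemma eq_zero_of_regular_of_tendsto {f : ℂ → ℂ} {T : Set ℂ} (hT : T.Finite)
    (hd : DifferentiableOn ℂ f Tᶜ) (hr : ∀ p ∈ T, RegularAt f p)
    (hi : Tendsto f (Bornology.cobounded ℂ) (𝓝 0)) {z : ℂ} (hz : z ∉ T) : f z = 0 := by
  obtain ⟨F, hF, e⟩ := exists_differentiable_extension hT hd hr
  rw [← e z hz]
  refine hF.apply_eq_of_tendsto_cocompact z ?_
  rw [← Metric.cobounded_eq_cocompact]
  refine hi.congr' ?_
  have : Tᶜ ∈ Bornology.cobounded ℂ := Bornology.isBounded_def.1 hT.isBounded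
  filter_upwards [this] with w hw
  exact (e w hw).symm

/-! ### Taylor coefficients and principal parts -/

lemma exists_taylor_remainder {h : ℂ → ℂ} {p : ℂ} (hh : AnalyticAt ℂ h p) (n : ℕ) :
    ∃ F : ℂ → ℂ, AnalyticAt ℂ F p ∧
      ∀ z, h z = ∑ i ∈ Finset.range n, taylorCoeff h p i * (z - p) ^ i + (z - p) ^ n * F z := by
  have h0 : AnalyticAt ℂ (fun w => h (p + w)) 0 := by
    have : AnalyticAt ℂ h (p + 0) := by simpa using hh
    exact this.fun_comp (by fun_prop)
  obtain ⟨F, hF, e⟩ := h0.exists_eq_sum_add_pow_mul n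
  refine ⟨fun z => F (z - p), ?_, fun z => ?_⟩
  · have : AnalyticAt ℂ F (p - p) := by simpa using hF
    exact AnalyticAt.fun_comp (f := fun z => z - p) this (by fun_prop)
  · have := e (z - p)
    simp only [add_sub_cancel, smul_eq_mul, iteratedDeriv_comp_const_add, add_zero] at this
    rw [this]
    congr 1
    refine Finset.sum_congr rfl fun i _ => ?_
    simp only [taylorCoeff]
    ring

lemma taylorCoeff_congr {f g : ℂ → ℂ} {p : ℂ} (h : f =ᶠ[𝓝 p] g) (l : ℕ) :
    taylorCoeff f p l = taylorCoeff g p l := by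
  rw [taylorCoeff, taylorCoeff, h.iteratedDeriv_eq]

lemma taylorCoeff_mul {f g : ℂ → ℂ} {p : ℂ} (hf : AnalyticAt ℂ f p) (hg : AnalyticAt ℂ g p)
    (n : ℕ) : taylorCoeff (fun z => f z * g z) p n =
      ∑ l ∈ Finset.range (n + 1), taylorCoeff f p (n - l) * taylorCoeff g p l := by
  have h := iteratedDeriv_fun_mul (n := n) (x := p) hg.contDiffAt hf.contDiffAt
  have e : (fun z => f z * g z) = fun z => g z * f z := by ext; ring
  rw [taylorCoeff, e, h, Finset.sum_div]
  refine Finset.sum_congr rfl fun l hl => ?_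
  have hl' : l ≤ n := Nat.lt_succ_iff.1 (Finset.mem_range.1 hl)
  rw [Nat.cast_choose ℂ hl', taylorCoeff, taylorCoeff]
  have := Nat.factorial_ne_zero n
  field_simp

lemma taylorCoeff_add {f g : ℂ → ℂ} {p : ℂ} (hf : AnalyticAt ℂ f p) (hg : AnalyticAt ℂ g p)
    (n : ℕ) : taylorCoeff (fun z => f z + g z) p n = taylorCoeff f p n + taylorCoeff g p n := by
  rw [taylorCoeff, iteratedDeriv_fun_add hf.contDiffAt hg.contDiffAt, add_div]
  rfl

lemma taylorCoeff_const_mul {g : ℂ → ℂ} {p : ℂ} (c : ℂ) (n : ℕ) :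
    taylorCoeff (fun z => c * g z) p n = c * taylorCoeff g p n := by
  rw [taylorCoeff, iteratedDeriv_const_mul_field, taylorCoeff, mul_div_assoc]

lemma taylorCoeff_sum {ι : Type*} (s : Finset ι) {f : ι → ℂ → ℂ} {p : ℂ}
    (hf : ∀ i ∈ s, AnalyticAt ℂ (f i) p) (n : ℕ) :
    taylorCoeff (fun z => ∑ i ∈ s, f i z) p n = ∑ i ∈ s, taylorCoeff (f i) p n := by
  rw [taylorCoeff, iteratedDeriv_fun_sum fun i hi => (hf i hi).contDiffAt, Finset.sum_div]
  rfl

lemma taylorCoeff_const (c p : ℂ) (n : ℕ) :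
    taylorCoeff (fun _ => c) p n = if n = 0 then c else 0 := by
  rw [taylorCoeff, iteratedDeriv_const]
  split_ifs with h <;> simp [h]

lemma iteratedDeriv_inv_pow {v : ℂ} (m : ℕ) (l : ℕ) :
    ∀ p, p ≠ v → iteratedDeriv l (fun z => 1 / (z - v) ^ (m + 1)) p =
      (l.factorial : ℂ) * ((m + l).choose l) * ((-1) ^ l / (p - v) ^ (m + 1 + l)) := by
  induction l with
  | zero => intro p _; simp
  | succ l ih =>
    intro p hp
    have hpv : p - v ≠ 0 := sub_ne_zero.2 hp
    rw [iteratedDeriv_succ]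
    have e : iteratedDeriv l (fun z => 1 / (z - v) ^ (m + 1)) =ᶠ[𝓝 p] fun z =>
        (l.factorial : ℂ) * ((m + l).choose l) * ((-1) ^ l / (z - v) ^ (m + 1 + l)) := by
      filter_upwards [isOpen_ne.mem_nhds hp] with z hz using ih z hz
    rw [e.deriv_eq]
    have hD : HasDerivAt (fun z : ℂ => (l.factorial : ℂ) * ((m + l).choose l) *
        ((-1) ^ l / (z - v) ^ (m + 1 + l))) ((l.factorial : ℂ) * ((m + l).choose l) *
        ((0 * (p - v) ^ (m + 1 + l) - (-1) ^ l * (((m + 1 + l : ℕ) : ℂ) * (p - v) ^ (m + l) * 1))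
          / ((p - v) ^ (m + 1 + l)) ^ 2)) p := by
      refine HasDerivAt.const_mul _ (HasDerivAt.div (hasDerivAt_const _ _) ?_ (pow_ne_zero _ hpv))
      have := ((hasDerivAt_id p).sub_const v).pow (m + 1 + l)
      rw [show m + 1 + l - 1 = m + l by omega] at this
      exact this
    rw [hD.deriv]
    -- The absorption identity for binomials accounts for the exponent m + 1 + l brought down by
    -- differentiation.
    have hc : ((m + (l + 1)).choose (l + 1) : ℂ) * (l + 1) = (m + 1 + l) * ((m + l).choose l) := by
      have := Nat.add_one_mul_choose_eq (m + l) l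
      have h2 : ((m + l + 1 : ℕ) : ℂ) * ((m + l).choose l) =
        ((m + l + 1).choose (l + 1)) * ((l + 1 : ℕ) : ℂ) := by exact_mod_cast this
      push_cast at h2
      rw [← add_assoc, ← h2]
      ring
    have hf : ((l + 1).factorial : ℂ) = (l + 1) * l.factorial := by
      rw [Nat.factorial_succ]; push_cast; ring
    rw [hf]
    have : ((l : ℂ) + 1) * l.factorial * ((m + (l + 1)).choose (l + 1)) =
        l.factorial * ((m + 1 + l) * ((m + l).choose l)) := by
      rw [← hc]; ring
    rw [this]
    push_cast
    field_simp
    ring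

lemma taylorCoeff_inv_pow {p v : ℂ} (hp : p ≠ v) (m l : ℕ) :
    taylorCoeff (fun z => 1 / (z - v) ^ (m + 1)) p l =
      ((m + l).choose l) * ((-1) ^ l / (p - v) ^ (m + 1 + l)) := by
  rw [taylorCoeff, iteratedDeriv_inv_pow m l p hp]
  have : (l.factorial : ℂ) ≠ 0 := by exact_mod_cast Nat.factorial_ne_zero l
  field_simp

/-- Multiply each singular term ρ_n/(z-p)^n by the Taylor expansion of `h` to order n: the remainder
cancels the pole, and the polynomial part distributes over the lower pole orders. The index `s`
starts at 0, so it stands for the pole of order s + 1. -/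
lemma regularAt_laurent_mul {N : ℕ} {r h : ℂ → ℂ} {p : ℂ} {ρ : ℕ → ℂ} (hr : HasLaurent N r p ρ)
    (hh : AnalyticAt ℂ h p) :
    RegularAt (fun z => r z * h z - ∑ s : Fin N,
      (∑ j ∈ Finset.Icc (s.val + 1) N, ρ j * taylorCoeff h p (j - (s.val + 1))) /
        (z - p) ^ (s.val + 1)) p := by
  obtain ⟨F, hF, e⟩ : ∃ F : ℕ → ℂ → ℂ, (∀ n, AnalyticAt ℂ (F n) p) ∧ ∀ n z, h z =
      ∑ i ∈ Finset.range n, taylorCoeff h p i * (z - p) ^ i + (z - p) ^ n * F n z := by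
    choose F hF e using fun n => exists_taylor_remainder hh n
    exact ⟨F, hF, e⟩
  have h1 : RegularAt (fun z => (r z - ∑ n ∈ Finset.Icc 1 N, ρ n / (z - p) ^ n) * h z
      + ∑ n ∈ Finset.Icc 1 N, ρ n * F n z) p :=
    (RegularAt.mul hr hh.regularAt).add (RegularAt.sum _ fun n _ =>
      (analyticAt_const.regularAt).mul (hF n).regularAt)
  refine h1.congr ?_
  filter_upwards [self_mem_nhdsWithin] with z hz
  have hzp : z - p ≠ 0 := sub_ne_zero.2 hz
  have key : (∑ n ∈ Finset.Icc 1 N, ρ n / (z - p) ^ n) * h z =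
      ∑ s : Fin N, (∑ j ∈ Finset.Icc (s.val + 1) N, ρ j * taylorCoeff h p (j - (s.val + 1))) /
        (z - p) ^ (s.val + 1) + ∑ n ∈ Finset.Icc 1 N, ρ n * F n z := by
    rw [Fin.sum_univ_eq_sum_range (fun s => (∑ j ∈ Finset.Icc (s + 1) N,
      ρ j * taylorCoeff h p (j - (s + 1))) / (z - p) ^ (s + 1))]
    have h2 : ∀ n ∈ Finset.Icc 1 N, ρ n / (z - p) ^ n * h z =
        ∑ s ∈ Finset.range n, ρ n * taylorCoeff h p (n - (s + 1)) / (z - p) ^ (s + 1)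
          + ρ n * F n z := by
      intro n _
      rw [e n z, mul_add]
      congr 1
      -- Reversing the Taylor sum makes the summation index count the pole order instead of the
      -- Taylor order.
      · rw [Finset.mul_sum, ← Finset.sum_range_reflect]
        refine Finset.sum_congr rfl fun s hs => ?_
        have hs' := Finset.mem_range.1 hs
        have hn : n = (n - 1 - s) + (s + 1) := by omega
        rw [show n - 1 - s = n - (s + 1) by omega]
        have : (z - p) ^ n = (z - p) ^ (n - (s + 1)) * (z - p) ^ (s + 1) := by
          rw [← pow_add]; congr 1; omega
        rw [this]
        field_simp
      · field_simp
    rw [Finset.sum_mul, Finset.sum_congr rfl h2, Finset.sum_add_distrib]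
    congr 1
    simp_rw [Finset.sum_div]
    -- Interchange of summation over the triangle s + 1 ≤ n ≤ N.
    rw [Finset.sum_comm' (t' := Finset.range N) (s' := fun s => Finset.Icc (s + 1) N)]
    intro n s
    simp only [Finset.mem_Icc, Finset.mem_range]
    omega
  rw [sub_mul, key]
  ring

end NonlocalMKdV

end

/-! ### The reflectionless Riemann–Hilbert problem as a finite linear system. -/

noncomputable section

namespace NonlocalMKdV

/-! ### Rational functions with two poles -/

/-- The sum of the principal parts with coefficients `F` at the points `a` and `b`. -/
def ppart {N : ℕ} (a b : ℂ) (F : Fin N ⊕ Fin N → ℂ) (z : ℂ) : ℂ :=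
  ∑ s : Fin N, F (Sum.inl s) / (z - a) ^ (s.val + 1)
    + ∑ s : Fin N, F (Sum.inr s) / (z - b) ^ (s.val + 1)

lemma analyticAt_inv_sum {N : ℕ} {a p : ℂ} (hp : p ≠ a) (F : Fin N → ℂ) :
    AnalyticAt ℂ (fun z => ∑ s : Fin N, F s / (z - a) ^ (s.val + 1)) p := by
  refine Finset.analyticAt_fun_sum _ fun s _ => ?_
  exact analyticAt_const.div (by fun_prop) (pow_ne_zero _ (sub_ne_zero.2 hp))

lemma analyticAt_ppart {N : ℕ} {a b p : ℂ} (ha : p ≠ a) (hb : p ≠ b) (F : Fin N ⊕ Fin N → ℂ) :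
    AnalyticAt ℂ (ppart a b F) p :=
  (analyticAt_inv_sum ha _).add (analyticAt_inv_sum hb _)

lemma analyticAt_const_div {p : ℂ} (h0 : p ≠ 0) (d : ℂ) : AnalyticAt ℂ (fun z => d / z) p :=
  analyticAt_const.div analyticAt_id h0

lemma analyticAt_const_add_div {p : ℂ} (h0 : p ≠ 0) (c d : ℂ) :
    AnalyticAt ℂ (fun z => c + d / z) p :=
  analyticAt_const.add (analyticAt_const_div h0 d)

lemma analyticAt_rational {N : ℕ} {a b p : ℂ} (h0 : p ≠ 0) (ha : p ≠ a) (hb : p ≠ b) (c d : ℂ)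
    (F : Fin N ⊕ Fin N → ℂ) : AnalyticAt ℂ (fun z => c + d / z + ppart a b F z) p :=
  (analyticAt_const_add_div h0 c d).add (analyticAt_ppart ha hb F)

lemma tendsto_sub_inv_pow (a : ℂ) (n : ℕ) :
    Tendsto (fun z : ℂ => z / (z - a) ^ (n + 1)) (Bornology.cobounded ℂ)
      (𝓝 (if n = 0 then 1 else 0)) := by
  have h0 : Tendsto (fun z : ℂ => (z - a)⁻¹) (Bornology.cobounded ℂ) (𝓝 0) := by
    refine tendsto_inv₀_cobounded.comp ?_
    simp [sub_eq_add_neg]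
  have h1 : Tendsto (fun z : ℂ => z / (z - a)) (Bornology.cobounded ℂ) (𝓝 1) := by
    have : Tendsto (fun z : ℂ => 1 + a * (z - a)⁻¹) (Bornology.cobounded ℂ) (𝓝 (1 + a * 0)) :=
      (h0.const_mul a).const_add 1
    rw [mul_zero, add_zero] at this
    refine this.congr' ?_
    have : ({a}ᶜ : Set ℂ) ∈ Bornology.cobounded ℂ :=
      Bornology.isBounded_def.1 (Set.finite_singleton a).isBounded
    filter_upwards [this] with z hz
    have : z - a ≠ 0 := sub_ne_zero.2 hz
    field_simp
    ring
  have h2 := h1.mul (h0.pow n)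
  rw [one_mul] at h2
  have e : (0 : ℂ) ^ n = if n = 0 then 1 else 0 := by split_ifs with h <;> simp [h]
  rw [e] at h2
  refine h2.congr fun z => ?_
  rw [pow_succ, inv_pow, div_mul_eq_mul_div, div_eq_mul_inv, div_eq_mul_inv, mul_inv]
  ring

/-- After multiplication by z only the simple poles survive at infinity, and their coefficients sit
exactly where `W₀` has its ones. -/
lemma tendsto_mul_ppart {N : ℕ} (a b : ℂ) (F : Fin N ⊕ Fin N → ℂ) :
    Tendsto (fun z => z * ppart a b F z) (Bornology.cobounded ℂ) (𝓝 (W₀ N ⬝ᵥ F)) := by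
  have h : ∀ (p : ℂ) (G : Fin N → ℂ), Tendsto (fun z => ∑ s : Fin N,
      G s * (z / (z - p) ^ (s.val + 1))) (Bornology.cobounded ℂ)
      (𝓝 (∑ s : Fin N, G s * (if s.val = 0 then 1 else 0))) := fun p G =>
    tendsto_finsetSum _ fun s _ => (tendsto_sub_inv_pow p s.val).const_mul _
  have := (h a fun s => F (Sum.inl s)).add (h b fun s => F (Sum.inr s))
  have e : W₀ N ⬝ᵥ F = (∑ s : Fin N, F (Sum.inl s) * (if s.val = 0 then 1 else 0))
      + ∑ s : Fin N, F (Sum.inr s) * (if s.val = 0 then 1 else 0) := by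
    simp [dotProduct, W₀, Fintype.sum_sum_type]
  rw [e]
  refine this.congr fun z => ?_
  rw [ppart, mul_add, Finset.mul_sum, Finset.mul_sum]
  congr 1 <;> exact Finset.sum_congr rfl fun s _ => by ring

lemma isBigO_inv_of_tendsto {f : ℂ → ℂ} {L : ℂ}
    (h : Tendsto (fun z => z * f z) (Bornology.cobounded ℂ) (𝓝 L)) :
    f =O[Bornology.cobounded ℂ] (fun z => z⁻¹) := by
  have h1 := (h.isBigO_one ℂ).mul (isBigO_refl (fun z : ℂ => z⁻¹) (Bornology.cobounded ℂ))
  have h0 : ({0}ᶜ : Set ℂ) ∈ Bornology.cobounded ℂ :=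
    Bornology.isBounded_def.1 (Set.finite_singleton 0).isBounded
  refine h1.congr' ?_ (Eventually.of_forall fun z => one_mul _)
  filter_upwards [h0] with z hz
  have : z ≠ 0 := hz
  field_simp

lemma tendsto_zero_of_isBigO_inv {f : ℂ → ℂ}
    (h : f =O[Bornology.cobounded ℂ] (fun z => z⁻¹)) :
    Tendsto f (Bornology.cobounded ℂ) (𝓝 0) :=
  h.trans_tendsto tendsto_inv₀_cobounded

lemma isBigO_ppart {N : ℕ} (a b : ℂ) (F : Fin N ⊕ Fin N → ℂ) :
    ppart a b F =O[Bornology.cobounded ℂ] (fun z => z⁻¹) :=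
  isBigO_inv_of_tendsto (tendsto_mul_ppart a b F)

lemma isBigO_const_div (d : ℂ) :
    (fun z : ℂ => d / z) =O[Bornology.cobounded ℂ] (fun z => z⁻¹) := by
  simpa [div_eq_mul_inv] using (isBigO_refl (fun z : ℂ => z⁻¹) (Bornology.cobounded ℂ)).const_mul_left d

/-- The principal coefficients at `p` of the product of a function with Laurent coefficients `ρ`,
the function `e` and a rational function. -/
lemma sum_taylorCoeff_rational {N : ℕ} {e : ℂ → ℂ} {p a b : ℂ} (he : AnalyticAt ℂ e p)
    (h0 : p ≠ 0) (ha : p ≠ a) (hb : p ≠ b) (ρ : ℕ → ℂ) (c d : ℂ) (G : Fin N ⊕ Fin N → ℂ) :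
    (fun s : Fin N => ∑ j ∈ Finset.Icc (s.val + 1) N,
        ρ j * taylorCoeff (fun z => e z * (c + d / z + ppart a b G z)) p (j - (s.val + 1))) =
      xiBlock N ρ (taylorCoeff e p) (p - a) *ᵥ (fun s => G (Sum.inl s))
        + xiBlock N ρ (taylorCoeff e p) (p - b) *ᵥ (fun s => G (Sum.inr s))
        + (c • etaTildeVec N ρ (taylorCoeff e p) + etaVec N ρ (taylorCoeff e p) d p) := by
  -- The Taylor coefficients of the rational factor: the constant will produce `etaTildeVec`, the
  -- term d/z will produce `etaVec`, and the poles at `a` and `b` carry the binomial weights of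
  -- `xiBlock`.
  have hT : ∀ l, taylorCoeff (fun z => c + d / z + ppart a b G z) p l =
      (if l = 0 then c else 0) + (-1) ^ l * d / p ^ (l + 1)
      + (∑ m : Fin N, G (Sum.inl m) * (((m.val + l).choose l) *
          ((-1) ^ l / (p - a) ^ (m.val + 1 + l)))
        + ∑ m : Fin N, G (Sum.inr m) * (((m.val + l).choose l) *
          ((-1) ^ l / (p - b) ^ (m.val + 1 + l)))) := by
    intro l
    have hs : ∀ v, p ≠ v → ∀ F : Fin N → ℂ,
        taylorCoeff (fun z => ∑ m : Fin N, F m / (z - v) ^ (m.val + 1)) p l =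
        ∑ m : Fin N, F m * (((m.val + l).choose l) * ((-1) ^ l / (p - v) ^ (m.val + 1 + l))) := by
      intro v hv F
      rw [taylorCoeff_sum (f := fun m z => F m / (z - v) ^ (m.val + 1)) _ (fun m _ =>
        analyticAt_const.div (by fun_prop) (pow_ne_zero _ (sub_ne_zero.2 hv)))]
      refine Finset.sum_congr rfl fun m _ => ?_
      rw [← taylorCoeff_inv_pow hv, ← taylorCoeff_const_mul]
      congr 1
      ext z
      ring
    have hd : taylorCoeff (fun z => d / z) p l = (-1) ^ l * d / p ^ (l + 1) := by
      have := taylorCoeff_inv_pow h0 0 l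
      simp only [sub_zero, zero_add, pow_one, Nat.choose_self, Nat.cast_one, one_mul] at this
      have e2 : (fun z : ℂ => d / z) = fun z => d * (1 / z) := by ext z; ring
      rw [e2, taylorCoeff_const_mul, this, add_comm 1 l]
      ring
    rw [taylorCoeff_add (analyticAt_const_add_div h0 c d) (analyticAt_ppart ha hb G),
      taylorCoeff_add analyticAt_const (analyticAt_const_div h0 d), taylorCoeff_const, hd]
    congr 1
    unfold ppart
    rw [taylorCoeff_add (analyticAt_inv_sum ha fun s => G (Sum.inl s))
      (analyticAt_inv_sum hb fun s => G (Sum.inr s)), hs a ha, hs b hb]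
  have hX : ∀ (v : ℂ) (F : Fin N → ℂ) (s : Fin N),
      (xiBlock N ρ (taylorCoeff e p) (p - v) *ᵥ F) s =
      ∑ j ∈ Finset.Icc (s.val + 1) N, ∑ l ∈ Finset.range (j - (s.val + 1) + 1),
        ρ j * (taylorCoeff e p (j - (s.val + 1) - l) * ∑ m : Fin N, F m *
          (((m.val + l).choose l) * ((-1) ^ l / (p - v) ^ (m.val + 1 + l)))) := by
    intro v F s
    simp only [mulVec, dotProduct, xiBlock, of_apply, Finset.sum_mul, Finset.mul_sum]
    rw [Finset.sum_comm]
    refine Finset.sum_congr rfl fun j _ => ?_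
    rw [Finset.sum_comm]
    refine Finset.sum_congr rfl fun l _ => Finset.sum_congr rfl fun m _ => ?_
    rw [show m.val + 1 + l - 1 = m.val + l by omega]
    ring
  ext s
  simp only [Pi.add_apply, Pi.smul_apply, hX, smul_eq_mul, etaTildeVec, etaVec]
  rw [Finset.mul_sum, ← Finset.sum_add_distrib, ← Finset.sum_add_distrib, ← Finset.sum_add_distrib]
  refine Finset.sum_congr rfl fun j _ => ?_
  rw [taylorCoeff_mul he (analyticAt_rational h0 ha hb c d G), Finset.mul_sum]
  -- A constant has only a zeroth Taylor coefficient; it is spread over the same range as the other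
  -- sums so that all of them can be compared termwise.
  have hc : c * (ρ j * taylorCoeff e p (j - (s.val + 1))) =
      ∑ l ∈ Finset.range (j - (s.val + 1) + 1), (if l = 0 then c else 0) *
        (ρ j * taylorCoeff e p (j - (s.val + 1) - l)) := by
    rw [Finset.sum_range_succ']
    simp
  rw [hc, ← Finset.sum_add_distrib, ← Finset.sum_add_distrib, ← Finset.sum_add_distrib]
  refine Finset.sum_congr rfl fun l _ => ?_
  rw [hT]
  ring

/-! ### One row of the reflectionless Riemann-Hilbert problem -/

/-- The data of the Riemann-Hilbert problem at fixed `(x, t)`: the poles `a₁, b₁` of the first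
column, the poles `a₂, b₂` of the second column, the phases, the functions with prescribed
singularities and their Laurent coefficients. -/
structure RowData (N : ℕ) where
  a₁ : ℂ
  b₁ : ℂ
  a₂ : ℂ
  b₂ : ℂ
  e : ℂ → ℂ
  et : ℂ → ℂ
  r : ℂ → ℂ
  rt : ℂ → ℂ
  c : Coeffs
  nodup : [0, a₁, b₁, a₂, b₂].Nodup
  analytic_a₁ : AnalyticAt ℂ e a₁
  analytic_b₁ : AnalyticAt ℂ e b₁
  analytic_a₂ : AnalyticAt ℂ et a₂
  analytic_b₂ : AnalyticAt ℂ et b₂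
  laurent_a₁ : HasLaurent N r a₁ c.r11
  laurent_b₁ : HasLaurent N r b₁ c.r12
  laurent_a₂ : HasLaurent N rt a₂ c.r21
  laurent_b₂ : HasLaurent N rt b₂ c.r22

namespace RowData

variable {N : ℕ} (D : RowData N)

/-- The matrix expressing the principal parts of the first column through those of the second. -/
def xi : Matrix (Fin N ⊕ Fin N) (Fin N ⊕ Fin N) ℂ :=
  fromBlocks
    (xiBlock N D.c.r11 (taylorCoeff D.e D.a₁) (D.a₁ - D.a₂))
    (xiBlock N D.c.r11 (taylorCoeff D.e D.a₁) (D.a₁ - D.b₂))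
    (xiBlock N D.c.r12 (taylorCoeff D.e D.b₁) (D.b₁ - D.a₂))
    (xiBlock N D.c.r12 (taylorCoeff D.e D.b₁) (D.b₁ - D.b₂))

/-- The matrix expressing the principal parts of the second column through those of the first. -/
def xit : Matrix (Fin N ⊕ Fin N) (Fin N ⊕ Fin N) ℂ :=
  fromBlocks
    (xiBlock N D.c.r21 (taylorCoeff D.et D.a₂) (D.a₂ - D.a₁))
    (xiBlock N D.c.r21 (taylorCoeff D.et D.a₂) (D.a₂ - D.b₁))
    (xiBlock N D.c.r22 (taylorCoeff D.et D.b₂) (D.b₂ - D.a₁))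
    (xiBlock N D.c.r22 (taylorCoeff D.et D.b₂) (D.b₂ - D.b₁))

/-- Contribution of `c + d / z` in the second column to the principal parts of the first one. -/
def beta (c d : ℂ) : Fin N ⊕ Fin N → ℂ :=
  Sum.elim (c • etaTildeVec N D.c.r11 (taylorCoeff D.e D.a₁)
      + etaVec N D.c.r11 (taylorCoeff D.e D.a₁) d D.a₁)
    (c • etaTildeVec N D.c.r12 (taylorCoeff D.e D.b₁)
      + etaVec N D.c.r12 (taylorCoeff D.e D.b₁) d D.b₁)

/-- Contribution of `c + d / z` in the first column to the principal parts of the second one. -/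
def betat (c d : ℂ) : Fin N ⊕ Fin N → ℂ :=
  Sum.elim (c • etaTildeVec N D.c.r21 (taylorCoeff D.et D.a₂)
      + etaVec N D.c.r21 (taylorCoeff D.et D.a₂) d D.a₂)
    (c • etaTildeVec N D.c.r22 (taylorCoeff D.et D.b₂)
      + etaVec N D.c.r22 (taylorCoeff D.et D.b₂) d D.b₂)

/-- A row `(m₁, m₂)` of a solution of the Riemann-Hilbert problem, with behaviour `c + O(1/z)` at
infinity and `d / z + O(1)` at the origin. -/
structure IsRow (c₁ d₁ c₂ d₂ : ℂ) (m₁ m₂ : ℂ → ℂ) : Prop where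
  diff₁ : DifferentiableOn ℂ m₁ {0, D.a₁, D.b₁}ᶜ
  diff₂ : DifferentiableOn ℂ m₂ {0, D.a₂, D.b₂}ᶜ
  res_a₁ : RegularAt (fun z => m₁ z - D.e z * D.r z * m₂ z) D.a₁
  res_b₁ : RegularAt (fun z => m₁ z - D.e z * D.r z * m₂ z) D.b₁
  res_a₂ : RegularAt (fun z => m₂ z - D.et z * D.rt z * m₁ z) D.a₂
  res_b₂ : RegularAt (fun z => m₂ z - D.et z * D.rt z * m₁ z) D.b₂
  inf₁ : (fun z => m₁ z - c₁) =O[Bornology.cobounded ℂ] (fun z => z⁻¹)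
  inf₂ : (fun z => m₂ z - c₂) =O[Bornology.cobounded ℂ] (fun z => z⁻¹)
  zero₁ : (fun z => m₁ z - d₁ / z) =O[𝓝[≠] 0] (fun _ => (1 : ℂ))
  zero₂ : (fun z => m₂ z - d₂ / z) =O[𝓝[≠] 0] (fun _ => (1 : ℂ))

/-- The data with the two columns exchanged. -/
def swap : RowData N where
  a₁ := D.a₂
  b₁ := D.b₂
  a₂ := D.a₁
  b₂ := D.b₁
  e := D.et
  et := D.e
  r := D.rt
  rt := D.r
  c := ⟨D.c.r21, D.c.r22, D.c.r11, D.c.r12⟩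
  nodup := by
    have := D.nodup
    simp only [List.nodup_cons, List.mem_cons, not_or] at this ⊢
    simp only [List.not_mem_nil, not_false_eq_true, List.nodup_nil, and_true] at this ⊢
    obtain ⟨⟨h1, h2, h3, h4⟩, ⟨h5, h6, h7⟩, ⟨h8, h9⟩, h10⟩ := this
    exact ⟨⟨h3, h4, h1, h2⟩, ⟨h10, Ne.symm h6, Ne.symm h8⟩, ⟨Ne.symm h7, Ne.symm h9⟩, h5⟩
  analytic_a₁ := D.analytic_a₂
  analytic_b₁ := D.analytic_b₂
  analytic_a₂ := D.analytic_a₁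
  analytic_b₂ := D.analytic_b₁
  laurent_a₁ := D.laurent_a₂
  laurent_b₁ := D.laurent_b₂
  laurent_a₂ := D.laurent_a₁
  laurent_b₂ := D.laurent_b₁

lemma ne : (D.a₁ ≠ 0 ∧ D.b₁ ≠ 0 ∧ D.a₂ ≠ 0 ∧ D.b₂ ≠ 0) ∧ D.a₁ ≠ D.b₁ ∧ D.a₂ ≠ D.b₂ ∧
    D.a₁ ≠ D.a₂ ∧ D.a₁ ≠ D.b₂ ∧ D.b₁ ≠ D.a₂ ∧ D.b₁ ≠ D.b₂ := by
  have := D.nodup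
  simp only [List.nodup_cons, List.mem_cons, not_or] at this
  simp only [List.not_mem_nil, not_false_eq_true, List.nodup_nil, and_true] at this
  obtain ⟨⟨h1, h2, h3, h4⟩, ⟨h5, h6, h7⟩, ⟨h8, h9⟩, h10⟩ := this
  exact ⟨⟨Ne.symm h1, Ne.symm h2, Ne.symm h3, Ne.symm h4⟩, h5, h10, h6, h7, h8, h9⟩

/-- The principal coefficients of `e r m` at the poles of the first column. -/
def coef (m : ℂ → ℂ) : Fin N ⊕ Fin N → ℂ :=
  Sum.elim
    (fun s => ∑ j ∈ Finset.Icc (s.val + 1) N,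
      D.c.r11 j * taylorCoeff (fun z => D.e z * m z) D.a₁ (j - (s.val + 1)))
    (fun s => ∑ j ∈ Finset.Icc (s.val + 1) N,
      D.c.r12 j * taylorCoeff (fun z => D.e z * m z) D.b₁ (j - (s.val + 1)))

variable {D}

/-- The principal coefficients depend affinely on those of the other column. This is what makes the
residue conditions a linear system, with `xi` as its matrix and `beta` as its inhomogeneity. -/
lemma coef_rational (c d : ℂ) (G : Fin N ⊕ Fin N → ℂ) :
    D.coef (fun z => c + d / z + ppart D.a₂ D.b₂ G z) = D.xi *ᵥ G + D.beta c d := by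
  obtain ⟨⟨h1, h2, h3, h4⟩, h5, h6, h7, h8, h9, h10⟩ := D.ne
  have ea := sum_taylorCoeff_rational (N := N) D.analytic_a₁ h1 h7 h8 D.c.r11 c d G
  have eb := sum_taylorCoeff_rational (N := N) D.analytic_b₁ h2 h9 h10 D.c.r12 c d G
  rw [coef, ea, eb, xi, fromBlocks_mulVec, beta]
  ext (s | s) <;> rfl

lemma regularAt_ppart_left {a b : ℂ} (h : a ≠ b) (F : Fin N ⊕ Fin N → ℂ) :
    RegularAt (fun z => ppart a b F z - ∑ s : Fin N, F (Sum.inl s) / (z - a) ^ (s.val + 1)) a :=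
  (analyticAt_inv_sum h fun s => F (Sum.inr s)).regularAt.congr
    (Eventually.of_forall fun z => by simp [ppart])

lemma regularAt_ppart_right {a b : ℂ} (h : b ≠ a) (F : Fin N ⊕ Fin N → ℂ) :
    RegularAt (fun z => ppart a b F z - ∑ s : Fin N, F (Sum.inr s) / (z - b) ^ (s.val + 1)) b :=
  (analyticAt_inv_sum h fun s => F (Sum.inl s)).regularAt.congr
    (Eventually.of_forall fun z => by simp [ppart])

lemma regularAt_sub_coef_a {m : ℂ → ℂ} (hm : AnalyticAt ℂ m D.a₁) :
    RegularAt (fun z => D.e z * D.r z * m z -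
      ∑ s : Fin N, D.coef m (Sum.inl s) / (z - D.a₁) ^ (s.val + 1)) D.a₁ :=
  (regularAt_laurent_mul D.laurent_a₁ (D.analytic_a₁.mul hm)).congr
    (Eventually.of_forall fun z => by
      simp only [coef, Sum.elim_inl, Pi.mul_apply]
      congr 1
      · ring)

lemma regularAt_sub_coef_b {m : ℂ → ℂ} (hm : AnalyticAt ℂ m D.b₁) :
    RegularAt (fun z => D.e z * D.r z * m z -
      ∑ s : Fin N, D.coef m (Sum.inr s) / (z - D.b₁) ^ (s.val + 1)) D.b₁ :=
  (regularAt_laurent_mul D.laurent_b₁ (D.analytic_b₁.mul hm)).congr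
    (Eventually.of_forall fun z => by
      simp only [coef, Sum.elim_inr, Pi.mul_apply]
      congr 1
      · ring)

lemma IsRow.swap {c₁ d₁ c₂ d₂ : ℂ} {m₁ m₂ : ℂ → ℂ} (h : D.IsRow c₁ d₁ c₂ d₂ m₁ m₂) :
    D.swap.IsRow c₂ d₂ c₁ d₁ m₂ m₁ :=
  ⟨h.diff₂, h.diff₁, h.res_a₂, h.res_b₂, h.res_a₁, h.res_b₁, h.inf₂, h.inf₁, h.zero₂, h.zero₁⟩

/-- Liouville's theorem for the difference of the two sides. At the poles the residue condition
allows `m₁` to be replaced by e·r·m₂, and there `m₂` is analytic because the two columns have no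
common pole, so `coef m₂` is the principal part. At the origin and at infinity the prescribed
behaviour is subtracted. -/
lemma IsRow.first_eq {c₁ d₁ c₂ d₂ : ℂ} {m₁ m₂ : ℂ → ℂ} (h : D.IsRow c₁ d₁ c₂ d₂ m₁ m₂) {z : ℂ}
    (h0 : z ≠ 0) (ha : z ≠ D.a₁) (hb : z ≠ D.b₁) :
    m₁ z = c₁ + d₁ / z + ppart D.a₁ D.b₁ (D.coef m₂) z := by
  obtain ⟨⟨h1, h2, h3, h4⟩, h5, h6, h7, h8, h9, h10⟩ := D.ne
  have hfin : ({0, D.a₁, D.b₁} : Set ℂ).Finite := by simp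
  have hopen : ∀ p ∉ ({0, D.a₂, D.b₂} : Set ℂ), AnalyticAt ℂ m₂ p := fun p hp =>
    h.diff₂.analyticAt ((by simp : ({0, D.a₂, D.b₂} : Set ℂ).Finite).isClosed.isOpen_compl.mem_nhds hp)
  have hd : DifferentiableOn ℂ (fun z => m₁ z - (c₁ + d₁ / z + ppart D.a₁ D.b₁ (D.coef m₂) z))
      {0, D.a₁, D.b₁}ᶜ := by
    refine h.diff₁.sub fun z hz => ?_
    simp only [Set.mem_compl_iff, Set.mem_insert_iff, Set.mem_singleton_iff, not_or] at hz
    exact (analyticAt_rational hz.1 hz.2.1 hz.2.2 _ _ _).differentiableAt.differentiableWithinAt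
  refine sub_eq_zero.1 (eq_zero_of_regular_of_tendsto hfin hd ?_ ?_ (z := z) ?_)
  · rintro p (rfl | rfl | rfl)
    · refine regularAt_of_bounded ?_ ?_
      · have : ({D.a₁, D.b₁} : Set ℂ)ᶜ ∈ 𝓝 (0 : ℂ) :=
          (by simp : ({D.a₁, D.b₁} : Set ℂ).Finite).isClosed.isOpen_compl.mem_nhds
            (by simp [h1.symm, h2.symm])
        filter_upwards [mem_nhdsWithin_of_mem_nhds this, self_mem_nhdsWithin] with z hz hz0
        refine hd.differentiableAt (hfin.isClosed.isOpen_compl.mem_nhds ?_)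
        simp only [Set.mem_compl_iff, Set.mem_insert_iff, Set.mem_singleton_iff, not_or] at hz hz0 ⊢
        exact ⟨hz0, hz⟩
      · have hc : (fun z => c₁ + ppart D.a₁ D.b₁ (D.coef m₂) z) =O[𝓝[≠] 0] (fun _ => (1 : ℂ)) := by
          refine IsBigO.mono ?_ nhdsWithin_le_nhds
          exact (analyticAt_const.add (analyticAt_ppart h1.symm h2.symm _)).continuousAt.tendsto.isBigO_one ℂ
        refine (h.zero₁.sub hc).congr_left fun z => ?_
        ring
    · have h1' := (h.res_a₁.add (regularAt_sub_coef_a (hopen D.a₁ (by simp [*])))).sub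
        ((analyticAt_const_add_div h1 c₁ d₁).regularAt.add
          (regularAt_ppart_left h5 (D.coef m₂)))
      refine h1'.congr (Eventually.of_forall fun z => ?_)
      ring
    · have h1' := (h.res_b₁.add (regularAt_sub_coef_b (hopen D.b₁ (by simp [*])))).sub
        ((analyticAt_const_add_div h2 c₁ d₁).regularAt.add
          (regularAt_ppart_right h5.symm (D.coef m₂)))
      refine h1'.congr (Eventually.of_forall fun z => ?_)
      ring
  · refine tendsto_zero_of_isBigO_inv ?_
    refine (h.inf₁.sub ((isBigO_const_div d₁).add (isBigO_ppart D.a₁ D.b₁ (D.coef m₂)))).congr_left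
      fun z => ?_
    ring
  · simp [h0, ha, hb]

/-- The principal parts of a row solve the linear system. -/
lemma IsRow.linear_system {c₁ d₁ c₂ d₂ : ℂ} {m₁ m₂ : ℂ → ℂ} (h : D.IsRow c₁ d₁ c₂ d₂ m₁ m₂) :
    D.coef m₂ = D.xi *ᵥ (D.swap.coef m₁) + D.beta c₂ d₂ := by
  obtain ⟨⟨h1, h2, h3, h4⟩, h5, h6, h7, h8, h9, h10⟩ := D.ne
  rw [← coef_rational]
  -- Applied to the exchanged data, the rational representation describes `m₂` near the poles of the
  -- first column, where its Taylor coefficients are needed.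
  have key : ∀ p, p ≠ 0 → p ≠ D.a₂ → p ≠ D.b₂ → (fun z => D.e z * m₂ z) =ᶠ[𝓝 p]
      fun z => D.e z * (c₂ + d₂ / z + ppart D.a₂ D.b₂ (D.swap.coef m₁) z) := by
    intro p h0 ha hb
    filter_upwards [isOpen_ne.mem_nhds h0, isOpen_ne.mem_nhds ha, isOpen_ne.mem_nhds hb]
      with z hz0 hza hzb
    rw [h.swap.first_eq hz0 hza hzb]
    rfl
  have ka := taylorCoeff_congr (key _ h1 h7 h8)
  have kb := taylorCoeff_congr (key _ h2 h9 h10)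
  generalize D.swap.coef m₁ = G at ka kb ⊢
  simp only [coef, ka, kb]

/-- A solution of the linear system gives a row. -/
lemma isRow_of_linear_system {c₁ d₁ c₂ d₂ : ℂ} {F G : Fin N ⊕ Fin N → ℂ}
    (hF : F = D.xi *ᵥ G + D.beta c₂ d₂) (hG : G = D.xit *ᵥ F + D.betat c₁ d₁) :
    D.IsRow c₁ d₁ c₂ d₂ (fun z => c₁ + d₁ / z + ppart D.a₁ D.b₁ F z)
      (fun z => c₂ + d₂ / z + ppart D.a₂ D.b₂ G z) := by
  -- Half of the claims, for arbitrary data: the other half is the same statement for the data with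
  -- the columns exchanged.
  have main : ∀ (D : RowData N) (c₁ d₁ c₂ d₂ : ℂ) (F G : Fin N ⊕ Fin N → ℂ),
      F = D.xi *ᵥ G + D.beta c₂ d₂ →
      DifferentiableOn ℂ (fun z => c₁ + d₁ / z + ppart D.a₁ D.b₁ F z) {0, D.a₁, D.b₁}ᶜ ∧
      RegularAt (fun z => (c₁ + d₁ / z + ppart D.a₁ D.b₁ F z)
        - D.e z * D.r z * (c₂ + d₂ / z + ppart D.a₂ D.b₂ G z)) D.a₁ ∧
      RegularAt (fun z => (c₁ + d₁ / z + ppart D.a₁ D.b₁ F z)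
        - D.e z * D.r z * (c₂ + d₂ / z + ppart D.a₂ D.b₂ G z)) D.b₁ ∧
      (fun z => (c₁ + d₁ / z + ppart D.a₁ D.b₁ F z) - c₁) =O[Bornology.cobounded ℂ]
        (fun z => z⁻¹) ∧
      (fun z => (c₁ + d₁ / z + ppart D.a₁ D.b₁ F z) - d₁ / z) =O[𝓝[≠] 0]
        (fun _ => (1 : ℂ)) := by
    intro D c₁ d₁ c₂ d₂ F G hF
    obtain ⟨⟨h1, h2, h3, h4⟩, h5, h6, h7, h8, h9, h10⟩ := D.ne
    rw [← coef_rational] at hF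
    refine ⟨fun z hz => ?_, ?_, ?_, ?_, ?_⟩
    · simp only [Set.mem_compl_iff, Set.mem_insert_iff, Set.mem_singleton_iff, not_or] at hz
      exact (analyticAt_rational hz.1 hz.2.1 hz.2.2 _ _ _).differentiableAt.differentiableWithinAt
    · have := (analyticAt_const_add_div h1 c₁ d₁).regularAt.add
        ((regularAt_ppart_left h5 F).sub
          (regularAt_sub_coef_a (analyticAt_rational h1 h7 h8 c₂ d₂ G)))
      refine this.congr (Eventually.of_forall fun z => ?_)
      simp only [← hF]; ring
    · have := (analyticAt_const_add_div h2 c₁ d₁).regularAt.add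
        ((regularAt_ppart_right h5.symm F).sub
          (regularAt_sub_coef_b (analyticAt_rational h2 h9 h10 c₂ d₂ G)))
      refine this.congr (Eventually.of_forall fun z => ?_)
      simp only [← hF]; ring
    · refine ((isBigO_const_div d₁).add (isBigO_ppart D.a₁ D.b₁ F)).congr_left fun z => ?_
      ring
    · have hc : (fun z => c₁ + ppart D.a₁ D.b₁ F z) =O[𝓝[≠] 0] (fun _ => (1 : ℂ)) := by
        refine IsBigO.mono ?_ nhdsWithin_le_nhds
        exact (analyticAt_const.add
          (analyticAt_ppart h1.symm h2.symm F)).continuousAt.tendsto.isBigO_one ℂ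
      refine hc.congr_left fun z => ?_
      ring
  obtain ⟨p1, p2, p3, p4, p5⟩ := main D c₁ d₁ c₂ d₂ F G hF
  obtain ⟨q1, q2, q3, q4, q5⟩ := main D.swap c₂ d₂ c₁ d₁ G F hG
  exact ⟨p1, q1, p2, p3, q2, q3, p4, q4, p5, q5⟩

/-- Eliminating the coefficients of the first column leaves a square system with matrix 1 - Ξ̃Ξ for
those of the second. -/
lemma exists_isRow (hA : (1 - D.xit * D.xi).det ≠ 0) (c₁ d₁ c₂ d₂ : ℂ) :
    ∃ m₁ m₂, D.IsRow c₁ d₁ c₂ d₂ m₁ m₂ := by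
  set A := 1 - D.xit * D.xi
  set b := D.xit *ᵥ D.beta c₂ d₂ + D.betat c₁ d₁
  have hG : A *ᵥ (A⁻¹ *ᵥ b) = b := by
    rw [mulVec_mulVec, mul_nonsing_inv _ (isUnit_iff_ne_zero.2 hA), one_mulVec]
  refine ⟨_, _, isRow_of_linear_system (F := D.xi *ᵥ (A⁻¹ *ᵥ b) + D.beta c₂ d₂)
    (G := A⁻¹ *ᵥ b) rfl ?_⟩
  have : A *ᵥ (A⁻¹ *ᵥ b) = A⁻¹ *ᵥ b - D.xit *ᵥ (D.xi *ᵥ (A⁻¹ *ᵥ b)) := by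
    conv_lhs => rw [show A = 1 - D.xit * D.xi from rfl, sub_mulVec, one_mulVec, ← mulVec_mulVec]
  rw [this, sub_eq_iff_eq_add] at hG
  generalize A⁻¹ *ᵥ b = G at hG
  conv_lhs => rw [hG]
  rw [mulVec_add]
  simp only [b]
  abel

/-- The leading coefficient at infinity of the second entry of a row. -/
lemma IsRow.tendsto_second {c₁ d₁ d₂ : ℂ} {m₁ m₂ : ℂ → ℂ} (h : D.IsRow c₁ d₁ 0 d₂ m₁ m₂)
    (hA : (1 - D.xit * D.xi).det ≠ 0) :
    Tendsto (fun z => z * m₂ z) (Bornology.cobounded ℂ) (𝓝 (d₂ +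
      (((1 - D.xit * D.xi) + vecMulVec (D.betat c₁ d₁) (W₀ N)).det
      + ((1 - D.xit * D.xi) + vecMulVec (D.xit *ᵥ D.beta 0 d₂) (W₀ N)).det)
        / (1 - D.xit * D.xi).det - 2)) := by
  set A := 1 - D.xit * D.xi with hAdef
  have e1 := h.linear_system
  have e2 : D.swap.coef m₁ = D.xit *ᵥ (D.coef m₂) + D.betat c₁ d₁ := h.swap.linear_system
  set G := D.swap.coef m₁ with hGdef
  have hlin : A *ᵥ G = D.betat c₁ d₁ + D.xit *ᵥ D.beta 0 d₂ := by
    rw [hAdef, sub_mulVec, one_mulVec, ← mulVec_mulVec, sub_eq_iff_eq_add]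
    conv_lhs => rw [e2, e1, mulVec_add]
    abel
  have hu : IsUnit A.det := isUnit_iff_ne_zero.2 hA
  have hGs : G = A⁻¹ *ᵥ (D.betat c₁ d₁ + D.xit *ᵥ D.beta 0 d₂) := by
    rw [← hlin, mulVec_mulVec, nonsing_inv_mul _ hu, one_mulVec]
  -- The matrix determinant lemma for a rank-one perturbation.
  have hdet : ∀ u : Fin N ⊕ Fin N → ℂ,
      (A + vecMulVec u (W₀ N)).det = A.det * (1 + W₀ N ⬝ᵥ (A⁻¹ *ᵥ u)) := by
    intro u
    have h1 : A + vecMulVec u (W₀ N) = A * (1 + vecMulVec (A⁻¹ *ᵥ u) (W₀ N)) := by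
      rw [mul_add, mul_one, mul_vecMulVec, mulVec_mulVec, mul_nonsing_inv _ hu, one_mulVec]
    rw [h1, det_mul, ← det_one_add_replicateCol_mul_replicateRow (ι := Unit)]
    congr 2
    rw [vecMulVec_eq (ι := Unit)]
  -- Each quotient of determinants is 1 plus the wanted scalar product; the constant 2 removes the
  -- two ones.
  have hval : d₂ + ((A + vecMulVec (D.betat c₁ d₁) (W₀ N)).det
      + (A + vecMulVec (D.xit *ᵥ D.beta 0 d₂) (W₀ N)).det) / A.det - 2 = d₂ + W₀ N ⬝ᵥ G := by
    rw [hdet, hdet, hGs, mulVec_add, dotProduct_add]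
    field_simp
    ring
  rw [hval]
  have ht : Tendsto (fun z => d₂ + z * ppart D.a₂ D.b₂ G z) (Bornology.cobounded ℂ)
      (𝓝 (d₂ + W₀ N ⬝ᵥ G)) := (tendsto_mul_ppart D.a₂ D.b₂ G).const_add d₂
  refine ht.congr' ?_
  have hT : ({0, D.a₂, D.b₂} : Set ℂ)ᶜ ∈ Bornology.cobounded ℂ :=
    Bornology.isBounded_def.1 (by simp : ({0, D.a₂, D.b₂} : Set ℂ).Finite).isBounded
  filter_upwards [hT] with z hz
  simp only [Set.mem_compl_iff, Set.mem_insert_iff, Set.mem_singleton_iff, not_or] at hz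
  have h0 : z ≠ 0 := hz.1
  rw [h.swap.first_eq h0 hz.2.1 hz.2.2, zero_add, mul_add]
  congr 1
  field_simp

end RowData

end NonlocalMKdV

end

/-! ### Parameters, spectral domains, the quartet, and the rows of the problem. -/

noncomputable section

namespace NonlocalMKdV

lemma mul_neg_iff_neg_of_pos {a b : ℝ} (hb : 0 < b) : a * b < 0 ↔ a < 0 :=
  ⟨fun h => by by_contra! h'; exact absurd h (not_lt.2 (mul_nonneg h' hb.le)),
    fun h => mul_neg_of_neg_of_pos h hb⟩

namespace Params

variable (P : Params)

/-! ### Parameters -/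

/-- The constraints on the parameters. -/
structure Admissible : Prop where
  sigma : P.σ = 1 ∨ P.σ = -1
  delta : P.δ = 1 ∨ P.δ = -1
  pos : 0 < P.q₀
  abs_qm : |P.qm| = P.q₀

variable {P}

namespace Admissible

variable (h : P.Admissible)
include h

lemma eps : P.ε = 1 ∨ P.ε = -1 := by
  rcases h.sigma with h1 | h1 <;> rcases h.delta with h2 | h2 <;> simp [ε, h1, h2]

lemma eps_sq : P.ε ^ 2 = 1 := by rcases h.eps with h | h <;> simp [h]

lemma sigma_sq : P.σ ^ 2 = 1 := by rcases h.sigma with h | h <;> simp [h]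

lemma delta_sq : P.δ ^ 2 = 1 := by rcases h.delta with h | h <;> simp [h]

lemma qm_sq : P.qm ^ 2 = P.q₀ ^ 2 := by rw [← h.abs_qm, sq_abs]

lemma qp_sq : P.qp ^ 2 = P.q₀ ^ 2 := by rw [qp, mul_pow, h.delta_sq, one_mul, h.qm_sq]

lemma qm_ne : P.qm ≠ 0 := by
  intro h0
  have := h.abs_qm
  rw [h0, abs_zero] at this
  exact h.pos.ne this

lemma cast_ne : (P.ε : ℂ) * (P.q₀ : ℂ) ^ 2 ≠ 0 := by
  have h1 : (P.ε : ℂ) ≠ 0 := by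
    rcases h.eps with h | h <;> simp [h]
  exact mul_ne_zero h1 (pow_ne_zero _ (by exact_mod_cast h.pos.ne'))

omit h in
-- The factor |z|² + εq₀² is positive for ε = 1 and has the sign of |z| - q₀ for ε = -1. Hence D⁺,
-- D⁻ and Σ are the sets where Im λ is positive, negative and zero, which treats both cases at once.
lemma lam_im {z : ℂ} (hz : z ≠ 0) :
    (P.lam z).im = z.im * (‖z‖ ^ 2 + P.ε * P.q₀ ^ 2) / (2 * ‖z‖ ^ 2) := by
  have hn : ‖z‖ ^ 2 ≠ 0 := by positivity
  have hn' : normSq z ≠ 0 := by rwa [normSq_eq_norm_sq]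
  have e : P.lam z = (1 / 2 : ℝ) * (z - (P.ε * P.q₀ ^ 2 : ℝ) * z⁻¹) := by
    simp only [lam]; push_cast; ring
  rw [e, im_ofReal_mul, sub_im, im_ofReal_mul, inv_im, normSq_eq_norm_sq]
  field_simp
  ring


lemma mem_Dplus {z : ℂ} : z ∈ P.Dplus ↔ z ≠ 0 ∧ 0 < (P.lam z).im := by
  by_cases hz : z = 0
  · subst hz
    simp only [Dplus]
    split_ifs <;> simp
  · have hn : 0 < ‖z‖ := norm_pos_iff.2 hz
    have hq := h.pos
    have hd : 0 < 2 * ‖z‖ ^ 2 := by positivity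
    rw [lam_im hz, Dplus]
    rcases h.eps with he | he
    · have hp : 0 < ‖z‖ ^ 2 + P.ε * P.q₀ ^ 2 := by rw [he]; positivity
      rw [if_pos he]
      simp only [Set.mem_ofPred_eq, ne_eq, hz, not_false_eq_true, true_and]
      rw [div_pos_iff_of_pos_right hd, mul_pos_iff_of_pos_right hp]
    · have e : z.im * (‖z‖ ^ 2 + P.ε * P.q₀ ^ 2) = ((‖z‖ - P.q₀) * z.im) * (‖z‖ + P.q₀) := by
        rw [he]; ring
      have hp : 0 < ‖z‖ + P.q₀ := by positivity
      rw [if_neg (by rw [he]; norm_num)]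
      simp only [Set.mem_ofPred_eq, ne_eq, hz, not_false_eq_true, true_and]
      rw [div_pos_iff_of_pos_right hd, e, mul_pos_iff_of_pos_right hp]

lemma mem_Dminus {z : ℂ} : z ∈ P.Dminus ↔ z ≠ 0 ∧ (P.lam z).im < 0 := by
  by_cases hz : z = 0
  · subst hz
    simp only [Dminus]
    split_ifs <;> simp
  · have hn : 0 < ‖z‖ := norm_pos_iff.2 hz
    have hq := h.pos
    have hd : 0 < 2 * ‖z‖ ^ 2 := by positivity
    rw [lam_im hz, Dminus]
    rcases h.eps with he | he
    · have hp : 0 < ‖z‖ ^ 2 + P.ε * P.q₀ ^ 2 := by rw [he]; positivity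
      rw [if_pos he]
      simp only [Set.mem_ofPred_eq, ne_eq, hz, not_false_eq_true, true_and]
      rw [div_lt_iff₀ hd, zero_mul, mul_neg_iff_neg_of_pos hp]
    · have e : z.im * (‖z‖ ^ 2 + P.ε * P.q₀ ^ 2) = ((‖z‖ - P.q₀) * z.im) * (‖z‖ + P.q₀) := by
        rw [he]; ring
      have hp : 0 < ‖z‖ + P.q₀ := by positivity
      rw [if_neg (by rw [he]; norm_num)]
      simp only [Set.mem_ofPred_eq, ne_eq, hz, not_false_eq_true, true_and]
      rw [div_lt_iff₀ hd, zero_mul, e, mul_neg_iff_neg_of_pos hp]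

lemma mem_contSpec {z : ℂ} : z ∈ P.contSpec ↔ z ≠ 0 ∧ (P.lam z).im = 0 := by
  by_cases hz : z = 0
  · subst hz
    simp only [contSpec]
    split_ifs <;> simp
  · have hn : 0 < ‖z‖ := norm_pos_iff.2 hz
    have hq := h.pos
    have hd : (2 * ‖z‖ ^ 2) ≠ 0 := by positivity
    rw [lam_im hz, contSpec]
    rcases h.eps with he | he
    · have hp : ‖z‖ ^ 2 + P.ε * P.q₀ ^ 2 ≠ 0 := by rw [he]; positivity
      rw [if_pos he]
      simp [hz, div_eq_zero_iff, hd, hp]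
    · have e : ‖z‖ ^ 2 + P.ε * P.q₀ ^ 2 = (‖z‖ - P.q₀) * (‖z‖ + P.q₀) := by
        rw [he]; ring
      have hp : ‖z‖ + P.q₀ ≠ 0 := by positivity
      rw [if_neg (by rw [he]; norm_num), e]
      simp [hz, div_eq_zero_iff, hp, sub_eq_zero]

end Admissible

variable (P) in
/-- The involution `z ↦ ε q₀² / z`. -/
def hat (z : ℂ) : ℂ := P.ε * P.q₀ ^ 2 / z

lemma v₂_eq : P.v₂ = P.hat P.v₁ := rfl

lemma lam_neg_conj (z : ℂ) : P.lam (-conj z) = -conj (P.lam z) := by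
  simp only [lam, map_div₀, map_sub, map_mul, map_pow, conj_ofReal, map_ofNat, div_neg]
  ring

lemma k_neg_conj (z : ℂ) : P.k (-conj z) = -conj (P.k z) := by
  simp only [k, map_div₀, map_add, map_mul, map_pow, conj_ofReal, map_ofNat, div_neg]
  ring

lemma lam_neg_conj_im (z : ℂ) : (P.lam (-conj z)).im = (P.lam z).im := by
  rw [lam_neg_conj]; simp

lemma hat_neg_conj (z : ℂ) : P.hat (-conj z) = -conj (P.hat z) := by
  simp only [hat, map_div₀, map_mul, map_pow, conj_ofReal, div_neg]

namespace Admissible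

variable (h : P.Admissible)
include h

lemma hat_ne {z : ℂ} (hz : z ≠ 0) : P.hat z ≠ 0 := div_ne_zero h.cast_ne hz

/-- No condition z ≠ 0 is needed: division by zero gives `hat 0 = 0`. -/
lemma hat_hat (z : ℂ) : P.hat (P.hat z) = z := by
  have := h.cast_ne
  simp only [hat]
  rw [div_div_eq_mul_div, mul_div_cancel_left₀ _ this]

lemma lam_hat (z : ℂ) : P.lam (P.hat z) = -P.lam z := by
  have h1 := h.hat_hat z
  simp only [hat] at h1
  simp only [lam, hat, h1]
  ring

lemma k_hat (z : ℂ) : P.k (P.hat z) = P.k z := by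
  have h1 := h.hat_hat z
  simp only [hat] at h1
  simp only [k, hat, h1]
  ring

lemma hat_mem_Dminus {z : ℂ} : P.hat z ∈ P.Dminus ↔ z ∈ P.Dplus := by
  by_cases hz : z = 0
  · subst hz; simp [h.mem_Dminus, h.mem_Dplus, hat]
  · rw [h.mem_Dminus, h.mem_Dplus, h.lam_hat]
    simp [hz, h.hat_ne hz]

lemma hat_mem_Dplus {z : ℂ} : P.hat z ∈ P.Dplus ↔ z ∈ P.Dminus := by
  rw [← h.hat_mem_Dminus, h.hat_hat]

lemma neg_conj_mem_Dplus {z : ℂ} : -conj z ∈ P.Dplus ↔ z ∈ P.Dplus := by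
  simp [h.mem_Dplus, lam_neg_conj_im]

lemma not_mem_Dplus_of_mem_Dminus {z : ℂ} (hz : z ∈ P.Dminus) : z ∉ P.Dplus := fun h' =>
  lt_asymm ((h.mem_Dminus).1 hz).2 ((h.mem_Dplus).1 h').2

omit h in
lemma analyticAt_lam {z : ℂ} (hz : z ≠ 0) : AnalyticAt ℂ P.lam z := by
  unfold lam
  exact (analyticAt_id.sub (analyticAt_const.div analyticAt_id hz)).div analyticAt_const two_ne_zero

omit h in
lemma analyticAt_k {z : ℂ} (hz : z ≠ 0) : AnalyticAt ℂ P.k z := by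
  unfold k
  exact (analyticAt_id.add (analyticAt_const.div analyticAt_id hz)).div analyticAt_const two_ne_zero

omit h in
lemma analyticAt_θ (x t : ℝ) {z : ℂ} (hz : z ≠ 0) : AnalyticAt ℂ (P.θ x t) z := by
  unfold θ
  exact (analyticAt_lam hz).mul (analyticAt_const.add
    (((analyticAt_const.mul ((analyticAt_k hz).pow 2)).add analyticAt_const).mul analyticAt_const))

lemma isOpen_Dplus : IsOpen P.Dplus := by
  have : P.Dplus = {z | z ≠ 0} ∩ {z | 0 < (P.lam z).im} := by ext z; simp [h.mem_Dplus]
  rw [this]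
  have hc : ContinuousOn (fun z => (P.lam z).im) {z : ℂ | z ≠ 0} := fun z hz =>
    (continuous_im.continuousAt.comp (analyticAt_lam hz).continuousAt).continuousWithinAt
  exact hc.isOpen_inter_preimage isOpen_ne isOpen_Ioi

lemma isOpen_Dminus : IsOpen P.Dminus := by
  have : P.Dminus = {z | z ≠ 0} ∩ {z | (P.lam z).im < 0} := by ext z; simp [h.mem_Dminus]
  rw [this]
  have hc : ContinuousOn (fun z => (P.lam z).im) {z : ℂ | z ≠ 0} := fun z hz =>
    (continuous_im.continuousAt.comp (analyticAt_lam hz).continuousAt).continuousWithinAt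
  exact hc.isOpen_inter_preimage isOpen_ne isOpen_Iio

/-- Re z₀ > 0 separates v₁ from -v₁*, and the involution `hat` carries this over to v₂. Poles of
different columns lie in the disjoint domains D⁺ and D⁻. -/
lemma nodup_quartet (hz₀ : P.z₀ ∈ P.Dplus) (hre : 0 < P.z₀.re) :
    [0, P.v₁, -conj P.v₁, P.v₂, -conj P.v₂].Nodup := by
  have hv1 : P.v₁ ∈ P.Dplus := hz₀
  have hv1' := h.neg_conj_mem_Dplus.2 hv1
  have hv2 : P.v₂ ∈ P.Dminus := h.hat_mem_Dminus.2 hv1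
  have hv2' : -conj P.v₂ ∈ P.Dminus := by
    rw [v₂_eq, ← hat_neg_conj]; exact h.hat_mem_Dminus.2 hv1'
  have hne : P.v₁ ≠ -conj P.v₁ := by
    intro e
    have := congrArg re e
    simp [v₁] at this
    linarith
  have hd : ∀ {a b : ℂ}, a ∈ P.Dplus → b ∈ P.Dminus → a ≠ b := fun ha hb e =>
    h.not_mem_Dplus_of_mem_Dminus hb (e ▸ ha)
  have h0 : ∀ {a : ℂ}, a ∈ P.Dplus → (0 : ℂ) ≠ a := fun ha => (h.mem_Dplus.1 ha).1.symm
  have h0' : ∀ {a : ℂ}, a ∈ P.Dminus → (0 : ℂ) ≠ a := fun ha => (h.mem_Dminus.1 ha).1.symm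
  have hne2 : P.v₂ ≠ -conj P.v₂ := by
    intro e
    rw [v₂_eq, ← hat_neg_conj] at e
    exact hne (by simpa only [h.hat_hat] using congrArg P.hat e)
  simp only [List.nodup_cons, List.mem_cons, not_or, List.not_mem_nil, not_false_eq_true,
    List.nodup_nil, and_true]
  exact ⟨⟨h0 hv1, h0 hv1', h0' hv2, h0' hv2'⟩, ⟨hne, hd hv1 hv2, hd hv1 hv2'⟩,
    ⟨hd hv1' hv2, hd hv1' hv2'⟩, hne2⟩

/-- The data of the rows of the Riemann-Hilbert problem. -/
def rowData (hz₀ : P.z₀ ∈ P.Dplus) (hre : 0 < P.z₀.re) {N : ℕ} {r rt : ℂ → ℂ} {c : Coeffs}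
    (hL : P.HasLaurentCoeffs N r rt c) (x t : ℝ) : RowData N where
  a₁ := P.v₁
  b₁ := -conj P.v₁
  a₂ := P.v₂
  b₂ := -conj P.v₂
  e := fun z => exp (-2 * I * P.θ x t z)
  et := fun z => exp (2 * I * P.θ x t z)
  r := r
  rt := rt
  c := c
  nodup := h.nodup_quartet hz₀ hre
  analytic_a₁ := (analyticAt_const.mul (analyticAt_θ x t (by
    have := h.nodup_quartet hz₀ hre; simp only [List.nodup_cons, List.mem_cons] at this; tauto))).cexp
  analytic_b₁ := (analyticAt_const.mul (analyticAt_θ x t (by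
    have := h.nodup_quartet hz₀ hre; simp only [List.nodup_cons, List.mem_cons] at this; tauto))).cexp
  analytic_a₂ := (analyticAt_const.mul (analyticAt_θ x t (by
    have := h.nodup_quartet hz₀ hre; simp only [List.nodup_cons, List.mem_cons] at this; tauto))).cexp
  analytic_b₂ := (analyticAt_const.mul (analyticAt_θ x t (by
    have := h.nodup_quartet hz₀ hre; simp only [List.nodup_cons, List.mem_cons] at this; tauto))).cexp
  laurent_a₁ := hL.1
  laurent_b₁ := hL.2.1
  laurent_a₂ := hL.2.2.1
  laurent_b₂ := hL.2.2.2

variable (hz₀ : P.z₀ ∈ P.Dplus) (hre : 0 < P.z₀.re) {N : ℕ} {r rt : ℂ → ℂ} {c : Coeffs}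
  (hL : P.HasLaurentCoeffs N r rt c) (x t : ℝ)

lemma rowData_xi : (h.rowData hz₀ hre hL x t).xi = P.Ξ N c x t := by
  simp [RowData.xi, Ξ, rowData, f₁]

lemma rowData_xit : (h.rowData hz₀ hre hL x t).xit = P.Ξt N c x t := by
  simp [RowData.xit, Ξt, rowData, f₂]

lemma rowData_A :
    1 - (h.rowData hz₀ hre hL x t).xit * (h.rowData hz₀ hre hL x t).xi = P.A N c x t := by
  rw [rowData_xi, rowData_xit, A]

lemma rowData_beta : (h.rowData hz₀ hre hL x t).beta 0 (I * P.qm) = P.α₁ N c x t := by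
  simp [RowData.beta, α₁, rowData, f₁]

lemma rowData_betat : (h.rowData hz₀ hre hL x t).betat 1 0 = P.α₂ N c x t := by
  have : ∀ (ρ f : ℕ → ℂ) (v : ℂ), etaVec N ρ f 0 v = 0 := by
    intro ρ f v; ext s; simp [etaVec]
  simp [RowData.betat, α₂, rowData, f₂, this]

/-- Every condition acts on the entries of a single row, so the matrix problem splits into two row
problems that differ only in their normalizations at infinity and at the origin. -/
lemma isRHSolution_iff (M : ℂ → Matrix (Fin 2) (Fin 2) ℂ) :
    P.IsRHSolution r rt x t M ↔
      (h.rowData hz₀ hre hL x t).IsRow 1 0 0 (I * P.qm) (fun z => M z 0 0) (fun z => M z 0 1) ∧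
      (h.rowData hz₀ hre hL x t).IsRow 0 (-(I * (P.ε * P.qm))) 1 0
        (fun z => M z 1 0) (fun z => M z 1 1) := by
  have m00 : ∀ z : ℂ, ((I / z) • (σ₃ * offDiag P.qm (P.ε * P.qm))) 0 0 = 0 / z := by
    intro z; simp [σ₃, offDiag]
  have m01 : ∀ z : ℂ, ((I / z) • (σ₃ * offDiag P.qm (P.ε * P.qm))) 0 1 = I * P.qm / z := by
    intro z; simp [σ₃, offDiag]; ring
  have m10 : ∀ z : ℂ, ((I / z) • (σ₃ * offDiag P.qm (P.ε * P.qm))) 1 0 =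
      -(I * (P.ε * P.qm)) / z := by
    intro z; simp [σ₃, offDiag]; ring
  have m11 : ∀ z : ℂ, ((I / z) • (σ₃ * offDiag P.qm (P.ε * P.qm))) 1 1 = 0 / z := by
    intro z; simp [σ₃, offDiag]
  have o00 : (1 : Matrix (Fin 2) (Fin 2) ℂ) 0 0 = 1 := rfl
  have o01 : (1 : Matrix (Fin 2) (Fin 2) ℂ) 0 1 = 0 := rfl
  have o10 : (1 : Matrix (Fin 2) (Fin 2) ℂ) 1 0 = 0 := rfl
  have o11 : (1 : Matrix (Fin 2) (Fin 2) ℂ) 1 1 = 1 := rfl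
  constructor
  · intro H
    have z00 := H.atZero 0 0
    have z01 := H.atZero 0 1
    have z10 := H.atZero 1 0
    have z11 := H.atZero 1 1
    have i00 := H.atInfinity 0 0
    have i01 := H.atInfinity 0 1
    have i10 := H.atInfinity 1 0
    have i11 := H.atInfinity 1 1
    simp only [m00, m01, m10, m11, o00, o01, o10, o11] at z00 z01 z10 z11 i00 i01 i10 i11
    exact ⟨⟨H.col1 0, H.col2 0, H.residue.1 _ (Or.inl rfl) 0, H.residue.1 _ (Or.inr rfl) 0,
      H.residue.2 _ (Or.inl rfl) 0, H.residue.2 _ (Or.inr rfl) 0, i00, i01, z00, z01⟩,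
      ⟨H.col1 1, H.col2 1, H.residue.1 _ (Or.inl rfl) 1, H.residue.1 _ (Or.inr rfl) 1,
      H.residue.2 _ (Or.inl rfl) 1, H.residue.2 _ (Or.inr rfl) 1, i10, i11, z10, z11⟩⟩
  · rintro ⟨H0, H1⟩
    refine ⟨fun i => ?_, fun i => ?_, ⟨?_, ?_⟩, fun i j => ?_, fun i j => ?_⟩
    · fin_cases i
      · exact H0.diff₁
      · exact H1.diff₁
    · fin_cases i
      · exact H0.diff₂
      · exact H1.diff₂
    · rintro p (rfl | rfl) i <;> fin_cases i
      · exact H0.res_a₁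
      · exact H1.res_a₁
      · exact H0.res_b₁
      · exact H1.res_b₁
    · rintro p (rfl | rfl) i <;> fin_cases i
      · exact H0.res_a₂
      · exact H1.res_a₂
      · exact H0.res_b₂
      · exact H1.res_b₂
    · fin_cases i <;> fin_cases j
      · exact H0.inf₁
      · exact H0.inf₂
      · exact H1.inf₁
      · exact H1.inf₂
    · fin_cases i <;> fin_cases j
      · simpa only [Fin.zero_eta, m00] using H0.zero₁
      · simpa only [Fin.zero_eta, Fin.mk_one, m01] using H0.zero₂
      · simpa only [Fin.zero_eta, Fin.mk_one, m10] using H1.zero₁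
      · simpa only [Fin.mk_one, m11] using H1.zero₂

include hz₀ hre hL in
/-- The reflectionless Riemann-Hilbert problem is solvable. -/
theorem exists_isRHSolution (hA : (P.A N c x t).det ≠ 0) : ∃ M, P.IsRHSolution r rt x t M := by
  rw [← h.rowData_A hz₀ hre hL] at hA
  obtain ⟨m₁, m₂, h1⟩ := RowData.exists_isRow hA 1 0 0 (I * P.qm)
  obtain ⟨n₁, n₂, h2⟩ := RowData.exists_isRow hA 0 (-(I * (P.ε * P.qm))) 1 0
  exact ⟨fun z => !![m₁ z, m₂ z; n₁ z, n₂ z],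
    (h.isRHSolution_iff hz₀ hre hL x t _).2 ⟨h1, h2⟩⟩

/-- The potential reconstructed from the first row of a solution of the Riemann-Hilbert problem. -/
theorem tendsto_of_isRow (hA : (P.A N c x t).det ≠ 0) {m₁ m₂ : ℂ → ℂ}
    (hM : (h.rowData hz₀ hre hL x t).IsRow 1 0 0 (I * P.qm) m₁ m₂) :
    Tendsto (fun z => -I * (z * m₂ z)) (Bornology.cobounded ℂ) (𝓝 (P.soliton N c x t)) := by
  rw [← h.rowData_A hz₀ hre hL] at hA
  have := (RowData.IsRow.tendsto_second hM hA).const_mul (-I)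
  rw [h.rowData_A, rowData_beta, rowData_betat, rowData_xit] at this
  convert this using 2
  rw [soliton]
  -- The pole i q₋/z of the second entry contributes -i · i q₋ = q₋.
  linear_combination (P.qm : ℂ) * I_mul_I

end Admissible

end Params

end NonlocalMKdV

end

/-! ### Zeros of the denominator as a function of x. -/

noncomputable section

namespace NonlocalMKdV

/-! ### The denominator of the determinant formula -/

/-- The Taylor coefficients of `g exp(a h)` are analytic in the parameter `a`. -/
lemma analyticAt_taylorCoeff_exp {g h : ℂ → ℂ} {p : ℂ} (hg : AnalyticAt ℂ g p)
    (hh : AnalyticAt ℂ h p) (l : ℕ) (x : ℝ) :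
    AnalyticAt ℝ (fun x : ℝ => taylorCoeff (fun z => g z * exp (x * h z)) p l) x := by
  have key : ∀ (l : ℕ) (g : ℂ → ℂ), AnalyticAt ℂ g p →
      AnalyticAt ℝ (fun x : ℝ => iteratedDeriv l (fun z => g z * exp (x * h z)) p) x := by
    intro l
    induction l with
    | zero =>
      intro g _
      simp only [iteratedDeriv_zero]
      have h1 : AnalyticAt ℝ (fun x : ℝ => (x : ℂ) * h p) x :=
        (ofRealCLM.analyticAt x).mul analyticAt_const
      have h2 : AnalyticAt ℝ exp ((x : ℂ) * h p) := analyticAt_cexp.restrictScalars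
      exact analyticAt_const.mul (AnalyticAt.fun_comp (f := fun x : ℝ => (x : ℂ) * h p) h2 h1)
    | succ l ih =>
      intro g hg
      -- One derivative in z replaces the amplitude g by g' and by x·g·h'. Hence the induction runs
      -- over all amplitudes simultaneously.
      have e : ∀ x : ℝ, iteratedDeriv (l + 1) (fun z => g z * exp (x * h z)) p =
          iteratedDeriv l (fun z => deriv g z * exp (x * h z)) p
          + x * iteratedDeriv l (fun z => (g z * deriv h z) * exp (x * h z)) p := by
        intro x
        have hx : AnalyticAt ℂ (fun z => exp (x * h z)) p := (analyticAt_const.mul hh).cexp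
        have e1 : deriv (fun z => g z * exp (x * h z)) =ᶠ[𝓝 p] fun z =>
            deriv g z * exp (x * h z) + x * ((g z * deriv h z) * exp (x * h z)) := by
          filter_upwards [hg.eventually_analyticAt, hh.eventually_analyticAt] with z hgz hhz
          have h1 := hgz.differentiableAt.hasDerivAt
          have h2 := (hhz.differentiableAt.hasDerivAt.const_mul (x : ℂ)).cexp
          rw [(h1.fun_mul h2).deriv]
          ring
        rw [iteratedDeriv_succ', e1.iteratedDeriv_eq,
          iteratedDeriv_fun_add (hg.deriv.fun_mul hx).contDiffAt
            (analyticAt_const.fun_mul ((hg.fun_mul hh.deriv).fun_mul hx)).contDiffAt,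
          iteratedDeriv_const_mul_field]
      simp only [e]
      exact (ih _ hg.deriv).add ((ofRealCLM.analyticAt x).mul (ih _ (hg.mul hh.deriv)))
  simp only [taylorCoeff]
  exact (key l g hg).div analyticAt_const (by exact_mod_cast Nat.factorial_ne_zero l)

/-- Cauchy's estimate gives the decay of the Taylor coefficients from the decay of the modulus. -/
lemma tendsto_taylorCoeff_exp {g h : ℂ → ℂ} {p : ℂ} (hg : AnalyticAt ℂ g p)
    (hh : AnalyticAt ℂ h p) (hp : 0 < (h p).re) (l : ℕ) :
    Tendsto (fun x : ℝ => taylorCoeff (fun z => g z * exp (x * h z)) p l) atBot (𝓝 0) := by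
  obtain ⟨κ, hκ, hκp⟩ : ∃ κ, 0 < κ ∧ κ < (h p).re := ⟨(h p).re / 2, by linarith, by linarith⟩
  have h1 : ∀ᶠ z in 𝓝 p, κ < (h z).re :=
    (continuous_re.continuousAt.comp hh.continuousAt).eventually (lt_mem_nhds hκp)
  have h2 : ∀ᶠ z in 𝓝 p, ‖g z‖ < ‖g p‖ + 1 :=
    hg.continuousAt.norm.eventually (gt_mem_nhds (by linarith))
  obtain ⟨R, hR, hball⟩ := Metric.eventually_nhds_iff_ball.1
    (h1.and (h2.and (hg.eventually_analyticAt.and hh.eventually_analyticAt)))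
  have hbound : ∀ x : ℝ, x < 0 → ‖taylorCoeff (fun z => g z * exp (x * h z)) p l‖ ≤
      (‖g p‖ + 1) / (R / 2) ^ l * Real.exp (κ * x) := by
    intro x hx
    have hsub : Metric.closedBall p (R / 2) ⊆ Metric.ball p R :=
      Metric.closedBall_subset_ball (by linarith)
    have hd : DiffContOnCl ℂ (fun z => g z * exp (x * h z)) (Metric.ball p (R / 2)) := by
      refine DifferentiableOn.diffContOnCl fun z hz => ?_
      have hz' := hball z (hsub (Metric.closure_ball_subset_closedBall hz))
      exact (hz'.2.2.1.mul ((analyticAt_const.mul hz'.2.2.2).cexp)).differentiableAt.differentiableWithinAt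
    have := norm_iteratedDeriv_le_of_forall_mem_sphere_norm_le l (half_pos hR) hd
      (C := (‖g p‖ + 1) * Real.exp (κ * x)) (fun z hz => by
        have hz' := hball z (hsub (Metric.sphere_subset_closedBall hz))
        rw [norm_mul, norm_exp, re_ofReal_mul]
        refine mul_le_mul hz'.2.1.le (Real.exp_le_exp.2 ?_) (Real.exp_pos _).le (by positivity)
        nlinarith [hz'.1])
    rw [taylorCoeff, norm_div, norm_natCast, div_le_iff₀ (by positivity)]
    refine this.trans (le_of_eq ?_)
    ring
  have hlim : Tendsto (fun x : ℝ => (‖g p‖ + 1) / (R / 2) ^ l * Real.exp (κ * x)) atBot (𝓝 0) := by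
    have : Tendsto (fun x : ℝ => Real.exp (κ * x)) atBot (𝓝 0) :=
      Real.tendsto_exp_atBot.comp (tendsto_id.const_mul_atBot hκ)
    simpa using this.const_mul ((‖g p‖ + 1) / (R / 2) ^ l)
  refine squeeze_zero_norm' ?_ hlim
  filter_upwards [eventually_lt_atBot 0] with x hx using hbound x hx

lemma analyticAt_xiBlock {N : ℕ} {f : ℝ → ℕ → ℂ} {x : ℝ}
    (hf : ∀ l, AnalyticAt ℝ (fun x => f x l) x) (ρ : ℕ → ℂ) (w : ℂ) (i j : Fin N) :
    AnalyticAt ℝ (fun x => xiBlock N ρ (f x) w i j) x := by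
  simp only [xiBlock, of_apply]
  refine Finset.analyticAt_fun_sum _ fun _ _ => Finset.analyticAt_fun_sum _ fun _ _ => ?_
  exact (analyticAt_const.mul (hf _)).mul analyticAt_const

lemma tendsto_xiBlock {N : ℕ} {f : ℝ → ℕ → ℂ} {F : Filter ℝ}
    (hf : ∀ l, Tendsto (fun x => f x l) F (𝓝 0)) (ρ : ℕ → ℂ) (w : ℂ) (i j : Fin N) :
    Tendsto (fun x => xiBlock N ρ (f x) w i j) F (𝓝 0) := by
  simp only [xiBlock, of_apply]
  rw [show (0 : ℂ) = ∑ j ∈ Finset.Icc (i.val + 1) N, ∑ l ∈ Finset.range (j - (i.val + 1) + 1), 0 by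
    simp]
  refine tendsto_finsetSum _ fun k _ => tendsto_finsetSum _ fun l _ => ?_
  simpa using ((hf (k - (i.val + 1) - l)).const_mul
    (((j.val + 1 + l - 1).choose l : ℂ) * ρ k)).mul_const ((-1) ^ l / w ^ (j.val + 1 + l))

lemma analyticAt_det {n : Type*} [Fintype n] [DecidableEq n] {A : ℝ → Matrix n n ℂ} {x : ℝ}
    (hA : ∀ i j, AnalyticAt ℝ (fun x => A x i j) x) : AnalyticAt ℝ (fun x => (A x).det) x := by
  simp only [det_apply']
  refine Finset.analyticAt_fun_sum _ fun σ _ => analyticAt_const.mul ?_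
  exact Finset.analyticAt_fun_prod _ fun i _ => hA _ _

namespace Params

variable {P : Params}

/-- The phase is affine in x with slope λ, so both exponentials have the form g·exp(xh) with h =
∓2iλ. -/
lemma θ_split (x t : ℝ) (z : ℂ) : P.θ x t z = x * P.lam z + P.θ 0 t z := by
  simp only [θ, ofReal_zero]; ring

lemma analyticAt_f₁ (t : ℝ) {p : ℂ} (hp : p ≠ 0) (l : ℕ) (x : ℝ) :
    AnalyticAt ℝ (fun x => P.f₁ x t p l) x := by
  have := analyticAt_taylorCoeff_exp (g := fun z => exp (-2 * I * P.θ 0 t z))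
    (h := fun z => -2 * I * P.lam z) (analyticAt_const.mul (Admissible.analyticAt_θ 0 t hp)).cexp
    (analyticAt_const.mul (Admissible.analyticAt_lam hp)) l x
  refine this.congr (Eventually.of_forall fun y => ?_)
  simp only [f₁]
  congr 1
  ext z
  rw [θ_split y t z, ← exp_add]
  ring_nf

lemma analyticAt_f₂ (t : ℝ) {p : ℂ} (hp : p ≠ 0) (l : ℕ) (x : ℝ) :
    AnalyticAt ℝ (fun x => P.f₂ x t p l) x := by
  have := analyticAt_taylorCoeff_exp (g := fun z => exp (2 * I * P.θ 0 t z))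
    (h := fun z => 2 * I * P.lam z) (analyticAt_const.mul (Admissible.analyticAt_θ 0 t hp)).cexp
    (analyticAt_const.mul (Admissible.analyticAt_lam hp)) l x
  refine this.congr (Eventually.of_forall fun y => ?_)
  simp only [f₂]
  congr 1
  ext z
  rw [θ_split y t z, ← exp_add]
  ring_nf

/-- Re(-2iλ) = 2 Im λ, which is positive in D⁺, the domain containing the poles of the first column;
hence decay as x → -∞. -/
lemma tendsto_f₁ (t : ℝ) {p : ℂ} (hp : p ≠ 0) (hl : 0 < (P.lam p).im) (l : ℕ) :
    Tendsto (fun x => P.f₁ x t p l) atBot (𝓝 0) := by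
  have := tendsto_taylorCoeff_exp (g := fun z => exp (-2 * I * P.θ 0 t z))
    (h := fun z => -2 * I * P.lam z) (analyticAt_const.mul (Admissible.analyticAt_θ 0 t hp)).cexp
    (analyticAt_const.mul (Admissible.analyticAt_lam hp)) (by simpa using hl) l
  refine this.congr fun y => ?_
  simp only [f₁]
  congr 1
  ext z
  rw [θ_split y t z, ← exp_add]
  ring_nf

lemma tendsto_f₂ (t : ℝ) {p : ℂ} (hp : p ≠ 0) (hl : (P.lam p).im < 0) (l : ℕ) :
    Tendsto (fun x => P.f₂ x t p l) atBot (𝓝 0) := by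
  have := tendsto_taylorCoeff_exp (g := fun z => exp (2 * I * P.θ 0 t z))
    (h := fun z => 2 * I * P.lam z) (analyticAt_const.mul (Admissible.analyticAt_θ 0 t hp)).cexp
    (analyticAt_const.mul (Admissible.analyticAt_lam hp)) (by simp; linarith) l
  refine this.congr fun y => ?_
  simp only [f₂]
  congr 1
  ext z
  rw [θ_split y t z, ← exp_add]
  ring_nf

/-- The zeros of the denominator are isolated. -/
theorem Admissible.finite_det_eq_zero (h : P.Admissible) (hz₀ : P.z₀ ∈ P.Dplus) (N : ℕ)
    (c : Coeffs) (t a b : ℝ) : {x | x ∈ Set.Icc a b ∧ (P.A N c x t).det = 0}.Finite := by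
  have hv1 := h.mem_Dplus.1 (show P.v₁ ∈ P.Dplus from hz₀)
  have hv1' := h.mem_Dplus.1 (h.neg_conj_mem_Dplus.2 hz₀ : -conj P.v₁ ∈ P.Dplus)
  have hv2 := h.mem_Dminus.1 (h.hat_mem_Dminus.2 hz₀ : P.v₂ ∈ P.Dminus)
  have hv2' : -conj P.v₂ ≠ 0 ∧ (P.lam (-conj P.v₂)).im < 0 := by
    rw [lam_neg_conj_im]
    exact ⟨neg_ne_zero.2 ((map_ne_zero _).2 hv2.1), hv2.2⟩
  have hXi : ∀ x i j, AnalyticAt ℝ (fun x => P.Ξ N c x t i j) x := by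
    rintro x (i | i) (j | j) <;> simp only [Ξ, fromBlocks_apply₁₁, fromBlocks_apply₁₂,
      fromBlocks_apply₂₁, fromBlocks_apply₂₂]
    · exact analyticAt_xiBlock (fun l => analyticAt_f₁ t hv1.1 l x) _ _ _ _
    · exact analyticAt_xiBlock (fun l => analyticAt_f₁ t hv1.1 l x) _ _ _ _
    · exact analyticAt_xiBlock (fun l => analyticAt_f₁ t hv1'.1 l x) _ _ _ _
    · exact analyticAt_xiBlock (fun l => analyticAt_f₁ t hv1'.1 l x) _ _ _ _
  have hXit : ∀ x i j, AnalyticAt ℝ (fun x => P.Ξt N c x t i j) x := by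
    rintro x (i | i) (j | j) <;> simp only [Ξt, fromBlocks_apply₁₁, fromBlocks_apply₁₂,
      fromBlocks_apply₂₁, fromBlocks_apply₂₂]
    · exact analyticAt_xiBlock (fun l => analyticAt_f₂ t hv2.1 l x) _ _ _ _
    · exact analyticAt_xiBlock (fun l => analyticAt_f₂ t hv2.1 l x) _ _ _ _
    · exact analyticAt_xiBlock (fun l => analyticAt_f₂ t hv2'.1 l x) _ _ _ _
    · exact analyticAt_xiBlock (fun l => analyticAt_f₂ t hv2'.1 l x) _ _ _ _
  have tXi : Tendsto (fun x => P.Ξ N c x t) atBot (𝓝 0) := by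
    refine tendsto_pi_nhds.2 fun i => tendsto_pi_nhds.2 fun j => ?_
    rcases i with i | i <;> rcases j with j | j <;> simp only [Ξ, fromBlocks_apply₁₁,
      fromBlocks_apply₁₂, fromBlocks_apply₂₁, fromBlocks_apply₂₂]
    · exact tendsto_xiBlock (fun l => tendsto_f₁ t hv1.1 hv1.2 l) _ _ _ _
    · exact tendsto_xiBlock (fun l => tendsto_f₁ t hv1.1 hv1.2 l) _ _ _ _
    · exact tendsto_xiBlock (fun l => tendsto_f₁ t hv1'.1 hv1'.2 l) _ _ _ _
    · exact tendsto_xiBlock (fun l => tendsto_f₁ t hv1'.1 hv1'.2 l) _ _ _ _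
  have tXit : Tendsto (fun x => P.Ξt N c x t) atBot (𝓝 0) := by
    refine tendsto_pi_nhds.2 fun i => tendsto_pi_nhds.2 fun j => ?_
    rcases i with i | i <;> rcases j with j | j <;> simp only [Ξt, fromBlocks_apply₁₁,
      fromBlocks_apply₁₂, fromBlocks_apply₂₁, fromBlocks_apply₂₂]
    · exact tendsto_xiBlock (fun l => tendsto_f₂ t hv2.1 hv2.2 l) _ _ _ _
    · exact tendsto_xiBlock (fun l => tendsto_f₂ t hv2.1 hv2.2 l) _ _ _ _
    · exact tendsto_xiBlock (fun l => tendsto_f₂ t hv2'.1 hv2'.2 l) _ _ _ _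
    · exact tendsto_xiBlock (fun l => tendsto_f₂ t hv2'.1 hv2'.2 l) _ _ _ _
  have han : AnalyticOnNhd ℝ (fun x => (P.A N c x t).det) Set.univ := by
    intro x _
    refine analyticAt_det fun i j => ?_
    simp only [A, Matrix.sub_apply, Matrix.mul_apply]
    exact analyticAt_const.sub (Finset.analyticAt_fun_sum _ fun k _ =>
      (hXit x i k).mul (hXi x k j))
  -- Both Ξ and Ξ̃ vanish in the limit x → -∞. Thus the determinant is not identically zero on the
  -- line, and analyticity isolates its zeros.
  have hlim : Tendsto (fun x => (P.A N c x t).det) atBot (𝓝 1) := by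
    have h1 : Tendsto (fun x => P.A N c x t) atBot (𝓝 (1 - 0 * 0)) :=
      tendsto_const_nhds.sub (tXit.mul tXi)
    rw [mul_zero, sub_zero] at h1
    have h2 := (Continuous.matrix_det continuous_id).continuousAt.tendsto.comp h1
    rwa [id, det_one] at h2
  obtain ⟨x₀, hx₀⟩ : ∃ x₀, (P.A N c x₀ t).det ≠ 0 :=
    (hlim.eventually_ne one_ne_zero).exists
  have hcod := han.preimage_zero_mem_codiscrete hx₀
  have := isCompact_Icc.finite_sdiff_of_mem_codiscreteWithin
    (Filter.codiscreteWithin_mono (Set.subset_univ (Set.Icc a b)) hcod)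
  refine this.subset fun x hx => ⟨hx.1, fun h' => h' hx.2⟩

end Params

end NonlocalMKdV

end

/-! ### Holomorphic parameter integrals and the propagator of the limiting system. -/

noncomputable section

namespace NonlocalMKdV

/-! ### Holomorphic dependence of integrals on a parameter -/

lemma differentiableOn_integral_param {E : Type*} [NormedAddCommGroup E] [NormedSpace ℂ E]
    [CompleteSpace E] {μ : Measure ℝ} {F : ℂ → ℝ → E} {U : Set ℂ} (hU : IsOpen U)
    {b : ℝ → ℝ} (hb : Integrable b μ) (hm : ∀ z ∈ U, AEStronglyMeasurable (F z) μ)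
    (hF : ∀ᵐ y ∂μ, DifferentiableOn ℂ (fun z => F z y) U)
    (hbd : ∀ᵐ y ∂μ, ∀ z ∈ U, ‖F z y‖ ≤ b y) :
    DifferentiableOn ℂ (fun z => ∫ y, F z y ∂μ) U := by
  intro z₀ hz₀
  obtain ⟨R, hR, hball⟩ := Metric.isOpen_iff.1 hU z₀ hz₀
  have hint : ∀ z ∈ U, Integrable (F z) μ := fun z hz =>
    hb.mono' (hm z hz) (hbd.mono fun y hy => hy z hz)
  -- Cauchy's estimate on circles of radius R/4 turns the bound on the integrand into a bound on its
  -- z-derivative.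
  have hderiv : ∀ᵐ y ∂μ, ∀ z ∈ Metric.ball z₀ (R / 2),
      ‖deriv (fun z => F z y) z‖ ≤ b y / (R / 4) := by
    filter_upwards [hF, hbd] with y hy hby z hz
    have hsub : Metric.closedBall z (R / 4) ⊆ U := by
      refine (Metric.closedBall_subset_closedBall' ?_).trans
        ((Metric.closedBall_subset_ball (ε₁ := R / 4 + R / 2) (by linarith)).trans hball)
      exact add_le_add_right (Metric.mem_ball.1 hz).le (R / 4)
    refine norm_deriv_le_of_forall_mem_sphere_norm_le (by positivity) ?_ fun w hw =>
      hby w (hsub (Metric.sphere_subset_closedBall hw))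
    exact DifferentiableOn.diffContOnCl (hy.mono
      (Metric.closure_ball_subset_closedBall.trans hsub))
  -- The derivative is measurable as a pointwise limit of difference quotients; the increments
  -- R/(2(n+2)) keep the points inside the ball.
  have hmeas : AEStronglyMeasurable (fun y => deriv (fun z => F z y) z₀) μ := by
    have hseq : Tendsto (fun n : ℕ => (((R / 2) / (n + 2) : ℝ) : ℂ)) atTop (𝓝[≠] 0) := by
      refine tendsto_nhdsWithin_iff.2 ⟨?_, Eventually.of_forall fun n => ?_⟩
      · have : Tendsto (fun n : ℕ => (R / 2) / ((n : ℝ) + 2)) atTop (𝓝 0) :=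
          tendsto_const_nhds.div_atTop
            (tendsto_atTop_add_const_right _ _ tendsto_natCast_atTop_atTop)
        have h2 := (continuous_ofReal.tendsto 0).comp this
        rwa [ofReal_zero] at h2
      · have : (R / 2) / ((n : ℝ) + 2) ≠ 0 := by positivity
        simpa using (ofReal_ne_zero.2 this)
    refine aestronglyMeasurable_of_tendsto_ae (u := atTop)
      (f := fun (n : ℕ) y => ((((R / 2) / (n + 2) : ℝ) : ℂ))⁻¹ •
        (F (z₀ + (((R / 2) / (n + 2) : ℝ) : ℂ)) y - F z₀ y)) (fun n => ?_) ?_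
    · refine (AEStronglyMeasurable.sub (hm _ (hball ?_)) (hm z₀ hz₀)).const_smul _
      rw [Metric.mem_ball, dist_eq_norm, add_sub_cancel_left, norm_real, Real.norm_of_nonneg
        (by positivity), div_lt_iff₀ (by positivity)]
      have : (0 : ℝ) ≤ n := by positivity
      nlinarith
    · filter_upwards [hF] with y hy
      have hd := (hy.differentiableAt (hU.mem_nhds hz₀)).hasDerivAt
      exact (hasDerivAt_iff_tendsto_slope_zero.1 hd).comp hseq
  have := hasDerivAt_integral_of_dominated_loc_of_deriv_le (μ := μ) (F := F)
    (F' := fun z y => deriv (fun z => F z y) z) (x₀ := z₀) (s := Metric.ball z₀ (R / 2))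
    (bound := fun y => b y / (R / 4)) (Metric.ball_mem_nhds _ (by positivity))
    (by filter_upwards [hU.mem_nhds hz₀] with z hz using hm z hz) (hint z₀ hz₀) hmeas hderiv
    (hb.div_const _) (by
      filter_upwards [hF] with y hy z hz
      exact (hy.differentiableAt (hU.mem_nhds
        (hball (Metric.ball_subset_ball (by linarith) hz)))).hasDerivAt)
  exact this.2.differentiableAt.differentiableWithinAt

/-! ### The scalar kernel -/

/-- `∫₀ˢ exp(-2iℓτ) dτ`, as an entire function of `ℓ`. -/
def gker (s : ℝ) (l : ℂ) : ℂ := s * dslope exp 0 (-2 * I * l * s)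

lemma differentiable_dslope_exp : Differentiable ℂ (dslope exp 0) := by
  rw [← differentiableOn_univ]
  exact (differentiableOn_dslope univ_mem).2 differentiable_exp.differentiableOn

lemma exp_eq_one_sub_gker (s : ℝ) (l : ℂ) : exp (-2 * I * l * s) = 1 - 2 * I * l * gker s l := by
  have := sub_smul_dslope exp 0 (-2 * I * l * s)
  simp only [sub_zero, smul_eq_mul, exp_zero] at this
  rw [gker]
  linear_combination (-1 : ℂ) * this

lemma norm_exp_sub_one_le {w : ℂ} (hw : w.re ≤ 0) : ‖exp w - 1‖ ≤ ‖w‖ := by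
  have := (convex_halfSpace_re_le 0).norm_image_sub_le_of_norm_hasDerivWithin_le
    (f := exp) (f' := exp) (C := 1) (x := 0) (y := w)
    (fun x _ => (hasDerivAt_exp x).hasDerivWithinAt)
    (fun x hx => by rw [norm_exp]; exact Real.exp_le_one_iff.2 hx) (by simp) hw
  simpa using this

lemma norm_dslope_exp_le {w : ℂ} (hw : w.re ≤ 0) : ‖dslope exp 0 w‖ ≤ 1 := by
  by_cases h : w = 0
  · subst h; simp [dslope_same]
  · rw [dslope_of_ne _ h, slope_def_field, sub_zero, exp_zero, norm_div,
      div_le_one (norm_pos_iff.2 h)]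
    exact norm_exp_sub_one_le hw

/-- This bound survives at λ = 0 but grows with |s|; the companion bound `norm_gker_mul_le` is
uniform in s and decays for large λ. Both rest on Re(-2iλs) ≤ 0. -/
lemma norm_gker_le {s : ℝ} {l : ℂ} (hs : s ≤ 0) (hl : 0 ≤ l.im) : ‖gker s l‖ ≤ |s| := by
  have hre : (-2 * I * l * s).re ≤ 0 := by
    simp
    nlinarith
  rw [gker, norm_mul, norm_real, Real.norm_eq_abs]
  exact mul_le_of_le_one_right (abs_nonneg _) (norm_dslope_exp_le hre)

lemma norm_gker_mul_le {s : ℝ} {l : ℂ} (hs : s ≤ 0) (hl : 0 ≤ l.im) : ‖gker s l‖ * ‖l‖ ≤ 1 := by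
  have hre : (-2 * I * l * s).re ≤ 0 := by
    simp
    nlinarith
  have h1 : 2 * I * l * gker s l = 1 - exp (-2 * I * l * s) := by
    rw [exp_eq_one_sub_gker]; ring
  have h2 : ‖2 * I * l * gker s l‖ ≤ 2 := by
    rw [h1]
    refine (norm_sub_le _ _).trans ?_
    rw [norm_one, norm_exp]
    have := Real.exp_le_one_iff.2 hre
    linarith
  simp only [norm_mul, norm_I, mul_one, norm_ofNat] at h2
  linarith

lemma hasDerivAt_gker (l : ℂ) (s : ℝ) : HasDerivAt (fun s : ℝ => gker s l)
    (exp (-2 * I * l * s)) s := by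
  by_cases hl : l = 0
  · subst hl
    have : (fun s : ℝ => gker s 0) = fun s : ℝ => (s : ℂ) := by
      ext s; simp [gker, dslope_same]
    rw [this]
    simpa using (hasDerivAt_id (s : ℂ)).comp_ofReal
  · have hne : 2 * I * l ≠ 0 := by simp [hl]
    have e : (fun s : ℝ => gker s l) = fun s : ℝ => (1 - exp (-2 * I * l * s)) / (2 * I * l) := by
      ext s
      rw [exp_eq_one_sub_gker, eq_div_iff hne]
      ring
    rw [e]
    have h1 : HasDerivAt (fun s : ℂ => (1 - exp (-2 * I * l * s)) / (2 * I * l))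
        (-(exp (-2 * I * l * s) * (-2 * I * l * 1)) / (2 * I * l)) s :=
      ((((hasDerivAt_id (s : ℂ)).const_mul (-2 * I * l)).cexp).const_sub 1).div_const _
    have h2 := h1.comp_ofReal
    convert h2 using 1
    field_simp

lemma continuous_gker : Continuous fun p : ℝ × ℂ => gker p.1 p.2 := by
  unfold gker
  exact (continuous_ofReal.comp continuous_fst).mul
    (differentiable_dslope_exp.continuous.comp (by fun_prop))

lemma differentiable_gker (s : ℝ) : Differentiable ℂ (gker s) := by
  unfold gker
  exact (differentiable_dslope_exp.comp (by fun_prop)).const_mul _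

lemma gker_zero (l : ℂ) : gker 0 l = 0 := by simp [gker]

/-! ### First-order systems on a half-line -/

/-- The coefficients `u`, `w` of a `2 × 2` system on the half-line, with their limits. -/
structure HalfLine where
  u : ℝ → ℂ
  w : ℝ → ℂ
  ui : ℂ
  wi : ℂ
  continuous_u : Continuous u
  continuous_w : Continuous w
  int_u : IntegrableOn (fun y => (1 + |y|) * ‖u y - ui‖) (Set.Ici 0)
  int_w : IntegrableOn (fun y => (1 + |y|) * ‖w y - wi‖) (Set.Ici 0)

namespace HalfLine

variable (H : HalfLine)

/-- The spectral function `λ`. -/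
def lam (z : ℂ) : ℂ := (z - H.ui * H.wi / z) / 2

/-- The size of the perturbation of the constant coefficients. -/
def d (y : ℝ) : ℝ := ‖H.u y - H.ui‖ + ‖H.w y - H.wi‖

/-- The matrix of the limiting system. -/
def binf (z : ℂ) : ℂ × ℂ →L[ℂ] ℂ × ℂ :=
  ((I * (H.ui * H.wi / z)) • ContinuousLinearMap.fst ℂ ℂ ℂ +
    H.ui • ContinuousLinearMap.snd ℂ ℂ ℂ).prod
  ((-I * z) • ContinuousLinearMap.snd ℂ ℂ ℂ + H.wi • ContinuousLinearMap.fst ℂ ℂ ℂ)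

/-- The perturbation of the limiting system. -/
def del (y : ℝ) (v : ℂ × ℂ) : ℂ × ℂ := ((H.u y - H.ui) * v.2, (H.w y - H.wi) * v.1)

/-- The eigenvector of the limiting system. -/
def evec (z : ℂ) : ℂ × ℂ := (1, -I * H.wi / z)

/-- The propagator of the limiting system. -/
def prop (z : ℂ) (s : ℝ) (v : ℂ × ℂ) : ℂ × ℂ := v + gker s (H.lam z) • H.binf z v

variable {H}

lemma binf_apply (z : ℂ) (v : ℂ × ℂ) : H.binf z v =
    (I * (H.ui * H.wi / z) * v.1 + H.ui * v.2, -I * z * v.2 + H.wi * v.1) := rfl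

lemma binf_evec {z : ℂ} (hz : z ≠ 0) : H.binf z (H.evec z) = 0 := by
  rw [binf_apply, evec]
  ext
  · simp; field_simp; ring
  · simp only [Prod.snd_zero]
    field_simp
    linear_combination H.wi * I_sq

/-- Once the factor exp(-iθ) is split off, the limiting matrix B has eigenvalues 0 and -2iλ, so B² =
-2iλB. Hence exp(sB) = 1 + `gker s λ`·B, which is `prop`, and it remains meaningful at λ = 0. -/
lemma binf_binf {z : ℂ} (hz : z ≠ 0) (v : ℂ × ℂ) :
    H.binf z (H.binf z v) = (-2 * I * H.lam z) • H.binf z v := by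
  simp only [binf_apply, lam]
  ext
  · simp only [Prod.smul_fst, smul_eq_mul]
    field_simp
    linear_combination (H.ui * z ^ 2 * H.wi * (v.1)) * I_sq
  · simp only [Prod.smul_snd, smul_eq_mul]
    field_simp
    ring_nf
    simp only [I_sq]
    ring

lemma continuous_d : Continuous H.d :=
  (H.continuous_u.sub continuous_const).norm.add (H.continuous_w.sub continuous_const).norm

lemma d_nonneg (y : ℝ) : 0 ≤ H.d y := by unfold d; positivity

lemma integrableOn_d (X : ℝ) : IntegrableOn (fun y => (1 + |y|) * H.d y) (Set.Ici X) := by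
  have h0 : IntegrableOn (fun y => (1 + |y|) * H.d y) (Set.Ici 0) := by
    refine (H.int_u.add H.int_w).congr_fun (fun y _ => ?_) measurableSet_Ici
    simp only [Pi.add_apply, d]; ring
  have hc : Continuous fun y => (1 + |y|) * H.d y :=
    (continuous_const.add continuous_abs).mul continuous_d
  refine ((hc.continuousOn.integrableOn_compact (isCompact_Icc (a := X) (b := 0))).union h0).mono_set ?_
  intro y hy
  by_cases h : 0 ≤ y
  · exact Or.inr h
  · exact Or.inl ⟨hy, (not_le.1 h).le⟩

lemma norm_del_le (y : ℝ) (v : ℂ × ℂ) : ‖H.del y v‖ ≤ H.d y * ‖v‖ := by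
  rw [del, Prod.norm_def, max_le_iff]
  constructor
  · rw [norm_mul]
    refine mul_le_mul ?_ (norm_snd_le v) (norm_nonneg _) (d_nonneg y)
    exact le_add_of_nonneg_right (norm_nonneg _)
  · rw [norm_mul]
    refine mul_le_mul ?_ (norm_fst_le v) (norm_nonneg _) (d_nonneg y)
    exact le_add_of_nonneg_left (norm_nonneg _)

lemma del_sub (y : ℝ) (v v' : ℂ × ℂ) : H.del y (v - v') = H.del y v - H.del y v' := by
  ext <;> simp [del] <;> ring

lemma prop_sub (z : ℂ) (s : ℝ) (v v' : ℂ × ℂ) :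
    H.prop z s (v - v') = H.prop z s v - H.prop z s v' := by
  simp only [prop, map_sub, smul_sub]; abel

lemma prop_zero (z : ℂ) (v : ℂ × ℂ) : H.prop z 0 v = v := by simp [prop, gker_zero]

lemma norm_binf_le {ρ : ℝ} (hρ : 0 < ρ) {z : ℂ} (hz : ρ ≤ ‖z‖) (v : ℂ × ℂ) :
    ‖H.binf z v‖ ≤ (‖H.ui * H.wi‖ / ρ ^ 2 + (‖H.ui‖ + ‖H.wi‖) / ρ + 1) * ‖z‖ * ‖v‖ := by
  have hz0 : 0 < ‖z‖ := hρ.trans_le hz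
  have h1 : ‖H.ui * H.wi / z‖ ≤ ‖H.ui * H.wi‖ / ρ ^ 2 * ‖z‖ := by
    rw [norm_div, div_mul_eq_mul_div, div_le_div_iff₀ hz0 (by positivity)]
    have : ρ ^ 2 ≤ ‖z‖ * ‖z‖ := by nlinarith
    nlinarith [norm_nonneg (H.ui * H.wi)]
  have h2 : ∀ a : ℂ, ‖a‖ ≤ ‖a‖ / ρ * ‖z‖ := fun a => by
    rw [div_mul_eq_mul_div, le_div_iff₀ hρ]
    exact mul_le_mul_of_nonneg_left hz (norm_nonneg _)
  have hu := h2 H.ui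
  have hw := h2 H.wi
  have hv1 := norm_fst_le v
  have hv2 := norm_snd_le v
  have hv := norm_nonneg v
  have hu0 : 0 ≤ ‖H.ui‖ / ρ * ‖z‖ := by positivity
  have hw0 : 0 ≤ ‖H.wi‖ / ρ * ‖z‖ := by positivity
  have hk0 : 0 ≤ ‖H.ui * H.wi‖ / ρ ^ 2 * ‖z‖ := by positivity
  have split : (‖H.ui * H.wi‖ / ρ ^ 2 + (‖H.ui‖ + ‖H.wi‖) / ρ + 1) * ‖z‖ * ‖v‖ =
      ‖H.ui * H.wi‖ / ρ ^ 2 * ‖z‖ * ‖v‖ + ‖H.ui‖ / ρ * ‖z‖ * ‖v‖ + ‖H.wi‖ / ρ * ‖z‖ * ‖v‖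
        + ‖z‖ * ‖v‖ := by ring
  have n1 := mul_nonneg hu0 hv
  have n2 := mul_nonneg hw0 hv
  have n3 := mul_nonneg hk0 hv
  have n4 := mul_nonneg hz0.le hv
  rw [binf_apply, Prod.norm_def, max_le_iff, split]
  constructor
  · refine (norm_add_le _ _).trans ?_
    rw [norm_mul, norm_mul, norm_mul, norm_I, one_mul]
    have a1 := mul_le_mul h1 hv1 (norm_nonneg _) hk0
    have a2 := mul_le_mul hu hv2 (norm_nonneg _) hu0
    linarith
  · refine (norm_add_le _ _).trans ?_
    rw [norm_mul, norm_mul, norm_mul, norm_neg, norm_I, one_mul]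
    have a1 := mul_le_mul_of_nonneg_left hv2 hz0.le
    have a2 := mul_le_mul hw hv1 (norm_nonneg _) hw0
    linarith

/-- At λ = 0 the propagator really grows linearly in s, and this is why the potential is measured
with the weight 1 + |x|. Bounded z use |gker| ≤ |s|; for large z the growth |z| of `binf` is
absorbed by |gker|·|λ| ≤ 1. -/
lemma exists_norm_prop_le (H : HalfLine) {ρ : ℝ} (hρ : 0 < ρ) : ∃ C, 0 ≤ C ∧
    ∀ z, ρ ≤ ‖z‖ → 0 ≤ (H.lam z).im → ∀ s ≤ 0, ∀ v,
      ‖H.prop z s v‖ ≤ C * (1 + |s|) * ‖v‖ := by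
  set c := ‖H.ui * H.wi‖ / ρ ^ 2 + (‖H.ui‖ + ‖H.wi‖) / ρ + 1 with hc
  have hc0 : 0 ≤ c := by positivity
  -- Beyond this radius |λ| ≥ |z|/4.
  set R := 1 + 2 * ‖H.ui * H.wi‖ with hR
  have hR1 : 1 ≤ R := by rw [hR]; linarith [norm_nonneg (H.ui * H.wi)]
  refine ⟨1 + 4 * c + c * R, by positivity, fun z hz hl s hs v => ?_⟩
  have hz0 : 0 < ‖z‖ := hρ.trans_le hz
  have hg : ‖gker s (H.lam z)‖ * (c * ‖z‖) ≤ (4 * c + c * R) * (1 + |s|) := by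
    have hg1 := norm_gker_le hs hl
    have hg2 := norm_gker_mul_le hs hl
    have hs0 := abs_nonneg s
    by_cases hzR : ‖z‖ ≤ R
    · have : ‖gker s (H.lam z)‖ * (c * ‖z‖) ≤ |s| * (c * R) :=
        mul_le_mul hg1 (mul_le_mul_of_nonneg_left hzR hc0) (by positivity) hs0
      nlinarith [mul_nonneg hc0 hs0, mul_nonneg hc0 (zero_le_one.trans hR1)]
    · have hzR' := (not_le.1 hzR).le
      have hlam : ‖z‖ / 4 ≤ ‖H.lam z‖ := by
        have h1 : ‖H.ui * H.wi / z‖ ≤ ‖z‖ / 2 := by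
          rw [norm_div, div_le_div_iff₀ hz0 two_pos]
          nlinarith [norm_nonneg (H.ui * H.wi)]
        have h2 : ‖H.lam z‖ = ‖z - H.ui * H.wi / z‖ / 2 := by
          rw [lam, norm_div]; simp
        have h3 := norm_sub_norm_le z (H.ui * H.wi / z)
        rw [h2]
        linarith
      have : ‖gker s (H.lam z)‖ * (‖z‖ / 4) ≤ 1 :=
        (mul_le_mul_of_nonneg_left hlam (norm_nonneg _)).trans hg2
      have h4 : ‖gker s (H.lam z)‖ * (c * ‖z‖) ≤ 4 * c := by nlinarith
      nlinarith [mul_nonneg hc0 hs0, mul_nonneg hc0 (zero_le_one.trans hR1),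
        mul_nonneg (mul_nonneg hc0 (zero_le_one.trans hR1)) hs0]
  have hB := norm_binf_le (H := H) hρ hz v
  rw [← hc] at hB
  calc ‖H.prop z s v‖ ≤ ‖v‖ + ‖gker s (H.lam z)‖ * ‖H.binf z v‖ := by
        rw [prop]
        refine (norm_add_le _ _).trans ?_
        rw [norm_smul]
    _ ≤ ‖v‖ + ‖gker s (H.lam z)‖ * (c * ‖z‖ * ‖v‖) := by gcongr
    _ = ‖v‖ + ‖gker s (H.lam z)‖ * (c * ‖z‖) * ‖v‖ := by ring
    _ ≤ ‖v‖ + (4 * c + c * R) * (1 + |s|) * ‖v‖ := by gcongr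
    _ ≤ (1 + 4 * c + c * R) * (1 + |s|) * ‖v‖ := by
        nlinarith [mul_nonneg (abs_nonneg s) (norm_nonneg v)]

end HalfLine

end NonlocalMKdV

end

/-! ### The Volterra equation and its Picard iteration. -/

noncomputable section

namespace NonlocalMKdV

/-! ### Exponential weights -/

/-- The tail integral of a weight. -/
def tailInt (ω : ℝ → ℝ) (x : ℝ) : ℝ := ∫ y in Set.Ioi x, ω y

/-- A continuous nonnegative function that is integrable at `+∞`. -/
structure IsWeight (ω : ℝ → ℝ) : Prop where
  continuous : Continuous ω
  nonneg : ∀ y, 0 ≤ ω y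
  integrableOn : ∀ X, IntegrableOn ω (Set.Ioi X)

namespace IsWeight

variable {ω : ℝ → ℝ} (h : IsWeight ω)
include h

lemma tailInt_eq (x : ℝ) : tailInt ω x = tailInt ω 0 - ∫ y in (0 : ℝ)..x, ω y := by
  have := intervalIntegral.integral_interval_add_Ioi (h.integrableOn 0) (h.integrableOn x)
  rw [tailInt, tailInt, ← this]
  ring

lemma hasDerivAt_tailInt (x : ℝ) : HasDerivAt (tailInt ω) (-ω x) x := by
  have e : tailInt ω = fun x => tailInt ω 0 - ∫ y in (0 : ℝ)..x, ω y := funext h.tailInt_eq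
  rw [e]
  exact (h.continuous.integral_hasStrictDerivAt 0 x).hasDerivAt.const_sub _

lemma tailInt_nonneg (x : ℝ) : 0 ≤ tailInt ω x :=
  setIntegral_nonneg measurableSet_Ioi fun y _ => h.nonneg y

lemma tendsto_tailInt : Tendsto (tailInt ω) atTop (𝓝 0) := by
  have h1 := intervalIntegral_tendsto_integral_Ioi 0 (h.integrableOn 0) tendsto_id
  have h2 := h1.const_sub (tailInt ω 0)
  rw [show tailInt ω 0 - ∫ x in Set.Ioi 0, ω x = 0 from sub_self _] at h2
  exact h2.congr fun x => (h.tailInt_eq x).symm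

lemma tailInt_anti {x y : ℝ} (hxy : x ≤ y) : tailInt ω y ≤ tailInt ω x :=
  setIntegral_mono_set (h.integrableOn x) (Eventually.of_forall h.nonneg)
    (Set.Ioi_subset_Ioi hxy).eventuallyLE

/-- With τ the tail integral of ω, -exp(2τ)/2 is an antiderivative of ω·exp(2τ). The 2 in the
exponent makes Volterra operators contract by 1/2 in the weighted norm, however large ω is. -/
lemma integral_mul_exp (x : ℝ) :
    IntegrableOn (fun y => ω y * Real.exp (2 * tailInt ω y)) (Set.Ioi x) ∧
    ∫ y in Set.Ioi x, ω y * Real.exp (2 * tailInt ω y) ≤ Real.exp (2 * tailInt ω x) / 2 := by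
  have hd : ∀ y ∈ Set.Ici x, HasDerivAt (fun y => -(Real.exp (2 * tailInt ω y) / 2))
      (ω y * Real.exp (2 * tailInt ω y)) y := by
    intro y _
    have := ((((h.hasDerivAt_tailInt y).const_mul 2).exp).div_const 2).fun_neg
    refine this.congr_deriv ?_
    ring
  have hnn : ∀ y ∈ Set.Ioi x, 0 ≤ ω y * Real.exp (2 * tailInt ω y) := fun y _ =>
    mul_nonneg (h.nonneg y) (Real.exp_pos _).le
  have hlim : Tendsto (fun y => -(Real.exp (2 * tailInt ω y) / 2)) atTop (𝓝 (-(1 / 2))) := by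
    have h1 : Tendsto (fun y => Real.exp (2 * tailInt ω y)) atTop (𝓝 (Real.exp (2 * 0))) :=
      (Real.continuous_exp.tendsto _).comp (h.tendsto_tailInt.const_mul 2)
    rw [mul_zero, Real.exp_zero] at h1
    exact (h1.div_const 2).neg
  refine ⟨integrableOn_Ioi_deriv_of_nonneg' hd hnn hlim, ?_⟩
  rw [integral_Ioi_of_hasDerivAt_of_nonneg' hd hnn hlim]
  linarith

lemma one_le_exp (x : ℝ) : 1 ≤ Real.exp (2 * tailInt ω x) :=
  Real.one_le_exp (by linarith [h.tailInt_nonneg x])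

/-- The basic estimate of the integral operators: they contract the weighted norm. -/
lemma norm_integral_le {E : Type*} [NormedAddCommGroup E] [NormedSpace ℝ E] {x K : ℝ}
    {F : ℝ → E} (hK : 0 ≤ K)
    (hF : ∀ y, x < y → ‖F y‖ ≤ ω y * (K * Real.exp (2 * tailInt ω y))) :
    ‖∫ y in Set.Ioi x, F y‖ ≤ K / 2 * Real.exp (2 * tailInt ω x) := by
  obtain ⟨h1, h2⟩ := h.integral_mul_exp x
  calc ‖∫ y in Set.Ioi x, F y‖
      ≤ ∫ y in Set.Ioi x, K * (ω y * Real.exp (2 * tailInt ω y)) := by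
        refine norm_integral_le_of_norm_le (h1.const_mul K) ?_
        filter_upwards [self_mem_ae_restrict measurableSet_Ioi] with y hy
        refine (hF y hy).trans (le_of_eq (by ring))
    _ = K * ∫ y in Set.Ioi x, ω y * Real.exp (2 * tailInt ω y) := integral_const_mul _ _
    _ ≤ K * (Real.exp (2 * tailInt ω x) / 2) := mul_le_mul_of_nonneg_left h2 hK
    _ = K / 2 * Real.exp (2 * tailInt ω x) := by ring

end IsWeight

namespace HalfLine

variable {H : HalfLine}

/-- For X ≤ x ≤ y one has 1 + |x - y| ≤ (1 + |X|)(1 + |y|), so one weight in y dominates the kernel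
for all x ≥ X and all admissible z with |z| ≥ ρ. -/
lemma exists_weight (H : HalfLine) {ρ : ℝ} (hρ : 0 < ρ) (X : ℝ) : ∃ ω, IsWeight ω ∧
    ∀ z, ρ ≤ ‖z‖ → 0 ≤ (H.lam z).im → ∀ x y, X ≤ x → x ≤ y → ∀ v,
      ‖H.prop z (x - y) (H.del y v)‖ ≤ ω y * ‖v‖ := by
  obtain ⟨C, hC, hbd⟩ := H.exists_norm_prop_le hρ
  refine ⟨fun y => C * (1 + |X|) * ((1 + |y|) * H.d y), ⟨?_, fun y => ?_, fun Y => ?_⟩, ?_⟩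
  · exact continuous_const.mul ((continuous_const.add continuous_abs).mul continuous_d)
  · have := H.d_nonneg y
    positivity
  · exact ((integrableOn_d Y).mono_set Set.Ioi_subset_Ici_self).const_mul _
  · intro z hz hl x y hx hxy v
    have h1 : 1 + |x - y| ≤ (1 + |X|) * (1 + |y|) := by
      rw [abs_of_nonpos (by linarith)]
      have := neg_abs_le X
      have := le_abs_self y
      nlinarith [abs_nonneg X, abs_nonneg y]
    have hd := H.d_nonneg y
    calc ‖H.prop z (x - y) (H.del y v)‖ ≤ C * (1 + |x - y|) * ‖H.del y v‖ :=
          hbd z hz hl _ (by linarith) _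
      _ ≤ C * ((1 + |X|) * (1 + |y|)) * (H.d y * ‖v‖) := by
          gcongr
          exact norm_del_le y v
      _ = _ := by ring

/-- The Picard iterates of the Volterra equation. -/
def iter (H : HalfLine) (z : ℂ) : ℕ → ℝ → ℂ × ℂ
  | 0 => fun _ => H.evec z
  | n + 1 => fun x => H.evec z - ∫ y in Set.Ioi x, H.prop z (x - y) (H.del y (H.iter z n y))

lemma continuous_prop (z : ℂ) : Continuous fun p : ℝ × (ℂ × ℂ) => H.prop z p.1 p.2 := by
  unfold prop
  exact continuous_snd.add ((continuous_gker.comp (continuous_fst.prodMk continuous_const)).smul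
    ((H.binf z).continuous.comp continuous_snd))

lemma continuous_del : Continuous fun p : ℝ × (ℂ × ℂ) => H.del p.1 p.2 := by
  unfold del
  exact (((H.continuous_u.comp continuous_fst).sub continuous_const).mul
      (continuous_snd.comp continuous_snd)).prodMk
    (((H.continuous_w.comp continuous_fst).sub continuous_const).mul
      (continuous_fst.comp continuous_snd))

lemma measurable_integrand {z : ℂ} {f : ℝ → ℂ × ℂ} (hf : Measurable f) :
    Measurable fun p : ℝ × ℝ => H.prop z (p.1 - p.2) (H.del p.2 (f p.2)) := by
  have h1 : Measurable fun p : ℝ × ℝ => H.del p.2 (f p.2) :=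
    continuous_del.measurable.comp (measurable_snd.prodMk (hf.comp measurable_snd))
  exact (continuous_prop z).measurable.comp ((measurable_fst.sub measurable_snd).prodMk h1)

lemma measurable_iter (z : ℂ) (n : ℕ) : Measurable (H.iter z n) := by
  induction n with
  | zero => exact measurable_const
  | succ n ih =>
    refine measurable_const.sub ?_
    -- With the half-line written as an indicator on the product, the integral is a measurable
    -- function of x.
    have h1 : StronglyMeasurable fun p : ℝ × ℝ => Set.indicator {p : ℝ × ℝ | p.1 < p.2}
        (fun p => H.prop z (p.1 - p.2) (H.del p.2 (H.iter z n p.2))) p :=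
      ((measurable_integrand ih).indicator
        (measurableSet_lt measurable_fst measurable_snd)).stronglyMeasurable
    have h2 := h1.integral_prod_right' (ν := volume)
    have e : (fun x => ∫ y in Set.Ioi x, H.prop z (x - y) (H.del y (H.iter z n y))) =
        fun x => ∫ y, Set.indicator {p : ℝ × ℝ | p.1 < p.2}
          (fun p => H.prop z (p.1 - p.2) (H.del p.2 (H.iter z n p.2))) (x, y) := by
      ext1 x
      rw [← integral_indicator measurableSet_Ioi]
      rfl
    rw [e]
    exact h2.measurable

lemma aestronglyMeasurable_integrand {z : ℂ} {f : ℝ → ℂ × ℂ} (hf : Measurable f) (x : ℝ)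
    (μ : Measure ℝ) : AEStronglyMeasurable (fun y => H.prop z (x - y) (H.del y (f y))) μ :=
  ((measurable_integrand hf).comp (measurable_const.prodMk measurable_id)).aestronglyMeasurable

lemma norm_evec_le {ρ : ℝ} (hρ : 0 < ρ) {z : ℂ} (hz : ρ ≤ ‖z‖) :
    ‖H.evec z‖ ≤ 1 + ‖H.wi‖ / ρ := by
  have : 0 ≤ ‖H.wi‖ / ρ := by positivity
  rw [evec, Prod.norm_def, max_le_iff]
  constructor
  · simpa using this
  · have h2 : ‖-I * H.wi / z‖ ≤ ‖H.wi‖ / ρ := by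
      rw [norm_div, norm_mul, norm_neg, norm_I, one_mul]
      exact div_le_div_of_nonneg_left (norm_nonneg _) hρ hz
    linarith

/-- The hypotheses under which the Volterra equation is studied. -/
structure Dominated (H : HalfLine) (ρ X : ℝ) (ω : ℝ → ℝ) : Prop where
  pos : 0 < ρ
  weight : IsWeight ω
  bound : ∀ z, ρ ≤ ‖z‖ → 0 ≤ (H.lam z).im → ∀ x y, X ≤ x → x ≤ y → ∀ v,
      ‖H.prop z (x - y) (H.del y v)‖ ≤ ω y * ‖v‖

section

variable {ρ X : ℝ} {ω : ℝ → ℝ} (hD : H.Dominated ρ X ω) {z : ℂ} (hz : ρ ≤ ‖z‖)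
  (hl : 0 ≤ (H.lam z).im)
include hD hz hl

/-- With M = 1 + |wi|/ρ, the bound 2M·exp(2τ) reproduces itself: the free term gives M and the
contracted integral gives at most M·exp(2τ). -/
lemma norm_iter_le (n : ℕ) {x : ℝ} (hx : X ≤ x) :
    ‖H.iter z n x‖ ≤ 2 * (1 + ‖H.wi‖ / ρ) * Real.exp (2 * tailInt ω x) := by
  have hρ := hD.pos
  have hM : 0 ≤ 1 + ‖H.wi‖ / ρ := by positivity
  have he := norm_evec_le (H := H) hD.pos hz
  induction n generalizing x with
  | zero =>
    have := hD.weight.one_le_exp x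
    refine he.trans ?_
    nlinarith
  | succ n ih =>
    have h1 : ‖∫ y in Set.Ioi x, H.prop z (x - y) (H.del y (H.iter z n y))‖ ≤
        2 * (1 + ‖H.wi‖ / ρ) / 2 * Real.exp (2 * tailInt ω x) :=
      hD.weight.norm_integral_le (by positivity) fun y hy => (hD.bound z hz hl x y hx hy.le _).trans
        (mul_le_mul_of_nonneg_left (ih (hx.trans hy.le)) (hD.weight.nonneg y))
    have := hD.weight.one_le_exp x
    refine (norm_sub_le _ _).trans ((add_le_add he h1).trans ?_)
    nlinarith

end

/-- A Jost solution of the system at the spectral point `z`. -/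
structure IsSol (H : HalfLine) (z : ℂ) (φ : ℝ → ℂ × ℂ) : Prop where
  deriv : ∀ x, HasDerivAt φ (H.binf z (φ x) + H.del x (φ x)) x
  lim : Tendsto φ atTop (𝓝 (H.evec z))

namespace IsSol

variable {z : ℂ} {φ : ℝ → ℂ × ℂ}

lemma continuous (h : H.IsSol z φ) : Continuous φ :=
  continuous_iff_continuousAt.2 fun x => (h.deriv x).continuousAt

lemma exists_bound (h : H.IsSol z φ) (X : ℝ) : ∃ K, 0 ≤ K ∧ ∀ x, X ≤ x → ‖φ x‖ ≤ K := by
  obtain ⟨R, hR⟩ := eventually_atTop.1 (h.lim.norm.eventually (gt_mem_nhds (lt_add_one _)))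
  obtain ⟨C, hC⟩ := (isCompact_Icc (a := X) (b := R)).exists_bound_of_continuousOn
    h.continuous.continuousOn
  refine ⟨max (max C (‖H.evec z‖ + 1)) 0, le_max_right _ _, fun x hx => ?_⟩
  by_cases hxR : x ≤ R
  · exact (hC x ⟨hx, hxR⟩).trans ((le_max_left _ _).trans (le_max_left _ _))
  · exact (hR x (not_le.1 hxR).le).le.trans ((le_max_right _ _).trans (le_max_left _ _))

/-- Duhamel's principle: the derivative of the propagator cancels the limiting system, and only the
perturbation remains. -/
lemma hasDerivAt_prop (h : H.IsSol z φ) (hz : z ≠ 0) (x y : ℝ) :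
    HasDerivAt (fun y => H.prop z (x - y) (φ y)) (H.prop z (x - y) (H.del y (φ y))) y := by
  have h1 : HasDerivAt (fun y : ℝ => gker (x - y) (H.lam z))
      (-exp (-2 * I * H.lam z * (x - y : ℝ))) y := by
    have := HasDerivAt.scomp y (hasDerivAt_gker (H.lam z) (x - y)) ((hasDerivAt_id y).const_sub x)
    simp only [neg_smul, one_smul] at this
    exact this
  have h2 : HasDerivAt (fun y => H.binf z (φ y)) (H.binf z (H.binf z (φ y) + H.del y (φ y))) y :=
    ((H.binf z).restrictScalars ℝ).hasFDerivAt.comp_hasDerivAt y (h.deriv y)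
  have h3 := (h.deriv y).fun_add (h1.fun_smul h2)
  refine h3.congr_deriv ?_
  rw [exp_eq_one_sub_gker, map_add, binf_binf hz, prop]
  module

/-- The decay that makes the boundary term of the Volterra equation vanish. -/
lemma tendsto_gker_binf (h : H.IsSol z φ) (hz : z ≠ 0) (hl : 0 ≤ (H.lam z).im) (x : ℝ) :
    Tendsto (fun y => gker (x - y) (H.lam z) • H.binf z (φ y)) atTop (𝓝 0) := by
  have hB : Tendsto (fun y => H.binf z (φ y)) atTop (𝓝 0) := by
    have := ((H.binf z).continuous.tendsto _).comp h.lim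
    rwa [binf_evec hz] at this
  -- At a branch point the kernel is x - y and the limiting matrix squares to zero. Then `binf z (φ
  -- y)` is minus the tail integral of `binf z` applied to the perturbation term, and the first
  -- moment of the coefficients pays for the factor |x - y|. Elsewhere the kernel is bounded by
  -- 1/|λ| and `binf z (φ y)` tends to 0.
  by_cases h0 : H.lam z = 0
  · obtain ⟨K, hK, hKb⟩ := h.exists_bound x
    set β := ‖H.binf z‖ with hβ
    set ω : ℝ → ℝ := fun y => (1 + |x|) * β * K * ((1 + |y|) * H.d y) with hω
    have hw : IsWeight ω := by
      refine ⟨?_, fun y => ?_, fun Y => ?_⟩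
      · exact continuous_const.mul ((continuous_const.add continuous_abs).mul continuous_d)
      · have := H.d_nonneg y
        positivity
      · exact ((integrableOn_d Y).mono_set Set.Ioi_subset_Ici_self).const_mul _
    have hd : ∀ y, HasDerivAt (fun y => H.binf z (φ y)) (H.binf z (H.del y (φ y))) y := by
      intro y
      have := ((H.binf z).restrictScalars ℝ).hasFDerivAt.comp_hasDerivAt y (h.deriv y)
      refine this.congr_deriv ?_
      simp only [ContinuousLinearMap.coe_restrictScalars', map_add, binf_binf hz, h0]
      simp
    have hbnd : ∀ y s, x ≤ y → y ≤ s → ‖x - y‖ * ‖H.binf z (H.del s (φ s))‖ ≤ ω s := by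
      intro y s hxy hys
      have e1 : ‖x - y‖ ≤ (1 + |x|) * (1 + |s|) := by
        rw [Real.norm_eq_abs, abs_of_nonpos (by linarith)]
        have := neg_abs_le x
        have := le_abs_self s
        nlinarith [abs_nonneg x, abs_nonneg s]
      have e2 : ‖H.binf z (H.del s (φ s))‖ ≤ β * (H.d s * K) := by
        refine ((H.binf z).le_opNorm _).trans ?_
        gcongr
        refine (norm_del_le _ _).trans ?_
        have := H.d_nonneg s
        gcongr
        exact hKb s (hxy.trans hys)
      calc _ ≤ (1 + |x|) * (1 + |s|) * (β * (H.d s * K)) := by gcongr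
        _ = ω s := by simp only [hω]; ring
    refine squeeze_zero_norm' ?_ hw.tendsto_tailInt
    filter_upwards [eventually_ge_atTop (x + 1)] with y hy
    have hxy : x ≤ y := by linarith
    have hpos : 0 < ‖x - y‖ := by
      rw [Real.norm_eq_abs, abs_of_nonpos (by linarith)]; linarith
    have hint : IntegrableOn (fun s => H.binf z (H.del s (φ s))) (Set.Ioi y) := by
      refine ((hw.integrableOn y).const_mul (‖x - y‖⁻¹)).mono' ?_ ?_
      · exact ((H.binf z).continuous.comp (continuous_del.comp
          (continuous_id.prodMk h.continuous))).aestronglyMeasurable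
      · filter_upwards [self_mem_ae_restrict measurableSet_Ioi] with s hs
        rw [inv_mul_eq_div, le_div_iff₀ hpos, mul_comm]
        exact hbnd y s hxy (le_of_lt hs)
    have e := integral_Ioi_of_hasDerivAt_of_tendsto' (fun s _ => hd s) hint hB
    have e' : H.binf z (φ y) = -∫ s in Set.Ioi y, H.binf z (H.del s (φ s)) := by
      rw [e]; simp
    have hg : gker (x - y) (H.lam z) = ((x - y : ℝ) : ℂ) := by simp [gker, h0, dslope_same]
    rw [norm_smul, hg, norm_real, e', norm_neg, ← Real.norm_of_nonneg (norm_nonneg (x - y)),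
      ← norm_smul, ← integral_smul]
    refine norm_integral_le_of_norm_le (hw.integrableOn y) ?_
    filter_upwards [self_mem_ae_restrict measurableSet_Ioi] with s hs
    rw [norm_smul, norm_norm]
    exact hbnd y s hxy (le_of_lt hs)
  · have hn : 0 < ‖H.lam z‖ := norm_pos_iff.2 h0
    have h2 : Tendsto (fun y => 1 / ‖H.lam z‖ * ‖H.binf z (φ y)‖) atTop (𝓝 0) := by
      simpa using hB.norm.const_mul (1 / ‖H.lam z‖)
    refine squeeze_zero_norm' ?_ h2
    filter_upwards [eventually_ge_atTop x] with y hy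
    rw [norm_smul]
    gcongr
    rw [le_div_iff₀ hn]
    exact norm_gker_mul_le (by linarith) hl

/-- Integration of Duhamel's identity from x to infinity. At y = x the propagator is the identity;
at infinity it leaves the limit `evec` fixed. -/
lemma volterra (h : H.IsSol z φ) (hz : z ≠ 0) (hl : 0 ≤ (H.lam z).im) (x : ℝ) :
    φ x = H.evec z - ∫ y in Set.Ioi x, H.prop z (x - y) (H.del y (φ y)) := by
  have hρ : 0 < ‖z‖ := norm_pos_iff.2 hz
  obtain ⟨ω, hω, hb⟩ := H.exists_weight hρ x
  obtain ⟨K, hK, hKb⟩ := h.exists_bound x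
  have hint : IntegrableOn (fun y => H.prop z (x - y) (H.del y (φ y))) (Set.Ioi x) := by
    refine ((hω.integrableOn x).mul_const K).mono'
      (aestronglyMeasurable_integrand h.continuous.measurable x _) ?_
    filter_upwards [self_mem_ae_restrict measurableSet_Ioi] with y hy
    refine (hb z le_rfl hl x y le_rfl (le_of_lt hy) _).trans ?_
    exact mul_le_mul_of_nonneg_left (hKb y (le_of_lt hy)) (hω.nonneg y)
  have hlim : Tendsto (fun y => H.prop z (x - y) (φ y)) atTop (𝓝 (H.evec z)) := by
    simpa [prop] using h.lim.add (h.tendsto_gker_binf hz hl x)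
  rw [integral_Ioi_of_hasDerivAt_of_tendsto' (fun y _ => h.hasDerivAt_prop hz x y) hint hlim,
    sub_self, prop_zero, sub_sub_cancel]

section

variable {ρ X : ℝ} {ω : ℝ → ℝ} (hD : H.Dominated ρ X ω) (hz : ρ ≤ ‖z‖)
  (hl : 0 ≤ (H.lam z).im)
include hD hz hl

/-- The a priori bound K depends on the solution. Each pass through the Volterra equation halves its
contribution, so the limit n → ∞ leaves a bound uniform over all solutions and all admissible z. -/
lemma norm_sub_evec_le (h : H.IsSol z φ) {x : ℝ} (hx : X ≤ x) :
    ‖φ x - H.evec z‖ ≤ (1 + ‖H.wi‖ / ρ) * Real.exp (2 * tailInt ω x) := by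
  have hρ := hD.pos
  have hM1 : 0 ≤ 1 + ‖H.wi‖ / ρ := by positivity
  set M := 1 + ‖H.wi‖ / ρ with hM
  have hz0 : z ≠ 0 := norm_pos_iff.1 (hD.pos.trans_le hz)
  have he := norm_evec_le (H := H) hD.pos hz
  obtain ⟨K, hK, hKb⟩ := h.exists_bound X
  have key : ∀ n : ℕ, ∀ x, X ≤ x →
      ‖φ x - H.evec z‖ ≤ (M + (K + M) / 2 ^ n) * Real.exp (2 * tailInt ω x) := by
    intro n
    induction n with
    | zero =>
      intro x hx
      have h1 := hD.weight.one_le_exp x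
      have hM0 : 0 ≤ M := (norm_nonneg _).trans he
      calc ‖φ x - H.evec z‖ ≤ K + M := (norm_sub_le _ _).trans (add_le_add (hKb x hx) he)
        _ ≤ _ := by rw [pow_zero, div_one]; nlinarith
    | succ n ih =>
      intro x hx
      conv_lhs => rw [h.volterra hz0 hl x, sub_sub_cancel_left, norm_neg]
      have := hD.weight.norm_integral_le (K := 2 * M + (K + M) / 2 ^ n) (by positivity)
        (F := fun y => H.prop z (x - y) (H.del y (φ y))) fun y hy => by
          refine (hD.bound z hz hl x y hx hy.le _).trans
            (mul_le_mul_of_nonneg_left ?_ (hD.weight.nonneg y))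
          have h1 := hD.weight.one_le_exp y
          have hM0 : 0 ≤ M := (norm_nonneg _).trans he
          have h2 := ih y (hx.trans hy.le)
          have h3 := norm_add_le (φ y - H.evec z) (H.evec z)
          rw [sub_add_cancel] at h3
          nlinarith
      refine this.trans (le_of_eq ?_)
      rw [pow_succ]
      ring
  have hlim : Tendsto (fun n : ℕ => (M + (K + M) / 2 ^ n) * Real.exp (2 * tailInt ω x)) atTop
      (𝓝 ((M + 0) * Real.exp (2 * tailInt ω x))) := by
    refine Tendsto.mul_const _ (Tendsto.const_add _ ?_)
    exact tendsto_const_nhds.div_atTop (tendsto_pow_atTop_atTop_of_one_lt one_lt_two)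
  rw [add_zero] at hlim
  exact ge_of_tendsto' hlim fun n => key n x hx

/-- Geometric convergence at a rate independent of z: it transfers regularity in z from the explicit
iterates to the given Jost solutions, and it gives uniqueness. -/
lemma norm_sub_iter_le (h : H.IsSol z φ) (n : ℕ) {x : ℝ} (hx : X ≤ x) :
    ‖φ x - H.iter z n x‖ ≤ (1 + ‖H.wi‖ / ρ) / 2 ^ n * Real.exp (2 * tailInt ω x) := by
  have hρ := hD.pos
  have hz0 : z ≠ 0 := norm_pos_iff.1 (hD.pos.trans_le hz)
  induction n generalizing x with
  | zero =>
    rw [pow_zero, div_one]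
    exact h.norm_sub_evec_le hD hz hl hx
  | succ n ih =>
    have hdom := hD.weight.integral_mul_exp x
    have i1 : IntegrableOn (fun y => H.prop z (x - y) (H.del y (φ y))) (Set.Ioi x) := by
      obtain ⟨K, hK, hKb⟩ := h.exists_bound x
      refine ((hD.weight.integrableOn x).mul_const K).mono'
        (aestronglyMeasurable_integrand h.continuous.measurable x _) ?_
      filter_upwards [self_mem_ae_restrict measurableSet_Ioi] with y hy
      refine (hD.bound z hz hl x y hx (le_of_lt hy) _).trans ?_
      exact mul_le_mul_of_nonneg_left (hKb y (le_of_lt hy)) (hD.weight.nonneg y)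
    have i2 : IntegrableOn (fun y => H.prop z (x - y) (H.del y (H.iter z n y))) (Set.Ioi x) := by
      refine (hdom.1.const_mul (2 * (1 + ‖H.wi‖ / ρ))).mono'
        (aestronglyMeasurable_integrand (measurable_iter z n) x _) ?_
      filter_upwards [self_mem_ae_restrict measurableSet_Ioi] with y hy
      refine (hD.bound z hz hl x y hx (le_of_lt hy) _).trans ?_
      refine (mul_le_mul_of_nonneg_left (norm_iter_le hD hz hl n (hx.trans (le_of_lt hy)))
        (hD.weight.nonneg y)).trans (le_of_eq (by ring))
    have e : φ x - H.iter z (n + 1) x =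
        -∫ y in Set.Ioi x, H.prop z (x - y) (H.del y (φ y - H.iter z n y)) := by
      conv_lhs => rw [h.volterra hz0 hl x, iter]
      simp only [del_sub, prop_sub]
      rw [integral_sub i1 i2]
      abel
    rw [e, norm_neg]
    have := hD.weight.norm_integral_le (K := (1 + ‖H.wi‖ / ρ) / 2 ^ n) (by positivity)
      (F := fun y => H.prop z (x - y) (H.del y (φ y - H.iter z n y))) fun y hy =>
        (hD.bound z hz hl x y hx hy.le _).trans
          (mul_le_mul_of_nonneg_left (ih (hx.trans hy.le)) (hD.weight.nonneg y))
    refine this.trans (le_of_eq ?_)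
    rw [pow_succ]
    ring

end

end IsSol

end HalfLine

end NonlocalMKdV

end

/-! ### Regularity, uniqueness and uniform bounds in the spectral parameter. -/

noncomputable section

namespace NonlocalMKdV

namespace HalfLine

variable {H : HalfLine}

/-! ### Dependence of the Jost solutions on the spectral parameter -/

lemma continuousOn_lam {S : Set ℂ} (hS : ∀ z ∈ S, z ≠ 0) : ContinuousOn H.lam S := by
  unfold lam
  exact (continuousOn_id.sub (continuousOn_const.div continuousOn_id hS)).div_const _

lemma differentiableOn_lam {S : Set ℂ} (hS : ∀ z ∈ S, z ≠ 0) : DifferentiableOn ℂ H.lam S := by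
  unfold lam
  exact (differentiableOn_id.sub ((differentiableOn_const _).div differentiableOn_id hS)).div_const _

lemma continuousOn_evec {S : Set ℂ} (hS : ∀ z ∈ S, z ≠ 0) : ContinuousOn H.evec S := by
  unfold evec
  exact continuousOn_const.prodMk (continuousOn_const.div continuousOn_id hS)

lemma differentiableOn_evec {S : Set ℂ} (hS : ∀ z ∈ S, z ≠ 0) :
    DifferentiableOn ℂ H.evec S := by
  unfold evec
  exact (differentiableOn_const _).prodMk ((differentiableOn_const _).div differentiableOn_id hS)

lemma continuousOn_prop {S : Set ℂ} (hS : ∀ z ∈ S, z ≠ 0) {f : ℂ → ℂ × ℂ}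
    (hf : ContinuousOn f S) (s : ℝ) : ContinuousOn (fun z => H.prop z s (f z)) S := by
  have hg : ContinuousOn (fun z => gker s (H.lam z)) S :=
    (differentiable_gker s).continuous.comp_continuousOn (continuousOn_lam hS)
  simp only [prop, binf_apply]
  refine hf.add (hg.smul (ContinuousOn.prodMk ?_ ?_))
  · exact ((continuousOn_const.mul (continuousOn_const.div continuousOn_id hS)).mul hf.fst).add
      (continuousOn_const.mul hf.snd)
  · exact ((continuousOn_const.mul continuousOn_id).mul hf.snd).add
      (continuousOn_const.mul hf.fst)

lemma differentiableOn_prop {S : Set ℂ} (hS : ∀ z ∈ S, z ≠ 0) {f : ℂ → ℂ × ℂ}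
    (hf : DifferentiableOn ℂ f S) (s : ℝ) : DifferentiableOn ℂ (fun z => H.prop z s (f z)) S := by
  have hg : DifferentiableOn ℂ (fun z => gker s (H.lam z)) S :=
    (differentiable_gker s).comp_differentiableOn (differentiableOn_lam hS)
  simp only [prop, binf_apply]
  refine hf.add (hg.smul (DifferentiableOn.prodMk ?_ ?_))
  · exact (((differentiableOn_const _).mul ((differentiableOn_const _).div differentiableOn_id
      hS)).mul hf.fst).add ((differentiableOn_const _).mul hf.snd)
  · exact (((differentiableOn_const _).mul differentiableOn_id).mul hf.snd).add
      ((differentiableOn_const _).mul hf.fst)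

lemma continuousOn_del {S : Set ℂ} {f : ℂ → ℂ × ℂ} (hf : ContinuousOn f S) (y : ℝ) :
    ContinuousOn (fun z => H.del y (f z)) S := by
  unfold del
  exact (continuousOn_const.mul hf.snd).prodMk (continuousOn_const.mul hf.fst)

lemma differentiableOn_del {S : Set ℂ} {f : ℂ → ℂ × ℂ} (hf : DifferentiableOn ℂ f S) (y : ℝ) :
    DifferentiableOn ℂ (fun z => H.del y (f z)) S := by
  unfold del
  exact ((differentiableOn_const _).mul hf.snd).prodMk ((differentiableOn_const _).mul hf.fst)

section

variable {ρ X : ℝ} {ω : ℝ → ℝ} (hD : H.Dominated ρ X ω) {S : Set ℂ}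
  (hS : ∀ z ∈ S, ρ ≤ ‖z‖ ∧ 0 ≤ (H.lam z).im)
include hD hS

lemma ae_norm_integrand_le (n : ℕ) {x : ℝ} (hx : X ≤ x) :
    ∀ᵐ y ∂volume.restrict (Set.Ioi x), ∀ z ∈ S,
      ‖H.prop z (x - y) (H.del y (H.iter z n y))‖ ≤
        2 * (1 + ‖H.wi‖ / ρ) * (ω y * Real.exp (2 * tailInt ω y)) := by
  filter_upwards [self_mem_ae_restrict measurableSet_Ioi] with y hy z hz
  refine (hD.bound z (hS z hz).1 (hS z hz).2 x y hx (le_of_lt hy) _).trans ?_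
  refine (mul_le_mul_of_nonneg_left (norm_iter_le hD (hS z hz).1 (hS z hz).2 n
    (hx.trans (le_of_lt hy))) (hD.weight.nonneg y)).trans (le_of_eq (by ring))

lemma continuousOn_iter (n : ℕ) {x : ℝ} (hx : X ≤ x) :
    ContinuousOn (fun z => H.iter z n x) S := by
  have hS0 : ∀ z ∈ S, z ≠ 0 := fun z hz => norm_pos_iff.1 (hD.pos.trans_le (hS z hz).1)
  induction n generalizing x with
  | zero => exact continuousOn_evec hS0
  | succ n ih =>
    refine (continuousOn_evec hS0).sub (continuousOn_of_dominated
      (bound := fun y => 2 * (1 + ‖H.wi‖ / ρ) * (ω y * Real.exp (2 * tailInt ω y)))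
      (fun z _ => aestronglyMeasurable_integrand (measurable_iter z n) x _) (fun z hz => ?_)
      ((hD.weight.integral_mul_exp x).1.const_mul _) ?_)
    · exact (ae_norm_integrand_le hD hS n hx).mono fun y hy => hy z hz
    · filter_upwards [self_mem_ae_restrict measurableSet_Ioi] with y hy
      exact continuousOn_prop hS0 (continuousOn_del (ih (hx.trans (le_of_lt hy))) y) _

lemma differentiableOn_iter (hSo : IsOpen S) (n : ℕ) {x : ℝ} (hx : X ≤ x) :
    DifferentiableOn ℂ (fun z => H.iter z n x) S := by
  have hS0 : ∀ z ∈ S, z ≠ 0 := fun z hz => norm_pos_iff.1 (hD.pos.trans_le (hS z hz).1)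
  induction n generalizing x with
  | zero => exact differentiableOn_evec hS0
  | succ n ih =>
    refine (differentiableOn_evec hS0).sub (differentiableOn_integral_param hSo
      (b := fun y => 2 * (1 + ‖H.wi‖ / ρ) * (ω y * Real.exp (2 * tailInt ω y)))
      ((hD.weight.integral_mul_exp x).1.const_mul _)
      (fun z _ => aestronglyMeasurable_integrand (measurable_iter z n) x _) ?_
      (ae_norm_integrand_le hD hS n hx))
    filter_upwards [self_mem_ae_restrict measurableSet_Ioi] with y hy
    exact differentiableOn_prop hS0 (differentiableOn_del (ih (hx.trans (le_of_lt hy))) y) _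

lemma tendstoUniformlyOn_iter {Φ : ℂ → ℝ → ℂ × ℂ} (hΦ : ∀ z ∈ S, H.IsSol z (Φ z)) {x : ℝ}
    (hx : X ≤ x) : TendstoUniformlyOn (fun n z => H.iter z n x) (fun z => Φ z x) atTop S := by
  have hlim : Tendsto (fun n : ℕ => (1 + ‖H.wi‖ / ρ) / 2 ^ n * Real.exp (2 * tailInt ω x)) atTop
      (𝓝 (0 * Real.exp (2 * tailInt ω x))) :=
    (tendsto_const_nhds.div_atTop (tendsto_pow_atTop_atTop_of_one_lt one_lt_two)).mul_const _
  rw [zero_mul] at hlim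
  refine Metric.tendstoUniformlyOn_iff.2 fun e he => ?_
  filter_upwards [hlim.eventually (gt_mem_nhds he)] with n hn z hz
  rw [dist_eq_norm]
  exact ((hΦ z hz).norm_sub_iter_le hD (hS z hz).1 (hS z hz).2 n hx).trans_lt hn

end

variable {D : Set ℂ} {Φ : ℂ → ℝ → ℂ × ℂ}

lemma exists_dominated (H : HalfLine) {ρ : ℝ} (hρ : 0 < ρ) (X : ℝ) :
    ∃ ω, H.Dominated ρ X ω := by
  obtain ⟨ω, h1, h2⟩ := H.exists_weight hρ X
  exact ⟨ω, hρ, h1, h2⟩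

/-- The Jost solutions depend continuously on the spectral parameter. -/
theorem continuousOn_of_isSol (hD : ∀ z ∈ D, z ≠ 0 ∧ 0 ≤ (H.lam z).im)
    (hΦ : ∀ z ∈ D, H.IsSol z (Φ z)) (x : ℝ) : ContinuousOn (fun z => Φ z x) D := by
  intro z₀ hz₀
  have hρ : 0 < ‖z₀‖ / 2 := half_pos (norm_pos_iff.2 (hD z₀ hz₀).1)
  obtain ⟨ω, hω⟩ := H.exists_dominated hρ x
  -- Away from the origin a single weight dominates the kernel for all z.
  set S := D ∩ {z | ‖z₀‖ / 2 < ‖z‖} with hS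
  have hSb : ∀ z ∈ S, ‖z₀‖ / 2 ≤ ‖z‖ ∧ 0 ≤ (H.lam z).im := fun z hz =>
    ⟨le_of_lt hz.2, (hD z hz.1).2⟩
  have h1 : ContinuousOn (fun z => Φ z x) S :=
    (tendstoUniformlyOn_iter hω hSb (fun z hz => hΦ z hz.1) le_rfl).continuousOn
      (Eventually.of_forall fun n => continuousOn_iter hω hSb n le_rfl).frequently
  have hmem : {z : ℂ | ‖z₀‖ / 2 < ‖z‖} ∈ 𝓝 z₀ :=
    (isOpen_lt continuous_const continuous_norm).mem_nhds (half_lt_self (norm_pos_iff.2 (hD z₀ hz₀).1))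
  exact (h1 z₀ ⟨hz₀, mem_of_mem_nhds hmem⟩).mono_of_mem_nhdsWithin
    (inter_mem self_mem_nhdsWithin (mem_nhdsWithin_of_mem_nhds hmem))

/-- The Jost solutions depend analytically on the spectral parameter. -/
theorem differentiableOn_of_isSol (hDo : IsOpen D) (hD : ∀ z ∈ D, z ≠ 0 ∧ 0 ≤ (H.lam z).im)
    (hΦ : ∀ z ∈ D, H.IsSol z (Φ z)) (x : ℝ) : DifferentiableOn ℂ (fun z => Φ z x) D := by
  intro z₀ hz₀
  have hρ : 0 < ‖z₀‖ / 2 := half_pos (norm_pos_iff.2 (hD z₀ hz₀).1)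
  obtain ⟨ω, hω⟩ := H.exists_dominated hρ x
  set S := D ∩ {z | ‖z₀‖ / 2 < ‖z‖} with hS
  have hSo : IsOpen S := hDo.inter (isOpen_lt continuous_const continuous_norm)
  have hSb : ∀ z ∈ S, ‖z₀‖ / 2 ≤ ‖z‖ ∧ 0 ≤ (H.lam z).im := fun z hz =>
    ⟨le_of_lt hz.2, (hD z hz.1).2⟩
  have h1 : DifferentiableOn ℂ (fun z => Φ z x) S :=
    (tendstoUniformlyOn_iter hω hSb (fun z hz => hΦ z hz.1)
      le_rfl).tendstoLocallyUniformlyOn.differentiableOn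
      (Eventually.of_forall fun n => differentiableOn_iter hω hSb hSo n le_rfl) hSo
  exact (h1.differentiableAt (hSo.mem_nhds
    ⟨hz₀, half_lt_self (norm_pos_iff.2 (hD z₀ hz₀).1)⟩)).differentiableWithinAt

/-- A Jost solution is unique. -/
theorem IsSol.unique {z : ℂ} (hz : z ≠ 0) (hl : 0 ≤ (H.lam z).im) {φ ψ : ℝ → ℂ × ℂ}
    (h : H.IsSol z φ) (h' : H.IsSol z ψ) : φ = ψ := by
  ext1 x
  obtain ⟨ω, hω⟩ := H.exists_dominated (norm_pos_iff.2 hz) x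
  have t : ∀ {φ}, H.IsSol z φ → Tendsto (fun n => H.iter z n x) atTop (𝓝 (φ x)) := fun {φ} h =>
    (tendstoUniformlyOn_iter (S := {z}) (Φ := fun _ => φ) hω (by simpa using hl) (by simpa using h)
      le_rfl).tendsto_at (Set.mem_singleton z)
  exact tendsto_nhds_unique (t h) (t h')

/-- The Jost solutions are bounded uniformly in the spectral parameter away from the origin. -/
theorem exists_uniform_bound (H : HalfLine) {ρ : ℝ} (hρ : 0 < ρ) (X : ℝ) : ∃ K, 0 ≤ K ∧
    ∀ z, ρ ≤ ‖z‖ → 0 ≤ (H.lam z).im → ∀ φ, H.IsSol z φ → ∀ x, X ≤ x → ‖φ x‖ ≤ K := by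
  obtain ⟨ω, hω⟩ := H.exists_dominated hρ X
  refine ⟨(1 + ‖H.wi‖ / ρ) * Real.exp (2 * tailInt ω X) + (1 + ‖H.wi‖ / ρ), by positivity,
    fun z hz hl φ h x hx => ?_⟩
  have h1 := h.norm_sub_evec_le hω hz hl hx
  have h2 := norm_evec_le (H := H) hρ hz
  have h3 := norm_add_le (φ x - H.evec z) (H.evec z)
  rw [sub_add_cancel] at h3
  have h4 : Real.exp (2 * tailInt ω x) ≤ Real.exp (2 * tailInt ω X) :=
    Real.exp_le_exp.2 (by linarith [hω.weight.tailInt_anti hx])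
  have h5 : 0 ≤ 1 + ‖H.wi‖ / ρ := by positivity
  nlinarith

/-- The boundary values are attained uniformly in the spectral parameter away from the origin. -/
theorem eventually_norm_sub_evec_le (H : HalfLine) {ρ : ℝ} (hρ : 0 < ρ) {e : ℝ} (he : 0 < e) :
    ∀ᶠ x in atTop, ∀ z, ρ ≤ ‖z‖ → 0 ≤ (H.lam z).im → ∀ φ, H.IsSol z φ →
      ‖φ x - H.evec z‖ ≤ e := by
  obtain ⟨ω, hω⟩ := H.exists_dominated hρ 0
  obtain ⟨K, hK, hKb⟩ := H.exists_uniform_bound hρ 0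
  have hlim : Tendsto (fun x => K * tailInt ω x) atTop (𝓝 0) := by
    simpa using hω.weight.tendsto_tailInt.const_mul K
  filter_upwards [hlim.eventually (gt_mem_nhds he), eventually_ge_atTop 0] with x hx hx0 z hz hl φ h
  have hz0 : z ≠ 0 := norm_pos_iff.1 (hρ.trans_le hz)
  conv_lhs => rw [h.volterra hz0 hl x, sub_sub_cancel_left, norm_neg]
  refine le_trans ?_ hx.le
  rw [tailInt, ← integral_const_mul]
  refine norm_integral_le_of_norm_le ((hω.weight.integrableOn x).const_mul K) ?_
  filter_upwards [self_mem_ae_restrict measurableSet_Ioi] with y hy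
  refine (hω.bound z hz hl x y hx0 (le_of_lt hy) _).trans ?_
  rw [mul_comm]
  exact mul_le_mul_of_nonneg_right (hKb z hz hl φ h y (hx0.trans (le_of_lt hy)))
    (hω.weight.nonneg y)

/-! ### Large values of the spectral parameter -/

lemma IsSol.deriv_fst {z : ℂ} {φ : ℝ → ℂ × ℂ} (h : H.IsSol z φ) (x : ℝ) :
    HasDerivAt (fun x => (φ x).1) (I * (H.ui * H.wi / z) * (φ x).1 + H.u x * (φ x).2) x := by
  have := (ContinuousLinearMap.fst ℝ ℂ ℂ).hasFDerivAt.comp_hasDerivAt x (h.deriv x)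
  refine this.congr_deriv ?_
  simp [binf_apply, del]
  ring

lemma IsSol.deriv_snd {z : ℂ} {φ : ℝ → ℂ × ℂ} (h : H.IsSol z φ) (x : ℝ) :
    HasDerivAt (fun x => (φ x).2) (-I * z * (φ x).2 + H.w x * (φ x).1) x := by
  have := (ContinuousLinearMap.snd ℝ ℂ ℂ).hasFDerivAt.comp_hasDerivAt x (h.deriv x)
  refine this.congr_deriv ?_
  simp [binf_apply, del]
  ring

/-- Integration by parts in the second component, on a bounded interval. -/
lemma exists_norm_snd_le {w' : ℝ → ℂ} (hw : ∀ x, HasDerivAt H.w (w' x) x) (hw' : Continuous w')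
    (a b : ℝ) : ∃ M, 0 ≤ M ∧ ∀ z, 1 ≤ ‖z‖ → 0 ≤ (H.lam z).im → 0 ≤ z.im → ∀ φ, H.IsSol z φ →
      ∀ x y, a ≤ x → x ≤ y → y ≤ b →
      ‖(φ x).2 - H.w x * (φ x).1 / (I * z)‖ ≤ Real.exp (-(z.im * (y - x))) *
        ‖(φ y).2 - H.w y * (φ y).1 / (I * z)‖ + M / ‖z‖ * (y - x) := by
  obtain ⟨K, hK, hKb⟩ := H.exists_uniform_bound one_pos a
  obtain ⟨C1, hC1⟩ := (isCompact_Icc (a := a) (b := b)).exists_bound_of_continuousOn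
    hw'.continuousOn
  obtain ⟨C2, hC2⟩ := (isCompact_Icc (a := a) (b := b)).exists_bound_of_continuousOn
    H.continuous_w.continuousOn
  obtain ⟨C3, hC3⟩ := (isCompact_Icc (a := a) (b := b)).exists_bound_of_continuousOn
    H.continuous_u.continuousOn
  refine ⟨|C1| * K + |C2| * (‖H.ui * H.wi‖ * K + |C3| * K), by positivity,
    fun z hz hl hi φ h x y hx hxy hy => ?_⟩
  have hz0 : z ≠ 0 := norm_pos_iff.1 (one_pos.trans_le hz)
  -- The exponential removes the fast term -izφ₂, and subtracting wφ₁/(iz) removes the forcing wφ₁;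
  -- what remains of the derivative is O(1/z).
  set F : ℝ → ℂ := fun s => exp (I * z * (s - x)) * ((φ s).2 - H.w s * (φ s).1 / (I * z)) with hF
  set F' : ℝ → ℂ := fun s => -(exp (I * z * (s - x)) * ((w' s * (φ s).1 + H.w s *
    (I * (H.ui * H.wi / z) * (φ s).1 + H.u s * (φ s).2)) / (I * z))) with hF'
  have hd : ∀ s, HasDerivAt F (F' s) s := by
    intro s
    have h1 : HasDerivAt (fun s : ℝ => exp (I * z * (s - x))) (exp (I * z * (s - x)) * (I * z)) s := by
      have := ((((hasDerivAt_id (s : ℂ)).sub_const (x : ℂ)).const_mul (I * z)).cexp).comp_ofReal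
      simpa using this
    have h2 := (h.deriv_snd s).fun_sub (((hw s).fun_mul (h.deriv_fst s)).div_const (I * z))
    refine (h1.fun_mul h2).congr_deriv ?_
    simp only [hF']
    field_simp
    ring
  have hexp : ∀ s : ℝ, ‖exp (I * z * (s - x))‖ = Real.exp (-(z.im * (s - x))) := by
    intro s
    rw [norm_exp]
    congr 1
    have : (s : ℂ) - x = ((s - x : ℝ) : ℂ) := by push_cast; ring
    rw [this, mul_comm, re_ofReal_mul]
    simp
    ring
  have hb : ∀ s ∈ Set.Ico x y, ‖F' s‖ ≤
      (|C1| * K + |C2| * (‖H.ui * H.wi‖ * K + |C3| * K)) / ‖z‖ := by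
    intro s hs
    have hsab : s ∈ Set.Icc a b := ⟨hx.trans hs.1, hs.2.le.trans hy⟩
    have hφ := hKb z hz hl φ h s hsab.1
    have e1 : ‖exp (I * z * (s - x))‖ ≤ 1 := by
      rw [hexp]
      refine Real.exp_le_one_iff.2 ?_
      have := mul_nonneg hi (sub_nonneg.2 hs.1)
      linarith
    have f1 := (norm_fst_le (φ s)).trans hφ
    have f2 := (norm_snd_le (φ s)).trans hφ
    have g1 := (hC1 s hsab).trans (le_abs_self C1)
    have g2 := (hC2 s hsab).trans (le_abs_self C2)
    have g3 := (hC3 s hsab).trans (le_abs_self C3)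
    have g4 : ‖I * (H.ui * H.wi / z)‖ ≤ ‖H.ui‖ * ‖H.wi‖ := by
      rw [norm_mul, norm_I, one_mul, norm_div, norm_mul]
      exact div_le_self (by positivity) hz
    simp only [hF', norm_neg, norm_mul, norm_div, norm_I, one_mul]
    calc _ ≤ 1 * (‖w' s * (φ s).1 + H.w s * (I * (H.ui * H.wi / z) * (φ s).1
          + H.u s * (φ s).2)‖ / ‖z‖) := by gcongr
      _ ≤ _ := by
        rw [one_mul]
        gcongr
        refine (norm_add_le _ _).trans ?_
        rw [norm_mul, norm_mul (H.w s)]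
        gcongr
        refine (norm_add_le _ _).trans ?_
        rw [norm_mul, norm_mul (H.u s)]
        gcongr
  have key := norm_image_sub_le_of_norm_deriv_le_segment' (f := F) (f' := F') (a := x) (b := y)
    (fun s _ => (hd s).hasDerivWithinAt) hb y ⟨hxy, le_rfl⟩
  have hFx : F x = (φ x).2 - H.w x * (φ x).1 / (I * z) := by simp [hF]
  have hFy : ‖F y‖ = Real.exp (-(z.im * (y - x))) * ‖(φ y).2 - H.w y * (φ y).1 / (I * z)‖ := by
    simp only [hF, norm_mul, hexp]
  rw [← hFx, ← hFy]
  have := norm_sub_norm_le (F x) (F y)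
  rw [norm_sub_rev] at this
  linarith

end HalfLine

end NonlocalMKdV

end

/-! ### Asymptotics of the Jost solutions for large spectral parameter. -/

noncomputable section

namespace NonlocalMKdV

namespace HalfLine

variable {H : HalfLine}

/-- Integration by parts in the first component, on a bounded interval. -/
lemma exists_norm_fst_sub_le {u' : ℝ → ℂ} (hu : ∀ x, HasDerivAt H.u (u' x) x)
    (hu' : Continuous u') (a b : ℝ) : ∃ M, 0 ≤ M ∧ ∀ z, 1 ≤ ‖z‖ → 0 ≤ (H.lam z).im →
      ∀ φ, H.IsSol z φ → ∀ x y, a ≤ x → x ≤ y → y ≤ b → ‖(φ x).1 - (φ y).1‖ ≤ M / ‖z‖ := by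
  obtain ⟨K, hK, hKb⟩ := H.exists_uniform_bound one_pos a
  obtain ⟨C1, hC1⟩ := (isCompact_Icc (a := a) (b := b)).exists_bound_of_continuousOn
    hu'.continuousOn
  obtain ⟨C2, hC2⟩ := (isCompact_Icc (a := a) (b := b)).exists_bound_of_continuousOn
    H.continuous_w.continuousOn
  obtain ⟨C3, hC3⟩ := (isCompact_Icc (a := a) (b := b)).exists_bound_of_continuousOn
    H.continuous_u.continuousOn
  refine ⟨(‖H.ui‖ * ‖H.wi‖ * K + (|C1| * K + |C3| * (|C2| * K))) * |b - a| + 2 * (|C3| * K),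
    by positivity, fun z hz hl φ h x y hx hxy hy => ?_⟩
  have hz0 : z ≠ 0 := norm_pos_iff.1 (one_pos.trans_le hz)
  have hz0' : 0 < ‖z‖ := one_pos.trans_le hz
  -- The derivative of the correction uφ₂/(iz) contains -uφ₂, which cancels the only term of φ₁'
  -- that is not O(1/z).
  set F : ℝ → ℂ := fun s => (φ s).1 + H.u s * (φ s).2 / (I * z) with hF
  set F' : ℝ → ℂ := fun s => (I * (H.ui * H.wi * (φ s).1)
    + (u' s * (φ s).2 + H.u s * (H.w s * (φ s).1)) / I) / z with hF'
  have hd : ∀ s, HasDerivAt F (F' s) s := by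
    intro s
    refine ((h.deriv_fst s).fun_add
      (((hu s).fun_mul (h.deriv_snd s)).div_const (I * z))).congr_deriv ?_
    simp only [hF']
    field_simp
    ring
  have bd : ∀ s ∈ Set.Icc a b, ‖(φ s).1‖ ≤ K ∧ ‖(φ s).2‖ ≤ K ∧ ‖u' s‖ ≤ |C1| ∧ ‖H.w s‖ ≤ |C2| ∧
      ‖H.u s‖ ≤ |C3| := fun s hs =>
    have hφ := hKb z hz hl φ h s hs.1
    ⟨(norm_fst_le (φ s)).trans hφ, (norm_snd_le (φ s)).trans hφ,
      (hC1 s hs).trans (le_abs_self C1), (hC2 s hs).trans (le_abs_self C2),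
      (hC3 s hs).trans (le_abs_self C3)⟩
  have hb : ∀ s ∈ Set.Ico x y, ‖F' s‖ ≤
      (‖H.ui‖ * ‖H.wi‖ * K + (|C1| * K + |C3| * (|C2| * K))) / ‖z‖ := by
    intro s hs
    obtain ⟨f1, f2, g1, g2, g3⟩ := bd s ⟨hx.trans hs.1, hs.2.le.trans hy⟩
    simp only [hF', norm_div]
    gcongr
    refine (norm_add_le _ _).trans ?_
    rw [norm_mul, norm_I, one_mul, norm_mul, norm_mul, norm_div, norm_I, div_one]
    gcongr
    refine (norm_add_le _ _).trans ?_
    rw [norm_mul, norm_mul (H.u s), norm_mul (H.w s)]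
    gcongr
  have key := norm_image_sub_le_of_norm_deriv_le_segment' (f := F) (f' := F') (a := x) (b := y)
    (fun s _ => (hd s).hasDerivWithinAt) hb y ⟨hxy, le_rfl⟩
  have hend : ∀ s ∈ Set.Icc a b, ‖H.u s * (φ s).2 / (I * z)‖ ≤ |C3| * K / ‖z‖ := by
    intro s hs
    obtain ⟨f1, f2, g1, g2, g3⟩ := bd s hs
    rw [norm_div, norm_mul, norm_mul, norm_I, one_mul]
    gcongr
  have e1 := hend x ⟨hx, hxy.trans hy⟩
  have e2 := hend y ⟨hx.trans hxy, hy⟩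
  have e3 : (φ x).1 - (φ y).1 = H.u y * (φ y).2 / (I * z) - H.u x * (φ x).2 / (I * z)
      - (F y - F x) := by
    simp only [hF]; ring
  have e4 : y - x ≤ |b - a| := (by linarith : y - x ≤ b - a).trans (le_abs_self _)
  rw [e3]
  refine (norm_sub_le _ _).trans ((add_le_add (norm_sub_le _ _) key).trans ?_)
  have e5 : (‖H.ui‖ * ‖H.wi‖ * K + (|C1| * K + |C3| * (|C2| * K))) / ‖z‖ * (y - x) ≤
    (‖H.ui‖ * ‖H.wi‖ * K + (|C1| * K + |C3| * (|C2| * K))) / ‖z‖ * |b - a| := by gcongr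
  refine (add_le_add (add_le_add e2 e1) e5).trans (le_of_eq ?_)
  ring

/-- The Jost solutions tend to `(1, 0)` for large values of the spectral parameter. -/
theorem exists_norm_sub_le {u' w' : ℝ → ℂ} (hu : ∀ x, HasDerivAt H.u (u' x) x)
    (hu' : Continuous u') (hw : ∀ x, HasDerivAt H.w (w' x) x) (hw' : Continuous w')
    (x : ℝ) {e : ℝ} (he : 0 < e) : ∃ R, 1 ≤ R ∧ ∀ z, R ≤ ‖z‖ → 0 ≤ (H.lam z).im → 0 ≤ z.im →
      ∀ φ, H.IsSol z φ → ‖φ x - (1, 0)‖ ≤ e := by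
  -- Choose a far point y where the boundary value is nearly attained, uniformly in z. The return
  -- from y to x over a fixed interval costs O(1/|z|).
  obtain ⟨y, hy, hxy⟩ := ((H.eventually_norm_sub_evec_le one_pos (half_pos he)).and
    (eventually_ge_atTop x)).exists
  obtain ⟨M1, hM1, h1⟩ := H.exists_norm_fst_sub_le hu hu' x y
  obtain ⟨M2, hM2, h2⟩ := H.exists_norm_snd_le hw hw' x y
  obtain ⟨K, hK, hKb⟩ := H.exists_uniform_bound one_pos x
  set c := ‖H.wi‖ + M1 + M2 * (y - x) + ‖H.w x‖ * K + ‖H.w y‖ * K with hc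
  have hyx : 0 ≤ y - x := sub_nonneg.2 hxy
  have hc0 : 0 ≤ c := by positivity
  refine ⟨1 + c / (e / 2), by linarith [div_nonneg hc0 (half_pos he).le],
    fun z hz hl hi φ h => ?_⟩
  have hz1 : 1 ≤ ‖z‖ := by linarith [div_nonneg hc0 (half_pos he).le]
  have hz0 : 0 < ‖z‖ := one_pos.trans_le hz1
  have hcz : c / ‖z‖ ≤ e / 2 := by
    rw [div_le_iff₀ hz0, ← div_le_iff₀' (half_pos he)]
    linarith
  have hφy := hy z hz1 hl φ h
  have hsplit : c / ‖z‖ = ‖H.wi‖ / ‖z‖ + M1 / ‖z‖ + M2 / ‖z‖ * (y - x) + ‖H.w x‖ * K / ‖z‖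
    + ‖H.w y‖ * K / ‖z‖ := by rw [hc]; ring
  have p1 : 0 ≤ ‖H.wi‖ / ‖z‖ := by positivity
  have p2 : 0 ≤ M1 / ‖z‖ := by positivity
  have p3 : 0 ≤ M2 / ‖z‖ * (y - x) := by positivity
  have p4 : 0 ≤ ‖H.w x‖ * K / ‖z‖ := by positivity
  have p5 : 0 ≤ ‖H.w y‖ * K / ‖z‖ := by positivity
  have a1 := (norm_fst_le _).trans hφy
  have a2 := (norm_snd_le _).trans hφy
  simp only [evec, Prod.fst_sub, Prod.snd_sub] at a1 a2
  have b1 : ∀ s, x ≤ s → ‖H.w s * (φ s).1 / (I * z)‖ ≤ ‖H.w s‖ * K / ‖z‖ := fun s hs => by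
    rw [norm_div, norm_mul, norm_mul, norm_I, one_mul]
    gcongr
    exact (norm_fst_le _).trans (hKb z hz1 hl φ h s hs)
  have ew : ‖-I * H.wi / z‖ = ‖H.wi‖ / ‖z‖ := by simp
  rw [Prod.norm_def, max_le_iff]
  simp only [Prod.fst_sub, Prod.snd_sub, sub_zero]
  constructor
  · have := norm_add_le ((φ x).1 - (φ y).1) ((φ y).1 - 1)
    rw [sub_add_sub_cancel] at this
    linarith [h1 z hz1 hl φ h x y le_rfl hxy le_rfl]
  · have k1 := h2 z hz1 hl hi φ h x y le_rfl hxy le_rfl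
    have k2 : Real.exp (-(z.im * (y - x))) ≤ 1 :=
      Real.exp_le_one_iff.2 (by linarith [mul_nonneg hi hyx])
    have k3 := mul_le_of_le_one_left (norm_nonneg ((φ y).2 - H.w y * (φ y).1 / (I * z))) k2
    have k4 := norm_sub_le (φ y).2 (H.w y * (φ y).1 / (I * z))
    have k5 := norm_le_norm_add_norm_sub' (φ y).2 (-I * H.wi / z)
    have k6 := norm_le_norm_add_norm_sub' (φ x).2 (H.w x * (φ x).1 / (I * z))
    linarith [b1 x le_rfl, b1 y hxy]

/-- The leading behaviour of the second component along the imaginary axis. -/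
theorem tendsto_mul_snd {u' w' : ℝ → ℂ} (hu : ∀ x, HasDerivAt H.u (u' x) x)
    (hu' : Continuous u') (hw : ∀ x, HasDerivAt H.w (w' x) x) (hw' : Continuous w')
    {Φ : ℂ → ℝ → ℂ × ℂ} (hl : ∀ᶠ s : ℝ in atTop, 0 ≤ (H.lam (s * I)).im)
    (hΦ : ∀ᶠ s : ℝ in atTop, H.IsSol (s * I) (Φ (s * I))) (x : ℝ) :
    Tendsto (fun s : ℝ => (s * I) * (Φ (s * I) x).2) atTop (𝓝 (-I * H.w x)) := by
  have hn : ∀ s : ℝ, 0 < s → ‖(s : ℂ) * I‖ = s := fun s hs => by simp [abs_of_pos hs]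
  have hfst : Tendsto (fun s : ℝ => (Φ (s * I) x).1) atTop (𝓝 1) := by
    rw [Metric.tendsto_nhds]
    intro e he
    obtain ⟨R, hR, h⟩ := H.exists_norm_sub_le hu hu' hw hw' x (half_pos he)
    filter_upwards [hl, hΦ, eventually_ge_atTop R] with s h1 h2 h3
    have hs : 0 < s := by linarith
    rw [dist_eq_norm]
    refine ((norm_fst_le _).trans (h _ (by rwa [hn s hs]) h1 (by simpa using hs.le) _ h2)).trans_lt
      (half_lt_self he)
  have hmain : Tendsto (fun s : ℝ => (s * I) * (Φ (s * I) x).2 - H.w x * (Φ (s * I) x).1 / I) atTop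
      (𝓝 0) := by
    obtain ⟨M, hM, h⟩ := H.exists_norm_snd_le hw hw' x (x + 1)
    obtain ⟨K, hK, hKb⟩ := H.exists_uniform_bound one_pos x
    obtain ⟨C, hC⟩ := (isCompact_Icc (a := x) (b := x + 1)).exists_bound_of_continuousOn
      H.continuous_w.continuousOn
    rw [Metric.tendsto_nhds]
    intro e he
    -- On an interval of length η the error multiplied by s is Mη, so η is fixed by the tolerance
    -- alone. The contribution of the far endpoint carries s·exp(-sη) and disappears as s grows.
    obtain ⟨η, hη0, hη1, hηe⟩ : ∃ η : ℝ, 0 < η ∧ η ≤ 1 ∧ M * η ≤ e / 2 := by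
      refine ⟨min 1 (e / 2 / (M + 1)), by positivity, min_le_left _ _, ?_⟩
      calc M * min 1 (e / 2 / (M + 1)) ≤ M * (e / 2 / (M + 1)) := by gcongr; exact min_le_right _ _
        _ ≤ (M + 1) * (e / 2 / (M + 1)) := by gcongr; linarith
        _ = e / 2 := by field_simp
    have hlim : Tendsto (fun s : ℝ => s ^ 1 * Real.exp (-η * s) * (K + |C| * K)) atTop (𝓝 0) := by
      have := (Real.tendsto_pow_mul_exp_neg_atTop_nhds_zero 1).comp
        (tendsto_id.const_mul_atTop hη0)
      have := (this.const_mul (1 / η)).mul_const (K + |C| * K)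
      simp only [mul_zero, zero_mul] at this
      refine this.congr fun s => ?_
      simp only [Function.comp, id]
      rw [neg_mul]
      field_simp
    filter_upwards [hl, hΦ, eventually_ge_atTop 1, hlim.eventually (gt_mem_nhds (half_pos he))]
      with s h1 h2 h3 h4
    have hs : 0 < s := by linarith
    have hz1 : 1 ≤ ‖(s : ℂ) * I‖ := by rwa [hn s hs]
    have hz0 : (s : ℂ) * I ≠ 0 := norm_pos_iff.1 (one_pos.trans_le hz1)
    have k := h _ hz1 h1 (by simpa using hs.le) _ h2 x (x + η) le_rfl (by linarith) (by linarith)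
    have hφ := hKb _ hz1 h1 _ h2 (x + η) (by linarith)
    have hend : ‖(Φ (s * I) (x + η)).2 - H.w (x + η) * (Φ (s * I) (x + η)).1 / (I * (s * I))‖ ≤
        K + |C| * K := by
      refine (norm_sub_le _ _).trans (add_le_add ((norm_snd_le _).trans hφ) ?_)
      rw [norm_div, norm_mul, norm_mul I, norm_I, one_mul]
      refine (div_le_self (by positivity) hz1).trans ?_
      gcongr
      · exact (hC _ ⟨by linarith, by linarith⟩).trans (le_abs_self C)
      · exact (norm_fst_le _).trans hφ
    rw [dist_zero_right]
    have e1 : (s * I) * (Φ (s * I) x).2 - H.w x * (Φ (s * I) x).1 / I = (s * I) *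
        ((Φ (s * I) x).2 - H.w x * (Φ (s * I) x).1 / (I * (s * I))) := by
      generalize (s : ℂ) * I = z at hz0
      field_simp
    rw [e1, norm_mul, hn s hs]
    rw [hn s hs, add_sub_cancel_left] at k
    have him : ((s : ℂ) * I).im = s := by simp
    rw [him] at k
    calc _ ≤ s * (Real.exp (-(s * η)) * (K + |C| * K) + M / s * η) := by
          gcongr
          exact k.trans (by gcongr)
      _ = s ^ 1 * Real.exp (-η * s) * (K + |C| * K) + M * η := by
          rw [show -(s * η) = -η * s by ring]
          field_simp
      _ < e := by linarith
  have := hmain.add ((hfst.const_mul (H.w x)).div_const I)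
  simp only [sub_add_cancel, mul_one, zero_add, div_I] at this
  rwa [show -I * H.w x = -(H.w x * I) by ring]

end HalfLine

end NonlocalMKdV

end

/-! ### The columns of the Jost matrices as solutions of half-line systems. -/

noncomputable section

namespace NonlocalMKdV

namespace HalfLine

/-- The system with the roles of the two coefficients exchanged. -/
def swap (H : HalfLine) : HalfLine where
  u := H.w
  w := H.u
  ui := H.wi
  wi := H.ui
  continuous_u := H.continuous_w
  continuous_w := H.continuous_u
  int_u := H.int_w
  int_w := H.int_u

lemma isSol_iff {H : HalfLine} {z : ℂ} {a c : ℝ → ℂ} : H.IsSol z (fun x => (a x, c x)) ↔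
    (∀ x, HasDerivAt a (I * (H.ui * H.wi / z) * a x + H.u x * c x) x) ∧
    (∀ x, HasDerivAt c (-I * z * c x + H.w x * a x) x) ∧
    Tendsto a atTop (𝓝 1) ∧ Tendsto c atTop (𝓝 (-I * H.wi / z)) := by
  constructor
  · intro h
    refine ⟨h.deriv_fst, h.deriv_snd, ?_, ?_⟩
    · simpa [evec, Function.comp_def] using (continuous_fst.tendsto _).comp h.lim
    · simpa [evec, Function.comp_def] using (continuous_snd.tendsto _).comp h.lim
  · rintro ⟨h1, h2, h3, h4⟩
    refine ⟨fun x => ((h1 x).prodMk (h2 x)).congr_deriv ?_, h3.prodMk_nhds h4⟩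
    rw [binf_apply, del]
    ext <;> simp <;> ring

end HalfLine

namespace Params

variable {P : Params} {q : ℝ → ℝ → ℝ}

namespace IsSolution

variable (hq : P.IsSolution q)
include hq

lemma contDiff_space (t : ℝ) : ContDiff ℝ 3 (fun x => q x t) :=
  hq.smooth.comp (contDiff_id.prodMk contDiff_const)

lemma hasDerivAt_space (x t : ℝ) : HasDerivAt (fun y => q y t) (dx q x t) x :=
  ((hq.contDiff_space t).differentiable (by norm_num) x).hasDerivAt

lemma continuous_dx (t : ℝ) : Continuous fun x => dx q x t :=
  (hq.contDiff_space t).continuous_deriv (by norm_num)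

/-- The profile and its reflection, as coefficients of a system on the right half-line. -/
def halfLine (h : P.Admissible) (t : ℝ) : HalfLine where
  u x := q x t
  w x := P.σ * rst q x t
  ui := P.qp
  wi := P.ε * P.qp
  continuous_u := continuous_ofReal.comp (hq.contDiff_space t).continuous
  continuous_w := continuous_const.mul (continuous_ofReal.comp
    ((hq.contDiff_space (-t)).continuous.comp continuous_neg))
  int_u := by
    refine IntegrableOn.congr_fun (hq.int_right t).norm (fun x _ => ?_) measurableSet_Ici
    simp only [norm_mul, Real.norm_eq_abs]
    rw [abs_of_nonneg (by positivity : 0 ≤ 1 + |x|), ← ofReal_sub, norm_real, Real.norm_eq_abs]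
  int_w := by
    have h1 : IntegrableOn (fun x => ‖(1 + |-x|) * (q (-x) (-t) - P.qm)‖) (Set.Ici 0) := by
      have h2 : IntegrableOn (fun x => ‖(1 + |x|) * (q x (-t) - P.qm)‖) (Set.Iic (-0)) := by
        simpa [IntegrableOn] using Integrable.norm (hq.int_left (-t))
      exact h2.comp_neg_Ici
    refine h1.congr_fun (fun x _ => ?_) measurableSet_Ici
    -- Since δ² = 1, the limit σq₋ of the reflected coefficient at +∞ equals εq₊.
    have e : P.ε * P.qp = P.σ * P.qm := by
      rw [ε, qp]; linear_combination (P.σ * P.qm) * h.delta_sq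
    have e' : ‖(P.σ : ℂ)‖ = 1 := by
      rcases h.sigma with h | h <;> simp [h]
    have e2 : (P.σ : ℂ) * rst q x t - P.ε * P.qp = P.σ * ((rst q x t - P.qm : ℝ) : ℂ) := by
      rw [← ofReal_mul P.ε, e]; push_cast; ring
    simp only [norm_mul, Real.norm_eq_abs]
    rw [e2, norm_mul, e', one_mul, norm_real, Real.norm_eq_abs, abs_neg,
      abs_of_nonneg (by positivity : 0 ≤ 1 + |x|), rst]

variable (h : P.Admissible)

lemma hasDerivAt_halfLine_u (t x : ℝ) :
    HasDerivAt (hq.halfLine h t).u ((dx q x t : ℝ) : ℂ) x :=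
  (hq.hasDerivAt_space x t).ofReal_comp

lemma hasDerivAt_halfLine_w (t x : ℝ) :
    HasDerivAt (hq.halfLine h t).w (P.σ * ((-dx q (-x) (-t) : ℝ) : ℂ)) x := by
  have := (hq.hasDerivAt_space (-x) (-t)).scomp x (hasDerivAt_neg x)
  refine ((this.ofReal_comp).const_mul (P.σ : ℂ)).congr_deriv ?_
  simp

lemma continuous_dx_ofReal (t : ℝ) : Continuous fun x => ((dx q x t : ℝ) : ℂ) :=
  continuous_ofReal.comp (hq.continuous_dx t)

lemma continuous_dx_rst (t : ℝ) :
    Continuous fun x => (P.σ : ℂ) * ((-dx q (-x) (-t) : ℝ) : ℂ) :=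
  continuous_const.mul (continuous_ofReal.comp ((hq.continuous_dx (-t)).comp continuous_neg).neg)

end IsSolution

lemma halfLine_lam (hq : P.IsSolution q) (h : P.Admissible) (t : ℝ) (z : ℂ) :
    (hq.halfLine h t).lam z = P.lam z := by
  have : (P.qp : ℂ) ^ 2 = P.q₀ ^ 2 := by exact_mod_cast h.qp_sq
  simp only [HalfLine.lam, IsSolution.halfLine, lam]
  rw [← this]; ring

lemma halfLine_swap_lam (hq : P.IsSolution q) (h : P.Admissible) (t : ℝ) (z : ℂ) :
    (hq.halfLine h t).swap.lam (-z) = -P.lam z := by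
  have : (P.qp : ℂ) ^ 2 = P.q₀ ^ 2 := by exact_mod_cast h.qp_sq
  simp only [HalfLine.lam, IsSolution.halfLine, lam, HalfLine.swap]
  rw [← this, div_neg]; ring

lemma k_sub_lam (z : ℂ) : P.k z - P.lam z = P.ε * P.q₀ ^ 2 / z := by
  simp only [k, lam]; ring

lemma k_add_lam (z : ℂ) : P.k z + P.lam z = z := by
  simp only [k, lam]; ring

lemma hasDerivAt_osc (j : Fin 2) (x t : ℝ) (z : ℂ) :
    HasDerivAt (fun y : ℝ => P.osc j y t z)
      (((if j = 0 then -I else I) * P.lam z) * P.osc j x t z) x := by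
  have h1 : HasDerivAt (fun y : ℂ => (if j = 0 then -I else I) *
      (P.lam z * (y + (4 * P.k z ^ 2 + 2 * P.ε * P.q₀ ^ 2) * t)))
      ((if j = 0 then -I else I) * P.lam z) (x : ℂ) := by
    simpa using (((hasDerivAt_id (x : ℂ)).add_const _).const_mul (P.lam z)).const_mul
      (if j = 0 then -I else I)
  refine h1.cexp.comp_ofReal.congr_deriv ?_
  rw [osc, θ, mul_comm]

lemma osc_ne (j : Fin 2) (x t : ℝ) (z : ℂ) : P.osc j x t z ≠ 0 := exp_ne_zero _

lemma theta_neg (x t : ℝ) (z : ℂ) : P.θ (-x) (-t) z = -P.θ x t z := by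
  simp only [θ]; push_cast; ring

lemma osc_zero_neg (x t : ℝ) (z : ℂ) : P.osc 0 (-x) (-t) z = P.osc 1 x t z := by
  simp [osc, theta_neg]

lemma osc_one_neg (x t : ℝ) (z : ℂ) : P.osc 1 (-x) (-t) z = P.osc 0 x t z := by
  simp [osc, theta_neg]

lemma osc_mul_osc (x t : ℝ) (z : ℂ) : P.osc 0 x t z * P.osc 1 x t z = 1 := by
  simp [osc, ← exp_add]

section

variable {z : ℂ} {φ : ℝ → ℝ → Fin 2 → ℂ}

lemma IsLaxSolution.deriv_zero (hφ : P.IsLaxSolution q z φ) (x t : ℝ) :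
    HasDerivAt (fun y => φ y t 0) (I * P.k z * φ x t 0 + q x t * φ x t 1) x := by
  have := hasDerivAt_pi.1 (hφ.1 x t) 0
  simpa [X, Q, offDiag, σ₃, Matrix.mulVec, dotProduct, Fin.sum_univ_two, Matrix.add_apply] using this

lemma IsLaxSolution.deriv_one (hφ : P.IsLaxSolution q z φ) (x t : ℝ) :
    HasDerivAt (fun y => φ y t 1) (P.σ * rst q x t * φ x t 0 - I * P.k z * φ x t 1) x := by
  have := hasDerivAt_pi.1 (hφ.1 x t) 1
  simp only [X, Q, offDiag, σ₃, Matrix.mulVec, dotProduct, Fin.sum_univ_two, Matrix.add_apply] at this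
  refine this.congr_deriv ?_
  simp
  ring

lemma hasDerivAt_reflect {f : ℝ → ℂ} {f' : ℂ} {x : ℝ} (hf : HasDerivAt f f' (-x)) :
    HasDerivAt (fun y => f (-y)) (-f') x := by
  refine (hf.scomp x (hasDerivAt_neg x)).congr_deriv ?_
  simp

end

section Columns

variable (h : P.Admissible) (hq : P.IsSolution q)
  {Φp Φm : ℝ → ℝ → ℂ → Matrix (Fin 2) (Fin 2) ℂ} (hJ : P.IsJost q Φp Φm)

include h in
lemma Admissible.ofReal_qp_sq : (P.qp : ℂ) ^ 2 = P.q₀ ^ 2 := by exact_mod_cast h.qp_sq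

include h hq hJ

/-- Splitting off exp(-iθ) changes the diagonal ±ik into i(k-λ) = iεq₀²/z and -i(k+λ) = -iz, which
are the diagonal coefficients of `binf`. -/
lemma isSol_p1 {z : ℂ} (hz : z ∈ P.Dplus ∪ P.contSpec) (t : ℝ) :
    (hq.halfLine h t).IsSol z
      (fun x => (Φp x t z 0 0 * P.osc 0 x t z, Φp x t z 1 0 * P.osc 0 x t z)) := by
  obtain ⟨h1, h2⟩ := hJ.p1 z hz
  have e := h.ofReal_qp_sq
  have kl := P.k_sub_lam z
  have ka := P.k_add_lam z
  refine HalfLine.isSol_iff.2 ⟨fun x => ?_, fun x => ?_, ?_, ?_⟩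
  · refine ((h1.deriv_zero x t).fun_mul (hasDerivAt_osc 0 x t z)).congr_deriv ?_
    simp only [IsSolution.halfLine, if_true]
    rw [show (P.qp : ℂ) * (P.ε * P.qp) / z = P.ε * P.q₀ ^ 2 / z by rw [← e]; ring, ← kl]
    ring
  · refine ((h1.deriv_one x t).fun_mul (hasDerivAt_osc 0 x t z)).congr_deriv ?_
    simp only [IsSolution.halfLine, if_true]
    linear_combination (-I * Φp x t z 1 0 * P.osc 0 x t z) * ka
  · simpa [E] using h2 t 0
  · have := h2 t 1
    simp only [E, of_apply, cons_val_one, cons_val_zero, cons_val', cons_val_fin_one] at this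
    simp only [IsSolution.halfLine]
    convert this using 2
    ring

/-- Exchanging the two components together with z ↦ -z turns a second column into a first one; λ
changes sign, so Im λ ≤ 0 becomes the admissible condition. -/
lemma isSol_p2 {z : ℂ} (hz : z ∈ P.Dminus ∪ P.contSpec) (t : ℝ) :
    (hq.halfLine h t).swap.IsSol (-z)
      (fun x => (Φp x t z 1 1 * P.osc 1 x t z, Φp x t z 0 1 * P.osc 1 x t z)) := by
  obtain ⟨h1, h2⟩ := hJ.p2 z hz
  have e := h.ofReal_qp_sq
  have kl := P.k_sub_lam z
  have ka := P.k_add_lam z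
  refine HalfLine.isSol_iff.2 ⟨fun x => ?_, fun x => ?_, ?_, ?_⟩
  · refine ((h1.deriv_one x t).fun_mul (hasDerivAt_osc 1 x t z)).congr_deriv ?_
    simp only [IsSolution.halfLine, HalfLine.swap]
    rw [show (P.ε : ℂ) * P.qp * P.qp / (-z) = -(P.ε * P.q₀ ^ 2 / z) by rw [← e, div_neg]; ring, ← kl]
    simp
    ring
  · refine ((h1.deriv_zero x t).fun_mul (hasDerivAt_osc 1 x t z)).congr_deriv ?_
    simp only [IsSolution.halfLine, HalfLine.swap]
    simp
    linear_combination (I * Φp x t z 0 1 * P.osc 1 x t z) * ka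
  · simpa [E] using h2 t 1
  · have := h2 t 0
    simp only [E, of_apply, cons_val_one, cons_val_zero, cons_val', cons_val_fin_one] at this
    simp only [IsSolution.halfLine, HalfLine.swap]
    convert this using 2
    rw [div_neg]; ring

/-- The map (x,t) ↦ (-x,-t) interchanges q and its reflection in Q. A solution normalized at -∞
thereby becomes one normalized at +∞, with its components exchanged and a factor -σ; one half-line
theory serves both ends. -/
lemma isSol_m2 {z : ℂ} (hz : z ∈ P.Dplus ∪ P.contSpec) (t : ℝ) :
    (hq.halfLine h t).IsSol z (fun x => (Φm (-x) (-t) z 1 1 * P.osc 1 (-x) (-t) z,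
      -P.σ * Φm (-x) (-t) z 0 1 * P.osc 1 (-x) (-t) z)) := by
  obtain ⟨h1, h2⟩ := hJ.m2 z hz
  have e := h.ofReal_qp_sq
  have kl := P.k_sub_lam z
  have ka := P.k_add_lam z
  have s2 : (P.σ : ℂ) ^ 2 = 1 := by exact_mod_cast h.sigma_sq
  refine HalfLine.isSol_iff.2 ⟨fun x => ?_, fun x => ?_, ?_, ?_⟩
  · refine (hasDerivAt_reflect ((h1.deriv_one (-x) (-t)).fun_mul
      (hasDerivAt_osc 1 (-x) (-t) z))).congr_deriv ?_
    simp only [IsSolution.halfLine]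
    rw [show (P.qp : ℂ) * (P.ε * P.qp) / z = P.ε * P.q₀ ^ 2 / z by rw [← e]; ring, ← kl]
    simp [rst]
    ring
  · refine (hasDerivAt_reflect (((h1.deriv_zero (-x) (-t)).const_mul (-(P.σ : ℂ))).fun_mul
      (hasDerivAt_osc 1 (-x) (-t) z))).congr_deriv ?_
    simp only [IsSolution.halfLine]
    simp [rst]
    linear_combination (I * P.σ * Φm (-x) (-t) z 0 1 * P.osc 1 (-x) (-t) z) * ka
  · simpa [E, Function.comp_def] using (h2 (-t) 1).comp tendsto_neg_atTop_atBot
  · have := ((h2 (-t) 0).comp tendsto_neg_atTop_atBot).const_mul (-(P.σ : ℂ))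
    simp only [E, of_apply, cons_val_one, cons_val_zero, cons_val', cons_val_fin_one,
      Function.comp_def] at this
    simp only [IsSolution.halfLine, ε, qp]
    have d2 : (P.δ : ℂ) ^ 2 = 1 := by exact_mod_cast h.delta_sq
    convert this using 2
    · ring
    · push_cast
      linear_combination (-I * P.σ * P.qm / z) * d2

lemma isSol_m1 {z : ℂ} (hz : z ∈ P.Dminus ∪ P.contSpec) (t : ℝ) :
    (hq.halfLine h t).swap.IsSol (-z) (fun x => (Φm (-x) (-t) z 0 0 * P.osc 0 (-x) (-t) z,
      -P.σ * Φm (-x) (-t) z 1 0 * P.osc 0 (-x) (-t) z)) := by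
  obtain ⟨h1, h2⟩ := hJ.m1 z hz
  have e := h.ofReal_qp_sq
  have kl := P.k_sub_lam z
  have ka := P.k_add_lam z
  have s2 : (P.σ : ℂ) ^ 2 = 1 := by exact_mod_cast h.sigma_sq
  refine HalfLine.isSol_iff.2 ⟨fun x => ?_, fun x => ?_, ?_, ?_⟩
  · refine (hasDerivAt_reflect ((h1.deriv_zero (-x) (-t)).fun_mul
      (hasDerivAt_osc 0 (-x) (-t) z))).congr_deriv ?_
    simp only [IsSolution.halfLine, HalfLine.swap]
    rw [show (P.ε : ℂ) * P.qp * P.qp / (-z) = -(P.ε * P.q₀ ^ 2 / z) by rw [← e, div_neg]; ring, ← kl]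
    simp [rst]
    linear_combination (-(q (-x) (-t) : ℂ) * Φm (-x) (-t) z 1 0 * P.osc 0 (-x) (-t) z) * (-s2)
  · refine (hasDerivAt_reflect (((h1.deriv_one (-x) (-t)).const_mul (-(P.σ : ℂ))).fun_mul
      (hasDerivAt_osc 0 (-x) (-t) z))).congr_deriv ?_
    simp only [IsSolution.halfLine, HalfLine.swap]
    simp [rst]
    linear_combination (-I * P.σ * Φm (-x) (-t) z 1 0 * P.osc 0 (-x) (-t) z) * ka + ((q x t : ℂ) * Φm (-x) (-t) z 0 0 * P.osc 0 (-x) (-t) z) * s2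
  · simpa [E, Function.comp_def] using (h2 (-t) 0).comp tendsto_neg_atTop_atBot
  · have := ((h2 (-t) 1).comp tendsto_neg_atTop_atBot).const_mul (-(P.σ : ℂ))
    simp only [E, of_apply, cons_val_one, cons_val_zero, cons_val', cons_val_fin_one, ε,
      Function.comp_def] at this
    simp only [IsSolution.halfLine, HalfLine.swap, ε, qp]
    push_cast at this
    convert this using 2
    · ring
    · push_cast
      rw [div_neg]
      linear_combination (-I * P.δ * P.qm / z) * s2

end Columns

end Params

end NonlocalMKdV

end

/-! ### Symmetries of the Jost solutions and their regularity in z. -/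

noncomputable section

namespace NonlocalMKdV

namespace Params

variable {P : Params}

namespace Admissible

variable (h : P.Admissible)
include h

lemma mem_Dplus_union {z : ℂ} : z ∈ P.Dplus ∪ P.contSpec ↔ z ≠ 0 ∧ 0 ≤ (P.lam z).im := by
  rw [Set.mem_union, h.mem_Dplus, h.mem_contSpec, ← and_or_left, le_iff_lt_or_eq]
  simp only [eq_comm]

lemma mem_Dminus_union {z : ℂ} : z ∈ P.Dminus ∪ P.contSpec ↔ z ≠ 0 ∧ (P.lam z).im ≤ 0 := by
  rw [Set.mem_union, h.mem_Dminus, h.mem_contSpec, ← and_or_left, le_iff_lt_or_eq]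

lemma hat_mem_Dminus_union {z : ℂ} (hz : z ∈ P.Dplus ∪ P.contSpec) :
    P.hat z ∈ P.Dminus ∪ P.contSpec := by
  rw [h.mem_Dplus_union] at hz
  rw [h.mem_Dminus_union, h.lam_hat]
  exact ⟨h.hat_ne hz.1, by simpa using hz.2⟩

lemma neg_conj_mem_Dplus_union {z : ℂ} (hz : z ∈ P.Dplus ∪ P.contSpec) :
    -conj z ∈ P.Dplus ∪ P.contSpec := by
  rw [h.mem_Dplus_union] at hz ⊢
  rw [lam_neg_conj_im]
  exact ⟨by simpa using hz.1, hz.2⟩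

lemma theta_hat (x t : ℝ) (z : ℂ) : P.θ x t (P.hat z) = -P.θ x t z := by
  simp only [θ, h.lam_hat, h.k_hat]; ring

lemma osc_one_hat (x t : ℝ) (z : ℂ) : P.osc 1 x t (P.hat z) = P.osc 0 x t z := by
  simp [osc, h.theta_hat]

lemma osc_zero_hat (x t : ℝ) (z : ℂ) : P.osc 0 x t (P.hat z) = P.osc 1 x t z := by
  simp [osc, h.theta_hat]

end Admissible

lemma theta_neg_conj (x t : ℝ) (z : ℂ) : P.θ x t (-conj z) = -conj (P.θ x t z) := by
  simp only [θ, lam_neg_conj, k_neg_conj, map_mul, map_add, map_pow, conj_ofReal, map_ofNat]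
  ring

lemma osc_neg_conj (j : Fin 2) (x t : ℝ) (z : ℂ) :
    P.osc j x t (-conj z) = conj (P.osc j x t z) := by
  rw [osc, osc, ← exp_conj, theta_neg_conj]
  congr 1
  split_ifs <;> simp

lemma analyticAt_osc (j : Fin 2) (x t : ℝ) {z : ℂ} (hz : z ≠ 0) :
    AnalyticAt ℂ (P.osc j x t) z :=
  (analyticAt_const.mul (Admissible.analyticAt_θ x t hz)).cexp

variable {q : ℝ → ℝ → ℝ} (h : P.Admissible) (hq : P.IsSolution q)
  {Φp Φm : ℝ → ℝ → ℂ → Matrix (Fin 2) (Fin 2) ℂ} (hJ : P.IsJost q Φp Φm)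
include h hq hJ

/-! ### Symmetries of the Jost solutions -/

/-- Both sides give Jost solutions of the same half-line system, so uniqueness identifies them. -/
lemma jost_reflect {z : ℂ} (hz : z ∈ P.Dplus ∪ P.contSpec) (x t : ℝ) :
    Φm x t z 1 1 = Φp (-x) (-t) z 0 0 ∧ Φm x t z 0 1 = -P.σ * Φp (-x) (-t) z 1 0 := by
  have hl := h.mem_Dplus_union.1 hz
  have key := congrFun ((isSol_m2 h hq hJ hz (-t)).unique hl.1 (by rw [halfLine_lam]; exact hl.2)
    (isSol_p1 h hq hJ hz (-t))) (-x)
  simp only [neg_neg, osc_zero_neg, Prod.mk.injEq] at key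
  have s2 : (P.σ : ℂ) ^ 2 = 1 := by exact_mod_cast h.sigma_sq
  refine ⟨mul_right_cancel₀ (osc_ne 1 x t z) key.1, ?_⟩
  have := mul_right_cancel₀ (osc_ne 1 x t z) key.2
  linear_combination (-P.σ : ℂ) * this - Φm x t z 0 1 * s2

lemma jost_reflect' {z : ℂ} (hz : z ∈ P.Dminus ∪ P.contSpec) (x t : ℝ) :
    Φm x t z 0 0 = Φp (-x) (-t) z 1 1 ∧ Φm x t z 1 0 = -P.σ * Φp (-x) (-t) z 0 1 := by
  have hl := h.mem_Dminus_union.1 hz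
  have key := congrFun ((isSol_m1 h hq hJ hz (-t)).unique (neg_ne_zero.2 hl.1)
    (by rw [halfLine_swap_lam]; simpa using hl.2) (isSol_p2 h hq hJ hz (-t))) (-x)
  simp only [neg_neg, osc_one_neg, Prod.mk.injEq] at key
  have s2 : (P.σ : ℂ) ^ 2 = 1 := by exact_mod_cast h.sigma_sq
  refine ⟨mul_right_cancel₀ (osc_ne 0 x t z) key.1, ?_⟩
  have := mul_right_cancel₀ (osc_ne 0 x t z) key.2
  linear_combination (-P.σ : ℂ) * this - Φm x t z 1 0 * s2

/-- The involution fixes k and reverses λ, hence preserves X and exchanges the two normalizations.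
The constant κ is found by comparing boundary values: it is the upper entry i q₊/ẑ of the second
column of E₊ at ẑ = εq₀²/z. -/
lemma jost_hat {z : ℂ} (hz : z ∈ P.Dplus ∪ P.contSpec) (x t : ℝ) (i : Fin 2) :
    Φp x t (P.hat z) i 1 = I * P.qp * z / (P.ε * P.q₀ ^ 2) * Φp x t z i 0 := by
  have hl := h.mem_Dplus_union.1 hz
  have hz' := h.hat_mem_Dminus_union hz
  have hl' := h.mem_Dminus_union.1 hz'
  have hc := h.cast_ne
  have hqp := h.ofReal_qp_sq
  have hz0 := hl.1
  have hee : (P.ε : ℂ) * P.qp ^ 2 ≠ 0 := by rwa [hqp]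
  have hε : (P.ε : ℂ) ≠ 0 := left_ne_zero_of_mul hee
  have hqp0 : (P.qp : ℂ) ≠ 0 := fun h0 => hee (by rw [h0]; ring)
  set κ := I * P.qp * z / (P.ε * P.q₀ ^ 2) with hκ
  obtain ⟨s1, s2, s3, s4⟩ := HalfLine.isSol_iff.1 (isSol_p1 h hq hJ hz t)
  have key : (hq.halfLine h t).swap.IsSol (-P.hat z) (fun x =>
      (κ * (Φp x t z 1 0 * P.osc 0 x t z), κ * (Φp x t z 0 0 * P.osc 0 x t z))) := by
    refine HalfLine.isSol_iff.2 ⟨fun x => ?_, fun x => ?_, ?_, ?_⟩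
    · refine ((s2 x).const_mul κ).congr_deriv ?_
      simp only [HalfLine.swap, IsSolution.halfLine, hat, ← hqp]
      field_simp
    · refine ((s1 x).const_mul κ).congr_deriv ?_
      simp only [HalfLine.swap, IsSolution.halfLine, hat, ← hqp]
      field_simp
    · convert s4.const_mul κ using 2
      simp only [hκ, IsSolution.halfLine, ← hqp]
      field_simp
      linear_combination I_sq
    · convert s3.const_mul κ using 2
      simp only [hκ, HalfLine.swap, IsSolution.halfLine, hat]
      field_simp
  have := congrFun ((isSol_p2 h hq hJ hz' t).unique (neg_ne_zero.2 hl'.1)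
    (by rw [halfLine_swap_lam]; simpa using hl'.2) key) x
  simp only [h.osc_one_hat, Prod.mk.injEq, ← mul_assoc] at this
  fin_cases i
  · exact mul_right_cancel₀ (osc_ne 0 x t z) this.2
  · exact mul_right_cancel₀ (osc_ne 0 x t z) this.1

lemma jost_hat' {z : ℂ} (hz : z ∈ P.Dplus ∪ P.contSpec) (x t : ℝ) (i : Fin 2) :
    Φm x t (P.hat z) i 0 = -(I * P.qm * z / P.q₀ ^ 2) * Φm x t z i 1 := by
  have hz' := h.hat_mem_Dminus_union hz
  have s2 : (P.σ : ℂ) ^ 2 = 1 := by exact_mod_cast h.sigma_sq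
  have hc := h.cast_ne
  have hε : (P.ε : ℂ) ≠ 0 := left_ne_zero_of_mul hc
  have hq0 : (P.q₀ : ℂ) ≠ 0 := fun h0 => hc (by rw [h0]; ring)
  have e : I * P.qp * z / (P.ε * P.q₀ ^ 2) * P.σ = I * P.qm * z / P.q₀ ^ 2 := by
    have : (P.qp : ℂ) * P.σ = P.ε * P.qm := by simp only [qp, ε]; push_cast; ring
    field_simp
    linear_combination z * this
  fin_cases i
  · refine (jost_reflect' h hq hJ hz' x t).1.trans ((jost_hat h hq hJ hz _ _ _).trans ?_)
    refine Eq.trans ?_ (congrArg _ (jost_reflect h hq hJ hz x t).2.symm)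
    rw [← e]
    linear_combination -(I * P.qp * z / (P.ε * P.q₀ ^ 2) * Φp (-x) (-t) z 1 0) * s2
  · refine (jost_reflect' h hq hJ hz' x t).2.trans ?_
    refine Eq.trans ?_ (congrArg _ (jost_reflect h hq hJ hz x t).1.symm)
    rw [jost_hat h hq hJ hz, ← e]
    ring

/-- As q is real, the system at -z* is the complex conjugate of the system at z. -/
lemma jost_neg_conj {z : ℂ} (hz : z ∈ P.Dplus ∪ P.contSpec) (x t : ℝ) (i : Fin 2) :
    Φp x t (-conj z) i 0 = conj (Φp x t z i 0) := by
  have hz' := h.neg_conj_mem_Dplus_union hz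
  have hl' := h.mem_Dplus_union.1 hz'
  obtain ⟨s1, s2, s3, s4⟩ := HalfLine.isSol_iff.1 (isSol_p1 h hq hJ hz t)
  have key : (hq.halfLine h t).IsSol (-conj z) (fun x =>
      (conj (Φp x t z 0 0 * P.osc 0 x t z), conj (Φp x t z 1 0 * P.osc 0 x t z))) := by
    refine HalfLine.isSol_iff.2 ⟨fun x => ?_, fun x => ?_, ?_, ?_⟩
    · refine (conjCLE.hasFDerivAt.comp_hasDerivAt x (s1 x)).congr_deriv ?_
      simp [IsSolution.halfLine, div_neg]
    · refine (conjCLE.hasFDerivAt.comp_hasDerivAt x (s2 x)).congr_deriv ?_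
      simp [IsSolution.halfLine]
    · simpa [Function.comp_def] using (continuous_conj.tendsto _).comp s3
    · have := (continuous_conj.tendsto _).comp s4
      convert this using 2
      · simp
      · simp [IsSolution.halfLine, div_neg, neg_div]
  have := congrFun ((isSol_p1 h hq hJ hz' t).unique hl'.1
    (by rw [halfLine_lam]; simpa using hl'.2) key) x
  simp only [osc_neg_conj, Prod.mk.injEq, map_mul] at this
  have ho : conj (P.osc 0 x t z) ≠ 0 := by simpa using osc_ne 0 x t z
  fin_cases i
  · exact mul_right_cancel₀ ho this.1
  · exact mul_right_cancel₀ ho this.2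

/-! ### Regularity in the spectral parameter -/

lemma continuousOn_jost (x t : ℝ) (i : Fin 2) :
    ContinuousOn (fun z => Φp x t z i 0 * P.osc 0 x t z) (P.Dplus ∪ P.contSpec) := by
  have := HalfLine.continuousOn_of_isSol (D := P.Dplus ∪ P.contSpec)
    (fun z hz => by rw [halfLine_lam hq h t]; exact h.mem_Dplus_union.1 hz)
    (fun z hz => isSol_p1 h hq hJ hz t) x
  fin_cases i
  exacts [this.fst, this.snd]

lemma differentiableOn_jost (x t : ℝ) (i : Fin 2) :
    DifferentiableOn ℂ (fun z => Φp x t z i 0 * P.osc 0 x t z) P.Dplus := by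
  have := HalfLine.differentiableOn_of_isSol (D := P.Dplus) h.isOpen_Dplus
    (fun z hz => by
      rw [halfLine_lam hq h t]; exact h.mem_Dplus_union.1 (Or.inl hz))
    (fun z hz => isSol_p1 h hq hJ (Or.inl hz) t) x
  fin_cases i
  exacts [this.fst, this.snd]

end Params

end NonlocalMKdV

end

/-! ### Painlevé continuation across the spectrum, and Gronwall's inequality. -/

noncomputable section

namespace NonlocalMKdV

/-! ### Continuation across a curve -/

/-- Painlevé's theorem for the real axis. -/
theorem analyticAt_of_continuousAt_of_im_ne_zero {f : ℂ → ℂ} {p : ℂ}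
    (hc : ∀ᶠ z in 𝓝 p, ContinuousAt f z)
    (hd : ∀ᶠ z in 𝓝 p, z.im ≠ 0 → DifferentiableAt ℂ f z) : AnalyticAt ℂ f p := by
  obtain ⟨r, hr, hball⟩ := Metric.eventually_nhds_iff_ball.1 (hc.and hd)
  have hcont : ContinuousOn f (Metric.ball p r) := fun z hz => (hball z hz).1.continuousWithinAt
  have hcons : IsConservativeOn f (Metric.ball p r) := by
    intro z w hzw
    rw [← add_eq_zero_iff_eq_neg, wedgeIntegral_add_wedgeIntegral_eq]
    -- Cauchy's theorem for rectangles whose interior avoids the real axis; continuity up to the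
    -- boundary suffices. A rectangle crossing the axis is cut along it into two such rectangles,
    -- and Morera's theorem applies.
    have one : ∀ a b : ℂ, Rectangle a b ⊆ Metric.ball p r →
        (0 ∉ Set.Ioo (min a.im b.im) (max a.im b.im)) →
        (∫ x : ℝ in a.re..b.re, f (x + a.im * I)) - (∫ x : ℝ in a.re..b.re, f (x + b.im * I)) +
        I • (∫ y : ℝ in a.im..b.im, f (re b + y * I)) -
        I • (∫ y : ℝ in a.im..b.im, f (re a + y * I)) = 0 := by
      intro a b hab h0
      refine integral_boundary_rect_eq_zero_of_continuousOn_of_differentiableOn f a b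
        (hcont.mono hab) fun s hs => ?_
      have hs' : s ∈ Metric.ball p r := hab
        ⟨⟨le_of_lt hs.1.1, le_of_lt hs.1.2⟩, ⟨le_of_lt hs.2.1, le_of_lt hs.2.2⟩⟩
      exact ((hball s hs').2 fun h => h0 (h ▸ hs.2)).differentiableWithinAt
    by_cases h0 : (0 : ℝ) ∈ Set.Ioo (min z.im w.im) (max z.im w.im)
    · have h0' : (0 : ℝ) ∈ Set.uIcc z.im w.im := ⟨le_of_lt h0.1, le_of_lt h0.2⟩
      have s1 : Rectangle z (w.re : ℂ) ⊆ Metric.ball p r := by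
        refine Set.Subset.trans ?_ hzw
        rintro s ⟨a, b⟩
        exact ⟨by simpa using a, Set.uIcc_subset_uIcc Set.left_mem_uIcc h0' (by simpa using b)⟩
      have s2 : Rectangle (z.re : ℂ) w ⊆ Metric.ball p r := by
        refine Set.Subset.trans ?_ hzw
        rintro s ⟨a, b⟩
        exact ⟨by simpa using a, Set.uIcc_subset_uIcc h0' Set.right_mem_uIcc (by simpa using b)⟩
      have i1 := one z (w.re : ℂ) s1 (fun h => by
        rcases le_total z.im 0 with h' | h' <;> simp [h'] at h)
      have i2 := one (z.re : ℂ) w s2 (fun h => by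
        rcases le_total w.im 0 with h' | h' <;> simp [h'] at h)
      have ii : ∀ c : ℝ, c ∈ Set.uIcc z.re w.re → ∀ a b : ℝ, a ∈ Set.uIcc z.im w.im →
          b ∈ Set.uIcc z.im w.im → IntervalIntegrable (fun y : ℝ => f (c + y * I)) volume a b := by
        intro c hc' a b ha hb
        refine ContinuousOn.intervalIntegrable ?_
        refine hcont.comp (by fun_prop) fun y hy => hzw ⟨by simpa using hc', ?_⟩
        simpa using Set.uIcc_subset_uIcc ha hb hy
      have j1 := intervalIntegral.integral_add_adjacent_intervals
        (ii w.re Set.right_mem_uIcc z.im 0 Set.left_mem_uIcc h0')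
        (ii w.re Set.right_mem_uIcc 0 w.im h0' Set.right_mem_uIcc)
      have j2 := intervalIntegral.integral_add_adjacent_intervals
        (ii z.re Set.left_mem_uIcc z.im 0 Set.left_mem_uIcc h0')
        (ii z.re Set.left_mem_uIcc 0 w.im h0' Set.right_mem_uIcc)
      rw [← j1, ← j2]
      simp only [ofReal_im, ofReal_re, smul_eq_mul] at i1 i2 ⊢
      linear_combination i1 + i2
    · exact one z w hzw h0
  exact ((isConservativeOn_and_continuousOn_iff_isDifferentiableOn Metric.isOpen_ball).1
    ⟨hcons, hcont⟩).analyticAt (Metric.ball_mem_nhds p hr)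

/-- Painlevé's theorem for a curve on which a local coordinate `L` is real. -/
theorem analyticAt_of_continuousAt_of_coord {f L : ℂ → ℂ} {p : ℂ} (hL : AnalyticAt ℂ L p)
    (hL' : deriv L p ≠ 0) (hc : ∀ᶠ z in 𝓝 p, ContinuousAt f z)
    (hd : ∀ᶠ z in 𝓝 p, (L z).im ≠ 0 → DifferentiableAt ℂ f z) : AnalyticAt ℂ f p := by
  have hs := hL.hasStrictDerivAt
  -- The local inverse of L straightens the curve to the real axis.
  set ψ := hs.localInverse L (deriv L p) p hL' with hψ
  have hψa : AnalyticAt ℂ ψ (L p) := hL.analyticAt_localInverse hL'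
  have hψp : ψ (L p) = p := (hs.hasStrictFDerivAt_equiv hL').localInverse_apply_image
  have ht : Tendsto ψ (𝓝 (L p)) (𝓝 p) := by
    have := hψa.continuousAt.tendsto
    rwa [hψp] at this
  have hr : ∀ᶠ w in 𝓝 (L p), L (ψ w) = w := hs.eventually_right_inverse hL'
  have hl : ∀ᶠ z in 𝓝 p, ψ (L z) = z := hs.eventually_left_inverse hL'
  have hg : AnalyticAt ℂ (fun w => f (ψ w)) (L p) := by
    refine analyticAt_of_continuousAt_of_im_ne_zero ?_ ?_
    · filter_upwards [ht.eventually hc, hψa.eventually_analyticAt] with w h1 h2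
      exact ContinuousAt.comp' h1 h2.continuousAt
    · filter_upwards [ht.eventually hd, hψa.eventually_analyticAt, hr] with w h1 h2 h3 h4
      exact (h1 (by rwa [h3])).comp w h2.differentiableAt
  refine (AnalyticAt.comp hg hL).congr ?_
  filter_upwards [hl] with z hz
  simp only [Function.comp, hz]

lemma continuousAt_ite_of_im {f g L : ℂ → ℂ} {z : ℂ} (hLz : ContinuousAt (fun z => (L z).im) z)
    (hf : 0 ≤ (L z).im → ContinuousWithinAt f {z | 0 ≤ (L z).im} z)
    (hg : (L z).im ≤ 0 → ContinuousWithinAt g {z | (L z).im ≤ 0} z)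
    (he : ∀ᶠ w in 𝓝 z, (L w).im = 0 → f w = g w) :
    ContinuousAt (fun z => if 0 < (L z).im then f z else g z) z := by
  set F := fun z => if 0 < (L z).im then f z else g z with hF
  rcases lt_trichotomy (L z).im 0 with hz | hz | hz
  · have hn : {z | (L z).im < 0} ∈ 𝓝 z := hLz.eventually_lt_const hz
    have : ContinuousAt g z := (hg hz.le).continuousAt
      (mem_of_superset hn fun s (hs : (L s).im < 0) => (hs.le : (L s).im ≤ 0))
    refine this.congr ?_
    filter_upwards [hn] with s (hs : _ < _)
    simp [hF, not_lt.2 hs.le]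
  · have hgF : ContinuousWithinAt F {z | (L z).im ≤ 0} z := by
      refine (hg hz.le).congr (fun s (hs : (L s).im ≤ 0) => ?_) ?_
      · simp [hF, not_lt.2 hs]
      · simp [hF, hz]
    have hfF : ContinuousWithinAt F {z | 0 ≤ (L z).im} z := by
      refine (hf hz.ge).congr_of_eventuallyEq ?_ ?_
      · filter_upwards [self_mem_nhdsWithin, mem_nhdsWithin_of_mem_nhds he] with s
          (hs : 0 ≤ (L s).im) h5
        rcases hs.lt_or_eq with h6 | h6
        · simp [hF, h6]
        · simp [hF, ← h6, h5 h6.symm]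
      · simp [hF, hz, he.self_of_nhds hz]
    have := hgF.union hfF
    rwa [show {z | (L z).im ≤ 0} ∪ {z | 0 ≤ (L z).im} = Set.univ by
      ext s; simpa using le_total _ _, continuousWithinAt_univ] at this
  · have hn : {z | 0 < (L z).im} ∈ 𝓝 z := hLz.eventually_const_lt hz
    have : ContinuousAt f z := (hf hz.le).continuousAt
      (mem_of_superset hn fun s (hs : 0 < (L s).im) => (hs.le : 0 ≤ (L s).im))
    refine this.congr ?_
    filter_upwards [hn] with s (hs : _ < _)
    simp [hF, hs]

/-- Functions that are continuous up to a curve from both sides, analytic off the curve, and agree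
on the curve are continuations of each other. -/
theorem analyticAt_ite_of_coord {f g L : ℂ → ℂ} {p : ℂ} (hL : AnalyticAt ℂ L p)
    (hL' : ∀ᶠ z in 𝓝[≠] p, deriv L z ≠ 0)
    (hf : ∀ᶠ z in 𝓝 p, 0 ≤ (L z).im → ContinuousWithinAt f {z | 0 ≤ (L z).im} z)
    (hg : ∀ᶠ z in 𝓝 p, (L z).im ≤ 0 → ContinuousWithinAt g {z | (L z).im ≤ 0} z)
    (hf' : ∀ᶠ z in 𝓝 p, 0 < (L z).im → DifferentiableAt ℂ f z)
    (hg' : ∀ᶠ z in 𝓝 p, (L z).im < 0 → DifferentiableAt ℂ g z)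
    (he : ∀ᶠ z in 𝓝 p, (L z).im = 0 → f z = g z) :
    AnalyticAt ℂ (fun z => if 0 < (L z).im then f z else g z) p := by
  set F := fun z => if 0 < (L z).im then f z else g z with hF
  have hLc := hL.eventually_analyticAt
  have him : ∀ᶠ z in 𝓝 p, ContinuousAt (fun z => (L z).im) z := hLc.mono fun z hz =>
    continuous_im.continuousAt.comp' hz.continuousAt
  have hcont : ∀ᶠ z in 𝓝 p, ContinuousAt F z := by
    filter_upwards [him, hf, hg, he.eventually_nhds] with z h1 h2 h3 h4
    exact continuousAt_ite_of_im h1 h2 h3 h4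
  have hdiff : ∀ᶠ z in 𝓝 p, (L z).im ≠ 0 → DifferentiableAt ℂ F z := by
    filter_upwards [hf', hg', him] with z h1 h2 hLz hz
    rcases lt_or_gt_of_ne hz with hz | hz
    · refine (h2 hz).congr_of_eventuallyEq ?_
      filter_upwards [hLz.eventually_lt_const hz] with s hs
      simp [hF, not_lt.2 hs.le]
    · refine (h1 hz).congr_of_eventuallyEq ?_
      filter_upwards [hLz.eventually_const_lt hz] with s hs
      simp [hF, hs]
  -- L is a coordinate only off isolated critical points. At such a point, where branches of the
  -- curve may cross, continuity makes the singularity removable.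
  refine analyticAt_of_differentiable_on_punctured_nhds_of_continuousAt ?_ hcont.self_of_nhds
  filter_upwards [hL', eventually_nhdsWithin_of_eventually_nhds hLc,
    eventually_nhdsWithin_of_eventually_nhds hcont.eventually_nhds,
    eventually_nhdsWithin_of_eventually_nhds hdiff.eventually_nhds] with z h1 h2 h3 h4
  exact (analyticAt_of_continuousAt_of_coord h2 h1 h3 h4).differentiableAt

/-! ### Linear differential equations -/

lemma norm_le_mul_exp_of_norm_deriv_le {E : Type*} [NormedAddCommGroup E] [NormedSpace ℝ E]
    {φ φ' : ℝ → E} (hd : ∀ s, HasDerivAt φ (φ' s) s) {C x y : ℝ}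
    (hb : ∀ s ∈ Set.uIcc x y, ‖φ' s‖ ≤ C * ‖φ s‖) :
    ‖φ y‖ ≤ ‖φ x‖ * Real.exp (C * |y - x|) := by
  have key : ∀ {ψ ψ' : ℝ → E} {a b : ℝ}, a ≤ b → (∀ s, HasDerivAt ψ (ψ' s) s) →
      (∀ s ∈ Set.Icc a b, ‖ψ' s‖ ≤ C * ‖ψ s‖) → ‖ψ b‖ ≤ ‖ψ a‖ * Real.exp (C * (b - a)) := by
    intro ψ ψ' a b hab h1 h2
    have := norm_le_gronwallBound_of_norm_deriv_right_le (f := ψ) (f' := ψ') (ε := 0)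
      (K := C) (δ := ‖ψ a‖) (a := a) (b := b)
      (fun s _ => (h1 s).continuousAt.continuousWithinAt)
      (fun s _ => (h1 s).hasDerivWithinAt) le_rfl
      (fun s hs => by rw [add_zero]; exact h2 s ⟨hs.1, hs.2.le⟩) b ⟨hab, le_rfl⟩
    rwa [gronwallBound_ε0] at this
  rcases le_total x y with h | h
  · rw [abs_of_nonneg (sub_nonneg.2 h)]
    exact key h hd fun s hs => hb s (Set.uIcc_of_le h ▸ hs)
  · rw [abs_sub_comm, abs_of_nonneg (sub_nonneg.2 h)]
    have := key (ψ := fun s => φ (-s)) (ψ' := fun s => -φ' (-s)) (neg_le_neg h) (fun s => by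
      refine ((hd (-s)).scomp s (hasDerivAt_neg s)).congr_deriv ?_
      simp) (fun s hs => by
      rw [norm_neg]
      refine hb _ ?_
      rw [Set.uIcc_of_ge h]
      exact ⟨by linarith [hs.2], by linarith [hs.1]⟩)
    simp only [neg_neg] at this
    rwa [show -y - -x = x - y by ring] at this

/-- By Gronwall's inequality a zero would persist to the right, contradicting the limit 1 of the
first component. -/
lemma HalfLine.IsSol.ne_zero {H : HalfLine} {z : ℂ} {φ : ℝ → ℂ × ℂ} (h : H.IsSol z φ) (x : ℝ) :
    φ x ≠ 0 := by
  intro h0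
  have hzero : ∀ y, x ≤ y → φ y = 0 := by
    intro y hy
    obtain ⟨C, hC⟩ := (isCompact_uIcc (a := x) (b := y)).exists_bound_of_continuousOn
      (H.continuous_d).continuousOn
    have := norm_le_mul_exp_of_norm_deriv_le (C := ‖H.binf z‖ + C) (x := x) (y := y) h.deriv
      fun s hs => by
        refine (norm_add_le _ _).trans ?_
        rw [add_mul]
        refine add_le_add ((H.binf z).le_opNorm _) ((norm_del_le s _).trans ?_)
        gcongr
        exact (le_abs_self _).trans (hC s hs)
    rw [h0, norm_zero, zero_mul] at this
    exact norm_le_zero_iff.1 this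
  have h1 : Tendsto φ atTop (𝓝 0) := tendsto_const_nhds.congr' <| by
    filter_upwards [eventually_ge_atTop x] with y hy
    exact (hzero y hy).symm
  have := congrArg Prod.fst (tendsto_nhds_unique h1 h.lim)
  simp [evec] at this

end NonlocalMKdV

end

/-! ### Scattering coefficients, gluing along Σ, and the branch points. -/

noncomputable section

namespace NonlocalMKdV

namespace Params

variable {P : Params}

variable (P) in
/-- The scattering coefficient `s₁₁`, as a function on the closure of `D⁺`. -/
def s₁ (Φp Φm : ℝ → ℝ → ℂ → Matrix (Fin 2) (Fin 2) ℂ) (z : ℂ) : ℂ :=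
  wr (Φp 0 0 z) 0 (Φm 0 0 z) 1 / (1 - P.ε * P.q₀ ^ 2 / z ^ 2)

variable (P) in
/-- The scattering coefficient `s₂₂`, as a function on the closure of `D⁻`. -/
def s₂ (Φp Φm : ℝ → ℝ → ℂ → Matrix (Fin 2) (Fin 2) ℂ) (z : ℂ) : ℂ :=
  wr (Φm 0 0 z) 0 (Φp 0 0 z) 1 / (1 - P.ε * P.q₀ ^ 2 / z ^ 2)

/-- The denominator of the Wronskian formulas degenerates only at the branch points λ = 0. -/
lemma one_sub_eq {z : ℂ} (hz : z ≠ 0) :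
    1 - (P.ε : ℂ) * P.q₀ ^ 2 / z ^ 2 = 2 * P.lam z / z := by
  simp only [lam]; field_simp

lemma lam_eq_zero_iff {z : ℂ} (hz : z ≠ 0) : P.lam z = 0 ↔ z ^ 2 = P.ε * P.q₀ ^ 2 := by
  have : z * (2 * P.lam z) = z ^ 2 - P.ε * P.q₀ ^ 2 := by simp only [lam]; field_simp
  rw [← sub_eq_zero (a := z ^ 2), ← this]
  simp [hz]

lemma hasDerivAt_lam {z : ℂ} (hz : z ≠ 0) :
    HasDerivAt P.lam ((1 + P.ε * P.q₀ ^ 2 / z ^ 2) / 2) z := by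
  have := (((hasDerivAt_id z).sub ((hasDerivAt_inv hz).const_mul
    ((P.ε : ℂ) * P.q₀ ^ 2))).div_const 2)
  refine (this.congr_deriv ?_).congr_of_eventuallyEq (Eventually.of_forall fun w => ?_)
  · field_simp; ring
  · simp [lam, div_eq_mul_inv]

lemma osc_origin (j : Fin 2) (z : ℂ) : P.osc j 0 0 z = 1 := by simp [osc, θ]

variable {q : ℝ → ℝ → ℝ} (h : P.Admissible)

section
include h

lemma Admissible.mem_contSpec₀ {z : ℂ} :
    z ∈ P.contSpec₀ ↔ z ≠ 0 ∧ (P.lam z).im = 0 ∧ P.lam z ≠ 0 := by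
  rw [contSpec₀, Set.mem_ofPred_eq, h.mem_contSpec, and_assoc]
  refine and_congr_right fun hz => and_congr_right fun _ => ?_
  rw [ne_eq, ne_eq, lam_eq_zero_iff hz]

omit h in
-- The critical points of λ satisfy z² = -εq₀². For ε = -1 they are ±q₀, where the line and the
-- circle of Σ cross.
lemma Admissible.eventually_deriv_lam_ne {p : ℂ} (hp : p ≠ 0) :
    ∀ᶠ z in 𝓝[≠] p, deriv P.lam z ≠ 0 := by
  have hn : ∀ᶠ z in 𝓝[≠] p, z ≠ 0 :=
    eventually_nhdsWithin_of_eventually_nhds (isOpen_ne.mem_nhds hp)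
  have hf : Set.Finite {z : ℂ | z ^ 2 = -(P.ε * P.q₀ ^ 2)} := by
    have : {z : ℂ | z ^ 2 = -(P.ε * P.q₀ ^ 2)} ⊆
        ((Polynomial.nthRoots 2 (-((P.ε : ℂ) * P.q₀ ^ 2))).toFinset : Set ℂ) := by
      intro _ hz
      simpa [Polynomial.mem_nthRoots] using hz
    exact (Finset.finite_toSet _).subset this
  have he : ∀ᶠ z in 𝓝[≠] p, z ∉ {z : ℂ | z ^ 2 = -(P.ε * P.q₀ ^ 2)} := by
    have : ({z : ℂ | z ^ 2 = -(P.ε * P.q₀ ^ 2)} \ {p})ᶜ ∈ 𝓝 p :=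
      (hf.subset Set.sdiff_subset).isClosed.isOpen_compl.mem_nhds (by simp)
    filter_upwards [mem_nhdsWithin_of_mem_nhds this, self_mem_nhdsWithin] with z h1 h2 h3
    exact h1 ⟨h3, h2⟩
  filter_upwards [hn, he] with z h1 h2 h3
  rw [(hasDerivAt_lam h1).deriv] at h3
  refine h2 (?_ : z ^ 2 = _)
  field_simp at h3
  linear_combination h3

omit h in
lemma Admissible.eventually_lam_ne {p : ℂ} (hp : p ≠ 0) : ∀ᶠ z in 𝓝[≠] p, P.lam z ≠ 0 := by
  rcases (analyticAt_lam hp (P := P)).eventually_eq_zero_or_eventually_ne_zero with h1 | h1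
  · exfalso
    have h2 : ∀ᶠ z in 𝓝[≠] p, deriv P.lam z = 0 := by
      refine eventually_nhdsWithin_of_eventually_nhds (h1.eventually_nhds.mono fun z hz => ?_)
      rw [EventuallyEq.deriv_eq (show P.lam =ᶠ[𝓝 z] fun _ => 0 from hz), deriv_const]
    obtain ⟨z, h3, h4⟩ := (h2.and (Admissible.eventually_deriv_lam_ne hp)).exists
    exact h4 h3
  · exact h1

end

variable (hq : P.IsSolution q)
  {Φp Φm : ℝ → ℝ → ℂ → Matrix (Fin 2) (Fin 2) ℂ} (hJ : P.IsJost q Φp Φm)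

omit h in
lemma analyticAt_hat {z : ℂ} (hz : z ≠ 0) : AnalyticAt ℂ P.hat z :=
  analyticAt_const.div analyticAt_id hz

include h in
lemma Admissible.hat_mem_Dplus_union {z : ℂ} (hz : z ∈ P.Dminus ∪ P.contSpec) :
    P.hat z ∈ P.Dplus ∪ P.contSpec := by
  rw [h.mem_Dminus_union] at hz
  rw [h.mem_Dplus_union, h.lam_hat]
  exact ⟨h.hat_ne hz.1, by simpa using hz.2⟩

include h in
lemma Admissible.continuousOn_comp_hat {f : ℂ → ℂ} (hf : ContinuousOn f (P.Dplus ∪ P.contSpec)) :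
    ContinuousOn (fun z => f (P.hat z)) (P.Dminus ∪ P.contSpec) :=
  hf.comp (fun _ hz => (analyticAt_hat (h.mem_Dminus_union.1 hz).1).continuousAt.continuousWithinAt)
    fun _ hz => h.hat_mem_Dplus_union hz

include h in
lemma Admissible.differentiableOn_comp_hat {f : ℂ → ℂ} (hf : DifferentiableOn ℂ f P.Dplus) :
    DifferentiableOn ℂ (fun z => f (P.hat z)) P.Dminus :=
  hf.comp (fun _ hz =>
    (analyticAt_hat (h.mem_Dminus.1 hz).1).differentiableAt.differentiableWithinAt)
    fun _ hz => h.hat_mem_Dplus.2 hz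

open Classical in
include h in
/-- Gluing of functions on the closures of `D⁺` and `D⁻`. -/
theorem Admissible.analyticAt_glue {F G : ℂ → ℂ} {p : ℂ} (hp : p ≠ 0)
    (hF : ∀ᶠ z in 𝓝 p, z ∈ P.Dplus ∪ P.contSpec → ContinuousWithinAt F (P.Dplus ∪ P.contSpec) z)
    (hG : ∀ᶠ z in 𝓝 p, z ∈ P.Dminus ∪ P.contSpec → ContinuousWithinAt G (P.Dminus ∪ P.contSpec) z)
    (hF' : ∀ᶠ z in 𝓝 p, z ∈ P.Dplus → DifferentiableAt ℂ F z)
    (hG' : ∀ᶠ z in 𝓝 p, z ∈ P.Dminus → DifferentiableAt ℂ G z)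
    (he : ∀ᶠ z in 𝓝 p, z ∈ P.contSpec → F z = G z) :
    AnalyticAt ℂ (fun z => if z ∈ P.Dplus then F z else G z) p := by
  have hn : ∀ᶠ z in 𝓝 p, z ≠ 0 := isOpen_ne.mem_nhds hp
  have key := analyticAt_ite_of_coord (f := F) (g := G) (Admissible.analyticAt_lam (P := P) hp)
    (Admissible.eventually_deriv_lam_ne hp) ?_ ?_ ?_ ?_ ?_
  · refine key.congr (hn.mono fun z hz => ?_)
    simp only [h.mem_Dplus, ne_eq, hz, not_false_eq_true, true_and]
  · filter_upwards [hn, hF] with z hz h1 h2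
    refine (h1 (h.mem_Dplus_union.2 ⟨hz, h2⟩)).mono_of_mem_nhdsWithin ?_
    filter_upwards [mem_nhdsWithin_of_mem_nhds (isOpen_ne.mem_nhds hz), self_mem_nhdsWithin]
      with w h3 h4
    exact h.mem_Dplus_union.2 ⟨h3, h4⟩
  · filter_upwards [hn, hG] with z hz h1 h2
    refine (h1 (h.mem_Dminus_union.2 ⟨hz, h2⟩)).mono_of_mem_nhdsWithin ?_
    filter_upwards [mem_nhdsWithin_of_mem_nhds (isOpen_ne.mem_nhds hz), self_mem_nhdsWithin]
      with w h3 h4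
    exact h.mem_Dminus_union.2 ⟨h3, h4⟩
  · filter_upwards [hn, hF'] with z hz h1 h2 using h1 (h.mem_Dplus.2 ⟨hz, h2⟩)
  · filter_upwards [hn, hG'] with z hz h1 h2 using h1 (h.mem_Dminus.2 ⟨hz, h2⟩)
  · filter_upwards [hn, he] with z hz h1 h2 using h1 (h.mem_contSpec.2 ⟨hz, h2⟩)

include h hq hJ

lemma continuousOn_jost_m (x t : ℝ) (i : Fin 2) :
    ContinuousOn (fun z => Φm x t z i 1 * P.osc 1 x t z) (P.Dplus ∪ P.contSpec) := by
  fin_cases i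
  · refine ((continuousOn_jost h hq hJ (-x) (-t) 1).const_smul (-P.σ : ℂ)).congr fun z hz => ?_
    simp only [Fin.zero_eta, (jost_reflect h hq hJ hz x t).2, osc_zero_neg, smul_eq_mul,
      Pi.smul_apply]
    ring
  · refine (continuousOn_jost h hq hJ (-x) (-t) 0).congr fun z hz => ?_
    simp only [Fin.mk_one, (jost_reflect h hq hJ hz x t).1, osc_zero_neg]

lemma differentiableOn_jost_m (x t : ℝ) (i : Fin 2) :
    DifferentiableOn ℂ (fun z => Φm x t z i 1 * P.osc 1 x t z) P.Dplus := by
  fin_cases i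
  · refine ((differentiableOn_jost h hq hJ (-x) (-t) 1).const_smul (-P.σ : ℂ)).congr fun z hz => ?_
    simp only [Fin.zero_eta, (jost_reflect h hq hJ (Or.inl hz) x t).2, osc_zero_neg, smul_eq_mul,
      Pi.smul_apply]
    ring
  · refine (differentiableOn_jost h hq hJ (-x) (-t) 0).congr fun z hz => ?_
    simp only [Fin.mk_one, (jost_reflect h hq hJ (Or.inl hz) x t).1, osc_zero_neg]

lemma jost_m1_eq {z : ℂ} (hz : z ∈ P.Dminus ∪ P.contSpec) (x t : ℝ) (i : Fin 2) :
    Φm x t z i 0 * P.osc 0 x t z = -(I * P.qm * P.hat z / P.q₀ ^ 2) *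
      (Φm x t (P.hat z) i 1 * P.osc 1 x t (P.hat z)) := by
  have := jost_hat' h hq hJ (h.hat_mem_Dplus_union hz) x t i
  rw [h.hat_hat] at this
  rw [this, h.osc_one_hat]; ring

lemma jost_p2_eq {z : ℂ} (hz : z ∈ P.Dminus ∪ P.contSpec) (x t : ℝ) (i : Fin 2) :
    Φp x t z i 1 * P.osc 1 x t z = I * P.qp * P.hat z / (P.ε * P.q₀ ^ 2) *
      (Φp x t (P.hat z) i 0 * P.osc 0 x t (P.hat z)) := by
  have := jost_hat h hq hJ (h.hat_mem_Dplus_union hz) x t i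
  rw [h.hat_hat] at this
  rw [this, h.osc_zero_hat]; ring

lemma continuousOn_jost_m1 (x t : ℝ) (i : Fin 2) :
    ContinuousOn (fun z => Φm x t z i 0 * P.osc 0 x t z) (P.Dminus ∪ P.contSpec) := by
  refine (h.continuousOn_comp_hat (f := fun z => -(I * P.qm * z / P.q₀ ^ 2) *
    (Φm x t z i 1 * P.osc 1 x t z)) (ContinuousOn.mul (by fun_prop)
    (continuousOn_jost_m h hq hJ x t i))).congr fun _ hz => jost_m1_eq h hq hJ hz x t i

lemma differentiableOn_jost_m1 (x t : ℝ) (i : Fin 2) :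
    DifferentiableOn ℂ (fun z => Φm x t z i 0 * P.osc 0 x t z) P.Dminus := by
  refine (h.differentiableOn_comp_hat (f := fun z => -(I * P.qm * z / P.q₀ ^ 2) *
    (Φm x t z i 1 * P.osc 1 x t z)) (DifferentiableOn.mul (by fun_prop)
    (differentiableOn_jost_m h hq hJ x t i))).congr fun _ hz =>
    jost_m1_eq h hq hJ (Or.inl hz) x t i

lemma jost_ne_zero {z : ℂ} (hz : z ∈ P.Dplus ∪ P.contSpec) (x t : ℝ) :
    ¬(Φp x t z 0 0 = 0 ∧ Φp x t z 1 0 = 0) := by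
  rintro ⟨h1, h2⟩
  exact (isSol_p1 h hq hJ hz t).ne_zero x (by simp [h1, h2])

/-- The reflection fixes (0,0), so there both columns of the Wronskian are expressed by Φ₊,₁ alone.
This quadratic form controls the zeros of s₁₁ and the residue data. -/
lemma wr_eq {z : ℂ} (hz : z ∈ P.Dplus ∪ P.contSpec) :
    wr (Φp 0 0 z) 0 (Φm 0 0 z) 1 = Φp 0 0 z 0 0 ^ 2 + P.σ * Φp 0 0 z 1 0 ^ 2 := by
  have := jost_reflect h hq hJ hz 0 0
  rw [neg_zero] at this
  rw [wr, this.1, this.2]; ring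

lemma continuousOn_origin (i : Fin 2) :
    ContinuousOn (fun z => Φp 0 0 z i 0) (P.Dplus ∪ P.contSpec) := by
  simpa [osc_origin] using continuousOn_jost h hq hJ 0 0 i

lemma differentiableOn_origin (i : Fin 2) :
    DifferentiableOn ℂ (fun z => Φp 0 0 z i 0) P.Dplus := by
  simpa [osc_origin] using differentiableOn_jost h hq hJ 0 0 i

lemma continuousOn_wr :
    ContinuousOn (fun z => wr (Φp 0 0 z) 0 (Φm 0 0 z) 1) (P.Dplus ∪ P.contSpec) :=
  (((continuousOn_origin h hq hJ 0).pow 2).add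
    (continuousOn_const.mul ((continuousOn_origin h hq hJ 1).pow 2))).congr
    fun _ hz => wr_eq h hq hJ hz

lemma differentiableOn_wr :
    DifferentiableOn ℂ (fun z => wr (Φp 0 0 z) 0 (Φm 0 0 z) 1) P.Dplus :=
  (((differentiableOn_origin h hq hJ 0).pow 2).add
    ((differentiableOn_const (P.σ : ℂ)).mul ((differentiableOn_origin h hq hJ 1).pow 2))).congr
    fun _ hz => wr_eq h hq hJ (Or.inl hz)

omit hq hJ in
lemma continuousOn_one_sub : ContinuousOn (fun z : ℂ => 1 - (P.ε : ℂ) * P.q₀ ^ 2 / z ^ 2)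
    (P.Dplus ∪ P.contSpec) :=
  continuousOn_const.sub (continuousOn_const.div (continuousOn_id.pow 2)
    fun _ hz => pow_ne_zero 2 (h.mem_Dplus_union.1 hz).1)

lemma continuousOn_s₁ :
    ContinuousOn (P.s₁ Φp Φm) ((P.Dplus ∪ P.contSpec) ∩ {z | P.lam z ≠ 0}) :=
  ((continuousOn_wr h hq hJ).mono Set.inter_subset_left).div
    ((continuousOn_one_sub h).mono Set.inter_subset_left) fun _ hz => by
      have hz0 := (h.mem_Dplus_union.1 hz.1).1
      rw [one_sub_eq hz0]
      exact div_ne_zero (mul_ne_zero two_ne_zero hz.2) hz0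

lemma differentiableOn_s₁ : DifferentiableOn ℂ (P.s₁ Φp Φm) P.Dplus := by
  have hz0 : ∀ z ∈ P.Dplus, z ≠ 0 := fun z hz => (h.mem_Dplus.1 hz).1
  refine (differentiableOn_wr h hq hJ).div ((differentiableOn_const _).sub
    ((differentiableOn_const _).div (differentiableOn_id.pow 2) fun z hz =>
      pow_ne_zero 2 (hz0 z hz))) fun z hz => ?_
  rw [one_sub_eq (hz0 z hz)]
  refine div_ne_zero (mul_ne_zero two_ne_zero fun h0 => ?_) (hz0 z hz)
  have := (h.mem_Dplus.1 hz).2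
  rw [h0] at this
  simp at this

lemma s₂_hat {z : ℂ} (hz : z ∈ P.Dplus ∪ P.contSpec) :
    P.s₂ Φp Φm (P.hat z) = P.δ * P.s₁ Φp Φm z := by
  have hz0 := (h.mem_Dplus_union.1 hz).1
  have hc := h.cast_ne
  have hε : (P.ε : ℂ) ≠ 0 := left_ne_zero_of_mul hc
  have hq0 : (P.q₀ : ℂ) ≠ 0 := fun h0 => hc (by rw [h0]; ring)
  have hqm : (P.qm : ℂ) ^ 2 = P.q₀ ^ 2 := by exact_mod_cast h.qm_sq
  have hε2 : (P.ε : ℂ) ^ 2 = 1 := by exact_mod_cast h.eps_sq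
  rw [s₁, s₂, one_sub_eq hz0, one_sub_eq (h.hat_ne hz0), h.lam_hat]
  simp only [wr, jost_hat h hq hJ hz, jost_hat' h hq hJ hz]
  simp only [hat, qp]
  push_cast
  rw [← hqm]
  have : (P.qm : ℂ) ≠ 0 := by exact_mod_cast h.qm_ne
  by_cases hl : P.lam z = 0
  · simp [hl]
  field_simp
  linear_combination P.δ * ((Φm 0 0 z 0 1 * Φp 0 0 z 1 0 - Φm 0 0 z 1 1 * Φp 0 0 z 0 0)) * I_sq

omit hq in
-- X is trace-free, so the Wronskian does not depend on x and equals its limit det E₋.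
lemma det_jost_m {z : ℂ} (hz : z ∈ P.contSpec) (x t : ℝ) :
    wr (Φm x t z) 0 (Φm x t z) 1 = 1 - P.ε * P.q₀ ^ 2 / z ^ 2 := by
  obtain ⟨a1, a2⟩ := hJ.m1 z (Or.inr hz)
  obtain ⟨b1, b2⟩ := hJ.m2 z (Or.inr hz)
  have hd : ∀ y, HasDerivAt (fun y => wr (Φm y t z) 0 (Φm y t z) 1) 0 y := by
    intro y
    refine (((a1.deriv_zero y t).fun_mul (b1.deriv_one y t)).fun_sub
      ((a1.deriv_one y t).fun_mul (b1.deriv_zero y t))).congr_deriv ?_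
    ring
  have hconst := is_const_of_deriv_eq_zero (fun y => (hd y).differentiableAt) fun y => (hd y).deriv
  have hlim : Tendsto (fun y => wr (Φm y t z) 0 (Φm y t z) 1) atBot
      (𝓝 (1 - P.ε * P.q₀ ^ 2 / z ^ 2)) := by
    have := ((a2 t 0).mul (b2 t 1)).sub ((a2 t 1).mul (b2 t 0))
    have e : P.E P.qm z 0 0 * P.E P.qm z 1 1 - P.E P.qm z 1 0 * P.E P.qm z 0 1 =
        1 - P.ε * P.q₀ ^ 2 / z ^ 2 := by
      have hqm : (P.qm : ℂ) ^ 2 = P.q₀ ^ 2 := by exact_mod_cast h.qm_sq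
      simp [E]
      rw [← hqm]
      have := (h.mem_contSpec.1 hz).1
      field_simp
      linear_combination (P.ε * P.qm ^ 2 : ℂ) * I_sq
    rw [e] at this
    refine this.congr fun y => ?_
    have := P.osc_mul_osc y t z
    rw [wr]
    linear_combination (Φm y t z 0 0 * Φm y t z 1 1 - Φm y t z 1 0 * Φm y t z 0 1) * this
  refine tendsto_nhds_unique (f := fun _ : ℝ => wr (Φm x t z) 0 (Φm x t z) 1)
    (l := atBot) tendsto_const_nhds (hlim.congr fun y => hconst y x)

variable {S : ℂ → Matrix (Fin 2) (Fin 2) ℂ} (hS : P.IsScattering Φp Φm S)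
  (hR : P.IsReflectionless S)

omit h hq hJ in
include hS hR in
lemma rel_reflectionless {z : ℂ} (hz : z ∈ P.contSpec₀) (x t : ℝ) (i : Fin 2) :
    Φp x t z i 0 = S z 0 0 * Φm x t z i 0 ∧ Φp x t z i 1 = S z 1 1 * Φm x t z i 1 := by
  have := hS.rel z hz x t
  obtain ⟨r1, r2⟩ := hR z hz
  constructor
  · rw [this, mul_apply, Fin.sum_univ_two, r1]; ring
  · rw [this, mul_apply, Fin.sum_univ_two, r2]; ring

include hS hR

omit hq in
-- On Σ₀ the matrix S is known only through Φ₊ = Φ₋S. Taking Wronskians with the columns of Φ₋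
-- identifies its diagonal with the Wronskian quotients used inside the domains.
lemma scattering_on_contSpec₀ {z : ℂ} (hz : z ∈ P.contSpec₀) :
    S z 0 0 = P.s₁ Φp Φm z ∧ S z 1 1 = P.s₂ Φp Φm z := by
  have hd := det_jost_m h hJ hz.1 0 0
  have hz' := h.mem_contSpec₀.1 hz
  have hne : (1 - (P.ε : ℂ) * P.q₀ ^ 2 / z ^ 2) ≠ 0 := by
    rw [one_sub_eq hz'.1]
    exact div_ne_zero (mul_ne_zero two_ne_zero hz'.2.2) hz'.1
  have hr := rel_reflectionless hS hR hz 0 0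
  constructor
  · rw [s₁, eq_div_iff hne, ← hd, wr, wr, (hr 0).1, (hr 1).1]; ring
  · rw [s₂, eq_div_iff hne, ← hd, wr, wr, (hr 0).2, (hr 1).2]; ring

/-- Without reflection Φ₊,₁ = s₁₁Φ₋,₁, and Φ₊,₁ never vanishes. -/
lemma s₁_ne_zero {z : ℂ} (hz : z ∈ P.contSpec₀) : P.s₁ Φp Φm z ≠ 0 := by
  intro h0
  rw [← (scattering_on_contSpec₀ h hJ hS hR hz).1] at h0
  have hr := rel_reflectionless hS hR hz 0 0
  exact jost_ne_zero h hq hJ (Or.inr hz.1) 0 0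
    ⟨by rw [(hr 0).1, h0, zero_mul], by rw [(hr 1).1, h0, zero_mul]⟩

/-- `s₁₁` has nonzero limits at the branch points. -/
theorem exists_tendsto_s₁ {p : ℂ} (hp : p ≠ 0) (hl : P.lam p = 0) :
    ∃ c, c ≠ 0 ∧ Tendsto (P.s₁ Φp Φm) (𝓝[P.Dplus] p) (𝓝 c) := by
  have hpp : P.hat p = p := by
    have := (lam_eq_zero_iff hp).1 hl
    rw [hat, ← this]; field_simp
  have hpS : p ∈ P.contSpec := h.mem_contSpec.2 ⟨hp, by simp [hl]⟩
  have hpD : p ∈ P.Dplus ∪ P.contSpec := Or.inr hpS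
  have hLa := Admissible.analyticAt_lam (P := P) hp
  have hd : HasDerivAt P.lam 1 p := by
    have h1 := hasDerivAt_lam (P := P) hp
    rwa [← (lam_eq_zero_iff hp).1 hl, div_self (pow_ne_zero 2 hp), one_add_one_eq_two,
      div_self two_ne_zero] at h1
  have hopen : map P.lam (𝓝 p) = 𝓝 0 := by
    rw [← hl]
    exact (by simpa [hd.deriv] using hLa.hasStrictDerivAt :
      HasStrictDerivAt P.lam 1 p).map_nhds_eq one_ne_zero
  -- λ is locally biholomorphic at a branch point, so preimages of nonzero reals accumulate there;
  -- limits may be taken along Σ₀.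
  have hfreq : ∃ᶠ z in 𝓝[≠] p, z ∈ P.contSpec₀ := by
    have h1 : ∃ᶠ w in 𝓝 (0 : ℂ), w.im = 0 ∧ w ≠ 0 := by
      have ht : Tendsto (fun x : ℝ => (x : ℂ)) (𝓝[≠] 0) (𝓝 0) :=
        (continuous_ofReal.tendsto' 0 0 (by simp)).mono_left nhdsWithin_le_nhds
      refine ht.frequently (Eventually.frequently ?_)
      filter_upwards [self_mem_nhdsWithin] with x hx
      exact ⟨by simp, by simpa using hx⟩
    rw [← hopen, frequently_map] at h1
    have h2 := h1.and_eventually (isOpen_ne.mem_nhds hp)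
    refine frequently_nhdsWithin_iff.2 (h2.mono fun z hz => ⟨h.mem_contSpec₀.2
      ⟨hz.2, hz.1.1, hz.1.2⟩, fun h0 => hz.1.2 ?_⟩)
    rw [show z = p from h0, hl]
  have hpM : p ∈ P.Dminus ∪ P.contSpec := Or.inr hpS
  have hm1 : ContinuousOn (fun z => Φm 0 0 z 0 0) (P.Dminus ∪ P.contSpec) := by
    simpa [osc_origin] using continuousOn_jost_m1 h hq hJ 0 0 0
  have hm1' : DifferentiableOn ℂ (fun z => Φm 0 0 z 0 0) P.Dminus := by
    simpa [osc_origin] using differentiableOn_jost_m1 h hq hJ 0 0 0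
  set a : ℂ → ℂ := fun z => Φp 0 0 z 0 0 with ha
  set c : ℂ → ℂ := fun z => Φp 0 0 z 1 0 with hc
  set m : ℂ → ℂ := fun z => Φm 0 0 z 0 0 with hm
  have ca := continuousOn_origin h hq hJ 0
  have cc := continuousOn_origin h hq hJ 1
  have hq0 : (P.q₀ : ℂ) ≠ 0 := by exact_mod_cast h.pos.ne'
  have hqm : (P.qm : ℂ) ≠ 0 := by exact_mod_cast h.qm_ne
  have hσ : (P.σ : ℂ) ≠ 0 := by rcases h.sigma with h | h <;> simp [h]
  have hmz : ∀ z ∈ P.contSpec, m z = P.σ * (I * P.qm * P.hat z / P.q₀ ^ 2) * c (P.hat z) ∧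
      Φm 0 0 z 1 0 = -(I * P.qm * P.hat z / P.q₀ ^ 2) * a (P.hat z) := by
    intro z hz
    have h1 := fun i => jost_m1_eq h hq hJ (Or.inr hz) 0 0 i
    have h2 := jost_reflect h hq hJ (h.hat_mem_Dplus_union (Or.inr hz)) 0 0
    simp only [osc_origin, mul_one, neg_zero] at h1 h2
    refine ⟨?_, by rw [h1, h2.1]⟩
    change Φm 0 0 z 0 0 = _
    rw [h1, h2.2]; ring
  -- On Σ₀ the column (a,c) is proportional to Φ₋,₁, which the symmetries make proportional to
  -- (-σc,a) at `hat z`. So a(z)a(ẑ) + σc(z)c(ẑ) = 0, and ẑ → p as z → p.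
  have hW0 : a p ^ 2 + P.σ * c p ^ 2 = 0 := by
    have hcont : ContinuousWithinAt (fun z => a z * a (P.hat z) + P.σ * (c z * c (P.hat z)))
        P.contSpec p := by
      have e1 := (h.continuousOn_comp_hat ca p hpM).mono Set.subset_union_right
      have e2 := (h.continuousOn_comp_hat cc p hpM).mono Set.subset_union_right
      exact (((ca p hpD).mono Set.subset_union_right).mul e1).add (continuousWithinAt_const.mul
        (((cc p hpD).mono Set.subset_union_right).mul e2))
    by_contra hne
    have h1 : a p * a (P.hat p) + P.σ * (c p * c (P.hat p)) ≠ 0 := by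
      rw [hpp]; intro h0; exact hne (by linear_combination h0)
    have h2 := eventually_nhdsWithin_iff.1 (hcont.eventually_ne h1)
    obtain ⟨z, hz, hz'⟩ := ((hfreq.filter_mono nhdsWithin_le_nhds).and_eventually h2).exists
    refine hz' hz.1 ?_
    have hr := rel_reflectionless hS hR hz 0 0
    have hz0 := (h.mem_contSpec₀.1 hz).1
    have hk : (I * P.qm * P.hat z / P.q₀ ^ 2 : ℂ) ≠ 0 :=
      div_ne_zero (mul_ne_zero (mul_ne_zero I_ne_zero hqm) (h.hat_ne hz0)) (pow_ne_zero 2 hq0)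
    have e0 : a z * Φm 0 0 z 1 0 = c z * m z := by
      simp only [ha, hc, hm, (hr 0).1, (hr 1).1]; ring
    rw [(hmz z hz.1).1, (hmz z hz.1).2] at e0
    refine mul_left_cancel₀ hk ?_
    linear_combination -e0
  have hap : a p ≠ 0 := by
    intro h0
    have hcp : c p = 0 := by simpa [h0, hσ] using hW0
    exact jost_ne_zero h hq hJ hpD 0 0 ⟨h0, hcp⟩
  have hcp : c p ≠ 0 := by
    intro h0
    have : a p = 0 := by simpa [h0] using hW0
    exact hap this
  have hmp : m p ≠ 0 := by
    rw [(hmz p hpS).1, hpp]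
    exact mul_ne_zero (mul_ne_zero hσ (div_ne_zero (mul_ne_zero (mul_ne_zero I_ne_zero hqm) hp)
      (pow_ne_zero 2 hq0))) hcp
  have hane := eventually_nhdsWithin_iff.1 ((ca p hpD).eventually_ne hap)
  have hmne := eventually_nhdsWithin_iff.1 ((hm1 p hpM).eventually_ne hmp)
  classical
  -- Both expressions are λs₁₁/a: on Σ₀ one has a = s₁₁m, where m is the upper entry of Φ₋,₁. The
  -- factor λ cancels the singular denominator of s₁₁, so continuity at p is available before any
  -- limit of s₁₁ is known.
  have hH := h.analyticAt_glue (F := fun z => z * wr (Φp 0 0 z) 0 (Φm 0 0 z) 1 / (2 * a z))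
    (G := fun z => P.lam z / m z) hp
    (hane.mono fun z hz hz' => ((continuousOn_id z hz').mul (continuousOn_wr h hq hJ z hz')).div
      (continuousWithinAt_const.mul (ca z hz')) (mul_ne_zero two_ne_zero (hz hz')))
    (hmne.mono fun z hz hz' => ((Admissible.analyticAt_lam
      (h.mem_Dminus_union.1 hz').1).continuousAt.continuousWithinAt).div (hm1 z hz') (hz hz'))
    (hane.mono fun z hz hz' => ((differentiableAt_id).mul ((differentiableOn_wr h hq hJ).differentiableAt
      (h.isOpen_Dplus.mem_nhds hz'))).div ((differentiableAt_const _).mul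
      ((differentiableOn_origin h hq hJ 0).differentiableAt
      (h.isOpen_Dplus.mem_nhds hz'))) (mul_ne_zero two_ne_zero (hz (Or.inl hz'))))
    (hmne.mono fun z hz hz' => ((Admissible.analyticAt_lam
      (h.mem_Dminus.1 hz').1).differentiableAt).div (hm1'.differentiableAt
      (h.isOpen_Dminus.mem_nhds hz')) (hz (Or.inl hz')))
    (by
      filter_upwards [hane, hmne, eventually_nhdsWithin_iff.1 (Admissible.eventually_lam_ne hp)]
        with z h1 h2 h5 hz
      have hz0 := (h.mem_contSpec.1 hz).1
      by_cases hlz : P.lam z = 0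
      · have hzp : z = p := by
          by_contra hne
          exact h5 hne hlz
        rw [hzp, hl, wr_eq h hq hJ hpD, show Φp 0 0 p 0 0 ^ 2 + P.σ * Φp 0 0 p 1 0 ^ 2 = 0 from hW0]
        simp
      · have hz0' : z ∈ P.contSpec₀ := h.mem_contSpec₀.2 ⟨hz0, (h.mem_contSpec.1 hz).2, hlz⟩
        have e1 := (scattering_on_contSpec₀ h hJ hS hR hz0').1
        have e2 := (rel_reflectionless hS hR hz0' 0 0 0).1
        rw [e1] at e2
        have e3 := h1 (Or.inr hz)
        have e4 : Φm 0 0 z 0 0 ≠ 0 := h2 (Or.inr hz)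
        change z * _ / (2 * Φp 0 0 z 0 0) = P.lam z / Φm 0 0 z 0 0
        simp only [s₁, one_sub_eq hz0] at e2
        field_simp at e2
        field_simp
        linear_combination -e2)
  set H : ℂ → ℂ := fun z => if z ∈ P.Dplus then z * wr (Φp 0 0 z) 0 (Φm 0 0 z) 1 / (2 * a z)
    else P.lam z / m z with hHdef
  have hHp : H p = 0 := by
    have : p ∉ P.Dplus := fun h' => by
      have := (h.mem_Dplus.1 h').2
      simp [hl] at this
    simp [hHdef, this, hl]
  -- H and λ both vanish at p and λ'(p) = 1, so H/λ = s₁₁/a has a limit from all directions.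
  have hslope : Tendsto (fun z => H z / P.lam z) (𝓝[≠] p) (𝓝 (deriv H p)) := by
    have t1 := hasDerivAt_iff_tendsto_slope.1 hH.differentiableAt.hasDerivAt
    have t2 := hasDerivAt_iff_tendsto_slope.1 hd
    have := t1.div t2 one_ne_zero
    rw [div_one] at this
    refine this.congr' ?_
    filter_upwards [self_mem_nhdsWithin] with z hz
    have : z - p ≠ 0 := sub_ne_zero.2 hz
    simp only [Pi.div_apply, slope_def_field, hHp, hl, sub_zero]
    rw [div_div_div_cancel_right₀ this]
  -- The limit is computed along Σ₀, where H/λ is exactly 1/m.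
  have hderiv : deriv H p = 1 / m p := by
    have : (𝓝[≠] p ⊓ 𝓟 P.contSpec₀).NeBot := by
      rw [inf_principal_neBot_iff]
      intro U hU
      obtain ⟨z, h1, h2⟩ := (hfreq.and_eventually hU).exists
      exact ⟨z, h2, h1⟩
    have t1 : Tendsto (fun z => H z / P.lam z) (𝓝[≠] p ⊓ 𝓟 P.contSpec₀) (𝓝 (deriv H p)) :=
      hslope.mono_left inf_le_left
    refine tendsto_nhds_unique t1 ?_
    have t2 : Tendsto m (𝓝[≠] p ⊓ 𝓟 P.contSpec₀) (𝓝 (m p)) :=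
      (hm1 p hpM).mono_left (inf_le_inf nhdsWithin_le_nhds
        (principal_mono.2 fun z hz => Or.inr hz.1))
    refine ((t2.inv₀ hmp).congr' ?_).trans (by rw [one_div])
    filter_upwards [mem_inf_of_right (mem_principal_self _)] with z hz
    have hz' := h.mem_contSpec₀.1 hz
    have : z ∉ P.Dplus := fun h' => by
      have := (h.mem_Dplus.1 h').2
      rw [hz'.2.1] at this
      exact lt_irrefl _ this
    simp only [hHdef, this, if_false]
    rw [div_div_cancel_left' hz'.2.2]
  refine ⟨a p * (1 / m p), mul_ne_zero hap (one_div_ne_zero hmp), ?_⟩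
  rw [← hderiv]
  have hsub : P.Dplus ⊆ {p}ᶜ := fun z hz h0 => by
    have := (h.mem_Dplus.1 hz).2
    rw [show z = p from h0, hl] at this
    simp at this
  have t1 := ((ca p hpD).mono Set.subset_union_left).tendsto.mul
    (hslope.mono_left (nhdsWithin_mono p hsub))
  refine t1.congr' ?_
  filter_upwards [self_mem_nhdsWithin, mem_nhdsWithin_of_mem_nhds hane] with z hz h1
  have hz0 := (h.mem_Dplus.1 hz).1
  have h2 := h1 (Or.inl hz)
  have h3 : P.lam z ≠ 0 := fun h0 => by
    have := (h.mem_Dplus.1 hz).2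
    simp [h0] at this
  simp only [hHdef, hz, if_true, s₁, one_sub_eq hz0]
  change a z * _ = _
  change a z ≠ 0 at h2
  field_simp

end Params

end NonlocalMKdV

end

/-! ### Jost columns and scattering coefficients at infinity. -/

noncomputable section

namespace NonlocalMKdV

/-- A function that is analytic near infinity and tends to a limit approaches it like `1 / z`. -/
lemma isBigO_inv_of_differentiable {f : ℂ → ℂ} {L : ℂ}
    (hd : ∀ᶠ z in Bornology.cobounded ℂ, DifferentiableAt ℂ f z)
    (ht : Tendsto f (Bornology.cobounded ℂ) (𝓝 L)) :
    (fun z => f z - L) =O[Bornology.cobounded ℂ] (fun z => z⁻¹) := by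
  have hi : Tendsto (fun w : ℂ => w⁻¹) (𝓝[≠] 0) (Bornology.cobounded ℂ) := by
    rw [← Filter.inv_cobounded₀]
    exact tendsto_map'_iff.2 (by simpa [Function.comp_def] using tendsto_id)
  -- Inversion moves infinity to a removable singularity at 0, where differentiability gives the
  -- linear rate.
  set g : ℂ → ℂ := Function.update (fun w => f w⁻¹) 0 L with hg
  have hgw : ∀ w ≠ 0, g w = f w⁻¹ := fun w hw => Function.update_of_ne hw _ _
  have hga : AnalyticAt ℂ g 0 := by
    refine analyticAt_of_differentiable_on_punctured_nhds_of_continuousAt ?_ ?_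
    · filter_upwards [hi.eventually hd, self_mem_nhdsWithin] with w hw hw0
      refine (hw.comp w (differentiableAt_inv hw0)).congr_of_eventuallyEq ?_
      filter_upwards [isOpen_ne.mem_nhds hw0] with s hs using hgw s hs
    · exact continuousAt_update_same.2 (ht.comp hi)
  have h1 : (fun w => g w - g 0) =O[𝓝 0] fun w => w - 0 := hga.differentiableAt.isBigO_sub
  have h2 := (h1.mono nhdsWithin_le_nhds).comp_tendsto (tendsto_inv₀_cobounded' (α := ℂ))
  refine h2.congr' ?_ (by simp [Function.comp_def])
  have h0 : ({0}ᶜ : Set ℂ) ∈ Bornology.cobounded ℂ :=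
    Bornology.isBounded_def.1 (Set.finite_singleton 0).isBounded
  filter_upwards [h0] with z hz
  simp only [Function.comp]
  rw [hgw _ (inv_ne_zero hz), inv_inv, hg, Function.update_self]

namespace Params

variable {P : Params} {q : ℝ → ℝ → ℝ} (h : P.Admissible)

lemma eventually_cobounded_le_norm (R : ℝ) : ∀ᶠ z in Bornology.cobounded ℂ, R ≤ ‖z‖ :=
  tendsto_norm_cobounded_atTop.eventually (eventually_ge_atTop R)

section
include h

lemma Admissible.lam_im_pos_factor {z : ℂ} (hz : P.q₀ < ‖z‖) :
    0 < ‖z‖ ^ 2 + P.ε * P.q₀ ^ 2 := by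
  have := h.pos
  rcases h.eps with he | he <;> rw [he] <;> nlinarith

/-- Outside the disc |z| ≤ q₀, Im λ and Im z have the same sign in both cases ε = ±1; the large-z
estimates require Im z ≥ 0 in addition to Im λ ≥ 0. -/
lemma Admissible.im_nonneg {z : ℂ} (hz : P.q₀ < ‖z‖) (hl : 0 ≤ (P.lam z).im) : 0 ≤ z.im := by
  have hz0 : 0 < ‖z‖ := h.pos.trans hz
  rw [lam_im (norm_pos_iff.1 hz0)] at hl
  by_contra! h'
  have := h.lam_im_pos_factor hz
  have : z.im * (‖z‖ ^ 2 + P.ε * P.q₀ ^ 2) / (2 * ‖z‖ ^ 2) < 0 :=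
    div_neg_of_neg_of_pos (mul_neg_of_neg_of_pos h' this) (by positivity)
  linarith

lemma Admissible.lam_ne_zero {z : ℂ} (hz : P.q₀ < ‖z‖) : P.lam z ≠ 0 := by
  have hz0 : 0 < ‖z‖ := h.pos.trans hz
  intro h0
  have := congrArg norm ((lam_eq_zero_iff (norm_pos_iff.1 hz0)).1 h0)
  have he : ‖(P.ε : ℂ)‖ = 1 := by rcases h.eps with h | h <;> simp [h]
  rw [norm_pow, norm_mul, he, one_mul, norm_pow, norm_real, Real.norm_eq_abs,
    abs_of_pos h.pos] at this
  nlinarith [h.pos]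

lemma Admissible.im_nonpos {z : ℂ} (hz : P.q₀ < ‖z‖) (hl : (P.lam z).im ≤ 0) : z.im ≤ 0 := by
  have := h.im_nonneg (z := -z) (by rwa [norm_neg]) (by
    have : P.lam (-z) = -P.lam z := by simp only [lam, div_neg]; ring
    rw [this]; simpa using hl)
  simpa using this

omit h in
lemma Admissible.tendsto_one_sub : Tendsto (fun z : ℂ => 1 - (P.ε : ℂ) * P.q₀ ^ 2 / z ^ 2)
    (Bornology.cobounded ℂ) (𝓝 1) := by
  have := ((tendsto_inv₀_cobounded (α := ℂ)).pow 2).const_mul ((P.ε : ℂ) * P.q₀ ^ 2)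
  have := this.const_sub 1
  simpa [div_eq_mul_inv] using this

end

variable (hq : P.IsSolution q)
  {Φp Φm : ℝ → ℝ → ℂ → Matrix (Fin 2) (Fin 2) ℂ} (hJ : P.IsJost q Φp Φm)
include h hq hJ

/-! ### Large values of the spectral parameter -/

lemma tendsto_jost_p1 (x t : ℝ) :
    Tendsto (fun z => (Φp x t z 0 0 * P.osc 0 x t z, Φp x t z 1 0 * P.osc 0 x t z))
      (Bornology.cobounded ℂ ⊓ 𝓟 (P.Dplus ∪ P.contSpec)) (𝓝 (1, 0)) := by
  rw [Metric.tendsto_nhds]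
  intro e he
  obtain ⟨R, hR, hb⟩ := (hq.halfLine h t).exists_norm_sub_le
    (hq.hasDerivAt_halfLine_u h t) (hq.continuous_dx_ofReal t)
    (hq.hasDerivAt_halfLine_w h t) (hq.continuous_dx_rst t) x (half_pos he)
  filter_upwards [mem_inf_of_left (eventually_cobounded_le_norm R),
    mem_inf_of_left (eventually_cobounded_le_norm (P.q₀ + 1)),
    mem_inf_of_right (mem_principal_self _)] with z h1 h2 h3
  have h3' := (h.mem_Dplus_union.1 h3).2
  rw [dist_eq_norm]
  refine (hb z h1 (by rwa [halfLine_lam]) (h.im_nonneg ?_ h3') _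
    (isSol_p1 h hq hJ h3 t)).trans_lt (half_lt_self he)
  have : P.q₀ + 1 ≤ ‖z‖ := h2
  linarith

lemma tendsto_jost_p2 (x t : ℝ) :
    Tendsto (fun z => (Φp x t z 1 1 * P.osc 1 x t z, Φp x t z 0 1 * P.osc 1 x t z))
      (Bornology.cobounded ℂ ⊓ 𝓟 (P.Dminus ∪ P.contSpec)) (𝓝 (1, 0)) := by
  rw [Metric.tendsto_nhds]
  intro e he
  obtain ⟨R, hR, hb⟩ := (hq.halfLine h t).swap.exists_norm_sub_le
    (hq.hasDerivAt_halfLine_w h t) (hq.continuous_dx_rst t)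
    (hq.hasDerivAt_halfLine_u h t) (hq.continuous_dx_ofReal t) x (half_pos he)
  filter_upwards [mem_inf_of_left (eventually_cobounded_le_norm R),
    mem_inf_of_left (eventually_cobounded_le_norm (P.q₀ + 1)),
    mem_inf_of_right (mem_principal_self _)] with z h1 h2 h3
  have h3' := (h.mem_Dminus_union.1 h3).2
  rw [dist_eq_norm]
  refine (hb (-z) (by rwa [norm_neg]) (by rw [halfLine_swap_lam]; simpa using h3') ?_ _
    (isSol_p2 h hq hJ h3 t)).trans_lt (half_lt_self he)
  have : P.q₀ + 1 ≤ ‖z‖ := h2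
  simpa using h.im_nonpos (by linarith) h3'

lemma tendsto_s₁ : Tendsto (P.s₁ Φp Φm)
    (Bornology.cobounded ℂ ⊓ 𝓟 (P.Dplus ∪ P.contSpec)) (𝓝 1) := by
  have h1 := tendsto_jost_p1 h hq hJ 0 0
  have ha : Tendsto (fun z => Φp 0 0 z 0 0)
      (Bornology.cobounded ℂ ⊓ 𝓟 (P.Dplus ∪ P.contSpec)) (𝓝 1) := by
    simpa [osc_origin, Function.comp_def] using (continuous_fst.tendsto _).comp h1
  have hc : Tendsto (fun z => Φp 0 0 z 1 0)
      (Bornology.cobounded ℂ ⊓ 𝓟 (P.Dplus ∪ P.contSpec)) (𝓝 0) := by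
    simpa [osc_origin, Function.comp_def] using (continuous_snd.tendsto _).comp h1
  have := ((ha.pow 2).add ((hc.pow 2).const_mul (P.σ : ℂ))).div
    ((Admissible.tendsto_one_sub (P := P)).mono_left inf_le_left) one_ne_zero
  simp only [one_pow, ne_eq, OfNat.ofNat_ne_zero, not_false_eq_true, zero_pow, mul_zero, add_zero,
    div_one] at this
  refine this.congr' ?_
  filter_upwards [mem_inf_of_right (mem_principal_self _)] with z hz
  rw [s₁, wr_eq h hq hJ hz, Pi.div_apply]

lemma tendsto_s₂ : Tendsto (P.s₂ Φp Φm)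
    (Bornology.cobounded ℂ ⊓ 𝓟 (P.Dminus ∪ P.contSpec)) (𝓝 1) := by
  have h1 := tendsto_jost_p2 h hq hJ 0 0
  have ha : Tendsto (fun z => Φp 0 0 z 1 1)
      (Bornology.cobounded ℂ ⊓ 𝓟 (P.Dminus ∪ P.contSpec)) (𝓝 1) := by
    simpa [osc_origin, Function.comp_def] using (continuous_fst.tendsto _).comp h1
  have hc : Tendsto (fun z => Φp 0 0 z 0 1)
      (Bornology.cobounded ℂ ⊓ 𝓟 (P.Dminus ∪ P.contSpec)) (𝓝 0) := by
    simpa [osc_origin, Function.comp_def] using (continuous_snd.tendsto _).comp h1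
  have := ((ha.pow 2).add ((hc.pow 2).const_mul (P.σ : ℂ))).div
    ((Admissible.tendsto_one_sub (P := P)).mono_left inf_le_left) one_ne_zero
  simp only [one_pow, ne_eq, OfNat.ofNat_ne_zero, not_false_eq_true, zero_pow, mul_zero, add_zero,
    div_one] at this
  refine this.congr' ?_
  filter_upwards [mem_inf_of_right (mem_principal_self _)] with z hz
  have := jost_reflect' h hq hJ hz 0 0
  rw [neg_zero] at this
  rw [s₂, wr, this.1, this.2, Pi.div_apply]
  ring

end Params

end NonlocalMKdV

end

/-! ### The matrix M off the origin, the branch points and the quartet. -/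

noncomputable section

namespace NonlocalMKdV

namespace Params

variable {P : Params} {q : ℝ → ℝ → ℝ} (h : P.Admissible)

/-! ### The matrix `M` is meromorphic -/

section
include h

lemma Admissible.mem_Dminus_union_of_not_mem {z : ℂ} (hz : z ≠ 0) (hz' : z ∉ P.Dplus) :
    z ∈ P.Dminus ∪ P.contSpec := by
  rw [h.mem_Dminus_union]
  rw [h.mem_Dplus] at hz'
  exact ⟨hz, not_lt.1 fun h' => hz' ⟨hz, h'⟩⟩

lemma Admissible.mem_contSpec₀_or {z : ℂ} (hz : z ∈ P.Dminus ∪ P.contSpec) (hl : P.lam z ≠ 0) :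
    z ∈ P.Dminus ∨ z ∈ P.contSpec₀ := by
  rcases hz with hz | hz
  · exact Or.inl hz
  · have := h.mem_contSpec.1 hz
    exact Or.inr (h.mem_contSpec₀.2 ⟨this.1, this.2, hl⟩)

lemma Admissible.lam_ne_of_mem_Dplus {z : ℂ} (hz : z ∈ P.Dplus) : P.lam z ≠ 0 := fun h0 => by
  have := (h.mem_Dplus.1 hz).2
  simp [h0] at this

lemma Admissible.lam_ne_of_mem_Dminus {z : ℂ} (hz : z ∈ P.Dminus) : P.lam z ≠ 0 := fun h0 => by
  have := (h.mem_Dminus.1 hz).2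
  simp [h0] at this

lemma Admissible.not_mem_Dplus_of_mem_contSpec {z : ℂ} (hz : z ∈ P.contSpec) : z ∉ P.Dplus :=
  fun h' => by
    have := (h.mem_Dplus.1 h').2
    rw [(h.mem_contSpec.1 hz).2] at this
    exact lt_irrefl _ this

lemma Admissible.hat_mem_poles₁ {z : ℂ} : P.hat z ∈ P.poles₁ ↔ z ∈ P.poles₂ := by
  have key : ∀ w, P.hat z = w ↔ z = P.hat w := fun w =>
    ⟨fun e => by rw [← e, h.hat_hat], fun e => by rw [e, h.hat_hat]⟩
  simp only [poles₁, poles₂, Set.mem_insert_iff, Set.mem_singleton_iff, key, hat_neg_conj, v₂_eq]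

omit h in
lemma finite_branch : {z : ℂ | z ≠ 0 ∧ P.lam z = 0}.Finite := by
  have : {z : ℂ | z ≠ 0 ∧ P.lam z = 0} ⊆
      ((Polynomial.nthRoots 2 ((P.ε : ℂ) * P.q₀ ^ 2)).toFinset : Set ℂ) := by
    intro z hz
    simpa [Polynomial.mem_nthRoots] using (lam_eq_zero_iff hz.1).1 hz.2
  exact (Finset.finite_toSet _).subset this

end

variable (P) in
lemma finite_poles₁ : P.poles₁.Finite := by
  unfold poles₁; exact Set.toFinite _

variable (P) in
lemma finite_poles₂ : P.poles₂.Finite := by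
  unfold poles₂; exact Set.toFinite _

lemma eventually_not_mem_poles₁ {p : ℂ} (hp : p ∉ P.poles₁) : ∀ᶠ z in 𝓝 p, z ∉ P.poles₁ :=
  P.finite_poles₁.isClosed.isOpen_compl.mem_nhds hp

lemma eventually_not_mem_poles₂ {p : ℂ} (hp : p ∉ P.poles₂) : ∀ᶠ z in 𝓝 p, z ∉ P.poles₂ :=
  P.finite_poles₂.isClosed.isOpen_compl.mem_nhds hp

lemma eventually_lam_ne_zero {p : ℂ} (hp : p ≠ 0) (hl : P.lam p ≠ 0) :
    ∀ᶠ z in 𝓝 p, P.lam z ≠ 0 :=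
  (Admissible.analyticAt_lam hp).continuousAt.eventually_ne hl

variable (hq : P.IsSolution q)
  {Φp Φm : ℝ → ℝ → ℂ → Matrix (Fin 2) (Fin 2) ℂ} (hJ : P.IsJost q Φp Φm)
  {S : ℂ → Matrix (Fin 2) (Fin 2) ℂ} (hS : P.IsScattering Φp Φm S)
  (hR : P.IsReflectionless S)
  (hZ : ∀ z ∈ P.Dplus, S z 0 0 = 0 → z ∈ P.poles₁)

include hS in
lemma S_eq_s₁ {z : ℂ} (hz : z ∈ P.Dplus) : S z 0 0 = P.s₁ Φp Φm z := hS.s11 z hz 0 0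

include hS in
lemma S_eq_s₂ {z : ℂ} (hz : z ∈ P.Dminus) : S z 1 1 = P.s₂ Φp Φm z := hS.s22 z hz 0 0

include h hJ hS hR in
lemma S_eq_s₂' {z : ℂ} (hz : z ∈ P.Dminus ∪ P.contSpec) (hl : P.lam z ≠ 0) :
    S z 1 1 = P.s₂ Φp Φm z := by
  rcases h.mem_contSpec₀_or hz hl with h1 | h1
  · exact S_eq_s₂ hS h1
  · exact (scattering_on_contSpec₀ h hJ hS hR h1).2

include h hq hJ

lemma s₂_eq {z : ℂ} (hz : z ∈ P.Dminus ∪ P.contSpec) :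
    P.s₂ Φp Φm z = P.δ * P.s₁ Φp Φm (P.hat z) := by
  rw [← s₂_hat h hq hJ (h.hat_mem_Dplus_union hz), h.hat_hat]

include hS hR hZ

lemma s₁_ne {z : ℂ} (hz : z ∈ P.Dplus ∪ P.contSpec) (hl : P.lam z ≠ 0) (hp : z ∉ P.poles₁) :
    P.s₁ Φp Φm z ≠ 0 := by
  rcases hz with hz | hz
  · rw [← S_eq_s₁ hS hz]
    exact fun h0 => hp (hZ z hz h0)
  · have := h.mem_contSpec.1 hz
    exact s₁_ne_zero h hq hJ hS hR (h.mem_contSpec₀.2 ⟨this.1, this.2, hl⟩)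

lemma s₂_ne {z : ℂ} (hz : z ∈ P.Dminus ∪ P.contSpec) (hl : P.lam z ≠ 0) (hp : z ∉ P.poles₂) :
    P.s₂ Φp Φm z ≠ 0 := by
  rw [s₂_eq h hq hJ hz]
  have hδ : (P.δ : ℂ) ≠ 0 := by rcases h.delta with h | h <;> simp [h]
  exact mul_ne_zero hδ (s₁_ne h hq hJ hS hR hZ (h.hat_mem_Dplus_union hz)
    (by rw [h.lam_hat]; exact neg_ne_zero.2 hl) fun h' => hp (h.hat_mem_poles₁.1 h'))

omit hS hR hZ in
lemma continuousWithinAt_s₁ {z : ℂ} (hz : z ∈ P.Dplus ∪ P.contSpec) (hl : P.lam z ≠ 0) :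
    ContinuousWithinAt (P.s₁ Φp Φm) (P.Dplus ∪ P.contSpec) z :=
  (continuousOn_s₁ h hq hJ z ⟨hz, hl⟩).mono_of_mem_nhdsWithin
    (inter_mem self_mem_nhdsWithin (mem_nhdsWithin_of_mem_nhds
      (eventually_lam_ne_zero (h.mem_Dplus_union.1 hz).1 hl)))

/-- The first column of `M` in `D⁺`, extended to the boundary. -/
lemma continuousWithinAt_col₁ (x t : ℝ) (i : Fin 2) {z : ℂ} (hz : z ∈ P.Dplus ∪ P.contSpec)
    (hl : P.lam z ≠ 0) (hp : z ∉ P.poles₁) :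
    ContinuousWithinAt (fun z => Φp x t z i 0 * P.osc 0 x t z / P.s₁ Φp Φm z)
      (P.Dplus ∪ P.contSpec) z :=
  (continuousOn_jost h hq hJ x t i z hz).div (continuousWithinAt_s₁ h hq hJ hz hl)
    (s₁_ne h hq hJ hS hR hZ hz hl hp)

lemma differentiableAt_col₁ (x t : ℝ) (i : Fin 2) {z : ℂ} (hz : z ∈ P.Dplus)
    (hp : z ∉ P.poles₁) :
    DifferentiableAt ℂ (fun z => Φp x t z i 0 * P.osc 0 x t z / P.s₁ Φp Φm z) z :=
  ((differentiableOn_jost h hq hJ x t i).differentiableAt (h.isOpen_Dplus.mem_nhds hz)).div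
    ((differentiableOn_s₁ h hq hJ).differentiableAt (h.isOpen_Dplus.mem_nhds hz))
    (s₁_ne h hq hJ hS hR hZ (Or.inl hz) (h.lam_ne_of_mem_Dplus hz) hp)

omit hS hR hZ in
-- This transports continuity and analyticity of the first column in D⁺ to the second column in D⁻.
lemma col₂_eq {z : ℂ} (x t : ℝ) (i : Fin 2) (hz : z ∈ P.Dminus ∪ P.contSpec) :
    Φp x t z i 1 * P.osc 1 x t z / P.s₂ Φp Φm z = I * P.qp * P.hat z / (P.ε * P.q₀ ^ 2 * P.δ) *
      (Φp x t (P.hat z) i 0 * P.osc 0 x t (P.hat z) / P.s₁ Φp Φm (P.hat z)) := by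
  rw [jost_p2_eq h hq hJ hz, s₂_eq h hq hJ hz, mul_div_mul_comm, div_div]

lemma continuousWithinAt_col₂ (x t : ℝ) (i : Fin 2) {z : ℂ} (hz : z ∈ P.Dminus ∪ P.contSpec)
    (hl : P.lam z ≠ 0) (hp : z ∉ P.poles₂) :
    ContinuousWithinAt (fun z => Φp x t z i 1 * P.osc 1 x t z / P.s₂ Φp Φm z)
      (P.Dminus ∪ P.contSpec) z := by
  have hz0 := (h.mem_Dminus_union.1 hz).1
  have h1 := continuousWithinAt_col₁ h hq hJ hS hR hZ x t i (h.hat_mem_Dplus_union hz)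
    (by rw [h.lam_hat]; exact neg_ne_zero.2 hl) (fun h' => hp (h.hat_mem_poles₁.1 h'))
  have h2 := ContinuousWithinAt.comp h1 ((analyticAt_hat hz0).continuousAt.continuousWithinAt
    (s := P.Dminus ∪ P.contSpec)) fun w hw => h.hat_mem_Dplus_union hw
  have h3 : ContinuousWithinAt (fun z => I * P.qp * P.hat z / (P.ε * P.q₀ ^ 2 * P.δ))
      (P.Dminus ∪ P.contSpec) z :=
    (((analyticAt_const.mul (analyticAt_hat hz0)).div_const).continuousAt).continuousWithinAt
  exact (h3.mul h2).congr (fun w hw => col₂_eq h hq hJ x t i hw) (col₂_eq h hq hJ x t i hz)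

lemma differentiableAt_col₂ (x t : ℝ) (i : Fin 2) {z : ℂ} (hz : z ∈ P.Dminus)
    (hp : z ∉ P.poles₂) :
    DifferentiableAt ℂ (fun z => Φp x t z i 1 * P.osc 1 x t z / P.s₂ Φp Φm z) z := by
  have hz0 := (h.mem_Dminus.1 hz).1
  have h1 := differentiableAt_col₁ h hq hJ hS hR hZ x t i (h.hat_mem_Dplus.2 hz)
    (fun h' => hp (h.hat_mem_poles₁.1 h'))
  have h3 : DifferentiableAt ℂ (fun z => I * P.qp * P.hat z / (P.ε * P.q₀ ^ 2 * P.δ)) z :=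
    ((analyticAt_const.mul (analyticAt_hat hz0)).div_const).differentiableAt
  refine (h3.mul (h1.comp z (analyticAt_hat hz0).differentiableAt)).congr_of_eventuallyEq ?_
  filter_upwards [h.isOpen_Dminus.mem_nhds hz] with w hw
  exact col₂_eq h hq hJ x t i (Or.inl hw)

/-- Absence of reflection means Φ₊,₁/s₁₁ = Φ₋,₁ on Σ₀: there is no jump, and the gluing theorem
continues the column across the spectrum. -/
theorem analyticAt_jostM₁ (x t : ℝ) (i : Fin 2) {p : ℂ} (hp0 : p ≠ 0) (hl : P.lam p ≠ 0)
    (hp : p ∉ P.poles₁) : AnalyticAt ℂ (fun z => P.jostM Φp Φm S x t z i 0) p := by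
  classical
  have e1 := eventually_not_mem_poles₁ hp
  have e2 := eventually_lam_ne_zero hp0 hl
  refine (h.analyticAt_glue (F := fun z => Φp x t z i 0 * P.osc 0 x t z / P.s₁ Φp Φm z)
    (G := fun z => Φm x t z i 0 * P.osc 0 x t z) hp0 ?_ ?_ ?_ ?_ ?_).congr ?_
  · filter_upwards [e1, e2] with z h1 h2 hz
    exact continuousWithinAt_col₁ h hq hJ hS hR hZ x t i hz h2 h1
  · exact Eventually.of_forall fun z hz => continuousOn_jost_m1 h hq hJ x t i z hz
  · filter_upwards [e1] with z h1 hz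
    exact differentiableAt_col₁ h hq hJ hS hR hZ x t i hz h1
  · exact Eventually.of_forall fun z hz => (differentiableOn_jost_m1 h hq hJ x t i).differentiableAt
      (h.isOpen_Dminus.mem_nhds hz)
  · filter_upwards [e1, e2] with z h1 h2 hz
    have hz' : z ∈ P.contSpec₀ := h.mem_contSpec₀.2
      ⟨(h.mem_contSpec.1 hz).1, (h.mem_contSpec.1 hz).2, h2⟩
    rw [(rel_reflectionless hS hR hz' x t i).1, (scattering_on_contSpec₀ h hJ hS hR hz').1]
    have := s₁_ne_zero h hq hJ hS hR hz'
    field_simp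
  · refine Eventually.of_forall fun z => ?_
    by_cases hz : z ∈ P.Dplus
    · simp [jostM, hz, S_eq_s₁ hS hz]
    · simp [jostM, hz]

theorem analyticAt_jostM₂ (x t : ℝ) (i : Fin 2) {p : ℂ} (hp0 : p ≠ 0) (hl : P.lam p ≠ 0)
    (hp : p ∉ P.poles₂) : AnalyticAt ℂ (fun z => P.jostM Φp Φm S x t z i 1) p := by
  classical
  have e1 := eventually_not_mem_poles₂ hp
  have e2 := eventually_lam_ne_zero hp0 hl
  have e3 : ∀ᶠ z in 𝓝 p, z ≠ 0 := isOpen_ne.mem_nhds hp0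
  refine (h.analyticAt_glue (F := fun z => Φm x t z i 1 * P.osc 1 x t z)
    (G := fun z => Φp x t z i 1 * P.osc 1 x t z / P.s₂ Φp Φm z) hp0 ?_ ?_ ?_ ?_ ?_).congr ?_
  · exact Eventually.of_forall fun z hz => continuousOn_jost_m h hq hJ x t i z hz
  · filter_upwards [e1, e2] with z h1 h2 hz
    exact continuousWithinAt_col₂ h hq hJ hS hR hZ x t i hz h2 h1
  · exact Eventually.of_forall fun z hz => (differentiableOn_jost_m h hq hJ x t i).differentiableAt
      (h.isOpen_Dplus.mem_nhds hz)
  · filter_upwards [e1] with z h1 hz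
    exact differentiableAt_col₂ h hq hJ hS hR hZ x t i hz h1
  · filter_upwards [e1, e2] with z h1 h2 hz
    have hz' : z ∈ P.contSpec₀ := h.mem_contSpec₀.2
      ⟨(h.mem_contSpec.1 hz).1, (h.mem_contSpec.1 hz).2, h2⟩
    have := s₂_ne h hq hJ hS hR hZ (Or.inr hz) h2 h1
    rw [(rel_reflectionless hS hR hz' x t i).2, (scattering_on_contSpec₀ h hJ hS hR hz').2]
    field_simp
  · filter_upwards [e2, e3] with z h2 h3
    by_cases hz : z ∈ P.Dplus
    · simp [jostM, hz]
    · simp [jostM, hz, S_eq_s₂' h hJ hS hR (h.mem_Dminus_union_of_not_mem h3 hz) h2]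

/-- The symmetry of `M` under `z ↦ ε q₀² / z`. -/
lemma jostM_hat (x t : ℝ) (i : Fin 2) {z : ℂ} (hz0 : z ≠ 0) (hl : P.lam z ≠ 0)
    (hp : z ∉ P.poles₁) : P.jostM Φp Φm S x t z i 0 =
      -(I * P.qm * P.hat z / P.q₀ ^ 2) * P.jostM Φp Φm S x t (P.hat z) i 1 := by
  have hc := h.cast_ne
  have hq0 : (P.q₀ : ℂ) ≠ 0 := by exact_mod_cast h.pos.ne'
  have hqm : (P.qm : ℂ) ^ 2 = P.q₀ ^ 2 := by exact_mod_cast h.qm_sq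
  have hε : (P.ε : ℂ) ≠ 0 := left_ne_zero_of_mul hc
  have hδ2 : (P.δ : ℂ) ^ 2 = 1 := by exact_mod_cast h.delta_sq
  have hδ : (P.δ : ℂ) ≠ 0 := by rcases h.delta with h | h <;> simp [h]
  by_cases hz : z ∈ P.Dplus
  · have hz' := h.hat_mem_Dminus.2 hz
    have hn := h.not_mem_Dplus_of_mem_Dminus hz'
    have e := col₂_eq h hq hJ x t i (Or.inl hz')
    rw [h.hat_hat] at e
    simp only [jostM, hz, hn, if_true, if_false, of_apply, cons_val_zero, cons_val_one,
      S_eq_s₁ hS hz, S_eq_s₂ hS hz', e]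
    simp only [hat, qp]
    push_cast
    rw [← hqm]
    have : (P.qm : ℂ) ≠ 0 := by exact_mod_cast h.qm_ne
    have hs := s₁_ne h hq hJ hS hR hZ (Or.inl hz) hl hp
    field_simp
    linear_combination (Φp x t z i 0 * P.osc 0 x t z) * I_sq
  · have hz' := h.mem_Dminus_union_of_not_mem hz0 hz
    have e := jost_m1_eq h hq hJ hz' x t i
    rcases h.mem_contSpec₀_or hz' hl with hm | hm
    · have hzp := h.hat_mem_Dplus.2 hm
      simp only [jostM, hz, hzp, if_true, if_false, of_apply, cons_val_zero, cons_val_one, e]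
    -- The involution preserves Σ₀, so z and `hat z` both fall into the second branch of `jostM`;
    -- the reflectionless relation Φ₊,₂ = s₂₂Φ₋,₂ supplies the missing identity.
    · have hm' : P.hat z ∈ P.contSpec₀ := by
        rw [h.mem_contSpec₀] at hm ⊢
        rw [h.lam_hat]
        exact ⟨h.hat_ne hm.1, by simpa using hm.2.1, neg_ne_zero.2 hm.2.2⟩
      have hn := h.not_mem_Dplus_of_mem_contSpec hm'.1
      have e2 := (rel_reflectionless hS hR hm' x t i).2
      have hs : S (P.hat z) 1 1 ≠ 0 := by
        rw [(scattering_on_contSpec₀ h hJ hS hR hm').2,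
          s₂_hat h hq hJ (Or.inr hm.1)]
        exact mul_ne_zero hδ (s₁_ne_zero h hq hJ hS hR hm)
      simp only [jostM, hz, hn, if_false, of_apply, cons_val_zero, cons_val_one, e, e2]
      field_simp

end Params

end NonlocalMKdV

end

/-! ### M at infinity, at the origin and at branch points; the determinant formula. -/

noncomputable section

namespace NonlocalMKdV

namespace Params

variable {P : Params} {q : ℝ → ℝ → ℝ} (h : P.Admissible) (hq : P.IsSolution q)
  {Φp Φm : ℝ → ℝ → ℂ → Matrix (Fin 2) (Fin 2) ℂ} (hJ : P.IsJost q Φp Φm)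
  {S : ℂ → Matrix (Fin 2) (Fin 2) ℂ} (hS : P.IsScattering Φp Φm S)
  (hR : P.IsReflectionless S)
  (hZ : ∀ z ∈ P.Dplus, S z 0 0 = 0 → z ∈ P.poles₁)

/-! ### Behaviour of `M` at infinity, at the origin and at the branch points -/

include h in
-- With the symmetry of M this reads off the behaviour at the origin from that at infinity.
lemma Admissible.tendsto_hat_zero : Tendsto P.hat (𝓝[≠] 0) (Bornology.cobounded ℂ) := by
  have hi : Tendsto (fun w : ℂ => w⁻¹) (𝓝[≠] 0) (Bornology.cobounded ℂ) := by
    rw [← Filter.inv_cobounded₀]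
    exact tendsto_map'_iff.2 (by simpa [Function.comp_def] using tendsto_id)
  have := (tendsto_mul_left_cobounded h.cast_ne).comp hi
  exact this.congr fun z => by simp [hat, div_eq_mul_inv]

include h in
lemma Admissible.tendsto_hat_branch {p : ℂ} (hp : p ≠ 0) (hl : P.lam p = 0) :
    Tendsto P.hat (𝓝[≠] p) (𝓝[≠] p) := by
  have hpp : P.hat p = p := by
    have := (lam_eq_zero_iff hp).1 hl
    rw [hat, ← this]; field_simp
  refine tendsto_nhdsWithin_iff.2 ⟨?_, ?_⟩
  · have := (analyticAt_hat (P := P) hp).continuousAt.tendsto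
    rw [hpp] at this
    exact this.mono_left nhdsWithin_le_nhds
  · filter_upwards [self_mem_nhdsWithin] with z hz hz'
    exact hz (by rw [Set.mem_singleton_iff, ← h.hat_hat z, show P.hat z = p from hz', hpp])

include h hq hJ hS

/-- The first row of `M` at infinity. -/
theorem tendsto_jostM₁ (x t : ℝ) : Tendsto (fun z => P.jostM Φp Φm S x t z 0 0)
    (Bornology.cobounded ℂ) (𝓝 1) := by
  have hpos : ∀ᶠ z in Bornology.cobounded ℂ, z ≠ 0 ∧ P.lam z ≠ 0 := by
    filter_upwards [eventually_cobounded_le_norm (P.q₀ + 1)] with z hz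
    have : P.q₀ < ‖z‖ := by linarith
    exact ⟨norm_pos_iff.1 (h.pos.trans this), h.lam_ne_zero this⟩
  have h1 : Tendsto (fun z => P.jostM Φp Φm S x t z 0 0) (Bornology.cobounded ℂ ⊓ 𝓟 P.Dplus)
      (𝓝 1) := by
    have a := (continuous_fst.tendsto _).comp (tendsto_jost_p1 h hq hJ x t)
    have b := (a.div (tendsto_s₁ h hq hJ) one_ne_zero).mono_left
      (inf_le_inf_left _ (principal_mono.2 (Set.subset_union_left (s := P.Dplus))))
    rw [div_one] at b
    refine b.congr' ?_
    filter_upwards [mem_inf_of_right (mem_principal_self _)] with z hz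
    simp [jostM, hz, S_eq_s₁ hS hz]
  have h2 : Tendsto (fun z => P.jostM Φp Φm S x t z 0 0) (Bornology.cobounded ℂ ⊓ 𝓟 P.Dplusᶜ)
      (𝓝 1) := by
    have a := (continuous_fst.tendsto _).comp (tendsto_jost_p2 h hq hJ (-x) (-t))
    have b := a.mono_left (y := Bornology.cobounded ℂ ⊓ 𝓟 P.Dplusᶜ) ?_
    · refine b.congr' ?_
      filter_upwards [mem_inf_of_right (mem_principal_self _), mem_inf_of_left hpos] with z hz hz0
      have := h.mem_Dminus_union_of_not_mem hz0.1 hz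
      simp [jostM, show z ∉ P.Dplus from hz, jost_reflect' h hq hJ this, osc_one_neg]
    · refine le_inf inf_le_left (le_principal_iff.2 ?_)
      filter_upwards [mem_inf_of_right (mem_principal_self _), mem_inf_of_left hpos] with z hz hz0
      exact h.mem_Dminus_union_of_not_mem hz0.1 hz
  have := h1.sup h2
  rwa [← inf_sup_left, sup_principal, Set.union_compl_self, principal_univ, inf_top_eq] at this

include hR in
theorem tendsto_jostM₂ (x t : ℝ) : Tendsto (fun z => P.jostM Φp Φm S x t z 0 1)
    (Bornology.cobounded ℂ) (𝓝 0) := by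
  have hpos : ∀ᶠ z in Bornology.cobounded ℂ, z ≠ 0 ∧ P.lam z ≠ 0 := by
    filter_upwards [eventually_cobounded_le_norm (P.q₀ + 1)] with z hz
    have : P.q₀ < ‖z‖ := by linarith
    exact ⟨norm_pos_iff.1 (h.pos.trans this), h.lam_ne_zero this⟩
  have h1 : Tendsto (fun z => P.jostM Φp Φm S x t z 0 1) (Bornology.cobounded ℂ ⊓ 𝓟 P.Dplus)
      (𝓝 0) := by
    have a := ((continuous_snd.tendsto _).comp (tendsto_jost_p1 h hq hJ (-x) (-t))).const_mul
      (-P.σ : ℂ)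
    have b := a.mono_left
      (inf_le_inf_left _ (principal_mono.2 (Set.subset_union_left (s := P.Dplus))))
    rw [mul_zero] at b
    refine b.congr' ?_
    filter_upwards [mem_inf_of_right (mem_principal_self _)] with z hz
    simp [jostM, hz, jost_reflect h hq hJ (Or.inl hz), osc_zero_neg, mul_assoc]
  have h2 : Tendsto (fun z => P.jostM Φp Φm S x t z 0 1) (Bornology.cobounded ℂ ⊓ 𝓟 P.Dplusᶜ)
      (𝓝 0) := by
    have a := ((continuous_snd.tendsto _).comp (tendsto_jost_p2 h hq hJ x t)).div
      (tendsto_s₂ h hq hJ) one_ne_zero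
    rw [zero_div] at a
    have b := a.mono_left (y := Bornology.cobounded ℂ ⊓ 𝓟 P.Dplusᶜ) ?_
    · refine b.congr' ?_
      filter_upwards [mem_inf_of_right (mem_principal_self _), mem_inf_of_left hpos] with z hz hz0
      have := h.mem_Dminus_union_of_not_mem hz0.1 hz
      simp [jostM, show z ∉ P.Dplus from hz, S_eq_s₂' h hJ hS hR this hz0.2]
    · refine le_inf inf_le_left (le_principal_iff.2 ?_)
      filter_upwards [mem_inf_of_right (mem_principal_self _), mem_inf_of_left hpos] with z hz hz0
      exact h.mem_Dminus_union_of_not_mem hz0.1 hz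
  have := h1.sup h2
  rwa [← inf_sup_left, sup_principal, Set.union_compl_self, principal_univ, inf_top_eq] at this

include hR hZ

lemma jostM_hat₂ (x t : ℝ) (i : Fin 2) {w : ℂ} (hw0 : w ≠ 0) (hl : P.lam w ≠ 0)
    (hp : w ∉ P.poles₂) : P.jostM Φp Φm S x t w i 1 =
      I * P.qm / w * P.jostM Φp Φm S x t (P.hat w) i 0 := by
  have hqm : (P.qm : ℂ) ^ 2 = P.q₀ ^ 2 := by exact_mod_cast h.qm_sq
  have := jostM_hat h hq hJ hS hR hZ x t i (h.hat_ne hw0) (by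
    rw [h.lam_hat]; exact neg_ne_zero.2 hl) (fun h' => hp (h.hat_mem_poles₁.1 h'))
  rw [this, h.hat_hat, ← hqm]
  have : (P.qm : ℂ) ≠ 0 := by exact_mod_cast h.qm_ne
  field_simp
  linear_combination (P.jostM Φp Φm S x t w i 1) * I_sq

omit hZ in
-- Inside D⁺ the nonzero limit of s₁₁ keeps the quotient bounded; outside, the column is
-- Φ₋,₁·exp(-iθ), which is continuous up to p.
lemma isBigO_jostM₁_branch (x t : ℝ) (i : Fin 2) {p : ℂ} (hp : p ≠ 0) (hl : P.lam p = 0) :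
    (fun z => P.jostM Φp Φm S x t z i 0) =O[𝓝[≠] p] (fun _ => (1 : ℂ)) := by
  have hpS : p ∈ P.contSpec := h.mem_contSpec.2 ⟨hp, by simp [hl]⟩
  obtain ⟨c, hc, ht⟩ := exists_tendsto_s₁ h hq hJ hS hR hp hl
  have h1 : (fun z => P.jostM Φp Φm S x t z i 0) =O[𝓝[P.Dplus] p] (fun _ => (1 : ℂ)) := by
    have a := ((continuousOn_jost h hq hJ x t i p (Or.inr hpS)).tendsto.mono_left
      (nhdsWithin_mono _ (Set.subset_union_left (s := P.Dplus)))).div ht hc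
    refine (a.isBigO_one ℂ).congr' ?_ EventuallyEq.rfl
    filter_upwards [self_mem_nhdsWithin] with z hz
    simp [jostM, hz, S_eq_s₁ hS hz]
  have h2 : (fun z => P.jostM Φp Φm S x t z i 0) =O[𝓝[P.Dplusᶜ] p] (fun _ => (1 : ℂ)) := by
    have a := (continuousOn_jost_m1 h hq hJ x t i p (Or.inr hpS)).tendsto.mono_left
      (show 𝓝[P.Dplusᶜ] p ≤ _ from nhdsWithin_le_of_mem ?_)
    · refine (a.isBigO_one ℂ).congr' ?_ EventuallyEq.rfl
      filter_upwards [self_mem_nhdsWithin] with z hz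
      simp [jostM, show z ∉ P.Dplus from hz]
    · filter_upwards [self_mem_nhdsWithin, mem_nhdsWithin_of_mem_nhds (isOpen_ne.mem_nhds hp)]
        with z hz hz0
      exact h.mem_Dminus_union_of_not_mem hz0 hz
  have := h1.sup h2
  rw [← nhdsWithin_union, Set.union_compl_self, nhdsWithin_univ] at this
  exact this.mono nhdsWithin_le_nhds

variable (hz₀ : P.z₀ ∈ P.Dplus)

omit hq hJ hS hR hZ in
include hz₀ in
lemma Admissible.poles₁_subset : P.poles₁ ⊆ P.Dplus := by
  rintro z (rfl | rfl)
  exacts [hz₀, h.neg_conj_mem_Dplus.2 hz₀]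

omit hq hJ hS hR hZ in
include hz₀ in
lemma Admissible.poles₂_subset : P.poles₂ ⊆ P.Dminus := by
  intro z hz
  rw [← h.hat_hat z]
  exact h.hat_mem_Dminus.2 (h.poles₁_subset hz₀ (h.hat_mem_poles₁.2 hz))

include hz₀

lemma regularAt_jostM₁_branch (x t : ℝ) (i : Fin 2) {p : ℂ} (hp : p ≠ 0) (hl : P.lam p = 0) :
    RegularAt (fun z => P.jostM Φp Φm S x t z i 0) p := by
  refine regularAt_of_bounded ?_ (isBigO_jostM₁_branch h hq hJ hS hR x t i hp hl)
  filter_upwards [Admissible.eventually_lam_ne hp, mem_nhdsWithin_of_mem_nhds (isOpen_ne.mem_nhds hp),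
    mem_nhdsWithin_of_mem_nhds (eventually_not_mem_poles₁ (P := P) (p := p) fun h' =>
      h.lam_ne_of_mem_Dplus (h.poles₁_subset hz₀ h') hl)] with z h1 h2 h3
  exact (analyticAt_jostM₁ h hq hJ hS hR hZ x t i h2 h1 h3).differentiableAt

lemma regularAt_jostM₂_branch (x t : ℝ) (i : Fin 2) {p : ℂ} (hp : p ≠ 0) (hl : P.lam p = 0) :
    RegularAt (fun z => P.jostM Φp Φm S x t z i 1) p := by
  have hev : ∀ᶠ z in 𝓝[≠] p, P.lam z ≠ 0 ∧ z ≠ 0 ∧ z ∉ P.poles₂ := by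
    filter_upwards [Admissible.eventually_lam_ne hp,
      mem_nhdsWithin_of_mem_nhds (isOpen_ne.mem_nhds hp),
      mem_nhdsWithin_of_mem_nhds (eventually_not_mem_poles₂ (P := P) (p := p) fun h' =>
        h.lam_ne_of_mem_Dminus (h.poles₂_subset hz₀ h') hl)] with z h1 h2 h3
    exact ⟨h1, h2, h3⟩
  refine regularAt_of_bounded ?_ ?_
  · filter_upwards [hev] with z hz
    exact (analyticAt_jostM₂ h hq hJ hS hR hZ x t i hz.2.1 hz.1 hz.2.2).differentiableAt
  · have h1 := (isBigO_jostM₁_branch h hq hJ hS hR x t i hp hl).comp_tendsto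
      (h.tendsto_hat_branch hp hl)
    have h2 : (fun z : ℂ => I * P.qm / z) =O[𝓝[≠] p] (fun _ => (1 : ℂ)) :=
      (((continuousAt_const.div continuousAt_id hp :
        ContinuousAt (fun z : ℂ => I * P.qm / z) p)).tendsto.mono_left
          nhdsWithin_le_nhds).isBigO_one ℂ
    refine (h2.mul h1).congr' ?_ (by simp)
    filter_upwards [hev] with z hz
    exact (jostM_hat₂ h hq hJ hS hR hZ x t i hz.2.1 hz.1 hz.2.2).symm

variable (hre : 0 < P.z₀.re) {N : ℕ} {r rt : ℂ → ℂ} {c : Coeffs}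
  (hL : P.HasLaurentCoeffs N r rt c)

/-- The first row of `M` solves the Riemann-Hilbert problem. -/
theorem exists_isRow_jostM (x t : ℝ) (hM : P.ResidueConditions r rt x t (P.jostM Φp Φm S x t)) :
    ∃ m₁ m₂ : ℂ → ℂ, (h.rowData hz₀ hre hL x t).IsRow 1 0 0 (I * P.qm) m₁ m₂ ∧
      ∀ᶠ z in Bornology.cobounded ℂ, m₂ z = P.jostM Φp Φm S x t z 0 1 := by
  have hfin := finite_branch (P := P)
  -- At the branch points themselves `S` is not controlled by the hypotheses, so the values of M
  -- there are replaced by the removable ones.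
  obtain ⟨m₁, d1, e1, f1⟩ := exists_extension hfin fun p hp =>
    regularAt_jostM₁_branch h hq hJ hS hR hZ hz₀ x t 0 hp.1 hp.2
  obtain ⟨m₂, d2, e2, f2⟩ := exists_extension hfin fun p hp =>
    regularAt_jostM₂_branch h hq hJ hS hR hZ hz₀ x t 0 hp.1 hp.2
  have diff1 : ∀ z, z ≠ 0 → z ∉ P.poles₁ → DifferentiableAt ℂ m₁ z := fun z hz0 hz => by
    by_cases hl : P.lam z = 0
    · exact d1 z ⟨hz0, hl⟩
    · exact e1 z (fun h' => hl h'.2)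
        (analyticAt_jostM₁ h hq hJ hS hR hZ x t 0 hz0 hl hz).differentiableAt
  have diff2 : ∀ z, z ≠ 0 → z ∉ P.poles₂ → DifferentiableAt ℂ m₂ z := fun z hz0 hz => by
    by_cases hl : P.lam z = 0
    · exact d2 z ⟨hz0, hl⟩
    · exact e2 z (fun h' => hl h'.2)
        (analyticAt_jostM₂ h hq hJ hS hR hZ x t 0 hz0 hl hz).differentiableAt
  have hfar : ∀ {T : Set ℂ}, T.Finite → ∀ᶠ z in Bornology.cobounded ℂ, z ∉ T := fun hT =>
    Bornology.isBounded_def.1 hT.isBounded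
  have ev1 : ∀ᶠ z in Bornology.cobounded ℂ, m₁ z = P.jostM Φp Φm S x t z 0 0 :=
    (hfar hfin).mono f1
  have ev2 : ∀ᶠ z in Bornology.cobounded ℂ, m₂ z = P.jostM Φp Φm S x t z 0 1 :=
    (hfar hfin).mono f2
  have inf1 : (fun z => m₁ z - 1) =O[Bornology.cobounded ℂ] (fun z => z⁻¹) := by
    refine isBigO_inv_of_differentiable ?_ ((tendsto_jostM₁ h hq hJ hS x t).congr'
      (ev1.mono fun z hz => hz.symm))
    filter_upwards [hfar (Set.finite_singleton 0), hfar P.finite_poles₁] with z h1 h2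
      using diff1 z h1 h2
  have inf2 : (fun z => m₂ z - 0) =O[Bornology.cobounded ℂ] (fun z => z⁻¹) := by
    refine isBigO_inv_of_differentiable ?_ ((tendsto_jostM₂ h hq hJ hS hR x t).congr'
      (ev2.mono fun z hz => hz.symm))
    filter_upwards [hfar (Set.finite_singleton 0), hfar P.finite_poles₂] with z h1 h2
      using diff2 z h1 h2
  have hinv : (fun z : ℂ => (P.hat z)⁻¹) =O[𝓝[≠] 0] fun z => z :=
    (isBigO_refl _ _).const_mul_left ((P.ε : ℂ) * P.q₀ ^ 2)⁻¹ |>.congr_left fun z => by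
      rw [hat, inv_div]; ring
  have hzinv : (fun z : ℂ => z⁻¹ * z) =O[𝓝[≠] 0] fun _ => (1 : ℂ) :=
    (isBigO_refl (fun _ : ℂ => (1 : ℂ)) (𝓝[≠] 0)).congr'
      (eventually_nhdsWithin_of_forall fun z hz => (inv_mul_cancel₀ hz).symm) EventuallyEq.rfl
  -- The symmetry gives m₁(z) = -(iεq₋/z) m₂(ẑ), and m₂(ẑ) = O(1/ẑ) = O(z).
  have zero1 : (fun z => m₁ z - 0 / z) =O[𝓝[≠] 0] (fun _ => (1 : ℂ)) := by
    have a := (inf2.comp_tendsto h.tendsto_hat_zero).trans hinv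
    have b := (((isBigO_refl (fun z : ℂ => z⁻¹) (𝓝[≠] 0)).const_mul_left
      (-(I * P.qm * P.ε))).mul a).trans hzinv
    refine b.congr' ?_ EventuallyEq.rfl
    filter_upwards [self_mem_nhdsWithin, eventually_not_mem_of_finite hfin 0, eventually_not_mem_of_finite P.finite_poles₁ 0,
      h.tendsto_hat_zero.eventually ev2] with z h0 h1 h2 h3
    have hl : P.lam z ≠ 0 := fun h' => h1 ⟨h0, h'⟩
    rw [Function.comp, h3, zero_div, sub_zero, sub_zero, f1 z h1,
      jostM_hat h hq hJ hS hR hZ x t 0 h0 hl h2]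
    have hq0 : (P.q₀ : ℂ) ≠ 0 := by exact_mod_cast h.pos.ne'
    have h0' : z ≠ 0 := h0
    simp only [hat]
    field_simp
  have zero2 : (fun z => m₂ z - I * P.qm / z) =O[𝓝[≠] 0] (fun _ => (1 : ℂ)) := by
    have a := (inf1.comp_tendsto h.tendsto_hat_zero).trans hinv
    have b := (((isBigO_refl (fun z : ℂ => z⁻¹) (𝓝[≠] 0)).const_mul_left
      (I * P.qm)).mul a).trans hzinv
    refine b.congr' ?_ EventuallyEq.rfl
    filter_upwards [self_mem_nhdsWithin, eventually_not_mem_of_finite hfin 0, eventually_not_mem_of_finite P.finite_poles₂ 0,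
      h.tendsto_hat_zero.eventually ev1] with z h0 h1 h2 h3
    have hl : P.lam z ≠ 0 := fun h' => h1 ⟨h0, h'⟩
    rw [Function.comp, h3, f2 z h1, jostM_hat₂ h hq hJ hS hR hZ x t 0 h0 hl h2]
    ring
  have res1 : ∀ p ∈ P.poles₁, RegularAt
      (fun z => m₁ z - exp (-2 * I * P.θ x t z) * r z * m₂ z) p := fun p hp =>
    (hM.1 p hp 0).congr ((eventually_not_mem_of_finite hfin p).mono fun z hz => by
      simp only [f1 z hz, f2 z hz])
  have res2 : ∀ p ∈ P.poles₂, RegularAt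
      (fun z => m₂ z - exp (2 * I * P.θ x t z) * rt z * m₁ z) p := fun p hp =>
    (hM.2 p hp 0).congr ((eventually_not_mem_of_finite hfin p).mono fun z hz => by
      simp only [f1 z hz, f2 z hz])
  refine ⟨m₁, m₂, ⟨?_, ?_, res1 _ (Or.inl rfl), res1 _ (Or.inr rfl), res2 _ (Or.inl rfl),
    res2 _ (Or.inr rfl), inf1, inf2, zero1, zero2⟩, ev2⟩
  · exact fun z hz => (diff1 z (fun h' => hz (Or.inl h'))
      fun h' => hz (Or.inr h')).differentiableWithinAt
  · exact fun z hz => (diff2 z (fun h' => hz (Or.inl h'))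
      fun h' => hz (Or.inr h')).differentiableWithinAt

include hre hL in
/-- The potential is given by the determinant formula. -/
theorem eq_soliton (x t : ℝ) (hM : P.ResidueConditions r rt x t (P.jostM Φp Φm S x t))
    (hA : (P.A N c x t).det ≠ 0) : (q x t : ℂ) = P.soliton N c x t := by
  obtain ⟨m₁, m₂, hrow, hev⟩ := exists_isRow_jostM h hq hJ hS hR hZ hz₀ hre hL x t hM
  have hsI : Tendsto (fun s : ℝ => (s : ℂ) * I) atTop (Bornology.cobounded ℂ) := by
    rw [← tendsto_norm_atTop_iff_cobounded]
    simpa using tendsto_abs_atTop_atTop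
  have h1 := (h.tendsto_of_isRow hz₀ hre hL x t hA hrow).comp hsI
  have hD : ∀ᶠ s : ℝ in atTop, (s : ℂ) * I ∈ P.Dplus := by
    filter_upwards [eventually_gt_atTop P.q₀] with s hs
    have hs0 : 0 < s := h.pos.trans hs
    rcases h.eps with he | he
    · rw [Dplus, if_pos he]; simpa using hs0
    · rw [Dplus, if_neg (by rw [he]; norm_num)]
      simpa [abs_of_pos hs0] using mul_pos (sub_pos.2 hs) hs0
  -- In D⁺ the entry M₁₂ comes from Φ₋,₂, that is, -σ times the second component of the right
  -- half-line solution at (-x,-t). Its leading coefficient there is -iσq(x,t), which brings in the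
  -- potential at the required point.
  have h2 := (hq.halfLine h (-t)).tendsto_mul_snd
    (hq.hasDerivAt_halfLine_u h (-t)) (hq.continuous_dx_ofReal (-t))
    (hq.hasDerivAt_halfLine_w h (-t)) (hq.continuous_dx_rst (-t))
    (Φ := fun z x => (Φp x (-t) z 0 0 * P.osc 0 x (-t) z, Φp x (-t) z 1 0 * P.osc 0 x (-t) z))
    (hD.mono fun s hs => by rw [halfLine_lam]; exact (h.mem_Dplus.1 hs).2.le)
    (hD.mono fun s hs => isSol_p1 h hq hJ (Or.inl hs) (-t)) (-x)
  have h3 : Tendsto (fun s : ℝ => -I * ((s * I) * m₂ (s * I))) atTop (𝓝 (q x t)) := by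
    have s2 : (P.σ : ℂ) ^ 2 = 1 := by exact_mod_cast h.sigma_sq
    have := h2.const_mul (I * P.σ)
    have e : I * P.σ * (-I * (hq.halfLine h (-t)).w (-x)) = q x t := by
      simp only [IsSolution.halfLine, rst, neg_neg]
      linear_combination (q x t : ℂ) * s2 - (P.σ : ℂ) ^ 2 * q x t * I_sq
    rw [e] at this
    refine this.congr' ?_
    filter_upwards [hD, hsI.eventually hev] with s hs hs'
    rw [hs']
    simp [jostM, hs, jost_reflect h hq hJ (Or.inl hs), osc_zero_neg]
    ring
  exact tendsto_nhds_unique h3 h1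

end Params

end NonlocalMKdV

end

/-! ### Transport of the order of vanishing by the symmetries. -/

noncomputable section

namespace NonlocalMKdV

/-! ### Orders of zeros -/

lemma analyticAt_conj_neg_conj {f : ℂ → ℂ} {p : ℂ} (hf : AnalyticAt ℂ f p) :
    AnalyticAt ℂ (fun z => conj (f (-conj z))) (-conj p) := by
  have hc : Tendsto (fun z : ℂ => -conj z) (𝓝 (-conj p)) (𝓝 p) := by
    have : Continuous fun z : ℂ => -conj z := continuous_conj.neg
    simpa using this.tendsto (-conj p)
  rw [analyticAt_iff_eventually_differentiableAt] at hf ⊢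
  filter_upwards [hc.eventually hf] with z hz
  have h1 : DifferentiableAt ℂ (fun w => f (-w)) (conj z) :=
    DifferentiableAt.comp (conj z) hz differentiableAt_id.neg
  have := h1.conj_conj
  simpa [Function.comp_def] using this

/-- The factor (z-p)^n becomes (-1)^n (z+p*)^n; the sign is put into the nonvanishing factor. -/
lemma analyticOrderAt_conj_neg_conj {f : ℂ → ℂ} {p : ℂ} {n : ℕ} (hf : AnalyticAt ℂ f p)
    (h : analyticOrderAt f p = n) :
    analyticOrderAt (fun z => conj (f (-conj z))) (-conj p) = n := by
  rw [hf.analyticOrderAt_eq_natCast] at h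
  obtain ⟨g, hg, hg0, e⟩ := h
  rw [(analyticAt_conj_neg_conj hf).analyticOrderAt_eq_natCast]
  have hc : Tendsto (fun z : ℂ => -conj z) (𝓝 (-conj p)) (𝓝 p) := by
    have : Continuous fun z : ℂ => -conj z := continuous_conj.neg
    simpa using this.tendsto (-conj p)
  refine ⟨fun z => (-1) ^ n * conj (g (-conj z)),
    analyticAt_const.mul (analyticAt_conj_neg_conj hg), by simpa using hg0, ?_⟩
  filter_upwards [hc.eventually e] with z hz
  rw [hz]
  simp only [smul_eq_mul, map_mul, map_pow, map_sub, map_neg, conj_conj]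
  rw [show -z - conj p = -1 * (z - -conj p) by ring, mul_pow]
  ring

namespace Params

variable {P : Params} {q : ℝ → ℝ → ℝ} (h : P.Admissible) (hq : P.IsSolution q)
  {Φp Φm : ℝ → ℝ → ℂ → Matrix (Fin 2) (Fin 2) ℂ} (hJ : P.IsJost q Φp Φm)
  {S : ℂ → Matrix (Fin 2) (Fin 2) ℂ} (hS : P.IsScattering Φp Φm S)

include h hq hJ hS

lemma analyticAt_S {p : ℂ} (hp : p ∈ P.Dplus) : AnalyticAt ℂ (fun z => S z 0 0) p := by
  refine ((differentiableOn_s₁ h hq hJ).analyticAt (h.isOpen_Dplus.mem_nhds hp)).congr ?_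
  filter_upwards [h.isOpen_Dplus.mem_nhds hp] with z hz using (S_eq_s₁ hS hz).symm

lemma S_neg_conj {z : ℂ} (hz : z ∈ P.Dplus) : S (-conj z) 0 0 = conj (S z 0 0) := by
  have hz' := h.neg_conj_mem_Dplus.2 hz
  rw [S_eq_s₁ hS hz, S_eq_s₁ hS hz', s₁, s₁, wr_eq h hq hJ (Or.inl hz),
    wr_eq h hq hJ (Or.inl hz'), jost_neg_conj h hq hJ (Or.inl hz),
    jost_neg_conj h hq hJ (Or.inl hz)]
  simp

lemma S_hat {z : ℂ} (hz : z ∈ P.Dminus) : S z 1 1 = P.δ * S (P.hat z) 0 0 := by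
  rw [S_eq_s₂ hS hz, s₂_eq h hq hJ (Or.inl hz), S_eq_s₁ hS (h.hat_mem_Dplus.2 hz)]

variable (hz₀ : P.z₀ ∈ P.Dplus) {N : ℕ} (hN : analyticOrderAt (fun z => S z 0 0) P.z₀ = N)
include hz₀ hN

theorem analyticOrderAt_poles₁ {p : ℂ} (hp : p ∈ P.poles₁) :
    analyticOrderAt (fun z => S z 0 0) p = N := by
  rcases hp with rfl | rfl
  · exact hN
  · rw [← analyticOrderAt_conj_neg_conj (analyticAt_S h hq hJ hS hz₀) hN]
    refine analyticOrderAt_congr ?_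
    have hp := h.neg_conj_mem_Dplus.2 hz₀
    filter_upwards [h.isOpen_Dplus.mem_nhds hp] with z hz
    rw [S_neg_conj h hq hJ hS hz, conj_conj]

/-- s₂₂ = δ·s₁₁∘`hat`, and `hat` is locally biholomorphic away from 0, so orders are preserved. -/
theorem analyticOrderAt_poles₂ {p : ℂ} (hp : p ∈ P.poles₂) :
    analyticOrderAt (fun z => S z 1 1) p = N := by
  have hp1 := h.hat_mem_poles₁.2 hp
  have hpD := h.poles₂_subset hz₀ hp
  have hp0 := (h.mem_Dminus.1 hpD).1
  have hd : deriv P.hat p ≠ 0 := by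
    have : deriv P.hat p = P.ε * P.q₀ ^ 2 * (-(p ^ 2)⁻¹) := by
      have := (hasDerivAt_inv hp0).const_mul ((P.ε : ℂ) * P.q₀ ^ 2)
      exact this.deriv
    rw [this]
    exact mul_ne_zero h.cast_ne (neg_ne_zero.2 (inv_ne_zero (pow_ne_zero 2 hp0)))
  have hδ : (P.δ : ℂ) ≠ 0 := by rcases h.delta with h | h <;> simp [h]
  have e : (fun z => S z 1 1) =ᶠ[𝓝 p] (fun _ => (P.δ : ℂ)) * ((fun z => S z 0 0) ∘ P.hat) := by
    filter_upwards [h.isOpen_Dminus.mem_nhds hpD] with z hz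
    exact S_hat h hq hJ hS hz
  rw [analyticOrderAt_congr e, analyticOrderAt_mul analyticAt_const
    ((analyticAt_S h hq hJ hS (h.poles₁_subset hz₀ hp1)).comp (analyticAt_hat hp0)),
    analyticOrderAt_comp_of_deriv_ne_zero (analyticAt_hat hp0) hd,
    analyticOrderAt_poles₁ h hq hJ hS hz₀ hN hp1,
    analyticAt_const.analyticOrderAt_eq_zero.2 hδ, zero_add]

end Params

end NonlocalMKdV

end

/-! ### Propagation of small initial values, and existence of Laurent expansions. -/

noncomputable section

namespace NonlocalMKdV

/-! ### Dependence of the solutions of the Lax pair on their initial value -/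

lemma norm_mulVec_le (A : Matrix (Fin 2) (Fin 2) ℂ) (v : Fin 2 → ℂ) :
    ‖A *ᵥ v‖ ≤ (∑ i, ∑ j, ‖A i j‖) * ‖v‖ := by
  refine (pi_norm_le_iff_of_nonneg (by positivity)).2 fun i => ?_
  calc ‖(A *ᵥ v) i‖ ≤ ∑ j, ‖A i j * v j‖ := by
        rw [mulVec, dotProduct]; exact norm_sum_le _ _
    _ ≤ ∑ j, ‖A i j‖ * ‖v‖ := Finset.sum_le_sum fun j _ => by
        rw [norm_mul]; exact mul_le_mul_of_nonneg_left (norm_le_pi_norm v j) (norm_nonneg _)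
    _ = (∑ j, ‖A i j‖) * ‖v‖ := by rw [Finset.sum_mul]
    _ ≤ _ := mul_le_mul_of_nonneg_right
        (Finset.single_le_sum (f := fun i => ∑ j, ‖A i j‖) (fun _ _ => by positivity)
          (Finset.mem_univ i)) (norm_nonneg _)

lemma contDiff_dx {f : ℝ → ℝ → ℝ} {n : ℕ} (hf : ContDiff ℝ (n + 1) fun p : ℝ × ℝ => f p.1 p.2) :
    ContDiff ℝ n fun p : ℝ × ℝ => dx f p.1 p.2 := by
  have e : (fun p : ℝ × ℝ => dx f p.1 p.2) =
      fun p => fderiv ℝ (fun p : ℝ × ℝ => f p.1 p.2) p (1, 0) := by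
    funext p
    have h1 : HasFDerivAt (fun p : ℝ × ℝ => f p.1 p.2) _ (p.1, p.2) :=
      (hf.differentiable (by simp) p).hasFDerivAt
    have h2 : HasDerivAt (fun y : ℝ => (y, p.2)) (1, 0) p.1 :=
      (hasDerivAt_id p.1).prodMk (hasDerivAt_const _ _)
    exact (h1.comp_hasDerivAt p.1 h2).deriv
  rw [e]
  exact (hf.fderiv_right le_rfl).clm_apply contDiff_const

lemma exists_bound_near {f : ℝ → ℂ → Matrix (Fin 2) (Fin 2) ℂ}
    (hf : Continuous fun p : {p : ℝ × ℂ // p.2 ≠ 0} => f p.1.1 p.1.2) {p : ℂ} (hp : p ≠ 0)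
    (a : ℝ) : ∃ C, ∀ᶠ z in 𝓝 p, ∀ s ∈ Set.uIcc 0 a, ∀ v, ‖f s z *ᵥ v‖ ≤ C * ‖v‖ := by
  have hpos : 0 < ‖p‖ := norm_pos_iff.2 hp
  set K : Set (ℝ × ℂ) := Set.uIcc 0 a ×ˢ Metric.closedBall p (‖p‖ / 2) with hK
  have hne : ∀ x ∈ K, x.2 ≠ 0 := by
    rintro ⟨s, z⟩ ⟨_, hz⟩ h0
    have : dist z p ≤ ‖p‖ / 2 := hz
    rw [show z = 0 from h0, dist_zero_left] at this
    linarith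
  have hc : ContinuousOn (fun x : ℝ × ℂ => ∑ i, ∑ j, ‖f x.1 x.2 i j‖) {x | x.2 ≠ 0} := by
    rw [continuousOn_iff_continuous_domRestrict]
    exact continuous_finsetSum _ fun i _ => continuous_finsetSum _ fun j _ =>
      (hf.matrix_elem i j).norm
  obtain ⟨C, hC⟩ := (isCompact_uIcc.prod (isCompact_closedBall p (‖p‖ / 2))).exists_bound_of_continuousOn
    (hc.mono hne)
  refine ⟨C, ?_⟩
  filter_upwards [Metric.closedBall_mem_nhds p (half_pos hpos)] with z hz s hs v
  refine (norm_mulVec_le _ _).trans (mul_le_mul_of_nonneg_right ?_ (norm_nonneg _))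
  exact (Real.le_norm_self _).trans (hC (s, z) ⟨hs, hz⟩)

namespace Params

variable {P : Params} {q : ℝ → ℝ → ℝ}

lemma continuous_offDiag {X : Type*} [TopologicalSpace X] {f g : X → ℂ} (hf : Continuous f)
    (hg : Continuous g) : Continuous fun x => offDiag (f x) (g x) := by
  refine continuous_matrix fun i j => ?_
  fin_cases i <;> fin_cases j <;> simp [offDiag, continuous_const, hf, hg]

lemma continuous_k : Continuous fun p : {p : ℝ × ℂ // p.2 ≠ 0} => P.k p.1.2 := by
  have h : Continuous fun p : {p : ℝ × ℂ // p.2 ≠ 0} => p.1.2 :=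
    continuous_snd.comp continuous_subtype_val
  unfold k
  exact (h.add (continuous_const.div h fun p => p.2)).div_const 2

lemma IsSolution.continuous_X (hq : P.IsSolution q) {f g : ℝ → ℝ} (hf : Continuous f)
    (hg : Continuous g) :
    Continuous fun p : {p : ℝ × ℂ // p.2 ≠ 0} => P.X q (f p.1.1) (g p.1.1) p.1.2 := by
  have h1 : Continuous fun p : {p : ℝ × ℂ // p.2 ≠ 0} => p.1.1 :=
    continuous_fst.comp continuous_subtype_val
  have h2 : Continuous fun p : ℝ × ℝ => q p.1 p.2 := hq.smooth.continuous
  have h3 : Continuous fun p : {p : ℝ × ℂ // p.2 ≠ 0} => q (f p.1.1) (g p.1.1) :=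
    h2.comp ((hf.comp h1).prodMk (hg.comp h1))
  have h4 : Continuous fun p : {p : ℝ × ℂ // p.2 ≠ 0} => q (-f p.1.1) (-g p.1.1) :=
    h2.comp ((hf.comp h1).neg.prodMk (hg.comp h1).neg)
  unfold X Q rst
  exact ((continuous_const.mul continuous_k).smul continuous_const).add
    (continuous_offDiag (continuous_ofReal.comp h3)
      (continuous_const.mul (continuous_ofReal.comp h4)))

lemma IsSolution.continuous_T (hq : P.IsSolution q) {f g : ℝ → ℝ} (hf : Continuous f)
    (hg : Continuous g) :
    Continuous fun p : {p : ℝ × ℂ // p.2 ≠ 0} => P.T q (f p.1.1) (g p.1.1) p.1.2 := by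
  have h1 : Continuous fun p : {p : ℝ × ℂ // p.2 ≠ 0} => p.1.1 :=
    continuous_fst.comp continuous_subtype_val
  have key : ∀ {F : ℝ → ℝ → ℝ}, (Continuous fun p : ℝ × ℝ => F p.1 p.2) →
      Continuous fun p : {p : ℝ × ℂ // p.2 ≠ 0} => ((F (f p.1.1) (g p.1.1) : ℝ) : ℂ) := fun h2 =>
    continuous_ofReal.comp (h2.comp ((hf.comp h1).prodMk (hg.comp h1)))
  have s0 : ContDiff ℝ 3 fun p : ℝ × ℝ => rst q p.1 p.2 :=
    hq.smooth.comp (contDiff_fst.neg.prodMk contDiff_snd.neg)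
  have a1 := contDiff_dx (f := q) (n := 2) (by exact_mod_cast hq.smooth)
  have a2 := contDiff_dx (f := dx q) (n := 1) (by exact_mod_cast a1)
  have b1 := contDiff_dx (f := rst q) (n := 2) (by exact_mod_cast s0)
  have b2 := contDiff_dx (f := dx (rst q)) (n := 1) (by exact_mod_cast b1)
  have cQ : Continuous fun p : {p : ℝ × ℂ // p.2 ≠ 0} => P.Q q (f p.1.1) (g p.1.1) :=
    continuous_offDiag (key hq.smooth.continuous) (continuous_const.mul (key s0.continuous))
  have cQx : Continuous fun p : {p : ℝ × ℂ // p.2 ≠ 0} => P.Qx q (f p.1.1) (g p.1.1) :=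
    continuous_offDiag (key a1.continuous) (continuous_const.mul (key b1.continuous))
  have cQxx : Continuous fun p : {p : ℝ × ℂ // p.2 ≠ 0} => P.Qxx q (f p.1.1) (g p.1.1) :=
    continuous_offDiag (key a2.continuous) (continuous_const.mul (key b2.continuous))
  have ck := continuous_k (P := P)
  have cs : Continuous fun p : {p : ℝ × ℂ // p.2 ≠ 0} => 4 * P.k p.1.2 ^ 2 +
      2 * (P.σ : ℂ) * q (f p.1.1) (g p.1.1) * q (-f p.1.1) (-g p.1.1) :=
    (continuous_const.mul (ck.pow 2)).add
      ((continuous_const.mul (key hq.smooth.continuous)).mul (key s0.continuous))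
  unfold T
  exact (((cs.smul (hq.continuous_X hf hg)).sub
    ((continuous_const.mul ck).smul (continuous_const.matrix_mul cQx))).add
    ((cQx.matrix_mul cQ).sub (cQ.matrix_mul cQx))).sub cQxx

/-- Smallness of the initial value of a family of solutions of the Lax pair is preserved. -/
theorem IsSolution.isBigO_of_isLaxSolution (hq : P.IsSolution q) {p : ℂ} (hp : p ≠ 0)
    {φ : ℂ → ℝ → ℝ → Fin 2 → ℂ} (hφ : ∀ᶠ z in 𝓝 p, P.IsLaxSolution q z (φ z)) {g : ℂ → ℂ}
    (h0 : (fun z => φ z 0 0) =O[𝓝 p] g) (x t : ℝ) : (fun z => φ z x t) =O[𝓝 p] g := by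
  obtain ⟨C₁, h1⟩ := exists_bound_near (f := fun s z => P.T q 0 s z)
    (hq.continuous_T (f := fun _ => 0) (g := fun s => s) continuous_const continuous_id) hp t
  obtain ⟨C₂, h2⟩ := exists_bound_near (f := fun s z => P.X q s t z)
    (hq.continuous_X (f := fun s => s) (g := fun _ => t) continuous_id continuous_const) hp x
  refine IsBigO.trans (IsBigO.of_bound (Real.exp (C₁ * |t - 0|) * Real.exp (C₂ * |x - 0|)) ?_) h0
  filter_upwards [hφ, h1, h2] with z a1 a2 a3
  -- The path runs from (0,0) in time to (0,t), then in space to (x,t), with Gronwall's inequality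
  -- on each leg. The constants are uniform for z near p, where the Lax matrices are bounded.
  have b1 := norm_le_mul_exp_of_norm_deriv_le (fun s => a1.2 0 s) fun s hs => a2 s hs _
  have b2 := norm_le_mul_exp_of_norm_deriv_le (fun s => a1.1 s t) fun s hs => a3 s hs _
  refine b2.trans ((mul_le_mul_of_nonneg_right b1 (Real.exp_nonneg _)).trans_eq ?_)
  ring

lemma IsLaxSolution.sub_smul {z : ℂ} {φ ψ : ℝ → ℝ → Fin 2 → ℂ} (hφ : P.IsLaxSolution q z φ)
    (hψ : P.IsLaxSolution q z ψ) (b : ℂ) :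
    P.IsLaxSolution q z fun x t => φ x t - b • ψ x t := by
  constructor
  · intro x t
    refine ((hφ.1 x t).fun_sub ((hψ.1 x t).fun_const_smul b)).congr_deriv ?_
    rw [mulVec_sub, mulVec_smul]
  · intro x t
    refine ((hφ.2 x t).fun_sub ((hψ.2 x t).fun_const_smul b)).congr_deriv ?_
    rw [mulVec_sub, mulVec_smul]

end Params

/-! ### Laurent expansions -/

/-- The pole of order n receives the Taylor coefficient of order N - n; the values of the sequence
outside 1, …, N play no role. -/
lemma exists_hasLaurent {N : ℕ} {f F : ℂ → ℂ} {p : ℂ} (hF : AnalyticAt ℂ F p)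
    (e : ∀ᶠ z in 𝓝[≠] p, f z = F z / (z - p) ^ N) : ∃ c, HasLaurent N f p c := by
  obtain ⟨G, hG, hFG⟩ := exists_taylor_remainder hF N
  refine ⟨fun n => taylorCoeff F p (N - n), hG.regularAt.congr ?_⟩
  filter_upwards [e, self_mem_nhdsWithin] with z hz hzp
  have hne : z - p ≠ 0 := sub_ne_zero.2 hzp
  have hs : ∑ n ∈ Finset.Icc 1 N, taylorCoeff F p (N - n) / (z - p) ^ n =
      (∑ i ∈ Finset.range N, taylorCoeff F p i * (z - p) ^ i) / (z - p) ^ N := by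
    rw [Finset.sum_div, ← Finset.sum_range_reflect, ← Finset.Ico_succ_right_eq_Icc,
      Finset.sum_Ico_eq_sum_range]
    refine Finset.sum_congr (by simp) fun i hi => ?_
    have hi : i < N := by simpa using hi
    rw [div_eq_div_iff (pow_ne_zero _ hne) (pow_ne_zero _ hne), mul_assoc, ← pow_add,
      show N - (1 + i) = N - 1 - i by omega, show N - 1 - i + (1 + i) = N by omega]
  rw [hs, hz, hFG z, ← sub_div]
  field_simp
  ring

end NonlocalMKdV

end

/-! ### Construction of the Laurent data and the residue conditions. -/

noncomputable section

namespace NonlocalMKdV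

namespace Params

variable {P : Params} {q : ℝ → ℝ → ℝ} (h : P.Admissible)

include h in
lemma Admissible.tendsto_hat_punctured {p : ℂ} (hp : p ≠ 0) :
    Tendsto P.hat (𝓝[≠] p) (𝓝[≠] (P.hat p)) := by
  refine tendsto_nhdsWithin_iff.2 ⟨(analyticAt_hat hp).continuousAt.tendsto.mono_left
    nhdsWithin_le_nhds, ?_⟩
  filter_upwards [self_mem_nhdsWithin] with z hz hz'
  exact hz (by rw [Set.mem_singleton_iff, ← h.hat_hat z, show P.hat z = P.hat p from hz', h.hat_hat])

include h in
lemma Admissible.regularAt_comp_hat {f : ℂ → ℂ} {p : ℂ} (hp : p ≠ 0)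
    (hf : RegularAt f (P.hat p)) : RegularAt (fun z => f (P.hat z)) p := by
  obtain ⟨g, hg, e⟩ := hf
  exact ⟨_, hg.comp (analyticAt_hat hp), (h.tendsto_hat_punctured hp).eventually e⟩

/-- The function whose principal parts at the poles are the residue data. -/
def resCoeff (Φp : ℝ → ℝ → ℂ → Matrix (Fin 2) (Fin 2) ℂ) (S : ℂ → Matrix (Fin 2) (Fin 2) ℂ)
    (z : ℂ) : ℂ := Φp 0 0 z 1 0 / Φp 0 0 z 0 0 / S z 0 0

lemma exp_neg_two_theta (x t : ℝ) (z : ℂ) :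
    exp (-2 * I * P.θ x t z) = P.osc 0 x t z * P.osc 0 x t z := by
  rw [osc, ← exp_add]
  congr 1
  simp
  ring

variable (hq : P.IsSolution q)
  {Φp Φm : ℝ → ℝ → ℂ → Matrix (Fin 2) (Fin 2) ℂ} (hJ : P.IsJost q Φp Φm)
  {S : ℂ → Matrix (Fin 2) (Fin 2) ℂ} (hS : P.IsScattering Φp Φm S)
  (hR : P.IsReflectionless S)
  (hZ : ∀ z ∈ P.Dplus, S z 0 0 = 0 → z ∈ P.poles₁)
  (hz₀ : P.z₀ ∈ P.Dplus) {N : ℕ} (hN1 : 1 ≤ N)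
  (hN : analyticOrderAt (fun z => S z 0 0) P.z₀ = N)

include h hq hJ hS

lemma sq_add_sq_eq {z : ℂ} (hz : z ∈ P.Dplus) :
    Φp 0 0 z 0 0 ^ 2 + P.σ * Φp 0 0 z 1 0 ^ 2 = 2 * P.lam z / z * S z 0 0 := by
  have hz0 := (h.mem_Dplus.1 hz).1
  have hl := h.lam_ne_of_mem_Dplus hz
  rw [S_eq_s₁ hS hz, s₁, one_sub_eq hz0, wr_eq h hq hJ (Or.inl hz)]
  field_simp

include hz₀ hN1 hN

/-- As N ≥ 1, s₁₁ vanishes at the pole, so a² + σc² = 0 there; a = 0 would force c = 0, but a Jost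
solution has no zero. Division by a is thus allowed. -/
lemma jost_origin_ne_zero {p : ℂ} (hp : p ∈ P.poles₁) : Φp 0 0 p 0 0 ≠ 0 := by
  intro h0
  have hpD := h.poles₁_subset hz₀ hp
  have hS0 : S p 0 0 = 0 := apply_eq_zero_of_analyticOrderAt_ne_zero (f := fun z => S z 0 0) (by
    rw [analyticOrderAt_poles₁ h hq hJ hS hz₀ hN hp]
    exact_mod_cast (by omega : N ≠ 0))
  have := sq_add_sq_eq h hq hJ hS hpD
  have hσ : (P.σ : ℂ) ≠ 0 := by rcases h.sigma with h | h <;> simp [h]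
  rw [h0, hS0] at this
  exact jost_ne_zero h hq hJ (Or.inl hpD) 0 0 ⟨h0, by simpa [hσ] using this⟩

/-- At the poles, the columns of `M` are proportional up to terms of order `N`. -/
lemma isBigO_jost_sub {p : ℂ} (hp : p ∈ P.poles₁) (x t : ℝ) :
    (fun z i => Φp x t z i 0 - Φp 0 0 z 1 0 / Φp 0 0 z 0 0 * Φm x t z i 1) =O[𝓝 p]
      fun z => S z 0 0 := by
  have hpD := h.poles₁_subset hz₀ hp
  have hp0 := (h.mem_Dplus.1 hpD).1
  have hcont : ∀ i, ContinuousAt (fun z => Φp 0 0 z i 0) p := fun i =>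
    ((differentiableOn_origin h hq hJ i).differentiableAt (h.isOpen_Dplus.mem_nhds hpD)).continuousAt
  have ha := jost_origin_ne_zero h hq hJ hS hz₀ hN1 hN hp
  -- The difference is itself a Lax solution, so it is enough to estimate it at (0,0). There Φ₋,₂ =
  -- (-σc,a), and its entries are (a² + σc²)/a, a bounded multiple of s₁₁, and 0.
  refine hq.isBigO_of_isLaxSolution hp0 (φ := fun z x t => (fun i => Φp x t z i 0) -
    (Φp 0 0 z 1 0 / Φp 0 0 z 0 0) • fun i => Φm x t z i 1) ?_ ?_ x t
  · filter_upwards [h.isOpen_Dplus.mem_nhds hpD] with z hz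
    exact (hJ.p1 z (Or.inl hz)).1.sub_smul (hJ.m2 z (Or.inl hz)).1 _
  · refine isBigO_pi.2 fun i => ?_
    have h1 : (fun z => 2 * P.lam z / z / Φp 0 0 z 0 0) =O[𝓝 p] fun _ => (1 : ℂ) := by
      have : ContinuousAt (fun z => 2 * P.lam z / z / Φp 0 0 z 0 0) p :=
        ((continuousAt_const.mul (Admissible.analyticAt_lam hp0).continuousAt).div
          continuousAt_id hp0).div (hcont 0) ha
      exact this.tendsto.isBigO_one ℂ
    have h2 := h1.mul (isBigO_refl (fun z => S z 0 0) (𝓝 p))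
    simp only [one_mul] at h2
    have hev : ∀ᶠ z in 𝓝 p, z ∈ P.Dplus ∧ Φp 0 0 z 0 0 ≠ 0 :=
      Filter.Eventually.and (h.isOpen_Dplus.mem_nhds hpD) ((hcont 0).eventually_ne ha)
    fin_cases i
    · refine h2.congr' ?_ EventuallyEq.rfl
      filter_upwards [hev] with z hz
      have := jost_reflect h hq hJ (Or.inl hz.1) 0 0
      rw [neg_zero] at this
      have e := sq_add_sq_eq h hq hJ hS hz.1
      have ha' := hz.2
      rw [div_mul_eq_mul_div, ← e]
      simp [this.2]
      field_simp
    · refine (isBigO_zero (fun z => S z 0 0) (𝓝 p)).congr' ?_ EventuallyEq.rfl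
      filter_upwards [hev] with z hz
      have := jost_reflect h hq hJ (Or.inl hz.1) 0 0
      rw [neg_zero] at this
      have ha' := hz.2
      simp [this.1]
      field_simp
      ring

lemma exists_resCoeff_eq {p : ℂ} (hp : p ∈ P.poles₁) : ∃ F, AnalyticAt ℂ F p ∧
    ∀ᶠ z in 𝓝 p, resCoeff Φp S z = F z / (z - p) ^ N := by
  have hpD := h.poles₁_subset hz₀ hp
  have han : ∀ i, AnalyticAt ℂ (fun z => Φp 0 0 z i 0) p := fun i =>
    (differentiableOn_origin h hq hJ i).analyticAt (h.isOpen_Dplus.mem_nhds hpD)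
  have ha := jost_origin_ne_zero h hq hJ hS hz₀ hN1 hN hp
  obtain ⟨g, hg, hg0, e⟩ := (analyticAt_S h hq hJ hS hpD).analyticOrderAt_eq_natCast.1
    (analyticOrderAt_poles₁ h hq hJ hS hz₀ hN hp)
  refine ⟨fun z => Φp 0 0 z 1 0 / Φp 0 0 z 0 0 / g z, ((han 1).div (han 0) ha).div hg hg0, ?_⟩
  filter_upwards [e] with z hz
  rw [resCoeff, hz, smul_eq_mul, mul_comm, div_div _ _ (_ ^ N)]

lemma exists_hasLaurent_poles₁ {p : ℂ} (hp : p ∈ P.poles₁) :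
    ∃ c, HasLaurent N (resCoeff Φp S) p c := by
  obtain ⟨F, hF, e⟩ := exists_resCoeff_eq h hq hJ hS hz₀ hN1 hN hp
  exact exists_hasLaurent hF (eventually_nhdsWithin_of_eventually_nhds e)

lemma exists_hasLaurent_poles₂ {p : ℂ} (hp : p ∈ P.poles₂) :
    ∃ c, HasLaurent N (fun z => -P.ε * resCoeff Φp S (P.hat z)) p c := by
  have hp0 := (h.mem_Dminus.1 (h.poles₂_subset hz₀ hp)).1
  obtain ⟨F, hF, e⟩ := exists_resCoeff_eq h hq hJ hS hz₀ hN1 hN (h.hat_mem_poles₁.2 hp)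
  have hc := h.cast_ne
  -- The last factor converts powers of `hat z - hat p` into powers of z - p: the two differences
  -- are related by the multiplier -εq₀²/(zp).
  refine exists_hasLaurent (F := fun z => -P.ε * F (P.hat z) * (-(z * p) / (P.ε * P.q₀ ^ 2)) ^ N)
    ((analyticAt_const.mul (hF.comp (analyticAt_hat hp0))).mul
      (((analyticAt_id.mul analyticAt_const).neg.div_const).pow N)) ?_
  filter_upwards [eventually_nhdsWithin_of_eventually_nhds
    ((analyticAt_hat hp0).continuousAt.eventually e), self_mem_nhdsWithin,
    mem_nhdsWithin_of_mem_nhds (isOpen_ne.mem_nhds hp0)] with z hz hzp hz0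
  have hne : z - p ≠ 0 := sub_ne_zero.2 hzp
  have hz0' : z ≠ 0 := hz0
  have hd : P.hat z - P.hat p = (z - p) / (-(z * p) / (P.ε * P.q₀ ^ 2)) := by
    simp only [hat]
    have hε := left_ne_zero_of_mul hc
    have hq0 : (P.q₀ : ℂ) ≠ 0 := by exact_mod_cast h.pos.ne'
    field_simp
    ring
  rw [hz, hd, div_pow]
  field_simp

include hR hZ

/-- The residue conditions at the poles of the first column. -/
theorem regularAt_residue₁ {p : ℂ} (hp : p ∈ P.poles₁) (x t : ℝ) (i : Fin 2) :
    RegularAt (fun z => P.jostM Φp Φm S x t z i 0 -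
      exp (-2 * I * P.θ x t z) * resCoeff Φp S z * P.jostM Φp Φm S x t z i 1) p := by
  have hpD := h.poles₁_subset hz₀ hp
  have hp0 := (h.mem_Dplus.1 hpD).1
  have hdiff : ∀ i, ∀ z ∈ P.Dplus, DifferentiableAt ℂ (fun z => Φp 0 0 z i 0) z := fun i z hz =>
    (differentiableOn_origin h hq hJ i).differentiableAt (h.isOpen_Dplus.mem_nhds hz)
  have ha := jost_origin_ne_zero h hq hJ hS hz₀ hN1 hN hp
  have hev : ∀ᶠ z in 𝓝[≠] p, z ∈ P.Dplus ∧ Φp 0 0 z 0 0 ≠ 0 ∧ z ∉ P.poles₁ ∧ S z 0 0 ≠ 0 := by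
    filter_upwards [mem_nhdsWithin_of_mem_nhds (h.isOpen_Dplus.mem_nhds hpD),
      mem_nhdsWithin_of_mem_nhds ((hdiff 0 p hpD).continuousAt.eventually_ne ha),
      eventually_not_mem_of_finite P.finite_poles₁ p] with z h1 h2 h3
    exact ⟨h1, h2, h3, fun h0 => h3 (hZ z h1 h0)⟩
  refine regularAt_of_bounded ?_ ?_
  · filter_upwards [hev] with z hz
    obtain ⟨h1, h2, h3, h4⟩ := hz
    have hz0 := (h.mem_Dplus.1 h1).1
    have hl := h.lam_ne_of_mem_Dplus h1
    have hn2 : z ∉ P.poles₂ := fun h' =>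
      h.not_mem_Dplus_of_mem_Dminus (h.poles₂_subset hz₀ h') h1
    refine (analyticAt_jostM₁ h hq hJ hS hR hZ x t i hz0 hl h3).differentiableAt.sub
      (DifferentiableAt.mul (DifferentiableAt.mul ?_ ?_)
        (analyticAt_jostM₂ h hq hJ hS hR hZ x t i hz0 hl hn2).differentiableAt)
    · exact ((Admissible.analyticAt_θ x t hz0).differentiableAt.const_mul _).cexp
    · exact ((hdiff 1 z h1).div (hdiff 0 z h1) h2).div
        (analyticAt_S h hq hJ hS h1).differentiableAt h4
  -- With exp(-2iθ) = `osc 0`² and `osc 0`·`osc 1` = 1, the expression is `osc 0`·(Φ₊,₁ -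
  -- (c/a)Φ₋,₂)/s₁₁, whose numerator is O(s₁₁).
  · have b1 := (isBigO_pi.1 (isBigO_jost_sub h hq hJ hS hz₀ hN1 hN hp x t) i).mono
      (nhdsWithin_le_nhds (s := {p}ᶜ))
    have b2 : (fun z => P.osc 0 x t z) =O[𝓝[≠] p] fun _ => (1 : ℂ) :=
      ((analyticAt_osc 0 x t hp0).continuousAt.tendsto.mono_left nhdsWithin_le_nhds).isBigO_one ℂ
    have b3 := (b2.mul b1).mul (isBigO_refl (fun z => (S z 0 0)⁻¹) (𝓝[≠] p))
    refine b3.congr' ?_ ?_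
    · filter_upwards [hev] with z hz
      obtain ⟨h1, h2, h3, h4⟩ := hz
      have := P.osc_mul_osc x t z
      simp only [jostM, h1, if_true, of_apply, cons_val_zero, cons_val_one, exp_neg_two_theta,
        resCoeff]
      field_simp
      linear_combination (P.osc 0 x t z * Φp 0 0 z 1 0 * Φm x t z i 1) * this
    · filter_upwards [hev] with z hz
      rw [one_mul, mul_inv_cancel₀ hz.2.2.2]

/-- The residue conditions at the poles of the second column. -/
theorem regularAt_residue₂ {p : ℂ} (hp : p ∈ P.poles₂) (x t : ℝ) (i : Fin 2) :
    RegularAt (fun z => P.jostM Φp Φm S x t z i 1 - exp (2 * I * P.θ x t z) *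
      (-P.ε * resCoeff Φp S (P.hat z)) * P.jostM Φp Φm S x t z i 0) p := by
  have hpD := h.poles₂_subset hz₀ hp
  have hp0 := (h.mem_Dminus.1 hpD).1
  have key := h.regularAt_comp_hat hp0
    (regularAt_residue₁ h hq hJ hS hR hZ hz₀ hN1 hN (h.hat_mem_poles₁.2 hp) x t i)
  have h1 : RegularAt (fun z : ℂ => I * P.qm / z) p :=
    (analyticAt_const.div analyticAt_id hp0).regularAt
  -- Multiplying the condition at `hat p` by i q₋/z gives M₂(z) in place of M₁(ẑ), and turns M₂(ẑ)
  -- into -ε M₁(z) because ε² = 1. This is the origin of the factor -ε in r̃.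
  refine (h1.mul key).congr ?_
  filter_upwards [mem_nhdsWithin_of_mem_nhds (h.isOpen_Dminus.mem_nhds hpD),
    eventually_not_mem_of_finite P.finite_poles₂ p] with z hz hz2
  have hz0 := (h.mem_Dminus.1 hz).1
  have hl := h.lam_ne_of_mem_Dminus hz
  have hn1 : z ∉ P.poles₁ := fun h' =>
    h.not_mem_Dplus_of_mem_Dminus hz (h.poles₁_subset hz₀ h')
  have hε2 : (P.ε : ℂ) ^ 2 = 1 := by exact_mod_cast h.eps_sq
  have hq0 : (P.q₀ : ℂ) ≠ 0 := by exact_mod_cast h.pos.ne'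
  rw [jostM_hat₂ h hq hJ hS hR hZ x t i hz0 hl hz2, jostM_hat h hq hJ hS hR hZ x t i hz0 hl hn1,
    h.theta_hat, show -2 * I * -P.θ x t z = 2 * I * P.θ x t z by ring]
  rw [show -(I * P.qm * P.hat z / (P.q₀ : ℂ) ^ 2) = -(I * P.qm * P.ε / z) by
    simp only [hat]; field_simp]
  linear_combination (-(exp (2 * I * P.θ x t z) * resCoeff Φp S (P.hat z) * I * P.qm / z *
    P.jostM Φp Φm S x t (P.hat z) i 1)) * hε2

end Params

end NonlocalMKdV

end

theorem theorem1 (P : NonlocalMKdV.Params) (N : ℕ) (hN : 1 ≤ N)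
    (hσ : P.σ = 1 ∨ P.σ = -1) (hδ : P.δ = 1 ∨ P.δ = -1)
    (hq₀ : 0 < P.q₀) (hqm : |P.qm| = P.q₀)
    (hz₀ : P.z₀ ∈ P.Dplus) (hre : 0 < P.z₀.re) :
    -- a solution of the equation whose scattering data have one `N`-th order quartet
    (∀ (q : ℝ → ℝ → ℝ) (Φp Φm : ℝ → ℝ → ℂ → Matrix (Fin 2) (Fin 2) ℂ)
        (S : ℂ → Matrix (Fin 2) (Fin 2) ℂ),
      P.IsSolution q → P.IsJost q Φp Φm → P.IsScattering Φp Φm S → P.IsReflectionless S →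
      analyticOrderAt (fun z => S z 0 0) P.z₀ = N →
      (∀ z ∈ P.Dplus, S z 0 0 = 0 → z = P.z₀ ∨ z = -conj P.z₀) →
        -- the quartet
        ((∀ p ∈ P.poles₁, p ∈ P.Dplus ∧ analyticOrderAt (fun z => S z 0 0) p = N) ∧
          (∀ p ∈ P.poles₂, p ∈ P.Dminus ∧ analyticOrderAt (fun z => S z 1 1) p = N) ∧
          (∀ z ∈ P.Dminus, S z 1 1 = 0 → z ∈ P.poles₂)) ∧
        -- the Laurent data exist
        (∃ (r rt : ℂ → ℂ) (c : NonlocalMKdV.Coeffs), P.HasLaurentCoeffs N r rt c ∧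
          ∀ x t, P.ResidueConditions r rt x t (P.jostM Φp Φm S x t)) ∧
        -- the determinant formula
        (∀ (r rt : ℂ → ℂ) (c : NonlocalMKdV.Coeffs), P.HasLaurentCoeffs N r rt c →
          (∀ x t, P.ResidueConditions r rt x t (P.jostM Φp Φm S x t)) →
          ∀ x t, (P.A N c x t).det ≠ 0 → (q x t : ℂ) = P.soliton N c x t)) ∧
    -- the Riemann-Hilbert problem with arbitrary Laurent data
    (∀ (r rt : ℂ → ℂ) (c : NonlocalMKdV.Coeffs), P.HasLaurentCoeffs N r rt c →
      ∀ x t, (P.A N c x t).det ≠ 0 →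
        (∃ M, P.IsRHSolution r rt x t M) ∧
        ∀ M, P.IsRHSolution r rt x t M →
          Tendsto (fun z => -I * (z * M z 0 1)) (Bornology.cobounded ℂ)
            (𝓝 (P.soliton N c x t))) ∧
    -- the denominator vanishes only at isolated points
    (∀ (c : NonlocalMKdV.Coeffs) (t a b : ℝ),
      {x | x ∈ Set.Icc a b ∧ (P.A N c x t).det = 0}.Finite) := by
  have h : P.Admissible := ⟨hσ, hδ, hq₀, hqm⟩
  refine ⟨fun q Φp Φm S hq hJ hS hR hord hzero => ?_, fun r rt c hL x t hA => ?_,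
    fun c t a b => h.finite_det_eq_zero hz₀ N c t a b⟩
  · have hZ : ∀ z ∈ P.Dplus, S z 0 0 = 0 → z ∈ P.poles₁ := hzero
    refine ⟨⟨fun p hp => ⟨h.poles₁_subset hz₀ hp,
        NonlocalMKdV.Params.analyticOrderAt_poles₁ h hq hJ hS hz₀ hord hp⟩,
      fun p hp => ⟨h.poles₂_subset hz₀ hp, NonlocalMKdV.Params.analyticOrderAt_poles₂ h hq hJ hS hz₀ hord hp⟩,
      fun z hz h0 => ?_⟩, ?_, fun r rt c hL hM x t hA => ?_⟩
    · rw [NonlocalMKdV.Params.S_hat h hq hJ hS hz] at h0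
      have hδ' : (P.δ : ℂ) ≠ 0 := by rcases hδ with h | h <;> simp [h]
      exact h.hat_mem_poles₁.1 (hZ _ (h.hat_mem_Dplus.2 hz) ((mul_eq_zero.1 h0).resolve_left hδ'))
    · obtain ⟨c₁, h1⟩ := NonlocalMKdV.Params.exists_hasLaurent_poles₁ h hq hJ hS hz₀ hN hord
        (Or.inl rfl)
      obtain ⟨c₂, h2⟩ := NonlocalMKdV.Params.exists_hasLaurent_poles₁ h hq hJ hS hz₀ hN hord
        (Or.inr rfl)
      obtain ⟨c₃, h3⟩ := NonlocalMKdV.Params.exists_hasLaurent_poles₂ h hq hJ hS hz₀ hN hord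
        (Or.inl rfl)
      obtain ⟨c₄, h4⟩ := NonlocalMKdV.Params.exists_hasLaurent_poles₂ h hq hJ hS hz₀ hN hord
        (Or.inr rfl)
      -- One function r serves both poles of the first column and r̃ = -ε r∘`hat` both poles of the
      -- second, independently of (x,t).
      exact ⟨_, _, ⟨c₁, c₂, c₃, c₄⟩, ⟨h1, h2, h3, h4⟩, fun x t =>
        ⟨fun p hp i => NonlocalMKdV.Params.regularAt_residue₁ h hq hJ hS hR hZ hz₀ hN hord hp x t i,
          fun p hp i =>
            NonlocalMKdV.Params.regularAt_residue₂ h hq hJ hS hR hZ hz₀ hN hord hp x t i⟩⟩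
    · exact NonlocalMKdV.Params.eq_soliton h hq hJ hS hR hZ hz₀ hre hL x t (hM x t) hA
  · exact ⟨h.exists_isRHSolution hz₀ hre hL x t hA, fun M hM =>
      h.tendsto_of_isRow hz₀ hre hL x t hA ((h.isRHSolution_iff hz₀ hre hL x t M).1 hM).1⟩
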